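/- **Conventions.** For a graded Hopf algebroid $(A,\Gamma)$ with left and right units $\eta_L,\eta_R$ and comultiplication $\psi$, let $H^{**}(A,\Gamma)=\operatorname{Ext}^{**}_{(A,\Gamma)}(A,A)$ be the cohomology of its cobar complex $\bigoplus_n \Gamma\otimes_A\cdots\otimes_A\Gamma$ ($n$ factors), a differential graded ring under concatenation with $d(a)=[\eta_R a]-[\eta_L a]$, $d[\gamma]=[1|\gamma]-[\psi\gamma]+[\gamma|1]$ and $d(xy)=d(x)y+(-1)^{|x|}x\,d(y)$. Here $H^{n,m}$ denotes cohomological degree $n$ and internal degree $m$, and $H^{**}=\bigoplus_{n,m}H^{n,m}$. The Massey product $\langle a,b,c\rangle$ is the set of classes of $xv-(-1)^{|a|}uz$, where $x,y,z$ are homogeneous cocycles representing $a,b,c$, and $u,v$ are homogeneous cochains with $du=xy$, $dv=yz$. Let $(A_{(3)},\Gamma_{(3)})$ be the elliptic curve Hopf algebroid localized at $3$: $A_{(3)}=\mathbf Z_{(3)}[a_1,a_2,a_3,a_4,a_6]$, $\Gamma_{(3)}=A_{(3)}[r,s,t]$, $|a_i|=2i$, $|r|=4$, $|s|=2$, $|t|=6$,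 $\eta_L$ the inclusion, $$\begin{aligned}\eta_R(a_1)&=a_1+2s,\quad \eta_R(a_2)=a_2-a_1s+3r-s^2,\quad \eta_R(a_3)=a_3+a_1r+2t,\\ \eta_R(a_4)&=a_4-a_3s+2a_2r-a_1t-a_1rs-2st+3r^2,\\ \eta_R(a_6)&=a_6+a_4r-a_3t+a_2r^2-a_1rt-t^2+r^3,\end{aligned}$$ with $r,s$ primitive and $\psi(t)=t\otimes1+1\otimes t+s\otimes r$. Let $$(A',\Gamma')=\bigl(\mathbf Z_{(3)}[a_2,a_4],\;A'[r]/(r^3+a_2r^2+a_4r)\bigr),$$ with $\eta_R(a_2)=a_2+3r$, $\eta_R(a_4)=a_4+2a_2r+3r^2$ and $r$ primitive. Let $(A_0,\Gamma_0),(A_1,\Gamma_1),(A_2,\Gamma_2)$ be its quotients by the invariant ideals $(3)$, $(3,a_2)$, $(3,a_2,a_4)$, so that $A_0=\mathbf F_3[a_2,a_4]$, $A_1=\mathbf F_3[a_4]$, $A_2=\mathbf F_3$ and $\Gamma_2=\mathbf F_3[r]/(r^3)$. In each of these Hopf algebroids write $\alpha\in H^{1,4}$ for the class of $[r]$ and $\beta\in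 H^{2,12}$ for the class of $[r^2|r]+[r|r^2]$. **Theorem.** 1. (Reduction.) The map $(A_{(3)},\Gamma_{(3)})\to(A',\Gamma')$ killing $a_1,a_3,a_6,s,t$ exhibits $\Gamma'$ as $A'\otimes_{A_{(3)}}\Gamma_{(3)}\otimes_{A_{(3)}}A'$ and induces an isomorphism of bigraded rings $H^{**}(A_{(3)},\Gamma_{(3)})\cong H^{**}(A',\Gamma')$. 2. $H^{**}(A_2,\Gamma_2)=E(\alpha)\otimes P(\beta)$ over $\mathbf F_3$, and $\langle\alpha,\alpha,\alpha\rangle=\{\beta\}$. 3. ($a_4$-Bockstein.) There are no differentials: $H^{**}(A_1,\Gamma_1)=H^{**}(A_2,\Gamma_2)\otimes P(a_4)$, compatibly with reduction modulo $a_4$. 4. ($a_2$-Bockstein.) In the cobar complex of $(A_0,\Gamma_0)$, for all $n\ge0$: $$\begin{aligned} d(a_4a_2^n)&=2a_2^{n+1}[r], & d(a_4[r]+a_2[r^2])&=0,\\ d(a_4^2a_2^n)&=a_2^{n+1}(a_4[r]+a_2[r^2]), & d(a_4^2[r]-a_4a_2[r^2])&=a_2^2([r^2|r]+[r|r^2]),\\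 d(a_4^3-a_2^2a_4^2)&=0.\end{aligned}$$ Let $\xi\in H^{1,12}(A_0,\Gamma_0)$ be the class of $a_4[r]+a_2[r^2]$ and $\Delta\in H^{0,24}(A_0,\Gamma_0)$ the class of $a_2^2a_4^2-a_4^3$. Then $H^{**}(A_0,\Gamma_0)$ is the graded commutative $\mathbf F_3$-algebra with generators $a_2,\Delta,\alpha,\xi,\beta$ (with $a_2\in H^{0,4}$) and relations $$\alpha^2=\xi^2=0,\quad a_2\alpha=0,\quad a_2\xi=0,\quad a_2^2\beta=0,\quad \xi\alpha=a_2\beta.$$ Moreover $\langle\alpha,\alpha,\alpha\rangle=\{\beta\}$, $\langle a_2,\alpha,\alpha\rangle=\{\xi\}$ and $a_2^n\xi\in\langle a_2^{n+1},\alpha,\alpha\rangle$ for all $n\ge 0$; in particular there is the exotic extension $\langle a_2,\alpha,\alpha\rangle\alpha=a_2\beta\neq0$. 5. ($3$-Bockstein and the $E_2$-term.) In the cobar complex of $(A',\Gamma')$ one has $d(a_2)=3[r]$ and $d(a_4[r]+a_2[r^2])=3([r^2|r]+[r|r^2])$. The $3$-local $E_2$-term of the elliptic spectral sequence is $$H^{**}(A_{(3)},\Gamma_{(3)})\cong\mathbf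 Z_{(3)}[c_4,c_6,\Delta,\alpha,\beta]\big/\bigl(c_4^3-c_6^2-1728\Delta,\;3\alpha,\;3\beta,\;\alpha^2,\;c_4\alpha,\;c_6\alpha,\;c_4\beta,\;c_6\beta\bigr),$$ where $c_4\in H^{0,8}$, $c_6\in H^{0,12}$, $\Delta\in H^{0,24}$ are the classical invariants: with $b_2=a_1^2+4a_2$, $b_4=2a_4+a_1a_3$, $b_6=a_3^2+4a_6$, they are $c_4=b_2^2-24b_4$, $c_6=-b_2^3+36b_2b_4-216b_6$, $\Delta=(c_4^3-c_6^2)/1728$. Again $\langle\alpha,\alpha,\alpha\rangle=\{\beta\}$. -/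

import Mathlib

open scoped TensorProduct

noncomputable section

namespace EllCoh

/-! ## Hopf algebroids (cogroupoid objects in commutative rings) -/

/-- A pair of commutative rings with a left and a right unit `A → Γ`. -/
structure Units2 where
  A : Type
  Γ : Type
  [instA : CommRing A]
  [instΓ : CommRing Γ]
  ηL : A →+* Γ
  ηR : A →+* Γ

attribute [instance] Units2.instA Units2.instΓ

namespace Units2

variable (U : Units2)

/-- `Γ`, regarded as an `A`-algebra through the left unit. -/
def LeftΓ : Type := U.Γ

/-- `Γ`, regarded as an `A`-algebra through the right unit. -/
def RightΓ : Type := U.Γ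

instance : CommRing U.LeftΓ := U.instΓ

instance : CommRing U.RightΓ := U.instΓ

instance : Algebra U.A U.LeftΓ := U.ηL.toAlgebra

instance : Algebra U.A U.RightΓ := U.ηR.toAlgebra

/-- The ring `Γ ⊗_A Γ`: the left factor is an `A`-module through `ηR`, the right one
through `ηL`. -/
def ΓΓ : Type := U.RightΓ ⊗[U.A] U.LeftΓ

instance : CommRing U.ΓΓ := inferInstanceAs (CommRing (U.RightΓ ⊗[U.A] U.LeftΓ))

/-- `γ ↦ γ ⊗ 1`. -/
def inl : U.Γ →+* U.ΓΓ :=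
  (Algebra.TensorProduct.includeLeftRingHom : U.RightΓ →+* U.RightΓ ⊗[U.A] U.LeftΓ)

/-- `γ ↦ 1 ⊗ γ`. -/
def inr : U.Γ →+* U.ΓΓ :=
  ((Algebra.TensorProduct.includeRight : U.LeftΓ →ₐ[U.A] U.RightΓ ⊗[U.A] U.LeftΓ) :
    U.LeftΓ →+* U.RightΓ ⊗[U.A] U.LeftΓ)

/-- The elementary tensor `γ ⊗ γ'`. -/
def tmul (x y : U.Γ) : U.ΓΓ := (show U.RightΓ from x) ⊗ₜ[U.A] (show U.LeftΓ from y)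

lemma inl_mul_inr (x y : U.Γ) : U.inl x * U.inr y = U.tmul x y := by
  refine (Algebra.TensorProduct.tmul_mul_tmul (R := U.A) (A := U.RightΓ) (B := U.LeftΓ)
    x 1 1 y).trans ?_
  exact congrArg₂ (fun (a : U.RightΓ) (b : U.LeftΓ) => a ⊗ₜ[U.A] b)
    (mul_one (show U.RightΓ from x)) (one_mul (show U.LeftΓ from y))

lemma tmul_balanced (x y : U.Γ) (a : U.A) :
    U.tmul (x * U.ηR a) y = U.tmul x (U.ηL a * y) := by
  have h := TensorProduct.smul_tmul (R := U.A) (R' := U.A) a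
    (show U.RightΓ from x) (show U.LeftΓ from y)
  rw [Algebra.smul_def, Algebra.smul_def] at h
  rw [mul_comm x]
  exact h

lemma glue (a : U.A) : U.inl (U.ηR a) = U.inr (U.ηL a) := by
  have h := U.tmul_balanced 1 1 a
  rw [one_mul, mul_one, ← inl_mul_inr, ← inl_mul_inr, map_one, map_one, one_mul, mul_one] at h
  exact h

lemma tens_induction {P : U.ΓΓ → Prop} (z : U.ΓΓ) (h0 : P 0)
    (ht : ∀ x y, P (U.tmul x y)) (ha : ∀ x y, P x → P y → P (x + y)) : P z :=
  TensorProduct.induction_on z h0 ht ha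

variable {U} in
/-- For ring maps `f g : Γ → R` with `f ∘ ηR = g ∘ ηL` (a composable pair of arrows of the
groupoid of `R`-points), the induced map `Γ ⊗_A Γ → R`, `γ ⊗ γ' ↦ f γ * g γ'`. -/
def pair {R : Type} [CommRing R] (f g : U.Γ →+* R) (h : f.comp U.ηR = g.comp U.ηL) :
    U.ΓΓ →+* R :=
  letI : Algebra U.A R := (f.comp U.ηR).toAlgebra
  let f' : U.RightΓ →ₐ[U.A] R :=
    { (show U.RightΓ →+* R from f) with commutes' := fun _ => rfl }
  let g' : U.LeftΓ →ₐ[U.A] R :=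
    { (show U.LeftΓ →+* R from g) with commutes' := fun a => (RingHom.congr_fun h a).symm }
  ((Algebra.TensorProduct.lift f' g' (fun _ _ => Commute.all _ _) :
    U.RightΓ ⊗[U.A] U.LeftΓ →ₐ[U.A] R) : U.RightΓ ⊗[U.A] U.LeftΓ →+* R)

variable {U} in
lemma pair_tmul {R : Type} [CommRing R] (f g : U.Γ →+* R) (h : f.comp U.ηR = g.comp U.ηL)
    (x y : U.Γ) : pair f g h (U.tmul x y) = f x * g y := rfl

variable {U} in
lemma pair_inl {R : Type} [CommRing R] (f g : U.Γ →+* R) (h : f.comp U.ηR = g.comp U.ηL)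
    (x : U.Γ) : pair f g h (U.inl x) = f x := by
  have := pair_tmul f g h x 1
  rwa [map_one, mul_one] at this

variable {U} in
lemma pair_inr {R : Type} [CommRing R] (f g : U.Γ →+* R) (h : f.comp U.ηR = g.comp U.ηL)
    (x : U.Γ) : pair f g h (U.inr x) = g x := by
  have := pair_tmul f g h 1 x
  rwa [map_one, one_mul] at this

end Units2

/-- The structure maps of a Hopf algebroid: units, counit `ε`, comultiplication `ψ` and
conjugation `c`. -/
structure HopfData extends Units2 where
  ε : Γ →+* A
  ψ : Γ →+* toUnits2.ΓΓ
  c : Γ →+* Γ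

/-- The composite of two composable `R`-valued points of `Γ`, that is
`γ ↦ ∑ f γ' * g γ''` where `ψ γ = ∑ γ' ⊗ γ''`. -/
def HopfData.comp (D : HopfData) {R : Type} [CommRing R] (f g : D.Γ →+* R)
    (h : f.comp D.ηR = g.comp D.ηL) : D.Γ →+* R :=
  (Units2.pair f g h).comp D.ψ

lemma HopfData.comp_apply (D : HopfData) {R : Type} [CommRing R] (f g : D.Γ →+* R)
    (h : f.comp D.ηR = g.comp D.ηL) (x : D.Γ) : D.comp f g h x = Units2.pair f g h (D.ψ x) := rfl

lemma HopfData.comp_ηL (D : HopfData) (hD : D.ψ.comp D.ηL = D.inl.comp D.ηL)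
    {R : Type} [CommRing R] (f g : D.Γ →+* R) (h : f.comp D.ηR = g.comp D.ηL) :
    (D.comp f g h).comp D.ηL = f.comp D.ηL := by
  ext a
  have := RingHom.congr_fun hD a
  simp only [RingHom.comp_apply] at this ⊢
  rw [HopfData.comp_apply, this, Units2.pair_inl]

/-- A Hopf algebroid: a cogroupoid object in commutative rings, with flat left unit.  The
associativity, unit and inverse laws are stated as those of the groupoids of `R`-points, for
all commutative rings `R`; this is the same as the usual laws for `ψ`, `ε` and `c`. -/
structure HopfAlgebroid extends HopfData where
  flat : toHopfData.ηL.Flat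
  ε_ηL : toHopfData.ε.comp toHopfData.ηL = RingHom.id toHopfData.A
  ε_ηR : toHopfData.ε.comp toHopfData.ηR = RingHom.id toHopfData.A
  ψ_ηL : toHopfData.ψ.comp toHopfData.ηL = toHopfData.inl.comp toHopfData.ηL
  ψ_ηR : toHopfData.ψ.comp toHopfData.ηR = toHopfData.inr.comp toHopfData.ηR
  c_ηL : toHopfData.c.comp toHopfData.ηL = toHopfData.ηR
  c_ηR : toHopfData.c.comp toHopfData.ηR = toHopfData.ηL
  id_comp : ∀ (R : Type) [CommRing R] (e f : toHopfData.Γ →+* R)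
    (h : e.comp toHopfData.ηR = f.comp toHopfData.ηL),
    e = (f.comp toHopfData.ηL).comp toHopfData.ε → toHopfData.comp e f h = f
  comp_id : ∀ (R : Type) [CommRing R] (f e : toHopfData.Γ →+* R)
    (h : f.comp toHopfData.ηR = e.comp toHopfData.ηL),
    e = (f.comp toHopfData.ηR).comp toHopfData.ε → toHopfData.comp f e h = f
  comp_inv : ∀ (R : Type) [CommRing R] (f g : toHopfData.Γ →+* R)
    (h : f.comp toHopfData.ηR = g.comp toHopfData.ηL), g = f.comp toHopfData.c →
    toHopfData.comp f g h = (f.comp toHopfData.ηL).comp toHopfData.ε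
  inv_comp : ∀ (R : Type) [CommRing R] (g f : toHopfData.Γ →+* R)
    (h : g.comp toHopfData.ηR = f.comp toHopfData.ηL), g = f.comp toHopfData.c →
    toHopfData.comp g f h = (f.comp toHopfData.ηR).comp toHopfData.ε
  assoc : ∀ (R : Type) [CommRing R] (f g k fg gk : toHopfData.Γ →+* R)
    (h₁ : f.comp toHopfData.ηR = g.comp toHopfData.ηL)
    (h₂ : g.comp toHopfData.ηR = k.comp toHopfData.ηL)
    (h₃ : fg.comp toHopfData.ηR = k.comp toHopfData.ηL)
    (h₄ : f.comp toHopfData.ηR = gk.comp toHopfData.ηL),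
    fg = toHopfData.comp f g h₁ → gk = toHopfData.comp g k h₂ →
    toHopfData.comp fg k h₃ = toHopfData.comp f gk h₄

/-- A map of Hopf algebroids: a pair of ring maps compatible with units, counit and
comultiplication. -/
structure HopfHom (H K : HopfAlgebroid) where
  f₀ : H.A →+* K.A
  f₁ : H.Γ →+* K.Γ
  map_ηL : f₁.comp H.ηL = K.ηL.comp f₀
  map_ηR : f₁.comp H.ηR = K.ηR.comp f₀
  map_ε : f₀.comp H.ε = K.ε.comp f₁
  map_ψ : ∀ h : (K.inl.comp f₁).comp H.ηR = (K.inr.comp f₁).comp H.ηL,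
    (Units2.pair (K.inl.comp f₁) (K.inr.comp f₁) h).comp H.ψ = K.ψ.comp f₁

/-! ## The cobar complex -/

/-- The relations defining the tensor ring of the `A`-bimodule `Γ`. -/
inductive CobarRel (H : HopfAlgebroid) :
    FreeAlgebra ℤ (H.A ⊕ H.Γ) → FreeAlgebra ℤ (H.A ⊕ H.Γ) → Prop
  | coeff_one : CobarRel H (FreeAlgebra.ι ℤ (Sum.inl 1)) 1
  | coeff_add (a b : H.A) : CobarRel H (FreeAlgebra.ι ℤ (Sum.inl (a + b)))
      (FreeAlgebra.ι ℤ (Sum.inl a) + FreeAlgebra.ι ℤ (Sum.inl b))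
  | coeff_mul (a b : H.A) : CobarRel H (FreeAlgebra.ι ℤ (Sum.inl (a * b)))
      (FreeAlgebra.ι ℤ (Sum.inl a) * FreeAlgebra.ι ℤ (Sum.inl b))
  | bar_add (x y : H.Γ) : CobarRel H (FreeAlgebra.ι ℤ (Sum.inr (x + y)))
      (FreeAlgebra.ι ℤ (Sum.inr x) + FreeAlgebra.ι ℤ (Sum.inr y))
  | coeff_bar (a : H.A) (x : H.Γ) : CobarRel H
      (FreeAlgebra.ι ℤ (Sum.inl a) * FreeAlgebra.ι ℤ (Sum.inr x))
      (FreeAlgebra.ι ℤ (Sum.inr (H.ηL a * x)))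
  | bar_coeff (x : H.Γ) (a : H.A) : CobarRel H
      (FreeAlgebra.ι ℤ (Sum.inr x) * FreeAlgebra.ι ℤ (Sum.inl a))
      (FreeAlgebra.ι ℤ (Sum.inr (x * H.ηR a)))

/-- The underlying ring `⊕ₙ Γ ⊗_A ⋯ ⊗_A Γ` (`n` factors) of the cobar complex of a Hopf
algebroid, with the concatenation product: the tensor ring over `A` of the `A`-bimodule `Γ`
(left action through `ηL`, right action through `ηR`). -/
def Cobar (H : HopfAlgebroid) : Type := RingQuot (CobarRel H)

namespace Cobar

variable {H : HopfAlgebroid}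

instance : Ring (Cobar H) := inferInstanceAs (Ring (RingQuot (CobarRel H)))

/-- The inclusion of the ring `A` of cochains of degree `0`. -/
def coeff : H.A →+* Cobar H :=
  RingHom.mk' ⟨⟨fun a => RingQuot.mkRingHom (CobarRel H) (FreeAlgebra.ι ℤ (Sum.inl a)),
    (RingQuot.mkRingHom_rel CobarRel.coeff_one).trans (map_one _)⟩,
    fun a b => (RingQuot.mkRingHom_rel (CobarRel.coeff_mul a b)).trans (map_mul _ _ _)⟩
    fun a b => (RingQuot.mkRingHom_rel (CobarRel.coeff_add a b)).trans (map_add _ _ _)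

/-- The cochain `[γ]` of degree `1`. -/
def bar : H.Γ →+ Cobar H :=
  AddMonoidHom.mk' (fun x => RingQuot.mkRingHom (CobarRel H) (FreeAlgebra.ι ℤ (Sum.inr x)))
    fun a b => (RingQuot.mkRingHom_rel (CobarRel.bar_add a b)).trans (map_add _ _ _)

lemma coeff_mul_bar (a : H.A) (x : H.Γ) : coeff a * bar x = bar (H.ηL a * x) :=
  (map_mul (RingQuot.mkRingHom (CobarRel H)) _ _).symm.trans
    (RingQuot.mkRingHom_rel (CobarRel.coeff_bar a x))

lemma bar_mul_coeff (x : H.Γ) (a : H.A) : bar x * coeff a = bar (x * H.ηR a) :=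
  (map_mul (RingQuot.mkRingHom (CobarRel H)) _ _).symm.trans
    (RingQuot.mkRingHom_rel (CobarRel.bar_coeff x a))

lemma induction {P : Cobar H → Prop} (hc : ∀ a, P (coeff a)) (hb : ∀ x, P (bar x))
    (hm : ∀ x y, P x → P y → P (x * y)) (ha : ∀ x y, P x → P y → P (x + y)) (z : Cobar H) :
    P z := by
  obtain ⟨w, rfl⟩ := RingQuot.mkRingHom_surjective (CobarRel H) z
  induction w using FreeAlgebra.induction with
  | grade0 n =>
    have h : RingQuot.mkRingHom (CobarRel H) (algebraMap ℤ _ n) = coeff (H := H) (n : H.A) := by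
      rw [map_intCast, eq_intCast, map_intCast]
      rfl
    rw [h]
    exact hc _
  | grade1 v =>
    cases v with
    | inl a => exact hc a
    | inr x => exact hb x
  | mul a b h1 h2 => rw [map_mul]; exact hm _ _ h1 h2
  | add a b h1 h2 => rw [map_add]; exact ha _ _ h1 h2

/-- The universal property of the tensor ring. -/
def lift {S : Type} [Ring S] (f : H.A →+* S) (g : H.Γ →+ S)
    (h₁ : ∀ a x, f a * g x = g (H.ηL a * x)) (h₂ : ∀ x a, g x * f a = g (x * H.ηR a)) :
    Cobar H →+* S :=
  RingQuot.lift ⟨((FreeAlgebra.lift ℤ (Sum.elim f g) : FreeAlgebra ℤ (H.A ⊕ H.Γ) →ₐ[ℤ] S) :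
    FreeAlgebra ℤ (H.A ⊕ H.Γ) →+* S), by
      intro x y hxy
      cases hxy <;> simp [h₁, h₂]⟩

lemma lift_coeff {S : Type} [Ring S] (f : H.A →+* S) (g : H.Γ →+ S)
    (h₁ : ∀ a x, f a * g x = g (H.ηL a * x)) (h₂ : ∀ x a, g x * f a = g (x * H.ηR a))
    (a : H.A) : lift f g h₁ h₂ (coeff a) = f a := by
  refine (RingQuot.lift_mkRingHom_apply _ _ _).trans ?_
  simp

lemma lift_bar {S : Type} [Ring S] (f : H.A →+* S) (g : H.Γ →+ S)
    (h₁ : ∀ a x, f a * g x = g (H.ηL a * x)) (h₂ : ∀ x a, g x * f a = g (x * H.ηR a))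
    (x : H.Γ) : lift f g h₁ h₂ (bar x) = g x := by
  refine (RingQuot.lift_mkRingHom_apply _ _ _).trans ?_
  simp

/-- The inclusion `γ ⊗ γ' ↦ [γ | γ'] = [γ] [γ']` of `Γ ⊗_A Γ` as the cochains of degree `2`. -/
def bar2 : H.ΓΓ →+ Cobar H :=
  TensorProduct.liftAddHom (R := H.A) (M := H.RightΓ) (N := H.LeftΓ)
    (AddMonoidHom.mk' (fun x : H.RightΓ =>
      (AddMonoidHom.mulLeft (bar (H := H) x)).comp (show H.LeftΓ →+ Cobar H from bar))
      (fun x y => by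
        ext z
        exact (congrArg (· * bar (H := H) z) (map_add (bar (H := H)) x y)).trans
          (add_mul _ _ _)))
    (fun a x y => by
      have h : ∀ u v : H.Γ, bar (H.ηR a * u) * bar v = bar u * bar (H := H) (H.ηL a * v) := by
        intro u v
        rw [mul_comm, ← bar_mul_coeff, ← coeff_mul_bar, mul_assoc]
      exact h x y)

lemma bar2_tmul (x y : H.Γ) : bar2 (H.tmul x y) = bar x * bar y := rfl

lemma bar2_inl_mul (x : H.A) (z : H.ΓΓ) :
    bar2 (H.inl (H.ηL x) * z) = coeff x * bar2 z := by
  induction z using Units2.tens_induction with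
  | h0 => simp
  | ht u v =>
    rw [← Units2.inl_mul_inr, ← mul_assoc, ← map_mul, Units2.inl_mul_inr, Units2.inl_mul_inr,
      bar2_tmul, bar2_tmul, ← coeff_mul_bar, mul_assoc]
  | ha u v hu hv => rw [mul_add, map_add, map_add, hu, hv, mul_add]

lemma bar2_mul_inr (x : H.A) (z : H.ΓΓ) :
    bar2 (z * H.inr (H.ηR x)) = bar2 z * coeff x := by
  induction z using Units2.tens_induction with
  | h0 => simp
  | ht u v =>
    rw [← Units2.inl_mul_inr, mul_assoc, ← map_mul, Units2.inl_mul_inr, Units2.inl_mul_inr,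
      bar2_tmul, bar2_tmul, ← bar_mul_coeff, mul_assoc]
  | ha u v hu hv => rw [add_mul, map_add, map_add, hu, hv, add_mul]

/-- The sign automorphism `x ↦ (-1)ⁿ x` for `x` of cohomological degree `n`. -/
def sgn : Cobar H →+* Cobar H :=
  lift coeff (-bar) (fun a x => by simp [coeff_mul_bar]) (fun x a => by simp [bar_mul_coeff])

lemma sgn_coeff (a : H.A) : sgn (coeff a) = coeff (H := H) a := lift_coeff _ _ _ _ a

lemma sgn_bar (x : H.Γ) : sgn (bar x) = -bar (H := H) x := lift_bar _ _ _ _ x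

lemma sgn_sgn (x : Cobar H) : sgn (sgn x) = x := by
  induction x using induction with
  | hc a => simp [sgn_coeff]
  | hb a => simp [sgn_bar]
  | hm x y hx hy => simp [hx, hy]
  | ha x y hx hy => simp [hx, hy]

lemma bar2_ψ_left (a : H.A) (x : H.Γ) :
    bar2 (H.ψ (H.ηL a * x)) = coeff a * bar2 (H.ψ x) := by
  rw [map_mul, ← bar2_inl_mul]
  exact congrArg (fun t => bar2 (t * H.ψ x)) (RingHom.congr_fun H.ψ_ηL a)

lemma bar2_ψ_right (x : H.Γ) (a : H.A) :
    bar2 (H.ψ (x * H.ηR a)) = bar2 (H.ψ x) * coeff a := by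
  rw [map_mul, ← bar2_mul_inr]
  exact congrArg (fun t => bar2 (H.ψ x * t)) (RingHom.congr_fun H.ψ_ηR a)

lemma tri_mul {S : Type} [Ring S] (x y z x' y' z' : S) :
    (!![x, y; 0, z] : Matrix (Fin 2) (Fin 2) S) * !![x', y'; 0, z'] =
      !![x * x', x * y' + y * z'; 0, z * z'] := by
  rw [Matrix.mul_fin_two]
  simp

lemma tri_add {S : Type} [Ring S] (x y z x' y' z' : S) :
    (!![x, y; 0, z] : Matrix (Fin 2) (Fin 2) S) + !![x', y'; 0, z'] =
      !![x + x', y + y'; 0, z + z'] := by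
  ext i j
  fin_cases i <;> fin_cases j <;> simp

lemma tri_congr {S : Type} [Ring S] {x y z x' y' z' : S} (h : x = x') (h' : y = y')
    (h'' : z = z') : (!![x, y; 0, z] : Matrix (Fin 2) (Fin 2) S) = !![x', y'; 0, z'] := by
  rw [h, h', h'']

/-- The restriction of `dMat` to `A`. -/
def dMatA : H.A →+* Matrix (Fin 2) (Fin 2) (Cobar H) where
  toFun a := !![coeff a, bar 1 * coeff a - coeff a * bar 1; 0, coeff a]
  map_one' := by rw [map_one, mul_one, one_mul, sub_self, Matrix.one_fin_two]
  map_zero' := by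
    rw [map_zero, mul_zero, zero_mul, sub_self]
    exact Matrix.eta_fin_two 0 |>.symm
  map_mul' a b := by
    rw [tri_mul]
    refine tri_congr (map_mul _ _ _) ?_ (map_mul _ _ _)
    rw [map_mul]
    noncomm_ring
  map_add' a b := by
    rw [tri_add]
    refine tri_congr (map_add _ _ _) ?_ (map_add _ _ _)
    rw [map_add]
    noncomm_ring

/-- The restriction of `dMat` to `Γ`. -/
def dMatΓ : H.Γ →+ Matrix (Fin 2) (Fin 2) (Cobar H) :=
  AddMonoidHom.mk' (fun x => !![-bar x, bar 1 * bar x + bar x * bar 1 - bar2 (H.ψ x);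
    0, bar x]) fun x y => by
      rw [tri_add]
      refine tri_congr ?_ ?_ (map_add _ _ _)
      · rw [map_add, neg_add]
      · rw [map_add, map_add, map_add]
        noncomm_ring

/-- The ring map `x ↦ [[± x, d x], [0, x]]` into upper triangular matrices that encodes the
graded derivation `d`. -/
def dMat : Cobar H →+* Matrix (Fin 2) (Fin 2) (Cobar H) :=
  lift dMatA dMatΓ
    (fun a x => by
      refine (tri_mul _ _ _ _ _ _).trans (tri_congr ?_ ?_ (coeff_mul_bar a x))
      · rw [mul_neg, coeff_mul_bar]
      · rw [bar2_ψ_left, ← coeff_mul_bar]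
        noncomm_ring)
    (fun x a => by
      refine (tri_mul _ _ _ _ _ _).trans (tri_congr ?_ ?_ (bar_mul_coeff x a))
      · rw [neg_mul, bar_mul_coeff]
      · rw [bar2_ψ_right, ← bar_mul_coeff]
        noncomm_ring)

lemma dMat_coeff (a : H.A) : dMat (coeff a) =
    !![coeff a, bar 1 * coeff a - coeff a * bar 1; 0, coeff (H := H) a] := lift_coeff _ _ _ _ a

lemma dMat_bar (x : H.Γ) : dMat (bar x) =
    !![-bar x, bar 1 * bar x + bar x * bar 1 - bar2 (H.ψ x); 0, bar (H := H) x] :=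
  lift_bar _ _ _ _ x

/-- The cobar differential: the graded derivation with `d a = [ηR a] - [ηL a]` and
`d [γ] = [1 | γ] - [ψ γ] + [γ | 1]`. -/
def d : Cobar H →+ Cobar H :=
  AddMonoidHom.mk' (fun x => dMat x 0 1) fun x y => by rw [map_add]; rfl

lemma d_coeff (a : H.A) : d (coeff a) = bar (H.ηR a) - bar (H := H) (H.ηL a) := by
  have h : d (coeff (H := H) a) = bar 1 * coeff a - coeff a * bar 1 := by
    change dMat (coeff a) 0 1 = _
    rw [dMat_coeff]
    rfl
  rw [h, bar_mul_coeff, coeff_mul_bar, one_mul, mul_one]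

lemma d_bar (x : H.Γ) :
    d (bar x) = bar 1 * bar x - bar2 (H.ψ x) + bar x * bar (H := H) 1 := by
  have h : d (bar (H := H) x) = bar 1 * bar x + bar x * bar 1 - bar2 (H.ψ x) := by
    change dMat (bar x) 0 1 = _
    rw [dMat_bar]
    rfl
  rw [h]
  abel

lemma dMat_eq (x : Cobar H) : dMat x = !![sgn x, d x; 0, x] := by
  have key : dMat x 0 0 = sgn x ∧ dMat x 1 0 = 0 ∧ dMat x 1 1 = x := by
    induction x using induction with
    | hc a => simp [dMat_coeff, sgn_coeff]
    | hb a => simp [dMat_bar, sgn_bar]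
    | hm x y hx hy => simp [Matrix.mul_apply, hx, hy]
    | ha x y hx hy => simp [hx, hy]
  ext i j
  fin_cases i <;> fin_cases j
  · exact key.1
  · rfl
  · exact key.2.1
  · exact key.2.2

lemma d_mul (x y : Cobar H) : d (x * y) = d x * y + sgn x * d y := by
  change dMat (x * y) 0 1 = _
  rw [map_mul, dMat_eq x, dMat_eq y]
  simp [Matrix.mul_apply, add_comm]

lemma d_one : d (1 : Cobar H) = 0 := by
  change dMat 1 0 1 = _
  rw [map_one]
  rfl

lemma d_sgn (x : Cobar H) : d (sgn x) = -sgn (d x) := by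
  induction x using induction with
  | hc a => rw [sgn_coeff, d_coeff, map_sub, sgn_bar, sgn_bar]; abel
  | hb x =>
    have h2 : ∀ z : H.ΓΓ, sgn (bar2 z) = bar2 z := by
      intro z
      induction z using Units2.tens_induction with
      | h0 => simp
      | ht u v => rw [bar2_tmul, map_mul, sgn_bar, sgn_bar, neg_mul_neg]
      | ha u v hu hv => rw [map_add, map_add, hu, hv]
    rw [sgn_bar, map_neg, d_bar, map_add, map_sub, map_mul, map_mul, sgn_bar, sgn_bar, h2]
    noncomm_ring
  | hm x y hx hy =>
    rw [map_mul, d_mul, d_mul, hx, hy, map_add, map_mul, map_mul]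
    noncomm_ring
  | ha x y hx hy => rw [map_add, map_add, hx, hy, map_add, map_add]; abel

/-- The map of cobar complexes induced by a map of Hopf algebroids. -/
def map {H K : HopfAlgebroid} (φ : HopfHom H K) : Cobar H →+* Cobar K :=
  lift (coeff.comp φ.f₀) (bar.comp φ.f₁.toAddMonoidHom)
    (fun a x => by
      refine (coeff_mul_bar _ _).trans (congrArg bar ?_)
      exact (congrArg (· * φ.f₁ x) (RingHom.congr_fun φ.map_ηL a)).symm.trans
        (map_mul φ.f₁ _ _).symm)
    (fun x a => by
      refine (bar_mul_coeff _ _).trans (congrArg bar ?_)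
      exact (congrArg (φ.f₁ x * ·) (RingHom.congr_fun φ.map_ηR a)).symm.trans
        (map_mul φ.f₁ _ _).symm)

lemma map_coeff {H K : HopfAlgebroid} (φ : HopfHom H K) (a : H.A) :
    map φ (coeff a) = coeff (φ.f₀ a) := lift_coeff _ _ _ _ a

lemma map_bar {H K : HopfAlgebroid} (φ : HopfHom H K) (x : H.Γ) :
    map φ (bar x) = bar (φ.f₁ x) := lift_bar _ _ _ _ x

lemma map_bar2_ψ {H K : HopfAlgebroid} (φ : HopfHom H K) (x : H.Γ) :
    map φ (bar2 (H.ψ x)) = bar2 (K.ψ (φ.f₁ x)) := by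
  have h : (K.inl.comp φ.f₁).comp H.ηR = (K.inr.comp φ.f₁).comp H.ηL := by
    ext a
    have h1 := RingHom.congr_fun φ.map_ηR a
    have h2 := RingHom.congr_fun φ.map_ηL a
    simp only [RingHom.comp_apply] at h1 h2 ⊢
    rw [h1, h2, Units2.glue]
  have key : ∀ z : H.ΓΓ, map φ (bar2 z) =
      bar2 (Units2.pair (K.inl.comp φ.f₁) (K.inr.comp φ.f₁) h z) := by
    intro z
    induction z using Units2.tens_induction with
    | h0 => simp
    | ht u v =>
      rw [bar2_tmul, map_mul, map_bar, map_bar, Units2.pair_tmul, RingHom.comp_apply,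
        RingHom.comp_apply, Units2.inl_mul_inr, bar2_tmul]
    | ha u v hu hv => simp only [map_add, hu, hv]
  rw [key]
  exact congrArg bar2 (RingHom.congr_fun (φ.map_ψ h) x)

lemma map_sgn {H K : HopfAlgebroid} (φ : HopfHom H K) (x : Cobar H) :
    map φ (sgn x) = sgn (map φ x) := by
  induction x using induction with
  | hc a => rw [sgn_coeff, map_coeff, sgn_coeff]
  | hb x => rw [sgn_bar, map_neg, map_bar, sgn_bar]
  | hm x y hx hy => rw [map_mul, map_mul, map_mul, map_mul, hx, hy]
  | ha x y hx hy => rw [map_add, map_add, map_add, map_add, hx, hy]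

lemma map_d {H K : HopfAlgebroid} (φ : HopfHom H K) (x : Cobar H) :
    map φ (d x) = d (map φ x) := by
  induction x using induction with
  | hc a =>
    have h1 := RingHom.congr_fun φ.map_ηR a
    have h2 := RingHom.congr_fun φ.map_ηL a
    simp only [RingHom.comp_apply] at h1 h2
    rw [d_coeff, map_sub, map_bar, map_bar, map_coeff, d_coeff, h1, h2]
  | hb x =>
    rw [d_bar, map_bar, d_bar, map_add, map_sub, map_mul, map_mul, map_bar, map_bar,
      map_bar2_ψ, map_one]
  | hm x y hx hy => rw [d_mul, map_mul, d_mul, map_add, map_mul, map_mul, hx, hy, map_sgn]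
  | ha x y hx hy => rw [map_add, map_add, map_add, map_add, hx, hy]

end Cobar

/-! ## Cohomology -/

/-- The ring of cocycles of the cobar complex. -/
def Cocycles (H : HopfAlgebroid) : Subring (Cobar H) where
  carrier := {x | Cobar.d x = 0}
  mul_mem' {x y} hx hy := by
    change Cobar.d (x * y) = 0
    rw [Cobar.d_mul, show Cobar.d x = 0 from hx, show Cobar.d y = 0 from hy, zero_mul, mul_zero,
      add_zero]
  one_mem' := Cobar.d_one
  add_mem' {x y} hx hy := by
    change Cobar.d (x + y) = 0
    rw [map_add, show Cobar.d x = 0 from hx, show Cobar.d y = 0 from hy, add_zero]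
  zero_mem' := map_zero _
  neg_mem' {x} hx := by
    change Cobar.d (-x) = 0
    rw [map_neg, show Cobar.d x = 0 from hx, neg_zero]

/-- Two cocycles are cohomologous if they differ by a coboundary. -/
def cohomologous (H : HopfAlgebroid) : RingCon (Cocycles H) where
  r x y := ∃ w : Cobar H, Cobar.d w = x.1 - y.1
  iseqv :=
    { refl := fun x => ⟨0, by rw [map_zero, sub_self]⟩
      symm := fun {x y} ⟨w, hw⟩ => ⟨-w, by rw [map_neg, hw, neg_sub]⟩
      trans := fun {x y z} ⟨w, hw⟩ ⟨v, hv⟩ => ⟨w + v, by rw [map_add, hw, hv]; abel⟩ }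
  add' {x y u v} := fun ⟨w, hw⟩ ⟨w', hw'⟩ => ⟨w + w', by
    rw [map_add, hw, hw']
    change _ = (x.1 + u.1) - (y.1 + v.1)
    abel⟩
  mul' {x y u v} := fun ⟨w, hw⟩ ⟨w', hw'⟩ => ⟨w * u.1 + Cobar.sgn y.1 * w', by
    have hu : Cobar.d u.1 = 0 := u.2
    have hy : Cobar.d y.1 = 0 := y.2
    rw [map_add, Cobar.d_mul, Cobar.d_mul, hw, hw', hu, Cobar.d_sgn, hy, Cobar.sgn_sgn]
    change _ = (x.1 * u.1) - (y.1 * v.1)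
    rw [map_zero]
    noncomm_ring⟩

/-- The cohomology ring `H^*(A, Γ)`: the cohomology of the cobar complex. -/
def Coh (H : HopfAlgebroid) : Type := (cohomologous H).Quotient

instance (H : HopfAlgebroid) : Ring (Coh H) := inferInstanceAs (Ring (cohomologous H).Quotient)

namespace Coh

/-- The class of a cocycle. -/
def cls {H : HopfAlgebroid} : Cocycles H →+* Coh H := (cohomologous H).mk'

/-- The cochain `x` is a cocycle, and `h` is its cohomology class. -/
def Represents {H : HopfAlgebroid} (x : Cobar H) (h : Coh H) : Prop :=
  ∃ hx : Cobar.d x = 0, cls ⟨x, hx⟩ = h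

/-- The map of cocycles induced by a map of Hopf algebroids. -/
def mapCocycles {H K : HopfAlgebroid} (φ : HopfHom H K) : Cocycles H →+* Cocycles K :=
  ((Cobar.map φ).comp (Cocycles H).subtype).codRestrict (Cocycles K) fun x => by
    change Cobar.d (Cobar.map φ x.1) = 0
    rw [← Cobar.map_d, show Cobar.d x.1 = 0 from x.2, map_zero]

/-- The map in cohomology induced by a map of Hopf algebroids. -/
def map {H K : HopfAlgebroid} (φ : HopfHom H K) : Coh H →+* Coh K :=
  (cohomologous H).lift (cls.comp (mapCocycles φ)) (by
    rintro x y ⟨w, hw⟩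
    refine ((cohomologous K).eq).2 ⟨Cobar.map φ w, ?_⟩
    rw [← Cobar.map_d, hw, map_sub]
    rfl)

lemma map_cls {H K : HopfAlgebroid} (φ : HopfHom H K) (x : Cocycles H) :
    map φ (cls x) = cls (mapCocycles φ x) := rfl

end Coh

/-! ## Internal degrees -/

/-- Internal degrees: for each `m`, the groups of elements of `A` and of `Γ` that are
homogeneous of degree `m`. -/
structure Grading (H : HopfAlgebroid) where
  degA : ℤ → AddSubgroup H.A
  degΓ : ℤ → AddSubgroup H.Γ

/-- `IsHomog g n m x`: the cochain `x` has cohomological degree `n` and internal degree `m`. -/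
inductive IsHomog {H : HopfAlgebroid} (g : Grading H) : ℕ → ℤ → Cobar H → Prop
  | coeff (m : ℤ) (a : H.A) : a ∈ g.degA m → IsHomog g 0 m (Cobar.coeff a)
  | bar (m : ℤ) (x : H.Γ) : x ∈ g.degΓ m → IsHomog g 1 m (Cobar.bar x)
  | zero (n : ℕ) (m : ℤ) : IsHomog g n m 0
  | add (n : ℕ) (m : ℤ) (x y : Cobar H) : IsHomog g n m x → IsHomog g n m y →
      IsHomog g n m (x + y)
  | neg (n : ℕ) (m : ℤ) (x : Cobar H) : IsHomog g n m x → IsHomog g n m (-x)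
  | mul (n n' : ℕ) (m m' : ℤ) (x y : Cobar H) : IsHomog g n m x → IsHomog g n' m' y →
      IsHomog g (n + n') (m + m') (x * y)

/-- The group `H^{n,m}(A, Γ)`: the classes of cocycles of cohomological degree `n` and internal
degree `m`. -/
def bigr {H : HopfAlgebroid} (g : Grading H) (n : ℕ) (m : ℤ) : AddSubgroup (Coh H) where
  carrier := {h | ∃ x, IsHomog g n m x ∧ Coh.Represents x h}
  add_mem' := by
    rintro _ _ ⟨x, hx, hx', rfl⟩ ⟨y, hy, hy', rfl⟩
    exact ⟨x + y, .add n m x y hx hy, by rw [map_add, hx', hy', add_zero],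
      map_add Coh.cls ⟨x, hx'⟩ ⟨y, hy'⟩⟩
  zero_mem' := ⟨0, .zero n m, map_zero _, map_zero Coh.cls⟩
  neg_mem' := by
    rintro _ ⟨x, hx, hx', rfl⟩
    exact ⟨-x, .neg n m x hx, by rw [map_neg, hx', neg_zero], map_neg Coh.cls ⟨x, hx'⟩⟩

/-- The Massey product `⟨a, b, c⟩` of `a ∈ H^{p,k}`, `b ∈ H^{q,l}`, `c ∈ H^{s,m}`: the set of
all classes of cocycles `x v - (-1)^p u z`, where `x, y, z` are homogeneous cocycles
representing `a, b, c`, and `u, v` are homogeneous with `d u = x y` and `d v = y z`. -/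
def massey {H : HopfAlgebroid} (g : Grading H) (p : ℕ) (k : ℤ) (q : ℕ) (l : ℤ) (s : ℕ) (m : ℤ)
    (a b c : Coh H) : Set (Coh H) :=
  {h | ∃ (x y z u v : Cobar H) (n n' : ℕ),
    IsHomog g p k x ∧ Coh.Represents x a ∧
    IsHomog g q l y ∧ Coh.Represents y b ∧
    IsHomog g s m z ∧ Coh.Represents z c ∧
    n + 1 = p + q ∧ IsHomog g n (k + l) u ∧ Cobar.d u = x * y ∧
    n' + 1 = q + s ∧ IsHomog g n' (l + m) v ∧ Cobar.d v = y * z ∧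
    Coh.Represents (x * v - (-1) ^ p * (u * z)) h}

/-! ## The elliptic curve Hopf algebroid -/

instance prime3 : (Ideal.span {(3 : ℤ)}).IsPrime :=
  (Ideal.span_singleton_prime (by norm_num)).2 Int.prime_three

/-- The localization of `ℤ` at the prime ideal `(3)`. -/
abbrev Z3 : Type := Localization.AtPrime (Ideal.span {(3 : ℤ)})

lemma Z3_hom_ext {R : Type} [CommRing R] (f g : Z3 →+* R) : f = g :=
  IsLocalization.ringHom_ext (Ideal.span {(3 : ℤ)}).primeCompl (Subsingleton.elim _ _)

/-- The names of the generators `a₁, a₂, a₃, a₄, a₆` of `A`. -/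
inductive WVar
  | a1 | a2 | a3 | a4 | a6

/-- The names of the generators `r, s, t` of `Γ` over `A`. -/
inductive TVar
  | r | s | t

/-- `A_(3) = ℤ_(3)[a₁, a₂, a₃, a₄, a₆]`. -/
abbrev WA : Type := MvPolynomial WVar Z3

/-- `Γ_(3) = A_(3)[r, s, t]`. -/
abbrev WΓ : Type := MvPolynomial TVar WA

namespace W

/-- `a₁` in `A`. -/
def a1 : WA := MvPolynomial.X WVar.a1
/-- `a₂` in `A`. -/
def a2 : WA := MvPolynomial.X WVar.a2
/-- `a₃` in `A`. -/
def a3 : WA := MvPolynomial.X WVar.a3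
/-- `a₄` in `A`. -/
def a4 : WA := MvPolynomial.X WVar.a4
/-- `a₆` in `A`. -/
def a6 : WA := MvPolynomial.X WVar.a6
/-- `r` in `Γ`. -/
def r : WΓ := MvPolynomial.X TVar.r
/-- `s` in `Γ`. -/
def s : WΓ := MvPolynomial.X TVar.s
/-- `t` in `Γ`. -/
def t : WΓ := MvPolynomial.X TVar.t

/-- The left unit, the standard inclusion. -/
def ηL : WA →+* WΓ := MvPolynomial.C

/-- The values of the right unit on generators. -/
def ηRval : WVar → WΓ
  | .a1 => ηL a1 + 2 * s
  | .a2 => ηL a2 - ηL a1 * s + 3 * r - s ^ 2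
  | .a3 => ηL a3 + ηL a1 * r + 2 * t
  | .a4 => ηL a4 - ηL a3 * s + 2 * ηL a2 * r - ηL a1 * t - ηL a1 * r * s - 2 * s * t + 3 * r ^ 2
  | .a6 => ηL a6 + ηL a4 * r - ηL a3 * t + ηL a2 * r ^ 2 - ηL a1 * r * t - t ^ 2 + r ^ 3

/-- The right unit. -/
def ηR : WA →+* WΓ := MvPolynomial.eval₂Hom (ηL.comp MvPolynomial.C) ηRval

lemma ηR_a1 : ηR a1 = ηL a1 + 2 * s := MvPolynomial.eval₂Hom_X' _ _ _
lemma ηR_a2 : ηR a2 = ηL a2 - ηL a1 * s + 3 * r - s ^ 2 := MvPolynomial.eval₂Hom_X' _ _ _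
lemma ηR_a3 : ηR a3 = ηL a3 + ηL a1 * r + 2 * t := MvPolynomial.eval₂Hom_X' _ _ _
lemma ηR_a4 : ηR a4 = ηL a4 - ηL a3 * s + 2 * ηL a2 * r - ηL a1 * t - ηL a1 * r * s
    - 2 * s * t + 3 * r ^ 2 := MvPolynomial.eval₂Hom_X' _ _ _
lemma ηR_a6 : ηR a6 = ηL a6 + ηL a4 * r - ηL a3 * t + ηL a2 * r ^ 2 - ηL a1 * r * t - t ^ 2
    + r ^ 3 := MvPolynomial.eval₂Hom_X' _ _ _

/-- The pair `(A, Γ)` with its units. -/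
def units : Units2 where
  A := WA
  Γ := WΓ
  ηL := ηL
  ηR := ηR

/-- `γ ↦ γ ⊗ 1`. -/
def inl : WΓ →+* units.ΓΓ := units.inl

/-- `γ ↦ 1 ⊗ γ`. -/
def inr : WΓ →+* units.ΓΓ := units.inr

lemma inl_mul_inr (x y : WΓ) : inl x * inr y = units.tmul x y := units.inl_mul_inr x y

lemma A_ext {R : Type} [CommRing R] {f g : WA →+* R} (h1 : f a1 = g a1) (h2 : f a2 = g a2)
    (h3 : f a3 = g a3) (h4 : f a4 = g a4) (h6 : f a6 = g a6) : f = g :=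
  MvPolynomial.ringHom_ext' (Z3_hom_ext _ _) (by rintro (_ | _ | _ | _ | _) <;> assumption)

lemma Γ_ext {R : Type} [CommRing R] {f g : WΓ →+* R} (h : f.comp ηL = g.comp ηL)
    (hr : f r = g r) (hs : f s = g s) (ht : f t = g t) : f = g :=
  MvPolynomial.ringHom_ext' h (by rintro (_ | _ | _) <;> assumption)

/-- The ring map out of `Γ` that is `f` on `A` and has the given values at `r, s, t`. -/
def ΓLift {R : Type} [CommRing R] (f : WA →+* R) (x y z : R) : WΓ →+* R :=
  MvPolynomial.eval₂Hom f (fun v => match v with | .r => x | .s => y | .t => z)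

section
variable {R : Type} [CommRing R] (f : WA →+* R) (x y z : R)
lemma ΓLift_ηL : (ΓLift f x y z).comp ηL = f :=
  RingHom.ext fun a => MvPolynomial.eval₂Hom_C _ _ a
lemma ΓLift_ηL' (a : WA) : ΓLift f x y z (ηL a) = f a := MvPolynomial.eval₂Hom_C _ _ a
lemma ΓLift_r : ΓLift f x y z r = x := MvPolynomial.eval₂Hom_X' _ _ _
lemma ΓLift_s : ΓLift f x y z s = y := MvPolynomial.eval₂Hom_X' _ _ _
lemma ΓLift_t : ΓLift f x y z t = z := MvPolynomial.eval₂Hom_X' _ _ _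
end

/-- The comultiplication: `r` and `s` are primitive and
`ψ t = t ⊗ 1 + 1 ⊗ t + s ⊗ r`. -/
def ψ : WΓ →+* units.ΓΓ :=
  ΓLift (inl.comp ηL) (inl r + inr r) (inl s + inr s) (inl t + inr t + units.tmul s r)

/-- The counit. -/
def ε : WΓ →+* WA := ΓLift (RingHom.id WA) 0 0 0

/-- The conjugation. -/
def c : WΓ →+* WΓ := ΓLift ηR (-r) (-s) (-t + s * r)

/-- The structure maps of the elliptic curve Hopf algebroid. -/
def data : HopfData where
  toUnits2 := units
  ε := ε
  ψ := ψ
  c := c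

lemma ψ_ηL : ψ.comp ηL = inl.comp ηL := ΓLift_ηL _ _ _ _

lemma ψ_r : ψ r = inl r + inr r := ΓLift_r _ _ _ _
lemma ψ_s : ψ s = inl s + inr s := ΓLift_s _ _ _ _
lemma ψ_t : ψ t = inl t + inr t + inl s * inr r := by
  rw [inl_mul_inr]
  exact ΓLift_t _ _ _ _

lemma glue (a : WA) : inr (ηL a) = inl (ηR a) := (units.glue a).symm

lemma ψ_ηR : ψ.comp ηR = inr.comp ηR := by
  have hL : ∀ a, ψ (ηL a) = inl (ηL a) := fun a => RingHom.congr_fun ψ_ηL a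
  apply A_ext <;>
    simp only [RingHom.comp_apply, ηR_a1, ηR_a2, ηR_a3, ηR_a4, ηR_a6, map_add, map_sub, map_mul,
      map_pow, map_ofNat, hL, ψ_r, ψ_s, ψ_t, glue] <;> ring

lemma ε_ηR : ε.comp ηR = RingHom.id WA := by
  apply A_ext <;>
    simp [ε, ηR_a1, ηR_a2, ηR_a3, ηR_a4, ηR_a6, ΓLift_ηL', ΓLift_r, ΓLift_s, ΓLift_t]

lemma c_ηR : c.comp ηR = ηL := by
  refine A_ext (R := WΓ) (f := c.comp ηR) (g := ηL) ?_ ?_ ?_ ?_ ?_ <;>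
    simp only [c, RingHom.comp_apply, ηR_a1, ηR_a2, ηR_a3, ηR_a4, ηR_a6, map_add,
      map_sub, map_mul, map_pow, map_ofNat, ΓLift_ηL', ΓLift_r, ΓLift_s, ΓLift_t] <;> ring

section
variable {R : Type} [CommRing R] (f g : WΓ →+* R) (h : f.comp ηR = g.comp ηL)

/-- The map `γ ⊗ γ' ↦ f γ * g γ'`. -/
def pr : units.ΓΓ →+* R := Units2.pair (U := units) f g h

lemma pr_inl (x : WΓ) : pr f g h (inl x) = f x := Units2.pair_inl (U := units) f g h x
lemma pr_inr (x : WΓ) : pr f g h (inr x) = g x := Units2.pair_inr (U := units) f g h x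

/-- The composite of two points of `Γ`. -/
def comp : WΓ →+* R := (pr f g h).comp ψ

lemma comp_ηL : (comp f g h).comp ηL = f.comp ηL :=
  RingHom.ext fun a => (congrArg (pr f g h) (RingHom.congr_fun ψ_ηL a)).trans (pr_inl f g h _)

lemma comp_r : comp f g h r = f r + g r :=
  (congrArg (pr f g h) ψ_r).trans (by rw [map_add, pr_inl, pr_inr])

lemma comp_s : comp f g h s = f s + g s :=
  (congrArg (pr f g h) ψ_s).trans (by rw [map_add, pr_inl, pr_inr])

lemma comp_t : comp f g h t = f t + g t + f s * g r :=
  (congrArg (pr f g h) ψ_t).trans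
    (by rw [map_add, map_add, map_mul, pr_inl, pr_inr, pr_inl, pr_inr])

end

section
variable {R : Type} [CommRing R]

lemma ε_ηL (a : WA) : ε (ηL a) = a := ΓLift_ηL' _ _ _ _ a
lemma ε_r : ε r = 0 := ΓLift_r _ _ _ _
lemma ε_s : ε s = 0 := ΓLift_s _ _ _ _
lemma ε_t : ε t = 0 := ΓLift_t _ _ _ _
lemma c_ηL (a : WA) : c (ηL a) = ηR a := ΓLift_ηL' _ _ _ _ a
lemma c_r : c r = -r := ΓLift_r _ _ _ _
lemma c_s : c s = -s := ΓLift_s _ _ _ _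
lemma c_t : c t = -t + s * r := ΓLift_t _ _ _ _

lemma id_comp (e f : WΓ →+* R) (h : e.comp ηR = f.comp ηL) (he : e = (f.comp ηL).comp ε) :
    comp e f h = f := by
  apply Γ_ext
  · rw [comp_ηL, he]
    refine RingHom.ext fun a => ?_
    simp only [RingHom.comp_apply, ε_ηL]
  all_goals simp [comp_r, comp_s, comp_t, he, ε_r, ε_s, ε_t]

lemma comp_id (f e : WΓ →+* R) (h : f.comp ηR = e.comp ηL) (he : e = (f.comp ηR).comp ε) :
    comp f e h = f := by
  apply Γ_ext
  · rw [comp_ηL]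
  all_goals simp [comp_r, comp_s, comp_t, he, ε_r, ε_s, ε_t]

lemma comp_inv (f g : WΓ →+* R) (h : f.comp ηR = g.comp ηL) (hg : g = f.comp c) :
    comp f g h = (f.comp ηL).comp ε := by
  apply Γ_ext
  · rw [comp_ηL]
    refine RingHom.ext fun a => ?_
    simp only [RingHom.comp_apply, ε_ηL]
  all_goals simp [comp_r, comp_s, comp_t, hg, ε_r, ε_s, ε_t, c_r, c_s, c_t]

lemma inv_comp (g f : WΓ →+* R) (h : g.comp ηR = f.comp ηL) (hg : g = f.comp c) :
    comp g f h = (f.comp ηR).comp ε := by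
  apply Γ_ext
  · rw [comp_ηL, hg]
    refine RingHom.ext fun a => ?_
    simp only [RingHom.comp_apply, ε_ηL, c_ηL]
  all_goals simp [comp_r, comp_s, comp_t, hg, ε_r, ε_s, ε_t, c_r, c_s, c_t]

lemma assoc (f g k fg gk : WΓ →+* R) (h₁ : f.comp ηR = g.comp ηL) (h₂ : g.comp ηR = k.comp ηL)
    (h₃ : fg.comp ηR = k.comp ηL) (h₄ : f.comp ηR = gk.comp ηL) (hfg : fg = comp f g h₁)
    (hgk : gk = comp g k h₂) : comp fg k h₃ = comp f gk h₄ := by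
  apply Γ_ext
  · rw [comp_ηL, comp_ηL, hfg, comp_ηL]
  all_goals
    simp only [comp_r, comp_s, comp_t, hfg, hgk]
    ring

end

end W

/-- The elliptic curve Hopf algebroid, localized at `3`. -/
def weierstrass : HopfAlgebroid where
  toHopfData := W.data
  flat := (RingHom.flat_algebraMap_iff (R := WA) (S := WΓ)).2 inferInstance
  ε_ηL := RingHom.ext W.ε_ηL
  ε_ηR := W.ε_ηR
  ψ_ηL := W.ψ_ηL
  ψ_ηR := W.ψ_ηR
  c_ηL := RingHom.ext W.c_ηL
  c_ηR := W.c_ηR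
  id_comp _ _ := W.id_comp
  comp_id _ _ := W.comp_id
  comp_inv _ _ := W.comp_inv
  inv_comp _ _ := W.inv_comp
  assoc _ _ := W.assoc

/-- The internal degree of `aᵢ` is `2 i`. -/
def WVar.deg : WVar → ℤ
  | .a1 => 2
  | .a2 => 4
  | .a3 => 6
  | .a4 => 8
  | .a6 => 12

/-- The internal grading of the elliptic curve Hopf algebroid: `|aᵢ| = 2 i`, `|r| = 4`,
`|s| = 2`, `|t| = 6`. -/
def weierstrassDeg : Grading weierstrass where
  degA m := (MvPolynomial.weightedHomogeneousSubmodule Z3 WVar.deg m).toAddSubgroup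
  degΓ m := AddSubgroup.closure {z : WΓ | ∃ (a : WA) (k : ℤ) (i j l : ℕ),
    a.IsWeightedHomogeneous WVar.deg k ∧ k + 4 * i + 2 * j + 6 * l = m ∧
    z = W.ηL a * W.r ^ i * W.s ^ j * W.t ^ l}

/-! ## The Hopf algebroids `(A, A[r]/(r³ + a₂ r² + a₄ r))` -/

/-- The polynomial `x³ + a₂ x² + a₄ x`. -/
def cubicPoly {A : Type} [CommRing A] (a2 a4 : A) : Polynomial A :=
  Polynomial.X ^ 3 + Polynomial.C a2 * Polynomial.X ^ 2 + Polynomial.C a4 * Polynomial.X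

lemma cubicPoly_eval₂ {A R : Type} [CommRing A] [CommRing R] (a2 a4 : A) (f : A →+* R) (x : R) :
    (cubicPoly a2 a4).eval₂ f x = x ^ 3 + f a2 * x ^ 2 + f a4 * x := by
  simp [cubicPoly, Polynomial.eval₂_add, Polynomial.eval₂_mul]

/-- The ring `A[r]/(r³ + a₂ r² + a₄ r)`. -/
abbrev CubΓ {A : Type} [CommRing A] (a2 a4 : A) : Type := AdjoinRoot (cubicPoly a2 a4)

lemma three_eq_zero {A : Type} [CommRing A] (a2 a4 : A) (h : ((3 : ℕ) : A) = 0) :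
    (3 : CubΓ a2 a4) = 0 := by
  have h' := congrArg (AdjoinRoot.of (cubicPoly a2 a4)) h
  rw [map_natCast, map_zero] at h'
  exact_mod_cast h'

/-- A ring `A` with elements `a₂, a₄` that determine ring maps out of `A`, and a right unit
`ηR : A → A[r]/(r³ + a₂ r² + a₄ r)` with `ηR a₂ = a₂ + 3 r` and
`ηR a₄ = a₄ + 2 a₂ r + 3 r²`. -/
structure CubicBase (A : Type) [CommRing A] where
  a2 : A
  a4 : A
  ηR : A →+* CubΓ a2 a4
  ηR_a2 : ηR a2 = AdjoinRoot.of (cubicPoly a2 a4) a2 + 3 * AdjoinRoot.root (cubicPoly a2 a4)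
  ηR_a4 : ηR a4 = AdjoinRoot.of (cubicPoly a2 a4) a4 +
    2 * AdjoinRoot.of (cubicPoly a2 a4) a2 * AdjoinRoot.root (cubicPoly a2 a4) +
    3 * AdjoinRoot.root (cubicPoly a2 a4) ^ 2
  hom_ext : ∀ (R : Type) [CommRing R] (f g : A →+* R), f a2 = g a2 → f a4 = g a4 → f = g

namespace CubicBase

variable {A : Type} [CommRing A] (B : CubicBase A)

/-- The ring `Γ = A[r]/(r³ + a₂ r² + a₄ r)`. -/
abbrev Γ : Type := CubΓ B.a2 B.a4

/-- The left unit, the inclusion of constants. -/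
def ηL : A →+* B.Γ := AdjoinRoot.of (cubicPoly B.a2 B.a4)

/-- The element `r` of `Γ`. -/
def r : B.Γ := AdjoinRoot.root (cubicPoly B.a2 B.a4)

/-- The pair `(A, Γ)` with its units. -/
def units : Units2 where
  A := A
  Γ := B.Γ
  ηL := B.ηL
  ηR := B.ηR

/-- `γ ↦ γ ⊗ 1`. -/
def inl : B.Γ →+* B.units.ΓΓ := B.units.inl

/-- `γ ↦ 1 ⊗ γ`. -/
def inr : B.Γ →+* B.units.ΓΓ := B.units.inr

lemma glue (a : A) : B.inr (B.ηL a) = B.inl (B.ηR a) := (B.units.glue a).symm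

lemma ηR_a2' : B.ηR B.a2 = B.ηL B.a2 + 3 * B.r := B.ηR_a2

lemma ηR_a4' : B.ηR B.a4 = B.ηL B.a4 + 2 * B.ηL B.a2 * B.r + 3 * B.r ^ 2 := B.ηR_a4

lemma rel : B.r ^ 3 + B.ηL B.a2 * B.r ^ 2 + B.ηL B.a4 * B.r = 0 := by
  have h := AdjoinRoot.eval₂_root (cubicPoly B.a2 B.a4)
  rw [cubicPoly_eval₂] at h
  exact h

variable {B} in
lemma Γ_ext {R : Type} [CommRing R] {f g : B.Γ →+* R} (h : f.comp B.ηL = g.comp B.ηL)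
    (hr : f B.r = g B.r) : f = g :=
  AdjoinRoot.ringHom_ext h hr

/-- The ring map out of `Γ` that is `f` on `A` and sends `r` to `x`. -/
def ΓLift {R : Type} [CommRing R] (f : A →+* R) (x : R)
    (hx : x ^ 3 + f B.a2 * x ^ 2 + f B.a4 * x = 0) : B.Γ →+* R :=
  AdjoinRoot.lift f x ((cubicPoly_eval₂ _ _ _ _).trans hx)

section
variable {R : Type} [CommRing R] (f : A →+* R) (x : R)
  (hx : x ^ 3 + f B.a2 * x ^ 2 + f B.a4 * x = 0)

lemma ΓLift_ηL (a : A) : B.ΓLift f x hx (B.ηL a) = f a := AdjoinRoot.lift_of _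

lemma ΓLift_r : B.ΓLift f x hx B.r = x := AdjoinRoot.lift_root _

end

/-- The comultiplication, `ψ r = r ⊗ 1 + 1 ⊗ r`. -/
def ψ : B.Γ →+* B.units.ΓΓ :=
  B.ΓLift (B.inl.comp B.ηL) (B.inl B.r + B.inr B.r) (by
    have h1 := congrArg B.inl B.rel
    have h2 := congrArg B.inr B.rel
    simp only [map_add, map_mul, map_pow, map_zero, glue, ηR_a2', ηR_a4', map_ofNat] at h1 h2
    rw [RingHom.comp_apply, RingHom.comp_apply]
    linear_combination h1 + h2)

/-- The counit, `ε r = 0`. -/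
def ε : B.Γ →+* A := B.ΓLift (RingHom.id A) 0 (by simp)

/-- The conjugation, `c r = - r`. -/
def c : B.Γ →+* B.Γ := B.ΓLift B.ηR (-B.r) (by
  rw [ηR_a2', ηR_a4']
  linear_combination -B.rel)

/-- The structure maps of `(A, A[r]/(r³ + a₂ r² + a₄ r))`. -/
def data : HopfData where
  toUnits2 := B.units
  ε := B.ε
  ψ := B.ψ
  c := B.c

lemma ψ_ηL (a : A) : B.ψ (B.ηL a) = B.inl (B.ηL a) := B.ΓLift_ηL _ _ _ a
lemma ψ_r : B.ψ B.r = B.inl B.r + B.inr B.r := B.ΓLift_r _ _ _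
lemma ε_ηL (a : A) : B.ε (B.ηL a) = a := B.ΓLift_ηL _ _ _ a
lemma ε_r : B.ε B.r = 0 := B.ΓLift_r _ _ _
lemma c_ηL (a : A) : B.c (B.ηL a) = B.ηR a := B.ΓLift_ηL _ _ _ a
lemma c_r : B.c B.r = -B.r := B.ΓLift_r _ _ _

lemma ψ_ηR : B.ψ.comp B.ηR = B.inr.comp B.ηR := by
  apply B.hom_ext
  all_goals
    simp only [RingHom.comp_apply, ηR_a2', ηR_a4', map_add, map_mul, map_pow, map_ofNat, ψ_ηL,
      ψ_r, glue]
    ring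

lemma ε_ηR : B.ε.comp B.ηR = RingHom.id A := by
  apply B.hom_ext <;> simp [ηR_a2', ηR_a4', ε_ηL, ε_r]

lemma c_ηR : B.c.comp B.ηR = B.ηL := by
  apply B.hom_ext
  all_goals
    simp only [RingHom.comp_apply, ηR_a2', ηR_a4', map_add, map_mul, map_pow, map_ofNat, c_ηL,
      c_r]
    ring

section
variable {R : Type} [CommRing R] (f g : B.Γ →+* R) (h : f.comp B.ηR = g.comp B.ηL)

/-- The map `γ ⊗ γ' ↦ f γ * g γ'`. -/
def pr : B.units.ΓΓ →+* R := Units2.pair (U := B.units) f g h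

lemma pr_inl (x : B.Γ) : B.pr f g h (B.inl x) = f x := Units2.pair_inl (U := B.units) f g h x
lemma pr_inr (x : B.Γ) : B.pr f g h (B.inr x) = g x := Units2.pair_inr (U := B.units) f g h x

/-- The composite of two points of `Γ`. -/
def comp : B.Γ →+* R := (B.pr f g h).comp B.ψ

lemma comp_ηL : (B.comp f g h).comp B.ηL = f.comp B.ηL :=
  RingHom.ext fun a => (congrArg (B.pr f g h) (B.ψ_ηL a)).trans (B.pr_inl f g h _)

lemma comp_r : B.comp f g h B.r = f B.r + g B.r :=
  (congrArg (B.pr f g h) B.ψ_r).trans (by rw [map_add, pr_inl, pr_inr])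

end

section
variable {R : Type} [CommRing R]

lemma id_comp (e f : B.Γ →+* R) (h : e.comp B.ηR = f.comp B.ηL)
    (he : e = (f.comp B.ηL).comp B.ε) : B.comp e f h = f := by
  apply Γ_ext
  · rw [comp_ηL, he]
    refine RingHom.ext fun a => ?_
    simp only [RingHom.comp_apply, ε_ηL]
  · simp [comp_r, he, ε_r]

lemma comp_id (f e : B.Γ →+* R) (h : f.comp B.ηR = e.comp B.ηL)
    (he : e = (f.comp B.ηR).comp B.ε) : B.comp f e h = f := by
  apply Γ_ext
  · rw [comp_ηL]
  · simp [comp_r, he, ε_r]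

lemma comp_inv (f g : B.Γ →+* R) (h : f.comp B.ηR = g.comp B.ηL) (hg : g = f.comp B.c) :
    B.comp f g h = (f.comp B.ηL).comp B.ε := by
  apply Γ_ext
  · rw [comp_ηL]
    refine RingHom.ext fun a => ?_
    simp only [RingHom.comp_apply, ε_ηL]
  · simp [comp_r, hg, ε_r, c_r]

lemma inv_comp (g f : B.Γ →+* R) (h : g.comp B.ηR = f.comp B.ηL) (hg : g = f.comp B.c) :
    B.comp g f h = (f.comp B.ηR).comp B.ε := by
  apply Γ_ext
  · rw [comp_ηL, hg]
    refine RingHom.ext fun a => ?_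
    simp only [RingHom.comp_apply, ε_ηL, c_ηL]
  · simp [comp_r, hg, ε_r, c_r]

lemma assoc (f g k fg gk : B.Γ →+* R) (h₁ : f.comp B.ηR = g.comp B.ηL)
    (h₂ : g.comp B.ηR = k.comp B.ηL) (h₃ : fg.comp B.ηR = k.comp B.ηL)
    (h₄ : f.comp B.ηR = gk.comp B.ηL) (hfg : fg = B.comp f g h₁) (hgk : gk = B.comp g k h₂) :
    B.comp fg k h₃ = B.comp f gk h₄ := by
  apply Γ_ext
  · rw [comp_ηL, comp_ηL, hfg, comp_ηL]
  · simp only [comp_r, hfg, hgk]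
    ring

end

lemma flat : B.ηL.Flat := by
  have hm : (cubicPoly B.a2 B.a4).Monic := by
    unfold cubicPoly
    monicity!
  have : Module.Free A B.Γ := Module.Free.of_basis (AdjoinRoot.powerBasis' hm).basis
  exact (RingHom.flat_algebraMap_iff (R := A) (S := B.Γ)).2 inferInstance

/-- The Hopf algebroid `(A, A[r]/(r³ + a₂ r² + a₄ r))` with `r` primitive. -/
def hopf : HopfAlgebroid where
  toHopfData := B.data
  flat := B.flat
  ε_ηL := RingHom.ext B.ε_ηL
  ε_ηR := B.ε_ηR
  ψ_ηL := RingHom.ext B.ψ_ηL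
  ψ_ηR := B.ψ_ηR
  c_ηL := RingHom.ext B.c_ηL
  c_ηR := B.c_ηR
  id_comp _ _ := B.id_comp
  comp_id _ _ := B.comp_id
  comp_inv _ _ := B.comp_inv
  inv_comp _ _ := B.inv_comp
  assoc _ _ := B.assoc

/-- The internal grading with `|r| = 4`, for a given grading of `A`. -/
def grading (degA : ℤ → AddSubgroup A) : Grading B.hopf where
  degA := degA
  degΓ m := AddSubgroup.closure {z : B.Γ | ∃ (a : A) (k : ℤ) (i : ℕ),
    a ∈ degA k ∧ k + 4 * i = m ∧ z = B.ηL a * B.r ^ i}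

/-- The map of Hopf algebroids induced by a ring map `A → A'` that preserves `a₂` and `a₄`. -/
def homOf {A' : Type} [CommRing A'] (B' : CubicBase A') (f : A →+* A') (h2 : f B.a2 = B'.a2)
    (h4 : f B.a4 = B'.a4) : HopfHom B.hopf B'.hopf :=
  let F : B.Γ →+* B'.Γ := B.ΓLift (B'.ηL.comp f) B'.r (by
    rw [RingHom.comp_apply, RingHom.comp_apply, h2, h4, B'.rel])
  have hL : ∀ a, F (B.ηL a) = B'.ηL (f a) := B.ΓLift_ηL _ _ _
  have hr : F B.r = B'.r := B.ΓLift_r _ _ _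
  { f₀ := f
    f₁ := F
    map_ηL := RingHom.ext hL
    map_ηR := by
      apply B.hom_ext
      · change F (B.ηR B.a2) = B'.ηR (f B.a2)
        simp only [ηR_a2', h2, map_add, map_mul, map_ofNat, hL, hr]
      · change F (B.ηR B.a4) = B'.ηR (f B.a4)
        simp only [ηR_a4', h2, h4, map_add, map_mul, map_pow, map_ofNat, hL, hr]
    map_ε := by
      refine Γ_ext (B := B) (f := f.comp B.ε) (g := B'.ε.comp F) (RingHom.ext fun a => ?_) ?_
      · simp only [RingHom.comp_apply, ε_ηL, hL]
      · simp only [RingHom.comp_apply, ε_r, hr, map_zero]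
    map_ψ := fun h₀ => by
      have h : (B'.inl.comp F).comp B.ηR = (B'.inr.comp F).comp B.ηL := h₀
      refine Γ_ext (B := B) (f := B.comp (B'.inl.comp F) (B'.inr.comp F) h)
        (g := B'.ψ.comp F) ?_ ?_
      · rw [comp_ηL]
        refine RingHom.ext fun a => ?_
        simp only [RingHom.comp_apply, hL, ψ_ηL]
      · simp only [comp_r, RingHom.comp_apply, hr, ψ_r] }

end CubicBase

/-- The names of the generators `a₂, a₄`. -/
inductive CVar
  | a2 | a4

/-- The internal degrees `|a₂| = 4`, `|a₄| = 8`. -/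
def CVar.deg : CVar → ℤ
  | .a2 => 4
  | .a4 => 8

/-- The values of the right unit of `k[a₂, a₄]` on generators: `a₂ + 3 r` and
`a₄ + 2 a₂ r + 3 r²`. -/
def cubicηRval (k : Type) [CommRing k] :
    CVar → CubΓ (MvPolynomial.X CVar.a2 : MvPolynomial CVar k) (MvPolynomial.X CVar.a4)
  | .a2 => AdjoinRoot.of _ (MvPolynomial.X CVar.a2) + 3 * AdjoinRoot.root _
  | .a4 => AdjoinRoot.of _ (MvPolynomial.X CVar.a4) +
      2 * AdjoinRoot.of _ (MvPolynomial.X CVar.a2) * AdjoinRoot.root _ + 3 * AdjoinRoot.root _ ^ 2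

/-- The polynomial ring `k[a₂, a₄]`, where `k` is a ring with at most one map to any ring, with
`ηR a₂ = a₂ + 3 r` and `ηR a₄ = a₄ + 2 a₂ r + 3 r²`. -/
def polyBase (k : Type) [CommRing k]
    (hk : ∀ (R : Type) [CommRing R] (f g : k →+* R), f = g) :
    CubicBase (MvPolynomial CVar k) where
  a2 := MvPolynomial.X CVar.a2
  a4 := MvPolynomial.X CVar.a4
  ηR := MvPolynomial.eval₂Hom ((AdjoinRoot.of _).comp MvPolynomial.C) (cubicηRval k)
  ηR_a2 := MvPolynomial.eval₂Hom_X' _ _ _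
  ηR_a4 := MvPolynomial.eval₂Hom_X' _ _ _
  hom_ext R _ f g h2 h4 := MvPolynomial.ringHom_ext' (hk R _ _) (by rintro (_ | _) <;> assumption)

/-- The base `A' = ℤ_(3)[a₂, a₄]`. -/
def base' : CubicBase (MvPolynomial CVar Z3) := polyBase Z3 fun _ _ => Z3_hom_ext

/-- The base `A₀ = A'/(3) = 𝔽₃[a₂, a₄]`. -/
def base0 : CubicBase (MvPolynomial CVar (ZMod 3)) :=
  polyBase (ZMod 3) fun _ _ _ _ => Subsingleton.elim _ _

/-- The base `A₁ = A'/(3, a₂) = 𝔽₃[a₄]`; here `ηR a₄ = a₄`. -/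
def base1 : CubicBase (Polynomial (ZMod 3)) where
  a2 := 0
  a4 := Polynomial.X
  ηR := AdjoinRoot.of _
  ηR_a2 := by
    have h : (3 : CubΓ (0 : Polynomial (ZMod 3)) Polynomial.X) = 0 :=
      three_eq_zero _ _ (CharP.cast_eq_zero (Polynomial (ZMod 3)) 3)
    rw [h, zero_mul, add_zero]
  ηR_a4 := by
    have h : (3 : CubΓ (0 : Polynomial (ZMod 3)) Polynomial.X) = 0 :=
      three_eq_zero _ _ (CharP.cast_eq_zero (Polynomial (ZMod 3)) 3)
    rw [h, map_zero, mul_zero, zero_mul, zero_mul, add_zero, add_zero]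
  hom_ext R _ f g _ h4 := Polynomial.ringHom_ext' (Subsingleton.elim _ _) h4

/-- The base `A₂ = A'/(3, a₂, a₄) = 𝔽₃`. -/
def base2 : CubicBase (ZMod 3) where
  a2 := 0
  a4 := 0
  ηR := AdjoinRoot.of _
  ηR_a2 := by
    have h : (3 : CubΓ (0 : ZMod 3) 0) = 0 :=
      three_eq_zero _ _ (CharP.cast_eq_zero (ZMod 3) 3)
    rw [h, zero_mul, add_zero]
  ηR_a4 := by
    have h : (3 : CubΓ (0 : ZMod 3) 0) = 0 :=
      three_eq_zero _ _ (CharP.cast_eq_zero (ZMod 3) 3)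
    rw [h, map_zero, mul_zero, zero_mul, zero_mul, add_zero, add_zero]
  hom_ext R _ f g _ _ := Subsingleton.elim _ _

/-- The grading of `(A', Γ')` (and below of `(A₀, Γ₀)`, `(A₁, Γ₁)`, `(A₂, Γ₂)`), with `|a₂| = 4`,
`|a₄| = 8`, `|r| = 4`. -/
def deg' : Grading base'.hopf :=
  base'.grading fun m => (MvPolynomial.weightedHomogeneousSubmodule Z3 CVar.deg m).toAddSubgroup

/-- See `deg'`. -/
def deg0 : Grading base0.hopf :=
  base0.grading fun m =>
    (MvPolynomial.weightedHomogeneousSubmodule (ZMod 3) CVar.deg m).toAddSubgroup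

/-- See `deg'`. -/
def deg1 : Grading base1.hopf :=
  base1.grading fun m => AddSubgroup.closure {z | ∃ (x : ZMod 3) (i : ℕ),
    (8 * i : ℤ) = m ∧ z = Polynomial.C x * Polynomial.X ^ i}

/-- See `deg'`. -/
def deg2 : Grading base2.hopf :=
  base2.grading fun m => if m = 0 then ⊤ else ⊥

/-- The first of the reduction maps `(A', Γ') → (A₀, Γ₀) → (A₁, Γ₁) → (A₂, Γ₂)`. -/
def red0 : HopfHom base'.hopf base0.hopf :=
  base'.homOf base0
    (MvPolynomial.eval₂Hom (MvPolynomial.C.comp (IsLocalization.lift (S := Z3)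
      (M := (Ideal.span {(3 : ℤ)}).primeCompl) (g := Int.castRingHom (ZMod 3)) (fun y => by
        have hy : ¬ (y : ℤ) ∈ Ideal.span {(3 : ℤ)} := y.2
        rw [Ideal.mem_span_singleton] at hy
        have hne : ((y : ℤ) : ZMod 3) ≠ 0 :=
          fun h => hy ((ZMod.intCast_zmod_eq_zero_iff_dvd _ 3).1 h)
        have : Fact (Nat.Prime 3) := ⟨Nat.prime_three⟩
        exact isUnit_iff_ne_zero.2 hne))) MvPolynomial.X)
    (MvPolynomial.eval₂Hom_X' _ _ _) (MvPolynomial.eval₂Hom_X' _ _ _)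

/-- See `red0`. -/
def red1 : HopfHom base0.hopf base1.hopf :=
  base0.homOf base1
    (MvPolynomial.eval₂Hom Polynomial.C (fun v => match v with | .a2 => 0 | .a4 => Polynomial.X))
    (MvPolynomial.eval₂Hom_X' _ _ _) (MvPolynomial.eval₂Hom_X' _ _ _)

/-- See `red0`. -/
def red2 : HopfHom base1.hopf base2.hopf :=
  base1.homOf base2 (Polynomial.evalRingHom 0) (map_zero _) (Polynomial.eval_X)

/-- The map `A_(3) → A'` that kills `a₁, a₃, a₆`. -/
def proj₀ : WA →+* MvPolynomial CVar Z3 :=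
  MvPolynomial.eval₂Hom MvPolynomial.C (fun v => match v with
    | .a1 => 0 | .a2 => base'.a2 | .a3 => 0 | .a4 => base'.a4 | .a6 => 0)

/-- The map `Γ_(3) → Γ'` that extends `proj₀`, kills `s, t`, and sends `r` to `r`. -/
def proj₁ : WΓ →+* base'.Γ := W.ΓLift (base'.ηL.comp proj₀) base'.r 0 0

/-- The map of Hopf algebroids `(A_(3), Γ_(3)) → (A', Γ')` that kills `a₁, a₃, a₆, s, t`. -/
def proj : HopfHom weierstrass base'.hopf :=
  have hL : ∀ a, proj₁ (W.ηL a) = base'.ηL (proj₀ a) := W.ΓLift_ηL' _ _ _ _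
  have hr : proj₁ W.r = base'.r := W.ΓLift_r _ _ _ _
  have hs : proj₁ W.s = 0 := W.ΓLift_s _ _ _ _
  have ht : proj₁ W.t = 0 := W.ΓLift_t _ _ _ _
  have h1 : proj₀ W.a1 = 0 := MvPolynomial.eval₂Hom_X' _ _ _
  have h2 : proj₀ W.a2 = base'.a2 := MvPolynomial.eval₂Hom_X' _ _ _
  have h3 : proj₀ W.a3 = 0 := MvPolynomial.eval₂Hom_X' _ _ _
  have h4 : proj₀ W.a4 = base'.a4 := MvPolynomial.eval₂Hom_X' _ _ _
  have h6 : proj₀ W.a6 = 0 := MvPolynomial.eval₂Hom_X' _ _ _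
  { f₀ := proj₀
    f₁ := proj₁
    map_ηL := RingHom.ext hL
    map_ηR := by
      refine W.A_ext (f := proj₁.comp W.ηR) (g := base'.ηR.comp proj₀) ?_ ?_ ?_ ?_ ?_
      all_goals
        simp only [RingHom.comp_apply, W.ηR_a1, W.ηR_a2, W.ηR_a3, W.ηR_a4, W.ηR_a6, map_add,
          map_sub, map_mul, map_pow, map_ofNat, hL, hr, hs, ht, h1, h2, h3, h4, h6,
          base'.ηR_a2', base'.ηR_a4', map_zero]
      · ring
      · ring
      · ring
      · ring
      · linear_combination base'.rel
    map_ε := by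
      refine W.Γ_ext (f := proj₀.comp W.ε) (g := base'.ε.comp proj₁)
        (RingHom.ext fun a => ?_) ?_ ?_ ?_
      · simp only [RingHom.comp_apply, W.ε_ηL, hL, base'.ε_ηL]
      · simp only [RingHom.comp_apply, W.ε_r, hr, base'.ε_r, map_zero]
      · simp only [RingHom.comp_apply, W.ε_s, hs, map_zero]
      · simp only [RingHom.comp_apply, W.ε_t, ht, map_zero]
    map_ψ := fun h₀ => by
      have h : (base'.inl.comp proj₁).comp W.ηR = (base'.inr.comp proj₁).comp W.ηL := h₀
      refine W.Γ_ext (f := W.comp (base'.inl.comp proj₁) (base'.inr.comp proj₁) h)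
        (g := base'.ψ.comp proj₁) ?_ ?_ ?_ ?_
      · rw [W.comp_ηL]
        refine RingHom.ext fun a => ?_
        simp only [RingHom.comp_apply, hL, base'.ψ_ηL]
      · simp only [W.comp_r, RingHom.comp_apply, hr, base'.ψ_r]
      · simp only [W.comp_s, RingHom.comp_apply, hs, map_zero, add_zero]
      · simp only [W.comp_t, RingHom.comp_apply, hs, ht, map_zero, add_zero, zero_mul] }

/-! ## Named cochains -/

namespace CubicBase

variable {A : Type} [CommRing A] (B : CubicBase A)

/-- An element of `A` as a cochain of degree `0`. -/
def cf : A →+* Cobar B.hopf := Cobar.coeff (H := B.hopf)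

/-- The cochain `[γ]` of degree `1`. -/
def br : B.Γ →+ Cobar B.hopf := Cobar.bar (H := B.hopf)

/-- The cochain `[r² | r] + [r | r²]`. -/
def βc : Cobar B.hopf := B.br (B.r ^ 2) * B.br B.r + B.br B.r * B.br (B.r ^ 2)

/-- The cochain `a₄ [r] + a₂ [r²]`. -/
def ξc : Cobar B.hopf := B.cf B.a4 * B.br B.r + B.cf B.a2 * B.br (B.r ^ 2)

end CubicBase

namespace W

/-- `b₂ = a₁² + 4 a₂`. -/
def b2 : WA := a1 ^ 2 + 4 * a2
/-- `b₄ = 2 a₄ + a₁ a₃`. -/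
def b4 : WA := 2 * a4 + a1 * a3
/-- `b₆ = a₃² + 4 a₆`. -/
def b6 : WA := a3 ^ 2 + 4 * a6
/-- `b₈ = a₁² a₆ + 4 a₂ a₆ - a₁ a₃ a₄ + a₂ a₃² - a₄²`. -/
def b8 : WA := a1 ^ 2 * a6 + 4 * a2 * a6 - a1 * a3 * a4 + a2 * a3 ^ 2 - a4 ^ 2
/-- `c₄ = b₂² - 24 b₄`. -/
def c4 : WA := b2 ^ 2 - 24 * b4
/-- `c₆ = - b₂³ + 36 b₂ b₄ - 216 b₆`. -/
def c6 : WA := -b2 ^ 3 + 36 * b2 * b4 - 216 * b6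
/-- The discriminant. -/
def Δ : WA := -b2 ^ 2 * b8 - 8 * b4 ^ 3 - 27 * b6 ^ 2 + 9 * b2 * b4 * b6

/-- The discriminant is `(c₄³ - c₆²) / 1728`. -/
lemma Δ_eq : 1728 * Δ = c4 ^ 3 - c6 ^ 2 := by
  simp only [Δ, c4, c6, b2, b4, b6, b8]
  ring

/-- An element of `A` as a cochain of degree `0`. -/
def cf : WA →+* Cobar weierstrass := Cobar.coeff (H := weierstrass)

/-- The cochain `[γ]` of degree `1`. -/
def br : WΓ →+ Cobar weierstrass := Cobar.bar (H := weierstrass)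

/-- The cochain `[r² | r] + [r | r²]`. -/
def βc : Cobar weierstrass := br (r ^ 2) * br r + br r * br (r ^ 2)

end W

/-! ## Presentations of the cohomology rings -/

/-- Generators of `H^{**}(A₂, Γ₂)`. -/
inductive Gen2
  | α | β

/-- The ring `E(α) ⊗ P(β) = 𝔽₃[α, β]/(α²)`. -/
abbrev Pres2 : Type :=
  MvPolynomial Gen2 (ZMod 3) ⧸ Ideal.span {(MvPolynomial.X Gen2.α : MvPolynomial Gen2 (ZMod 3)) ^ 2}

/-- The generators of `Pres2`. -/
def Pres2.gen (v : Gen2) : Pres2 := Ideal.Quotient.mk _ (MvPolynomial.X v)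

/-- Generators of `H^{**}(A₀, Γ₀)`. -/
inductive Gen0
  | a2 | Δ | α | ξ | β

open FreeAlgebra in
/-- Relations for `H^{**}(A₀, Γ₀)`: `a₂, Δ, β` are central, the generators `α, ξ` of odd degree
anticommute and have square zero, and `a₂ α = 0`, `a₂ ξ = 0`, `a₂² β = 0`, `ξ α = a₂ β`. -/
inductive Rel0 : FreeAlgebra (ZMod 3) Gen0 → FreeAlgebra (ZMod 3) Gen0 → Prop
  | a2_central (v : Gen0) :
      Rel0 (ι (ZMod 3) Gen0.a2 * ι (ZMod 3) v) (ι (ZMod 3) v * ι (ZMod 3) Gen0.a2)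
  | Δ_central (v : Gen0) :
      Rel0 (ι (ZMod 3) Gen0.Δ * ι (ZMod 3) v) (ι (ZMod 3) v * ι (ZMod 3) Gen0.Δ)
  | β_central (v : Gen0) :
      Rel0 (ι (ZMod 3) Gen0.β * ι (ZMod 3) v) (ι (ZMod 3) v * ι (ZMod 3) Gen0.β)
  | anticomm :
      Rel0 (ι (ZMod 3) Gen0.α * ι (ZMod 3) Gen0.ξ) (-(ι (ZMod 3) Gen0.ξ * ι (ZMod 3) Gen0.α))
  | α_sq : Rel0 (ι (ZMod 3) Gen0.α ^ 2) 0
  | ξ_sq : Rel0 (ι (ZMod 3) Gen0.ξ ^ 2) 0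
  | a2_α : Rel0 (ι (ZMod 3) Gen0.a2 * ι (ZMod 3) Gen0.α) 0
  | a2_ξ : Rel0 (ι (ZMod 3) Gen0.a2 * ι (ZMod 3) Gen0.ξ) 0
  | a2_sq_β : Rel0 (ι (ZMod 3) Gen0.a2 ^ 2 * ι (ZMod 3) Gen0.β) 0
  | ξ_α :
      Rel0 (ι (ZMod 3) Gen0.ξ * ι (ZMod 3) Gen0.α) (ι (ZMod 3) Gen0.a2 * ι (ZMod 3) Gen0.β)

/-- The graded commutative `𝔽₃`-algebra with the generators `Gen0` and the relations `Rel0`. -/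
abbrev Pres0 : Type := RingQuot Rel0

/-- The generators of `Pres0`. -/
def Pres0.gen (v : Gen0) : Pres0 := RingQuot.mkRingHom Rel0 (FreeAlgebra.ι (ZMod 3) v)

/-- Generators of `H^{**}(A_(3), Γ_(3))`. -/
inductive GenE
  | c4 | c6 | Δ | α | β

open MvPolynomial in
/-- The ideal of relations of `H^{**}(A_(3), Γ_(3))`. -/
def relE : Ideal (MvPolynomial GenE Z3) :=
  Ideal.span {X GenE.c4 ^ 3 - X GenE.c6 ^ 2 - 1728 * X GenE.Δ,
    3 * X GenE.α, 3 * X GenE.β, X GenE.α ^ 2,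
    X GenE.c4 * X GenE.α, X GenE.c6 * X GenE.α, X GenE.c4 * X GenE.β, X GenE.c6 * X GenE.β}

/-- The ring `ℤ_(3)[c₄, c₆, Δ, α, β]` modulo `c₄³ - c₆² = 1728 Δ`, `3 α = 3 β = 0`, `α² = 0`,
`c₄ α = c₆ α = 0`, `c₄ β = c₆ β = 0`. -/
abbrev PresE : Type := MvPolynomial GenE Z3 ⧸ relE

/-- The generators of `PresE`. -/
def PresE.gen (v : GenE) : PresE := Ideal.Quotient.mk _ (MvPolynomial.X v)

end EllCoh

end

open EllCoh

/-!
The cohomology of each Hopf algebroid in the statement is computed from a coinduced comodule that is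
free of rank three over the base, instead of from Bockstein spectral sequences.

A `CubicResolution` of `(A, Γ)` comes from a comodule algebra `P`, free over `A` with basis `1, ρ,
ρ²`, over which the curve acquires a point of order two, together with a map `Γ → P`; its
coordinates are a right `A`-linear map `e : Γ → A³` with `e 1, e r, e r²` the standard basis. The
operators `κ` on the cobar complex, with `κ([γ] t) = e(γ) t`, are contractions up to the part
generated by `1, [r], [r²]`, and from them (`CubicResolution.decompose`,
`CubicResolution.coh_induction`) every cohomology class is obtained from `0` by finitely many steps
`h ↦ a + s b + β h`. Here `a` is a cocycle in `A`, and `s b` is a class of degree one with leading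
term `[r] b`, for `b` in the kernel of a component `F₂` of the coordinates `F = e ∘ ηL`. By
`CubicResolution.eq_zero_of_coh` the only relations are `s (F₁ c) = 0` and `β F₂ c = 0`. Thus the
cohomology is periodic under `β` above degree one, and it is determined by the two maps `F₁` and
`F₂` of `A`, that is by the cohomology of the complex `A → A → A → ⋯` with differentials `F₁`, `F₂`,
`F₁`, ….

For the bases `A₂`, `A₁` the maps `F₁, F₂` vanish (`CubicResolution.bijective_of_trivial`). For `A₀`
the polynomial ring `𝔽₃[a₂, a₄]` is free on `1, a₄, a₄²` over the invariants `𝔽₃[a₂, Δ]`, and `F₁`,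
`F₂` are linear over them, hence explicit (`Base0.F_coords`, `Base0.φ0_bijective`). For `A'` the
invariants are generated by `c₄, c₆, Δ` (`BaseZ.inv_eq`): after multiplication by a power of `3`
every polynomial lies in the span of `1, a₂, a₂²` over `ℤ_(3)[c₄, c₆, Δ]`, where the invariants are
visible, and the powers of `3` are cancelled by reduction to `A₀`
(`BaseZ.exists_three_pow_mul_mem_N`, `BaseZ.three_dvd_of_redA`). The odd elements modulo the values
of `F₁`, and the values of `F₂`, are found in the same way (`BaseZ.exists_of_isOdd`,
`BaseZ.exists_F2_eq`, `BaseZ.φ'_bijective`). The presented rings are compared with the cohomology by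
`CubicResolution.injective_of_exhausts` and `CubicResolution.surjective_of`.

For the elliptic curve Hopf algebroid the comodule algebra is the ring that classifies a root of the
cubic obtained by completing the square (`W.resolution`). Moving the point of order two so obtained
to the origin shows that `F` factors through `A'`, and a map of cubic resolutions that is surjective
on `A` with kernel killed by `F` is an isomorphism in cohomology
(`CubicResolution.Compatible.bijective`, `W.bijective_map_proj`).

The bigrading is handled by coactions of a Laurent polynomial Hopf algebra (`RingGrading`): they
give projections of the cobar complex to its homogeneous parts, hence the direct sum decompositions
and the indeterminacy of the Massey products. The product `⟨α, α, α⟩` contains `-β / 2 = β`, as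
`3 β = 0`, and its indeterminacy vanishes because `H^{1,8} = 0`.
-/

noncomputable section

namespace EllCoh

/-! ### Complements on the cobar complex -/

namespace Cobar

variable {H : HopfAlgebroid}

/-- Every cochain is a sum of cochains of degree `0` and cochains of the form `[γ] t`. -/
lemma induction_left {P : Cobar H → Prop} (hc : ∀ a, P (coeff a))
    (hb : ∀ x t, P (bar x * t)) (ha : ∀ x y, P x → P y → P (x + y)) (z : Cobar H) : P z := by
  let S : AddSubmonoid (Cobar H) := AddSubmonoid.closure
    ({t | ∃ a, t = coeff a} ∪ {t | ∃ x y, t = bar x * y})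
  have hS : ∀ t ∈ S, P t := by
    intro t ht
    refine AddSubmonoid.closure_induction (motive := fun t _ => P t) ?_ ?_ ?_ ht
    · rintro t (⟨a, rfl⟩ | ⟨x, y, rfl⟩)
      exacts [hc a, hb x y]
    · simpa using hc 0
    · intro x y _ _ hx hy
      exact ha x y hx hy
  have h1 : (1 : Cobar H) ∈ S := AddSubmonoid.subset_closure (Or.inl ⟨1, (map_one _).symm⟩)
  have key : ∀ z t : Cobar H, t ∈ S → z * t ∈ S := by
    intro z
    induction z using induction with
    | hc a =>
      intro t ht
      refine AddSubmonoid.closure_induction (motive := fun t _ => coeff a * t ∈ S) ?_ ?_ ?_ ht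
      · rintro t (⟨b, rfl⟩ | ⟨x, y, rfl⟩)
        · exact AddSubmonoid.subset_closure (Or.inl ⟨a * b, (map_mul _ _ _).symm⟩)
        · exact AddSubmonoid.subset_closure (Or.inr ⟨H.ηL a * x, y, by
            rw [← coeff_mul_bar, mul_assoc]⟩)
      · rw [mul_zero]; exact zero_mem _
      · intro x y _ _ hx hy
        rw [mul_add]; exact add_mem hx hy
    | hb x => exact fun t _ => AddSubmonoid.subset_closure (Or.inr ⟨x, t, rfl⟩)
    | hm x y hx hy => intro t ht; rw [mul_assoc]; exact hx _ (hy _ ht)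
    | ha x y hx hy => intro t ht; rw [add_mul]; exact add_mem (hx _ ht) (hy _ ht)
  exact hS z (by simpa using key z 1 h1)

lemma d_coeff' (a : H.A) : d (coeff (H := H) a) = bar 1 * coeff a - coeff a * bar 1 := by
  rw [d_coeff, bar_mul_coeff, coeff_mul_bar, one_mul, mul_one]

lemma d_coeff_mul (a : H.A) (x : Cobar H) :
    d (coeff a * x) = d (coeff a) * x + coeff a * d x := by
  rw [d_mul, sgn_coeff]

lemma d_bar_mul (γ : H.Γ) (x : Cobar H) :
    d (bar γ * x) = d (bar γ) * x - bar γ * d x := by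
  rw [d_mul, sgn_bar, neg_mul, sub_eq_add_neg]

lemma d_d_coeff (a : H.A) : d (d (coeff (H := H) a)) = 0 := by
  have h1 : bar2 (H.ψ (H.ηR a)) = bar 1 * bar (H.ηR a) := by
    rw [← bar2_tmul, ← Units2.inl_mul_inr, map_one, one_mul]
    exact congrArg bar2 (RingHom.congr_fun H.ψ_ηR a)
  have h2 : bar2 (H.ψ (H.ηL a)) = bar (H.ηL a) * bar 1 := by
    rw [← bar2_tmul, ← Units2.inl_mul_inr, map_one, mul_one]
    exact congrArg bar2 (RingHom.congr_fun H.ψ_ηL a)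
  have h3 : bar (H.ηR a) * bar 1 = bar 1 * bar (H := H) (H.ηL a) := by
    rw [← one_mul (H.ηR a), ← bar_mul_coeff, mul_assoc, coeff_mul_bar, mul_one]
  rw [d_coeff, map_sub, d_bar, d_bar, h1, h2, h3]
  abel

/-- The projection to the cochains of degree `0`. -/
def deg0part : Cobar H →+* H.A :=
  lift (RingHom.id H.A) 0 (fun a x => by simp) (fun x a => by simp)

lemma deg0part_coeff (a : H.A) : deg0part (coeff a) = a := lift_coeff _ _ _ _ a

lemma deg0part_bar (x : H.Γ) : deg0part (bar x) = 0 := lift_bar _ _ _ _ x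

lemma coeff_injective : Function.Injective (coeff (H := H)) :=
  Function.LeftInverse.injective deg0part_coeff

lemma deg0part_d (x : Cobar H) : deg0part (d x) = 0 := by
  induction x using induction with
  | hc a => rw [d_coeff, map_sub, deg0part_bar, deg0part_bar, sub_zero]
  | hb x =>
    have h2 : ∀ z : H.ΓΓ, deg0part (bar2 z) = 0 := by
      intro z
      induction z using Units2.tens_induction with
      | h0 => simp
      | ht u v => rw [bar2_tmul, map_mul, deg0part_bar, zero_mul]
      | ha u v hu hv => rw [map_add, map_add, hu, hv, add_zero]
    rw [d_bar, map_add, map_sub, map_mul, map_mul, h2, deg0part_bar]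
    simp
  | hm x y hx hy => rw [d_mul, map_add, map_mul, map_mul, hx, hy, zero_mul, mul_zero, add_zero]
  | ha x y hx hy => rw [map_add, map_add, hx, hy, add_zero]

/-- Invariant elements are central in the cobar complex. -/
lemma coeff_commute {a : H.A} (ha : H.ηR a = H.ηL a) (x : Cobar H) :
    Commute (coeff a) x := by
  induction x using induction with
  | hc b => exact (map_mul coeff a b).symm.trans ((congrArg coeff (mul_comm a b)).trans
      (map_mul coeff b a))
  | hb x => exact (coeff_mul_bar a x).trans (((congrArg bar (by rw [ha, mul_comm])).trans
      (bar_mul_coeff x a).symm))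
  | hm x y hx hy => exact hx.mul_right hy
  | ha x y hx hy => exact hx.add_right hy

lemma d_coeff_eq_zero {a : H.A} (ha : H.ηR a = H.ηL a) : d (coeff (H := H) a) = 0 := by
  rw [d_coeff, ha, sub_self]

end Cobar

/-! ### Cubic resolutions -/

open Cobar in
/-- Data that make the complex `T ⊕ T ρ ⊕ T ρ²`, with `d ρ = [r]` and `d ρ² = 2 ρ [r] + [r²]`,
over the cobar complex `T` acyclic in positive degrees.  Here `T ⊕ T ρ ⊕ T ρ²` is the cobar
complex with coefficients in a comodule algebra `P` that is free over `A` with basis `1, ρ, ρ²`,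
and `P` comes with a map `Γ → P` that identifies it with a quotient `A' ⊗_A Γ`.  The algebra `P`
only enters through the coordinates `e` of the map `Γ → P`, and through the matrices `M a` of
the multiplication with the image of `ηL a` in `P`. -/
structure CubicResolution (H : HopfAlgebroid) where
  e : H.Γ →+ (Fin 3 → H.A)
  M : H.A →+* Matrix (Fin 3) (Fin 3) H.A
  r : H.Γ
  half : H.A
  two_half : 2 * half = 1
  e_ηR : ∀ γ a i, e (γ * H.ηR a) i = e γ i * a
  e_ηL : ∀ a γ, e (H.ηL a * γ) = (M a).mulVec (e γ)
  e_one : e 1 = ![1, 0, 0]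
  e_r : e r = ![0, 1, 0]
  e_r2 : e (r ^ 2) = ![0, 0, 1]
  ψ_r : H.ψ r = H.inl r + H.inr r
  /-- The pairing `γ ⊗ γ' ↦ e γ [γ']`. -/
  eΓ : Fin 3 → H.ΓΓ →+ Cobar H
  eΓ_tmul : ∀ i x y, eΓ i (H.tmul x y) = coeff (e x i) * bar y
  coact0 : ∀ γ, eΓ 0 (H.ψ γ) =
    bar 1 * coeff (e γ 0) + bar r * coeff (e γ 1) + bar (r ^ 2) * coeff (e γ 2)
  coact1 : ∀ γ, eΓ 1 (H.ψ γ) = bar 1 * coeff (e γ 1) + 2 * (bar r * coeff (e γ 2))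
  coact2 : ∀ γ, eΓ 2 (H.ψ γ) = bar 1 * coeff (e γ 2)

namespace CubicResolution

open Cobar

variable {H : HopfAlgebroid} (R : CubicResolution H)

lemma d_r : d (bar R.r) = 0 := by
  have h1 : H.inl R.r = H.tmul R.r 1 := by rw [← Units2.inl_mul_inr, map_one, mul_one]
  have h2 : H.inr R.r = H.tmul 1 R.r := by rw [← Units2.inl_mul_inr, map_one, one_mul]
  rw [d_bar, R.ψ_r, map_add, h1, h2, bar2_tmul, bar2_tmul]
  abel

lemma ψ_r2 : H.ψ (R.r ^ 2) = H.tmul (R.r ^ 2) 1 + 2 * H.tmul R.r R.r + H.tmul 1 (R.r ^ 2) := by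
  rw [map_pow, R.ψ_r, ← Units2.inl_mul_inr, ← Units2.inl_mul_inr, ← Units2.inl_mul_inr, map_one,
    map_one, map_pow, map_pow]
  ring

lemma d_r2 : d (bar (R.r ^ 2)) = -(2 * (bar R.r * bar R.r)) := by
  have h : bar2 (2 * H.tmul R.r R.r) = 2 * (bar R.r * bar R.r) := by
    rw [two_mul, map_add, bar2_tmul, two_mul]
  rw [d_bar, R.ψ_r2, map_add, map_add, h, bar2_tmul, bar2_tmul]
  abel

lemma d_r_mul (x : Cobar H) : d (bar R.r * x) = -(bar R.r * d x) := by
  rw [d_bar_mul, R.d_r, zero_mul, zero_sub]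

lemma d_r2_mul (x : Cobar H) :
    d (bar (R.r ^ 2) * x) = -(2 * (bar R.r * bar R.r * x)) - bar (R.r ^ 2) * d x := by
  rw [d_bar_mul, R.d_r2, neg_mul, mul_assoc]

/-- The constant `1/2` as a cochain. -/
def h : Cobar H := coeff R.half

lemma two_h : 2 * R.h = 1 := by
  have := congrArg (coeff (H := H)) R.two_half
  rwa [map_mul, map_ofNat, map_one] at this

lemma h_comm (x : Cobar H) : x * R.h = R.h * x := by
  have h2 : ∀ y : Cobar H, 2 * y = y * 2 := fun y => by rw [two_mul, mul_two]
  calc x * R.h = (2 * R.h) * (x * R.h) := by rw [two_h, one_mul]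
    _ = R.h * (2 * x) * R.h := by rw [h2 R.h]; noncomm_ring
    _ = R.h * x * (2 * R.h) := by rw [h2 x]; noncomm_ring
    _ = R.h * x := by rw [two_h, mul_one]

lemma d_h : d R.h = 0 := by
  rw [h, d_coeff', ← h, h_comm, sub_self]

lemma d_h_mul (x : Cobar H) : d (R.h * x) = R.h * d x := by
  rw [h, d_coeff_mul, ← h, d_h, zero_mul, zero_add]

lemma h_two_mul (x : Cobar H) : R.h * (2 * x) = x := by
  rw [← mul_assoc, show R.h * 2 = 2 * R.h by rw [two_mul, mul_two], two_h, one_mul]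

lemma two_h_mul (x : Cobar H) : 2 * (R.h * x) = x := by
  rw [← mul_assoc, two_h, one_mul]

/-! ### The contraction -/

/-- The left action of `A` on `T³ × T`. -/
def actA : H.A →+* AddMonoid.End ((Fin 3 → Cobar H) × Cobar H) where
  toFun a :=
    { toFun := fun v => ((coeff.mapMatrix (R.M a)).mulVec v.1, coeff a * v.2)
      map_zero' := by simp
      map_add' := fun v w => by simp [Matrix.mulVec_add, mul_add] }
  map_one' := by
    refine DFunLike.ext _ _ fun v => Prod.ext ?_ ?_
    · change (coeff.mapMatrix (R.M 1)).mulVec v.1 = v.1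
      rw [map_one, map_one, Matrix.one_mulVec]
    · change coeff 1 * v.2 = v.2
      rw [map_one, one_mul]
  map_zero' := by
    refine DFunLike.ext _ _ fun v => Prod.ext ?_ ?_
    · change (coeff.mapMatrix (R.M 0)).mulVec v.1 = 0
      rw [map_zero, map_zero, Matrix.zero_mulVec]
    · change coeff 0 * v.2 = 0
      rw [map_zero, zero_mul]
  map_mul' a b := by
    refine DFunLike.ext _ _ fun v => Prod.ext ?_ ?_
    · change (coeff.mapMatrix (R.M (a * b))).mulVec v.1 = (coeff.mapMatrix (R.M a)).mulVec
        ((coeff.mapMatrix (R.M b)).mulVec v.1)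
      rw [map_mul, map_mul, Matrix.mulVec_mulVec]
    · change coeff (a * b) * v.2 = coeff a * (coeff b * v.2)
      rw [map_mul, mul_assoc]
  map_add' a b := by
    refine DFunLike.ext _ _ fun v => Prod.ext ?_ ?_
    · change (coeff.mapMatrix (R.M (a + b))).mulVec v.1 = (coeff.mapMatrix (R.M a)).mulVec v.1 +
        (coeff.mapMatrix (R.M b)).mulVec v.1
      rw [map_add, map_add, Matrix.add_mulVec]
    · change coeff (a + b) * v.2 = coeff a * v.2 + coeff b * v.2
      rw [map_add, add_mul]

/-- The left action of `[γ]` on `T³ × T`. -/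
def actΓ : H.Γ →+ AddMonoid.End ((Fin 3 → Cobar H) × Cobar H) :=
  AddMonoidHom.mk' (fun γ =>
    { toFun := fun v => (fun i => coeff (R.e γ i) * v.2, bar γ * v.2)
      map_zero' := by ext <;> simp
      map_add' := fun v w => by ext <;> simp [mul_add] })
    (fun x y => by
      refine DFunLike.ext _ _ fun v => Prod.ext ?_ ?_
      · funext i
        change coeff (R.e (x + y) i) * v.2 = coeff (R.e x i) * v.2 + coeff (R.e y i) * v.2
        rw [map_add, Pi.add_apply, map_add, add_mul]
      · change bar (x + y) * v.2 = bar x * v.2 + bar y * v.2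
        rw [map_add, add_mul])

lemma coeff_mulVec (N : Matrix (Fin 3) (Fin 3) H.A) (v : Fin 3 → H.A) (t : Cobar H) :
    (coeff.mapMatrix N).mulVec (fun i => coeff (v i) * t) =
      fun i => coeff (N.mulVec v i) * t := by
  funext i
  simp [Matrix.mulVec, dotProduct, Fin.sum_univ_three, add_mul, mul_assoc]

/-- The action of the cobar complex on `T³ × T`, where `T³` is annihilated by the cochains of
positive degree, and `[γ]` maps `t` to `([γ] t, e γ t)`. -/
def act : Cobar H →+* AddMonoid.End ((Fin 3 → Cobar H) × Cobar H) :=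
  lift R.actA R.actΓ
    (fun a x => by
      refine DFunLike.ext _ _ fun v => Prod.ext ?_ ?_
      · change (coeff.mapMatrix (R.M a)).mulVec (fun i => coeff (R.e x i) * v.2) =
          fun i => coeff (R.e (H.ηL a * x) i) * v.2
        rw [coeff_mulVec, R.e_ηL]
      · change coeff a * (bar x * v.2) = bar (H.ηL a * x) * v.2
        rw [← coeff_mul_bar, mul_assoc])
    (fun x a => by
      refine DFunLike.ext _ _ fun v => Prod.ext ?_ ?_
      · funext i
        change coeff (R.e x i) * (coeff a * v.2) = coeff (R.e (x * H.ηR a) i) * v.2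
        rw [R.e_ηR, map_mul, mul_assoc]
      · change bar x * (coeff a * v.2) = bar (x * H.ηR a) * v.2
        rw [← bar_mul_coeff, mul_assoc])

lemma act_coeff (a : H.A) : R.act (coeff a) = R.actA a := lift_coeff _ _ _ _ a

lemma act_bar (x : H.Γ) : R.act (bar x) = R.actΓ x := lift_bar _ _ _ _ x

lemma act_mul (x y : Cobar H) (v : (Fin 3 → Cobar H) × Cobar H) :
    R.act (x * y) v = R.act x (R.act y v) := by
  rw [map_mul]
  rfl

lemma act_add (x y : Cobar H) (v : (Fin 3 → Cobar H) × Cobar H) :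
    R.act (x + y) v = R.act x v + R.act y v := by
  rw [map_add]
  rfl

/-- The contraction `κ : T → T³`, with `κ a = 0` for `a` of degree `0`, and
`κ ([γ] t) = e γ t`. -/
def κ : Cobar H →+ (Fin 3 → Cobar H) :=
  AddMonoidHom.mk' (fun x => (R.act x (0, 1)).1) fun x y => by rw [map_add]; rfl

lemma act_snd (x : Cobar H) (v : (Fin 3 → Cobar H) × Cobar H) : (R.act x v).2 = x * v.2 := by
  induction x using induction generalizing v with
  | hc a => rw [act_coeff]; rfl
  | hb x => rw [act_bar]; rfl
  | hm x y hx hy => rw [act_mul, hx, hy, mul_assoc]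
  | ha x y hx hy => rw [act_add, Prod.snd_add, hx, hy, add_mul]

lemma κ_coeff (a : H.A) : R.κ (coeff a) = 0 := by
  change (R.act (coeff a) (0, 1)).1 = 0
  rw [act_coeff]
  exact Matrix.mulVec_zero (coeff.mapMatrix (R.M a))

lemma κ_bar_mul (γ : H.Γ) (t : Cobar H) (i : Fin 3) :
    R.κ (bar γ * t) i = coeff (R.e γ i) * t := by
  change (R.act (bar γ * t) (0, 1)).1 i = _
  rw [act_mul, act_bar]
  change coeff (R.e γ i) * (R.act t (0, 1)).2 = _
  rw [act_snd, mul_one]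

lemma κ_coeff_mul (a : H.A) (t : Cobar H) :
    R.κ (coeff a * t) = (coeff.mapMatrix (R.M a)).mulVec (R.κ t) := by
  change (R.act (coeff a * t) (0, 1)).1 = _
  rw [act_mul, act_coeff]
  rfl

lemma κ_bar2_mul (z : H.ΓΓ) (t : Cobar H) (i : Fin 3) :
    R.κ (bar2 z * t) i = R.eΓ i z * t := by
  induction z using Units2.tens_induction with
  | h0 => simp
  | ht u v => rw [bar2_tmul, mul_assoc, κ_bar_mul, R.eΓ_tmul, mul_assoc]
  | ha u v hu hv => rw [map_add, add_mul, map_add, Pi.add_apply, hu, hv, map_add, add_mul]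

/-- The coordinates of the image of `ηL a` in the comodule algebra `P`. -/
def F : H.A →+ (Fin 3 → H.A) :=
  R.e.comp H.ηL.toAddMonoidHom

lemma F_apply (a : H.A) : R.F a = R.e (H.ηL a) := rfl

lemma κ_d_coeff (a : H.A) (i : Fin 3) :
    R.κ (d (coeff a)) i = coeff ((![a, 0, 0] : Fin 3 → H.A) i) - coeff (R.F a i) := by
  have h1 : R.κ (bar (H.ηR a)) i = coeff ((![a, 0, 0] : Fin 3 → H.A) i) := by
    have := R.κ_bar_mul (H.ηR a) 1 i
    rw [mul_one, mul_one] at this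
    rw [this, ← one_mul (H.ηR a), R.e_ηR, R.e_one]
    congr 1
    fin_cases i <;> simp
  have h2 : R.κ (bar (H.ηL a)) i = coeff (R.F a i) := by
    have := R.κ_bar_mul (H.ηL a) 1 i
    rwa [mul_one, mul_one] at this
  rw [d_coeff, map_sub, Pi.sub_apply, h1, h2]

/-- The differential of `T ⊕ ρ T ⊕ ρ² T`. -/
def dL : (Fin 3 → Cobar H) →+ (Fin 3 → Cobar H) :=
  AddMonoidHom.mk' (fun v => ![d (v 0) + bar R.r * v 1 + bar (R.r ^ 2) * v 2,
    d (v 1) + 2 * (bar R.r * v 2), d (v 2)]) fun v w => by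
      funext i
      fin_cases i <;> simp [mul_add] <;> abel

lemma dL_0 (v : Fin 3 → Cobar H) :
    R.dL v 0 = d (v 0) + bar R.r * v 1 + bar (R.r ^ 2) * v 2 := rfl
lemma dL_1 (v : Fin 3 → Cobar H) : R.dL v 1 = d (v 1) + 2 * (bar R.r * v 2) := rfl
lemma dL_2 (v : Fin 3 → Cobar H) : R.dL v 2 = d (v 2) := rfl

lemma eq_zero_iff (v : Fin 3 → Cobar H) : R.dL v = 0 ↔
    d (v 0) + bar R.r * v 1 + bar (R.r ^ 2) * v 2 = 0 ∧ d (v 1) + 2 * (bar R.r * v 2) = 0 ∧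
      d (v 2) = 0 := by
  rw [funext_iff, Fin.forall_fin_succ, Fin.forall_fin_succ, Fin.forall_fin_one]
  rfl

/-- `κ` is a contracting homotopy of `T ⊂ T ⊕ ρ T ⊕ ρ² T` in positive degrees. -/
lemma homotopy (x : Cobar H) : R.dL (R.κ x) + R.κ (d x) =
    ![x, 0, 0] - fun i => coeff (R.F (deg0part x) i) := by
  induction x using induction_left with
  | hc a =>
    rw [κ_coeff, map_zero, zero_add]
    funext i
    rw [κ_d_coeff, deg0part_coeff, Pi.sub_apply]
    fin_cases i <;> simp
  | hb γ t =>
    have hF : (fun i => coeff (R.F (deg0part (bar γ * t)) i)) = (0 : Fin 3 → Cobar H) := by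
      funext i
      rw [map_mul, deg0part_bar, zero_mul, map_zero]
      simp
    have hd : d (bar γ * t) = bar 1 * (bar γ * t) - bar2 (H.ψ γ) * t + bar γ * (bar 1 * t)
        - bar γ * d t := by
      rw [d_bar_mul, d_bar]
      noncomm_ring
    rw [hF, sub_zero, hd]
    funext i
    rw [Pi.add_apply, map_sub, map_add, map_sub, Pi.sub_apply, Pi.add_apply, Pi.sub_apply,
      κ_bar_mul, κ_bar_mul, κ_bar_mul, κ_bar2_mul, R.e_one]
    fin_cases i
    · change R.dL (R.κ (bar γ * t)) 0 + (coeff 1 * (bar γ * t) - R.eΓ 0 (H.ψ γ) * t +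
        coeff (R.e γ 0) * (bar 1 * t) - coeff (R.e γ 0) * d t) = bar γ * t
      rw [dL_0, κ_bar_mul, κ_bar_mul, κ_bar_mul, d_coeff_mul, d_coeff', R.coact0, map_one coeff]
      noncomm_ring
    · change R.dL (R.κ (bar γ * t)) 1 + (coeff 0 * (bar γ * t) - R.eΓ 1 (H.ψ γ) * t +
        coeff (R.e γ 1) * (bar 1 * t) - coeff (R.e γ 1) * d t) = 0
      rw [dL_1, κ_bar_mul, κ_bar_mul, d_coeff_mul, d_coeff', R.coact1, map_zero]
      noncomm_ring
    · change R.dL (R.κ (bar γ * t)) 2 + (coeff 0 * (bar γ * t) - R.eΓ 2 (H.ψ γ) * t +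
        coeff (R.e γ 2) * (bar 1 * t) - coeff (R.e γ 2) * d t) = 0
      rw [dL_2, κ_bar_mul, d_coeff_mul, d_coeff', R.coact2, map_zero]
      noncomm_ring
  | ha x y hx hy =>
    have h1 : (![x + y, 0, 0] : Fin 3 → Cobar H) = ![x, 0, 0] + ![y, 0, 0] := by
      funext i; fin_cases i <;> simp
    have h2 : (fun i => coeff (R.F (deg0part (x + y)) i)) =
        (fun i => coeff (R.F (deg0part x) i)) +
          (fun i => coeff (H := H) (R.F (deg0part y) i)) := by
      funext i; simp
    rw [map_add, map_add, map_add, map_add, h1, h2, add_add_add_comm, hx, hy]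
    abel

/-- The coordinates of the elements `ηL a` are cocycles of `T ⊕ ρ T ⊕ ρ² T`. -/
lemma dL_F (a : H.A) : R.dL (fun i => coeff (R.F a i)) = 0 := by
  have h1 := R.homotopy (d (coeff a))
  rw [d_d_coeff, map_zero, add_zero, deg0part_d, map_zero] at h1
  have h2 : R.κ (d (coeff a)) = ![coeff a, 0, 0] - fun i => coeff (R.F a i) := by
    funext i
    rw [κ_d_coeff, Pi.sub_apply]
    fin_cases i <;> simp
  rw [h2, map_sub] at h1
  have h3 : R.dL ![coeff a, 0, 0] = ![d (coeff a), 0, 0] := by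
    funext i
    fin_cases i
    · change R.dL ![coeff a, 0, 0] 0 = d (coeff a); rw [dL_0]; simp
    · change R.dL ![coeff a, 0, 0] 1 = 0; rw [dL_1]; simp
    · change R.dL ![coeff a, 0, 0] 2 = 0; rw [dL_2]; simp
  rw [h3] at h1
  have h4 : ![d (coeff a), 0, 0] - R.dL (fun i => coeff (R.F a i)) = ![d (coeff a), 0, 0] := by
    rw [h1]
    funext i
    simp
  exact sub_eq_self.1 h4

/-- A cocycle of `T ⊕ ρ T ⊕ ρ² T` is, up to an explicit coboundary, an element of `A'`. -/
lemma eq_F_add_dL {x y z : Cobar H}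
    (h0 : d x + bar R.r * y + bar (R.r ^ 2) * z = 0) :
    x = coeff (R.F (deg0part x) 0) + (d (R.κ x 0) + bar R.r * R.κ x 1
      + bar (R.r ^ 2) * R.κ x 2) ∧
    y = coeff (R.F (deg0part x) 1) + (d (R.κ x 1) + 2 * (bar R.r * R.κ x 2)) ∧
    z = coeff (R.F (deg0part x) 2) + d (R.κ x 2) := by
  have hx := R.homotopy x
  have hd : R.κ (d x) = -![0, y, z] := by
    have hdx : d x = -(bar R.r * y + bar (R.r ^ 2) * z) := by
      rw [add_assoc] at h0
      exact eq_neg_of_add_eq_zero_left h0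
    rw [hdx, map_neg, map_add]
    congr 1
    funext i
    rw [Pi.add_apply, κ_bar_mul, κ_bar_mul, R.e_r, R.e_r2]
    fin_cases i <;> simp
  rw [hd] at hx
  have key : ∀ i, (![x, y, z] : Fin 3 → Cobar H) i =
      coeff (R.F (deg0part x) i) + R.dL (R.κ x) i := by
    intro i
    have := congrFun hx i
    rw [Pi.add_apply, Pi.neg_apply, Pi.sub_apply] at this
    rw [eq_sub_iff_add_eq] at this
    have h3 : (![x, y, z] : Fin 3 → Cobar H) i =
        (![x, 0, 0] : Fin 3 → Cobar H) i + (![0, y, z] : Fin 3 → Cobar H) i := by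
      fin_cases i <;> simp
    rw [h3, ← this]
    abel
  exact ⟨key 0, key 1, key 2⟩

end CubicResolution

end EllCoh

namespace EllCoh

/-! ### Classes of cocycles -/

namespace Coh

open Cobar

variable {H : HopfAlgebroid}

/-- The cohomology class of a cocycle. -/
def clsOf (x : Cobar H) (hx : d x = 0) : Coh H := cls ⟨x, hx⟩

lemma represents_clsOf (x : Cobar H) (hx : d x = 0) : Represents x (clsOf x hx) := ⟨hx, rfl⟩

lemma exists_rep (h : Coh H) : ∃ (x : Cobar H) (hx : d x = 0), h = clsOf x hx := by
  obtain ⟨⟨x, hx⟩, rfl⟩ := (cohomologous H).mk'_surjective h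
  exact ⟨x, hx, rfl⟩

lemma clsOf_eq_clsOf {x y : Cobar H} {hx : d x = 0} {hy : d y = 0} :
    clsOf x hx = clsOf y hy ↔ ∃ w, d w = x - y := (cohomologous H).eq

lemma clsOf_eq_zero {x : Cobar H} {hx : d x = 0} : clsOf x hx = 0 ↔ ∃ w, d w = x := by
  have h : (0 : Coh H) = clsOf 0 (map_zero d) := (map_zero cls).symm
  rw [h, clsOf_eq_clsOf, sub_zero]

lemma clsOf_add {x y : Cobar H} (hx : d x = 0) (hy : d y = 0) :
    clsOf x hx + clsOf y hy = clsOf (x + y) (by rw [map_add, hx, hy, add_zero]) :=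
  (map_add cls ⟨x, hx⟩ ⟨y, hy⟩).symm

lemma d_mul_eq_zero {x y : Cobar H} (hx : d x = 0) (hy : d y = 0) : d (x * y) = 0 := by
  rw [d_mul, hx, hy, zero_mul, mul_zero, add_zero]

lemma clsOf_mul {x y : Cobar H} (hx : d x = 0) (hy : d y = 0) :
    clsOf x hx * clsOf y hy = clsOf (x * y) (d_mul_eq_zero hx hy) :=
  (map_mul cls ⟨x, hx⟩ ⟨y, hy⟩).symm

lemma clsOf_neg {x : Cobar H} (hx : d x = 0) :
    -clsOf x hx = clsOf (-x) (by rw [map_neg, hx, neg_zero]) :=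
  (map_neg cls ⟨x, hx⟩).symm

lemma clsOf_congr {x y : Cobar H} (h : x = y) (hx : d x = 0) : clsOf x hx = clsOf y (h ▸ hx) := by
  subst h; rfl

lemma map_clsOf {K : HopfAlgebroid} (φ : HopfHom H K) (x : Cobar H) (hx : d x = 0) :
    map φ (clsOf x hx) = clsOf (Cobar.map φ x) (by rw [← Cobar.map_d, hx, map_zero]) := rfl

lemma Represents.map {K : HopfAlgebroid} (φ : HopfHom H K) {x : Cobar H} {h : Coh H}
    (hx : Represents x h) : Represents (Cobar.map φ x) (Coh.map φ h) := by
  obtain ⟨hx, rfl⟩ := hx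
  exact represents_clsOf _ (by rw [← Cobar.map_d, hx, map_zero])

lemma Represents.mul {x y : Cobar H} {h k : Coh H} (hx : Represents x h) (hy : Represents y k) :
    Represents (x * y) (h * k) := by
  obtain ⟨hx, rfl⟩ := hx
  obtain ⟨hy, rfl⟩ := hy
  exact ⟨d_mul_eq_zero hx hy, (clsOf_mul hx hy).symm⟩

lemma Represents.unique {x : Cobar H} {h k : Coh H} (hx : Represents x h)
    (hy : Represents x k) : h = k := by
  obtain ⟨_, rfl⟩ := hx
  obtain ⟨_, rfl⟩ := hy
  rfl

end Coh

open Cobar in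
/-- The cocycles of degree `0`, as a subring of `A`. -/
def cocycles0 (H : HopfAlgebroid) : Subring H.A := (Cocycles H).comap coeff

lemma mem_cocycles0 {H : HopfAlgebroid} {a : H.A} :
    a ∈ cocycles0 H ↔ Cobar.d (Cobar.coeff a) = 0 := Iff.rfl

/-- The inclusion of the cocycles of degree `0` in the cohomology. -/
def Coh.ofA (H : HopfAlgebroid) : cocycles0 H →+* Coh H :=
  Coh.cls.comp ((Cobar.coeff.comp (cocycles0 H).subtype).codRestrict (Cocycles H) fun a => a.2)

lemma Coh.ofA_eq {H : HopfAlgebroid} (a : cocycles0 H) :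
    Coh.ofA H a = Coh.clsOf (Cobar.coeff a.1) (mem_cocycles0.1 a.2) := rfl

/-! ### The cohomology computed by a cubic resolution -/

namespace CubicResolution

open Cobar Coh

variable {H : HopfAlgebroid} (R : CubicResolution H)

/-- The cocycle `[r² | r] + [r | r²]`. -/
def βc : Cobar H := bar (R.r ^ 2) * bar R.r + bar R.r * bar (R.r ^ 2)

/-- For `F b 2 = 0`, a cocycle of degree `1` with leading term `[r] b`. -/
def s (b : H.A) : Cobar H := bar R.r * coeff b + R.h * (bar (R.r ^ 2) * coeff (R.F b 1))

lemma s_add (b b' : H.A) : R.s (b + b') = R.s b + R.s b' := by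
  simp only [s, map_add, Pi.add_apply]
  noncomm_ring

lemma d_βc : d R.βc = 0 := by
  rw [βc, map_add, R.d_r2_mul, R.d_r_mul, R.d_r, R.d_r2, mul_zero, sub_zero, mul_neg, neg_neg,
    mul_assoc, ← mul_assoc (bar R.r) 2, show bar R.r * 2 = 2 * bar R.r by rw [two_mul, mul_two],
    mul_assoc, neg_add_cancel]

/-- The components of the identity `dL (F a) = 0`. -/
lemma d_F (a : H.A) :
    d (coeff (R.F a 0)) + bar R.r * coeff (R.F a 1) + bar (R.r ^ 2) * coeff (R.F a 2) = 0 ∧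
    d (coeff (R.F a 1)) + 2 * (bar R.r * coeff (R.F a 2)) = 0 ∧
    d (coeff (R.F a 2)) = 0 :=
  (R.eq_zero_iff _).1 (R.dL_F a)

lemma F_of_d_eq_zero {a : H.A} (ha : d (coeff a) = 0) : R.F a = ![a, 0, 0] := by
  funext i
  have := R.κ_d_coeff a i
  rw [ha, map_zero, Pi.zero_apply, eq_comm, sub_eq_zero] at this
  exact (coeff_injective this).symm

/-- The operator `a ↦ F a 1` has divided square `a ↦ F a 2` and its cube vanishes. -/
lemma F_F (a : H.A) : R.F (R.F a 1) = ![R.F a 1, 2 * R.F a 2, 0] := by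
  have h0 : d (coeff (R.F a 1)) + bar R.r * coeff (2 * R.F a 2) + bar (R.r ^ 2) * 0 = 0 := by
    rw [mul_zero, add_zero, map_mul, map_ofNat, ← (R.d_F a).2.1, ← mul_assoc, ← mul_assoc,
      two_mul, mul_two]
  obtain ⟨h1, h2, h3⟩ := R.eq_F_add_dL h0
  rw [deg0part_coeff, κ_coeff] at h1 h2 h3
  simp only [Pi.zero_apply, map_zero, mul_zero, add_zero] at h1 h2 h3
  funext i
  fin_cases i
  · exact (coeff_injective h1).symm
  · exact (coeff_injective h2).symm
  · exact (coeff_injective (h3.symm.trans (map_zero _).symm))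

/-- The condition on `b` under which `s b` is a cocycle. -/
def IsOdd (b : H.A) : Prop := R.F b 0 = b ∧ R.F b 2 = 0

lemma isOdd_F (a : H.A) : R.IsOdd (R.F a 1) := by
  unfold IsOdd
  rw [F_F]
  exact ⟨rfl, rfl⟩

lemma d_s {b : H.A} (hb : R.IsOdd b) : d (R.s b) = 0 := by
  obtain ⟨h1, h2, -⟩ := R.d_F b
  rw [hb.2, map_zero, mul_zero, add_zero] at h1
  rw [hb.2, map_zero, mul_zero, mul_zero, add_zero] at h2
  rw [hb.1] at h1
  rw [s, map_add, d_h_mul, d_r_mul, d_r2_mul, h2, eq_neg_of_add_eq_zero_left h1, mul_zero, sub_zero,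
    mul_neg, neg_neg, mul_neg, h_two_mul, mul_assoc, add_neg_cancel]

/-- `s` of a value of the operator `F · 1` is a coboundary. -/
lemma s_F (a : H.A) : R.s (R.F a 1) = d (-coeff (R.F a 0)) := by
  have h1 := (R.d_F a).1
  rw [map_neg, s, F_F]
  have h2 : R.h * (bar (R.r ^ 2) * coeff (2 * R.F a 2)) = bar (R.r ^ 2) * coeff (R.F a 2) := by
    have h3 : bar (R.r ^ 2) * coeff (2 * R.F a 2) = 2 * (bar (R.r ^ 2) * coeff (R.F a 2)) := by
      rw [map_mul, map_ofNat, ← mul_assoc, ← mul_assoc, two_mul, mul_two]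
    rw [h3, h_two_mul]
  change bar R.r * coeff (R.F a 1) + R.h * (bar (R.r ^ 2) * coeff (2 * R.F a 2)) = _
  rw [h2, eq_neg_iff_add_eq_zero, ← h1]
  abel

/-- `β` times a value of the operator `F · 2` is a coboundary. -/
lemma β_F (a : H.A) : R.βc * coeff (R.F a 2) =
    d (R.h * (bar (R.r ^ 2) * coeff (R.F a 1)) + bar R.r * coeff (R.F a 0)) := by
  obtain ⟨h1, h2, -⟩ := R.d_F a
  have h3 : d (coeff (R.F a 0)) =
      -(bar R.r * coeff (R.F a 1) + bar (R.r ^ 2) * coeff (R.F a 2)) := by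
    rw [eq_neg_iff_add_eq_zero, ← h1, add_assoc]
  rw [map_add, d_h_mul, d_r2_mul, d_r_mul, eq_neg_of_add_eq_zero_left h2, h3, βc,
    show bar (R.r ^ 2) * -(2 * (bar R.r * coeff (R.F a 2))) =
      -(2 * (bar (R.r ^ 2) * bar R.r * coeff (R.F a 2))) by noncomm_ring, sub_neg_eq_add,
    mul_add, mul_neg, h_two_mul, h_two_mul]
  noncomm_ring

/-- Every cocycle is cohomologous to one of the form `a + s b + β z`. -/
lemma decompose {x : Cobar H} (hx : d x = 0) : ∃ a b w, d (coeff a) = 0 ∧ R.IsOdd b ∧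
    d (R.κ (R.κ x 1) 2) = 0 ∧
    x = coeff a + R.s b + R.βc * R.κ (R.κ x 1) 2 + d w := by
  have h0 : d x + bar R.r * 0 + bar (R.r ^ 2) * 0 = 0 := by rw [hx]; simp
  obtain ⟨h1, h2, h3⟩ := R.eq_F_add_dL h0
  set a := deg0part x with ha
  have e1 : R.F a 0 = a := by
    have := congrArg deg0part h1
    simp only [map_add, map_mul, deg0part_d, deg0part_bar, deg0part_coeff, zero_mul,
      add_zero] at this
    exact this.symm
  have e2 : R.F a 1 = 0 := by
    have := congrArg deg0part h2
    simpa only [map_add, map_mul, deg0part_d, deg0part_bar, deg0part_coeff, zero_mul,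
      add_zero, map_zero, mul_zero, eq_comm] using this
  have e3 : R.F a 2 = 0 := by
    have := congrArg deg0part h3
    simpa only [map_add, map_mul, deg0part_d, deg0part_bar, deg0part_coeff, zero_mul,
      add_zero, map_zero, mul_zero, eq_comm] using this
  have e4 : d (coeff a) = 0 := by
    have := (R.d_F a).1
    rwa [e1, e2, e3, map_zero, mul_zero, mul_zero, add_zero, add_zero] at this
  rw [e1] at h1
  rw [e2, map_zero, zero_add] at h2
  rw [e3, map_zero, zero_add] at h3
  set y := R.κ x with hy
  have h4 : d (y 1) + bar R.r * (2 * y 2) + bar (R.r ^ 2) * 0 = 0 := by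
    rw [mul_zero, add_zero, show bar R.r * (2 * y 2) = 2 * (bar R.r * y 2) by noncomm_ring]
    exact h2.symm
  obtain ⟨k1, k2, k3⟩ := R.eq_F_add_dL h4
  set b := deg0part (y 1) with hb
  set v := R.κ (y 1) with hv
  have f1 : R.F b 0 = b := by
    have := congrArg deg0part k1
    simp only [map_add, map_mul, deg0part_d, deg0part_bar, deg0part_coeff, zero_mul,
      add_zero] at this
    exact this.symm
  have f3 : R.F b 2 = 0 := by
    have := congrArg deg0part k3
    simpa only [map_add, map_mul, deg0part_d, deg0part_bar, deg0part_coeff, zero_mul,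
      add_zero, map_zero, mul_zero, eq_comm] using this
  rw [f3, map_zero, zero_add] at k3
  rw [f1] at k1
  refine ⟨a, b, y 0 - bar R.r * v 0 - R.h * (bar (R.r ^ 2) * v 1), e4, ⟨f1, f3⟩, k3.symm, ?_⟩
  have h5 : bar (R.r ^ 2) * y 2 = R.h * (bar (R.r ^ 2) * coeff (R.F b 1)) +
      R.h * (bar (R.r ^ 2) * d (v 1)) + bar (R.r ^ 2) * (bar R.r * v 2) := by
    rw [← R.h_two_mul (bar (R.r ^ 2) * y 2),
      show 2 * (bar (R.r ^ 2) * y 2) = bar (R.r ^ 2) * (2 * y 2) by noncomm_ring, k2,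
      ← R.h_two_mul (bar (R.r ^ 2) * (bar R.r * v 2))]
    noncomm_ring
  have h6 : d (y 0 - bar R.r * v 0 - R.h * (bar (R.r ^ 2) * v 1)) =
      d (y 0) + bar R.r * d (v 0) + bar R.r * bar R.r * v 1 +
        R.h * (bar (R.r ^ 2) * d (v 1)) := by
    rw [map_sub, map_sub, d_r_mul, d_h_mul, d_r2_mul, mul_sub, mul_neg, h_two_mul]
    abel
  rw [h6, s, βc]
  nth_rewrite 1 [h1]
  rw [h5]
  nth_rewrite 1 [k1]
  noncomm_ring

/-- The relations between the classes of the cocycles `a + s b + β z`. -/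
lemma eq_of_coboundary {b : H.A} {z w : Cobar H} (h : d w = R.s b + R.βc * z) :
    (∃ a, b = R.F a 1) ∧ ∃ a v, z = coeff (R.F a 2) + d v := by
  have h0 : d (-w) + bar R.r * (coeff b + bar (R.r ^ 2) * z) +
      bar (R.r ^ 2) * (R.h * coeff (R.F b 1) + bar R.r * z) = 0 := by
    rw [map_neg, h, s, βc, mul_add (bar (R.r ^ 2)), ← mul_assoc _ R.h, h_comm]
    noncomm_ring
  obtain ⟨-, h2, h3⟩ := R.eq_F_add_dL h0
  set a := deg0part (-w)
  set y := R.κ (-w)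
  have e2 : b = R.F a 1 := by
    have := congrArg deg0part h2
    simpa only [map_add, map_mul, deg0part_d, deg0part_bar, deg0part_coeff, zero_mul,
      add_zero, map_zero, mul_zero] using this
  have e3 : R.h * coeff (R.F b 1) = coeff (R.F a 2) := by
    have := congrArg deg0part h3
    simp only [map_add, map_mul, deg0part_d, deg0part_bar, deg0part_coeff, zero_mul,
      add_zero] at this
    rw [← this, map_mul, CubicResolution.h, deg0part_coeff]
  rw [e3] at h3
  rw [← e2] at h2
  have h4 := add_left_cancel h2
  have h5 := add_left_cancel h3
  have h6 : d (y 1) + bar R.r * (2 * y 2) + bar (R.r ^ 2) * (-z) = 0 := by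
    rw [mul_neg, h4]; noncomm_ring
  obtain ⟨-, -, k3⟩ := R.eq_F_add_dL h6
  refine ⟨⟨a, e2⟩, -deg0part (y 1), -R.κ (y 1) 2, ?_⟩
  rw [map_neg, map_neg, Pi.neg_apply, map_neg, ← neg_add, ← k3, neg_neg]

/-! ### Exhaustion by nilpotency of the contraction -/

/-- The cochains annihilated by the `n`-fold iterates of the contraction. -/
def nil : ℕ → AddSubgroup (Cobar H)
  | 0 => ⊥
  | n + 1 => ⨅ i, (nil n).comap ((Pi.evalAddMonoidHom _ i).comp R.κ)

lemma mem_nil_succ {n : ℕ} {x : Cobar H} : x ∈ R.nil (n + 1) ↔ ∀ i, R.κ x i ∈ R.nil n := by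
  simp only [nil, AddSubgroup.mem_iInf]
  rfl

lemma nil_mono (n : ℕ) : R.nil n ≤ R.nil (n + 1) := by
  induction n with
  | zero => exact bot_le
  | succ n ih => exact fun x hx => R.mem_nil_succ.2 fun i => ih (R.mem_nil_succ.1 hx i)

lemma coeff_mul_mem_nil (n : ℕ) (a : H.A) {x : Cobar H} (hx : x ∈ R.nil n) :
    coeff a * x ∈ R.nil n := by
  induction n generalizing a x with
  | zero => rw [show x = 0 from hx, mul_zero]; exact zero_mem _
  | succ n ih =>
    rw [mem_nil_succ] at hx ⊢
    intro i
    rw [κ_coeff_mul]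
    exact sum_mem (t := Finset.univ) fun j _ => ih (R.M a i j) (hx j)

/-- The operators `κ` are locally nilpotent: each lowers the number of tensor factors. -/
lemma exists_mem_nil (x : Cobar H) : ∃ n, x ∈ R.nil n := by
  let S : AddSubgroup (Cobar H) := ⨆ n, R.nil n
  have hm : Monotone R.nil := monotone_nat_of_le_succ R.nil_mono
  have hS : ∀ {t}, t ∈ S ↔ ∃ n, t ∈ R.nil n := AddSubgroup.mem_iSup_of_directed hm.directed_le
  have hb : ∀ γ t, t ∈ S → bar γ * t ∈ S := by
    intro γ t ht
    obtain ⟨n, hn⟩ := hS.1 ht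
    refine hS.2 ⟨n + 1, R.mem_nil_succ.2 fun i => ?_⟩
    rw [κ_bar_mul]
    exact R.coeff_mul_mem_nil n _ hn
  have hc : ∀ a t, t ∈ S → coeff a * t ∈ S := by
    intro a t ht
    obtain ⟨n, hn⟩ := hS.1 ht
    exact hS.2 ⟨n, R.coeff_mul_mem_nil n a hn⟩
  have key : ∀ z t : Cobar H, t ∈ S → z * t ∈ S := by
    intro z
    induction z using Cobar.induction with
    | hc a => exact hc a
    | hb x => exact hb x
    | hm x y hx hy => intro t ht; rw [mul_assoc]; exact hx _ (hy _ ht)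
    | ha x y hx hy => intro t ht; rw [add_mul]; exact add_mem (hx _ ht) (hy _ ht)
  have h1 : (1 : Cobar H) ∈ S := hS.2 ⟨1, R.mem_nil_succ.2 fun i => by
    rw [← map_one coeff, κ_coeff]; exact zero_mem _⟩
  exact hS.1 (by simpa using key x 1 h1)

/-- The class `β`. -/
def β : Coh H := clsOf R.βc R.d_βc

/-- The class of `s b`. -/
def sCls (b : H.A) (hb : R.IsOdd b) : Coh H := clsOf (R.s b) (R.d_s hb)

/-- Every cohomology class is obtained from `0` by finitely many steps
`h ↦ a + s b + β h`. -/
lemma coh_induction {P : Coh H → Prop} (h0 : P 0)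
    (hs : ∀ (a : cocycles0 H) (b : H.A) (hb : R.IsOdd b) (h : Coh H), P h →
      P (ofA H a + R.sCls b hb + R.β * h)) (h : Coh H) : P h := by
  have key : ∀ n x (hx : d x = 0), x ∈ R.nil n → P (clsOf x hx) := by
    intro n
    induction n with
    | zero =>
      intro x hx hn
      obtain rfl : x = 0 := hn
      have : clsOf (0 : Cobar H) hx = 0 := map_zero cls
      rwa [this]
    | succ n ih =>
      intro x hx hn
      obtain ⟨a, b, w, ha, hb, hz, he⟩ := R.decompose hx
      have hn' : R.κ (R.κ x 1) 2 ∈ R.nil n :=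
        R.mem_nil_succ.1 (R.nil_mono n (R.mem_nil_succ.1 hn 1)) 2
      have : clsOf x hx = ofA H ⟨a, mem_cocycles0.2 ha⟩ + R.sCls b hb + R.β * clsOf _ hz := by
        rw [ofA_eq, sCls, β, clsOf_mul, clsOf_add, clsOf_add, clsOf_eq_clsOf]
        exact ⟨w, (sub_eq_of_eq_add' he).symm⟩
      rw [this]
      exact hs _ _ _ _ (ih _ hz hn')
  obtain ⟨x, hx, rfl⟩ := exists_rep h
  obtain ⟨n, hn⟩ := R.exists_mem_nil x
  exact key n x hx hn

lemma F2_mem (a : H.A) : R.F a 2 ∈ cocycles0 H := (R.d_F a).2.2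

lemma ofA_injective : Function.Injective (ofA H) := by
  rw [injective_iff_map_eq_zero]
  intro a ha
  obtain ⟨w, hw⟩ := clsOf_eq_zero.1 ha
  refine Subtype.ext ?_
  have := congrArg deg0part hw
  rw [deg0part_d] at this
  exact (deg0part_coeff a.1).symm.trans this.symm

/-- The relations in the cohomology. -/
lemma eq_zero_of_coh {a : cocycles0 H} {b : H.A} {hb : R.IsOdd b} {h : Coh H}
    (h0 : ofA H a + R.sCls b hb + R.β * h = 0) :
    a = 0 ∧ (∃ c, b = R.F c 1) ∧ ∃ c, h = ofA H ⟨R.F c 2, R.F2_mem c⟩ := by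
  obtain ⟨z, hz, rfl⟩ := exists_rep h
  rw [ofA_eq, sCls, β, clsOf_mul, clsOf_add, clsOf_add, clsOf_eq_zero] at h0
  obtain ⟨w, hw⟩ := h0
  have ha : a.1 = 0 := by
    have := congrArg deg0part hw
    simpa only [deg0part_d, map_add, map_mul, s, βc, deg0part_bar, deg0part_coeff, zero_mul,
      mul_zero, add_zero, eq_comm] using this
  rw [ha, map_zero, zero_add] at hw
  obtain ⟨h1, c, v, h2⟩ := R.eq_of_coboundary hw
  refine ⟨Subtype.ext ha, h1, c, clsOf_eq_clsOf.2 ⟨v, ?_⟩⟩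
  exact (sub_eq_of_eq_add' h2).symm

lemma sCls_F (a : H.A) : R.sCls (R.F a 1) (R.isOdd_F a) = 0 :=
  clsOf_eq_zero.2 ⟨_, (R.s_F a).symm⟩

lemma β_mul_F (a : H.A) : R.β * ofA H ⟨R.F a 2, R.F2_mem a⟩ = 0 := by
  rw [β, ofA_eq, clsOf_mul]
  exact clsOf_eq_zero.2 ⟨_, (R.β_F a).symm⟩

lemma IsOdd.add {b b' : H.A} (hb : R.IsOdd b) (hb' : R.IsOdd b') : R.IsOdd (b + b') := by
  constructor
  · rw [map_add, Pi.add_apply, hb.1, hb'.1]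
  · rw [map_add, Pi.add_apply, hb.2, hb'.2, add_zero]

lemma sCls_add {b b' : H.A} (hb : R.IsOdd b) (hb' : R.IsOdd b') :
    R.sCls (b + b') (hb.add R hb') = R.sCls b hb + R.sCls b' hb' := by
  rw [sCls, sCls, sCls, clsOf_add]
  exact clsOf_congr (R.s_add b b') _

end CubicResolution

end EllCoh

namespace EllCoh

/-! ### The cubic resolutions of the two Hopf algebroids -/

open Cobar

/-- For a right `A`-linear functional `f` on `Γ`, the pairing `γ ⊗ γ' ↦ f γ [γ']`. -/
def contractLeft {H : HopfAlgebroid} (f : H.Γ →+ H.A) (hf : ∀ γ a, f (γ * H.ηR a) = f γ * a) :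
    H.ΓΓ →+ Cobar H :=
  TensorProduct.liftAddHom (R := H.A) (M := H.RightΓ) (N := H.LeftΓ)
    (AddMonoidHom.mk' (fun x : H.RightΓ =>
      (AddMonoidHom.mulLeft (coeff (H := H) (f x))).comp (show H.LeftΓ →+ Cobar H from bar))
      (fun x y => by
        ext z
        exact (congrArg (fun t => coeff t * bar (H := H) z) (map_add f x y)).trans
          ((congrArg (· * bar (H := H) z) (map_add coeff _ _)).trans (add_mul _ _ _))))
    (fun a x y => by
      have h : ∀ u v : H.Γ, coeff (f (H.ηR a * u)) * bar v =
          coeff (f u) * bar (H := H) (H.ηL a * v) := by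
        intro u v
        rw [mul_comm, hf, map_mul, ← coeff_mul_bar, mul_assoc]
      exact h x y)

lemma contractLeft_tmul {H : HopfAlgebroid} (f : H.Γ →+ H.A)
    (hf : ∀ γ a, f (γ * H.ηR a) = f γ * a) (x y : H.Γ) :
    contractLeft f hf (H.tmul x y) = coeff (f x) * bar y := rfl

lemma contractLeft_mul_inr {H : HopfAlgebroid} (f : H.Γ →+ H.A)
    (hf : ∀ γ a, f (γ * H.ηR a) = f γ * a) (z : H.ΓΓ) (a : H.A) :
    contractLeft f hf (z * H.inr (H.ηR a)) = contractLeft f hf z * coeff a := by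
  induction z using Units2.tens_induction with
  | h0 => simp
  | ht u v =>
    rw [← Units2.inl_mul_inr, mul_assoc, ← map_mul, Units2.inl_mul_inr, Units2.inl_mul_inr,
      contractLeft_tmul, contractLeft_tmul, ← bar_mul_coeff, mul_assoc]
  | ha u v hu hv => rw [add_mul, map_add, map_add, hu, hv, add_mul]

/-- The cubic resolution of a Hopf algebroid whose `Γ` has the basis `1, r, r²` as a right
`A`-module, with `r` primitive; the comodule algebra is `Γ`. -/
def CubicResolution.ofRightBasis {H : HopfAlgebroid} (e : H.Γ →+ (Fin 3 → H.A))
    (M : H.A →+* Matrix (Fin 3) (Fin 3) H.A) (r : H.Γ) (half : H.A) (hh : 2 * half = 1)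
    (he : ∀ γ a i, e (γ * H.ηR a) i = e γ i * a)
    (hM : ∀ a γ, e (H.ηL a * γ) = (M a).mulVec (e γ))
    (e1 : e 1 = ![1, 0, 0]) (er : e r = ![0, 1, 0]) (er2 : e (r ^ 2) = ![0, 0, 1])
    (ψr : H.ψ r = H.inl r + H.inr r)
    (hsum : ∀ γ, γ = H.ηR (e γ 0) + r * H.ηR (e γ 1) + r ^ 2 * H.ηR (e γ 2)) :
    CubicResolution H :=
  let p : Fin 3 → H.ΓΓ →+ Cobar H := fun i =>
    contractLeft ((Pi.evalAddMonoidHom (fun _ => H.A) i).comp e) fun γ a => he γ a i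
  have hp : ∀ i x y, p i (H.tmul x y) = coeff (e x i) * bar y := fun _ _ _ => rfl
  have hpm : ∀ i γ a, p i (H.ψ (γ * H.ηR a)) = p i (H.ψ γ) * coeff a := by
    intro i γ a
    rw [map_mul]
    exact (congrArg (fun t => p i (H.ψ γ * t)) (RingHom.congr_fun H.ψ_ηR a)).trans
      (contractLeft_mul_inr _ _ _ _)
  have ψ1 : H.ψ 1 = H.tmul 1 1 := by
    rw [map_one, ← Units2.inl_mul_inr, map_one, map_one, mul_one]
  have ψr' : H.ψ r = H.tmul r 1 + H.tmul 1 r := by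
    rw [← Units2.inl_mul_inr, ← Units2.inl_mul_inr, map_one, map_one, mul_one, one_mul, ψr]
  have ψr2 : H.ψ (r ^ 2) = H.tmul (r ^ 2) 1 + (H.tmul r r + H.tmul r r) + H.tmul 1 (r ^ 2) := by
    rw [map_pow, ψr]
    simp only [← Units2.inl_mul_inr, map_one, map_pow]
    ring
  have hψ : ∀ i γ, p i (H.ψ γ) = p i (H.ψ 1) * coeff (e γ 0) + p i (H.ψ r) * coeff (e γ 1) +
      p i (H.ψ (r ^ 2)) * coeff (e γ 2) := by
    intro i γ
    conv_lhs => rw [hsum γ, ← one_mul (H.ηR (e γ 0)), map_add, map_add, map_add, map_add,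
      hpm, hpm, hpm]
  { e := e
    M := M
    r := r
    half := half
    two_half := hh
    e_ηR := he
    e_ηL := hM
    e_one := e1
    e_r := er
    e_r2 := er2
    ψ_r := ψr
    eΓ := p
    eΓ_tmul := hp
    coact0 := fun γ => by
      rw [hψ, ψ1, ψr', ψr2]
      simp [hp, e1, er, er2]
    coact1 := fun γ => by
      rw [hψ, ψ1, ψr', ψr2]
      simp [hp, e1, er, er2]
      noncomm_ring
    coact2 := fun γ => by
      rw [hψ, ψ1, ψr', ψr2]
      simp [hp, e1, er, er2] }

/-- The basis `1, x, x²` of the ring `A[x]/(g)` for a monic cubic `g`. -/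
def cubicBasis {A : Type} [CommRing A] {g : Polynomial A} (hg : g.Monic)
    (h3 : g.natDegree = 3) : Module.Basis (Fin 3) A (AdjoinRoot g) :=
  (AdjoinRoot.powerBasis' hg).basis.reindex
    (finCongr ((AdjoinRoot.powerBasis'_dim hg).trans h3))

lemma cubicBasis_apply {A : Type} [CommRing A] {g : Polynomial A} (hg : g.Monic)
    (h3 : g.natDegree = 3) (i : Fin 3) : cubicBasis hg h3 i = AdjoinRoot.root g ^ (i : ℕ) := by
  rw [cubicBasis, Module.Basis.reindex_apply, PowerBasis.basis_eq_pow, AdjoinRoot.powerBasis'_gen]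
  rfl

lemma cubicBasis_repr {A : Type} [CommRing A] {g : Polynomial A} (hg : g.Monic)
    (h3 : g.natDegree = 3) (x y z : A) :
    ⇑((cubicBasis hg h3).repr (AdjoinRoot.of g x + AdjoinRoot.of g y * AdjoinRoot.root g +
      AdjoinRoot.of g z * AdjoinRoot.root g ^ 2)) = ![x, y, z] := by
  have h : AdjoinRoot.of g x + AdjoinRoot.of g y * AdjoinRoot.root g +
      AdjoinRoot.of g z * AdjoinRoot.root g ^ 2 = ∑ i, (![x, y, z] : Fin 3 → A) i •
        cubicBasis hg h3 i := by
    simp only [Fin.sum_univ_three, cubicBasis_apply, Algebra.smul_def]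
    simp [AdjoinRoot.algebraMap_eq]
  rw [h, Module.Basis.repr_sum_self]

lemma cubicBasis_sum {A : Type} [CommRing A] {g : Polynomial A} (hg : g.Monic)
    (h3 : g.natDegree = 3) (p : AdjoinRoot g) :
    p = AdjoinRoot.of g ((cubicBasis hg h3).repr p 0) +
      AdjoinRoot.of g ((cubicBasis hg h3).repr p 1) * AdjoinRoot.root g +
      AdjoinRoot.of g ((cubicBasis hg h3).repr p 2) * AdjoinRoot.root g ^ 2 := by
  conv_lhs => rw [← (cubicBasis hg h3).sum_repr p]
  simp only [Fin.sum_univ_three, cubicBasis_apply, Algebra.smul_def]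
  simp [AdjoinRoot.algebraMap_eq]

namespace CubicBase

variable {A : Type} [CommRing A] (B : CubicBase A)

lemma monic : (cubicPoly B.a2 B.a4).Monic := by
  unfold cubicPoly
  monicity!

lemma c_c (γ : B.Γ) : B.c (B.c γ) = γ := by
  have : B.c.comp B.c = RingHom.id _ := by
    apply Γ_ext
    · ext a
      change B.c (B.c (B.ηL a)) = B.ηL a
      rw [c_ηL]
      exact RingHom.congr_fun B.c_ηR a
    · change B.c (B.c B.r) = B.r
      rw [c_r, map_neg, c_r, neg_neg]
  exact RingHom.congr_fun this γ

lemma c_ηR' (a : A) : B.c (B.ηR a) = B.ηL a := RingHom.congr_fun B.c_ηR a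

lemma natDegree [Nontrivial A] : (cubicPoly B.a2 B.a4).natDegree = 3 := by
  unfold cubicPoly
  compute_degree!

variable [Nontrivial A]

/-- The coordinates of an element of `Γ` with respect to the basis `1, r, r²` of the left
`A`-module `Γ`. -/
def coord : B.Γ →+ (Fin 3 → A) :=
  (Finsupp.coeFnAddHom (M := A)).comp
    ((cubicBasis B.monic B.natDegree).repr : B.Γ →ₗ[A] (Fin 3 →₀ A)).toAddMonoidHom

lemma coord_eq (x y z : A) : B.coord (B.ηL x + B.ηL y * B.r + B.ηL z * B.r ^ 2) = ![x, y, z] :=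
  cubicBasis_repr B.monic B.natDegree x y z

lemma coord_sum (γ : B.Γ) : γ = B.ηL (B.coord γ 0) + B.ηL (B.coord γ 1) * B.r +
    B.ηL (B.coord γ 2) * B.r ^ 2 :=
  cubicBasis_sum B.monic B.natDegree γ

lemma coord_ηL_mul (a : A) (γ : B.Γ) (i : Fin 3) : B.coord (B.ηL a * γ) i = a * B.coord γ i := by
  have : B.ηL a * γ = a • γ := (Algebra.smul_def a γ).symm
  rw [this]
  change (cubicBasis B.monic B.natDegree).repr (a • γ) i = a * _
  rw [map_smul]
  rfl

/-- The coordinates of an element of `Γ` with respect to the basis `1, r, r²` of the right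
`A`-module `Γ`. -/
def rcoord : B.Γ →+ (Fin 3 → A) :=
  AddMonoidHom.mk' (fun γ => ![B.coord (B.c γ) 0, -B.coord (B.c γ) 1, B.coord (B.c γ) 2])
    fun x y => by
      funext i
      fin_cases i <;> simp
      abel

/-- The matrix of the multiplication by `ηR a` on `Γ` with respect to the basis `1, -r, r²`. -/
def matR : A →+* Matrix (Fin 3) (Fin 3) A :=
  ((Algebra.leftMulMatrix ((cubicBasis B.monic B.natDegree).unitsSMul
    (![1, -1, 1] : Fin 3 → Aˣ))).toRingHom).comp B.ηR

lemma rcoord_eq_repr (γ : B.Γ) : B.rcoord γ = ((cubicBasis B.monic B.natDegree).unitsSMul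
    (![1, -1, 1] : Fin 3 → Aˣ)).repr (B.c γ) := by
  funext i
  rw [Module.Basis.repr_unitsSMul]
  fin_cases i
  · change B.coord (B.c γ) 0 = (1 : Aˣ)⁻¹ • B.coord (B.c γ) 0
    simp
  · change -B.coord (B.c γ) 1 = (-1 : Aˣ)⁻¹ • B.coord (B.c γ) 1
    simp [Units.smul_def]
  · change B.coord (B.c γ) 2 = (1 : Aˣ)⁻¹ • B.coord (B.c γ) 2
    simp

lemma rcoord_mul_ηR (γ : B.Γ) (a : A) (i : Fin 3) :
    B.rcoord (γ * B.ηR a) i = B.rcoord γ i * a := by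
  have h : ∀ j, B.coord (B.c (γ * B.ηR a)) j = B.coord (B.c γ) j * a := by
    intro j
    rw [map_mul, c_ηR', mul_comm, coord_ηL_mul, mul_comm]
  fin_cases i
  · exact h 0
  · exact (congrArg Neg.neg (h 1)).trans (neg_mul _ _).symm
  · exact h 2

lemma rcoord_ηL_mul (a : A) (γ : B.Γ) :
    B.rcoord (B.ηL a * γ) = (B.matR a).mulVec (B.rcoord γ) := by
  rw [rcoord_eq_repr, rcoord_eq_repr, map_mul, c_ηL, ← Algebra.leftMulMatrix_mulVec_repr]
  rfl

lemma rcoord_eq (x y z : A) :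
    B.rcoord (B.ηR x + B.r * B.ηR y + B.r ^ 2 * B.ηR z) = ![x, y, z] := by
  have h : B.c (B.ηR x + B.r * B.ηR y + B.r ^ 2 * B.ηR z) =
      B.ηL x + B.ηL (-y) * B.r + B.ηL z * B.r ^ 2 := by
    simp only [map_add, map_mul, map_pow, c_ηR', c_r, map_neg]
    ring
  change ![B.coord (B.c _) 0, -B.coord (B.c _) 1, B.coord (B.c _) 2] = _
  rw [h, coord_eq]
  simp

lemma rcoord_sum (γ : B.Γ) : γ = B.ηR (B.rcoord γ 0) + B.r * B.ηR (B.rcoord γ 1) +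
    B.r ^ 2 * B.ηR (B.rcoord γ 2) := by
  have h := congrArg B.c (B.coord_sum (B.c γ))
  rw [c_c] at h
  simp only [map_add, map_mul, map_pow, c_ηL, c_r] at h
  change γ = B.ηR (B.coord (B.c γ) 0) + B.r * B.ηR (-B.coord (B.c γ) 1) +
    B.r ^ 2 * B.ηR (B.coord (B.c γ) 2)
  rw [map_neg]
  linear_combination h

/-- The cubic resolution of `(A, A[r]/(r³ + a₂ r² + a₄ r))`, with the comodule algebra `Γ`. -/
def resolution (half : A) (hh : 2 * half = 1) : CubicResolution B.hopf :=
  CubicResolution.ofRightBasis (H := B.hopf) B.rcoord B.matR B.r half hh B.rcoord_mul_ηR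
    B.rcoord_ηL_mul
    (by
      have h := B.rcoord_eq 1 0 0
      simp only [map_one, map_zero, mul_zero, add_zero] at h
      exact h)
    (by
      have h := B.rcoord_eq 0 1 0
      simp only [map_one, map_zero, mul_zero, add_zero, zero_add, mul_one] at h
      exact h)
    (by
      have h := B.rcoord_eq 0 0 1
      simp only [map_one, map_zero, mul_zero, zero_add, mul_one] at h
      exact h)
    B.ψ_r B.rcoord_sum

end CubicBase

end EllCoh

namespace EllCoh

open Cobar

/-! ### The comodule algebra of a root of the cubic -/

/-- A cubic resolution for which the coaction is given as an `H.Γ`-valued pairing. -/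
def CubicResolution.ofPairing {H : HopfAlgebroid} (e : H.Γ →+ (Fin 3 → H.A))
    (M : H.A →+* Matrix (Fin 3) (Fin 3) H.A) (r : H.Γ) (half : H.A) (hh : 2 * half = 1)
    (he : ∀ γ a i, e (γ * H.ηR a) i = e γ i * a)
    (hM : ∀ a γ, e (H.ηL a * γ) = (M a).mulVec (e γ))
    (e1 : e 1 = ![1, 0, 0]) (er : e r = ![0, 1, 0]) (er2 : e (r ^ 2) = ![0, 0, 1])
    (ψr : H.ψ r = H.inl r + H.inr r) (q : Fin 3 → H.ΓΓ →+ H.Γ)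
    (hq : ∀ i x y, q i (H.tmul x y) = H.ηL (e x i) * y)
    (hψ : ∀ γ, q 0 (H.ψ γ) = H.ηR (e γ 0) + r * H.ηR (e γ 1) + r ^ 2 * H.ηR (e γ 2) ∧
      q 1 (H.ψ γ) = H.ηR (e γ 1) + 2 * (r * H.ηR (e γ 2)) ∧ q 2 (H.ψ γ) = H.ηR (e γ 2)) :
    CubicResolution H :=
  have h1 : ∀ a, bar (H.ηR a) = bar 1 * coeff (H := H) a := fun a => by
    rw [bar_mul_coeff, one_mul]
  { e := e
    M := M
    r := r
    half := half
    two_half := hh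
    e_ηR := he
    e_ηL := hM
    e_one := e1
    e_r := er
    e_r2 := er2
    ψ_r := ψr
    eΓ := fun i => bar.comp (q i)
    eΓ_tmul := fun i x y => by
      rw [AddMonoidHom.comp_apply, hq, coeff_mul_bar]
    coact0 := fun γ => by
      rw [AddMonoidHom.comp_apply, (hψ γ).1, map_add, map_add, h1, bar_mul_coeff r,
        bar_mul_coeff (r ^ 2)]
    coact1 := fun γ => by
      rw [AddMonoidHom.comp_apply, (hψ γ).2.1, map_add, h1, two_mul, map_add, bar_mul_coeff r,
        two_mul]
    coact2 := fun γ => by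
      rw [AddMonoidHom.comp_apply, (hψ γ).2.2, h1] }

lemma isUnit_two_Z3 : IsUnit (2 : Z3) := by
  have h : (2 : ℤ) ∈ (Ideal.span {(3 : ℤ)}).primeCompl := by
    change ¬ (2 : ℤ) ∈ Ideal.span {(3 : ℤ)}
    rw [Ideal.mem_span_singleton]
    decide
  have := IsLocalization.map_units Z3 (⟨2, h⟩ : (Ideal.span {(3 : ℤ)}).primeCompl)
  simpa using this

/-- The element `1/2` of `ℤ_(3)`. -/
def halfZ3 : Z3 := ↑(isUnit_two_Z3.unit⁻¹)

lemma two_mul_halfZ3 : 2 * halfZ3 = 1 := isUnit_two_Z3.mul_val_inv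

namespace W

/-- The element `1/2` of `A`. -/
def half : WA := MvPolynomial.C halfZ3

lemma two_half : 2 * half = 1 := by
  have := congrArg (MvPolynomial.C (σ := WVar)) two_mul_halfZ3
  rwa [map_mul, map_one, map_ofNat] at this

lemma ηR_half : ηR half = ηL half := MvPolynomial.eval₂Hom_C _ _ _

/-- `e₂ = b₂ / 4`; the equation of the curve is `y² = x³ + e₂ x² + e₄ x + e₆` after completing the
square. -/
def e2 : WA := a2 + half ^ 2 * a1 ^ 2
/-- `e₄ = b₄ / 2`. -/
def e4 : WA := a4 + half * a1 * a3
/-- `e₆ = b₆ / 4`. -/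
def e6 : WA := a6 + half ^ 2 * a3 ^ 2

lemma two_ηL_half : 2 * ηL half = 1 := by
  have := congrArg ηL two_half
  rwa [map_mul, map_one, map_ofNat] at this

lemma ηR_e2 : ηR e2 = ηL e2 + 3 * r := by
  simp only [e2, map_add, map_mul, map_pow, ηR_half, ηR_a1, ηR_a2]
  linear_combination (ηL a1 * s + s ^ 2) * (2 * ηL half + 1) * two_ηL_half

lemma ηR_e4 : ηR e4 = ηL e4 + 2 * ηL e2 * r + 3 * r ^ 2 := by
  simp only [e4, e2, map_add, map_mul, map_pow, ηR_half, ηR_a1, ηR_a3, ηR_a4]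
  linear_combination (ηL a3 * s + ηL a1 * t + ηL a1 * r * s + 2 * s * t -
    ηL half * ηL a1 ^ 2 * r) * two_ηL_half

lemma ηR_e6 : ηR e6 = ηL e6 + ηL e4 * r + ηL e2 * r ^ 2 + r ^ 3 := by
  simp only [e6, e4, e2, map_add, map_mul, map_pow, ηR_half, ηR_a3, ηR_a6]
  linear_combination ((ηL a3 * t + ηL a1 * r * t + t ^ 2) * (2 * ηL half + 1) +
    ηL half * ηL a1 * ηL a3 * r) * two_ηL_half

/-- The cubic `x³ - e₂ x² + e₄ x - e₆`.  Its roots are the negatives of the `x`-coordinates of the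
points of order two. -/
def cubic {B : Type} [CommRing B] (f : WA →+* B) : Polynomial B :=
  Polynomial.X ^ 3 - Polynomial.C (f e2) * Polynomial.X ^ 2 +
    Polynomial.C (f e4) * Polynomial.X - Polynomial.C (f e6)

lemma cubic_monic {B : Type} [CommRing B] (f : WA →+* B) : (cubic f).Monic := by
  unfold cubic
  monicity!

lemma cubic_natDegree {B : Type} [CommRing B] [Nontrivial B] (f : WA →+* B) :
    (cubic f).natDegree = 3 := by
  unfold cubic
  compute_degree!

lemma cubic_eval₂ {B C : Type} [CommRing B] [CommRing C] (f : WA →+* B) (g : B →+* C) (x : C) :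
    (cubic f).eval₂ g x = x ^ 3 - g (f e2) * x ^ 2 + g (f e4) * x - g (f e6) := by
  simp [cubic, Polynomial.eval₂_add, Polynomial.eval₂_sub, Polynomial.eval₂_mul]

/-- The base change along `f : A → B` of the ring over which the curve acquires a chosen point of
order two. -/
def PB {B : Type} [CommRing B] (f : WA →+* B) : Type := AdjoinRoot (cubic f)

section
variable {B : Type} [CommRing B] (f : WA →+* B)

instance PB.commRing : CommRing (PB f) := inferInstanceAs (CommRing (AdjoinRoot (cubic f)))

/-- The structure map of `PB f`. -/
def ofPB : B →+* PB f := AdjoinRoot.of (cubic f)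

/-- The root in `PB f`. -/
def rootPB : PB f := AdjoinRoot.root (cubic f)

/-- The ring map out of `PB f` with given values on `B` and on the root. -/
def liftPB {C : Type} [CommRing C] (g : B →+* C) (x : C)
    (h : x ^ 3 - g (f e2) * x ^ 2 + g (f e4) * x - g (f e6) = 0) : PB f →+* C :=
  AdjoinRoot.lift g x ((cubic_eval₂ _ _ _).trans h)

lemma liftPB_ofPB {C : Type} [CommRing C] (g : B →+* C) (x : C)
    (h : x ^ 3 - g (f e2) * x ^ 2 + g (f e4) * x - g (f e6) = 0) (b : B) :
    liftPB f g x h (ofPB f b) = g b := AdjoinRoot.lift_of _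

lemma liftPB_rootPB {C : Type} [CommRing C] (g : B →+* C) (x : C)
    (h : x ^ 3 - g (f e2) * x ^ 2 + g (f e4) * x - g (f e6) = 0) :
    liftPB f g x h (rootPB f) = x := AdjoinRoot.lift_root _

lemma rootPB_rel : rootPB f ^ 3 - ofPB f (f e2) * rootPB f ^ 2 + ofPB f (f e4) * rootPB f -
    ofPB f (f e6) = 0 := by
  have h := AdjoinRoot.eval₂_root (cubic f)
  rwa [cubic_eval₂] at h

variable [Nontrivial B]

/-- The coordinates of an element of `PB f` with respect to the powers of the root. -/
def coordPB : PB f →+ (Fin 3 → B) :=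
  (Finsupp.coeFnAddHom (M := B)).comp ((cubicBasis (cubic_monic f) (cubic_natDegree f)).repr :
    AdjoinRoot (cubic f) →ₗ[B] (Fin 3 →₀ B)).toAddMonoidHom

lemma coordPB_eq (x y z : B) :
    coordPB f (ofPB f x + ofPB f y * rootPB f + ofPB f z * rootPB f ^ 2) = ![x, y, z] :=
  cubicBasis_repr (cubic_monic f) (cubic_natDegree f) x y z

lemma coordPB_sum (p : PB f) : p = ofPB f (coordPB f p 0) + ofPB f (coordPB f p 1) * rootPB f +
    ofPB f (coordPB f p 2) * rootPB f ^ 2 :=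
  cubicBasis_sum (cubic_monic f) (cubic_natDegree f) p

lemma coordPB_mul_ofPB (p : PB f) (b : B) (i : Fin 3) :
    coordPB f (p * ofPB f b) i = coordPB f p i * b := by
  have key : ∀ q : AdjoinRoot (cubic f), (cubicBasis (cubic_monic f) (cubic_natDegree f)).repr
      (q * AdjoinRoot.of (cubic f) b) i =
        (cubicBasis (cubic_monic f) (cubic_natDegree f)).repr q i * b := fun q => by
    have : q * AdjoinRoot.of (cubic f) b = b • q := by
      rw [Algebra.smul_def, mul_comm]
      rfl
    rw [this, map_smul, mul_comm]
    rfl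
  exact key p

/-- The matrices of the multiplication by elements of `PB f`. -/
def matPB : PB f →+* Matrix (Fin 3) (Fin 3) B :=
  (Algebra.leftMulMatrix (cubicBasis (cubic_monic f) (cubic_natDegree f))).toRingHom

lemma matPB_mulVec (p q : PB f) : (matPB f p).mulVec (coordPB f q) = coordPB f (p * q) :=
  Algebra.leftMulMatrix_mulVec_repr (cubicBasis (cubic_monic f) (cubic_natDegree f)) p q

end

/-- The ring over which the curve acquires a chosen point of order two. -/
abbrev P : Type := PB (RingHom.id WA)

/-- The structure map of `P`. -/
def ofP : WA →+* P := ofPB (RingHom.id WA)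

/-- The root `ρ` in `P`. -/
def ρ : P := rootPB (RingHom.id WA)

lemma ρ_rel : ρ ^ 3 - ofP e2 * ρ ^ 2 + ofP e4 * ρ - ofP e6 = 0 := rootPB_rel (RingHom.id WA)

/-- The coefficients `0, a₂', 0, a₄', 0` of the curve after moving the chosen point of order two
to the origin. -/
def fP : WA →+* P :=
  MvPolynomial.eval₂Hom (ofP.comp MvPolynomial.C) (fun v => match v with
    | .a1 => 0 | .a2 => ofP e2 - 3 * ρ | .a3 => 0 | .a4 => ofP e4 - 2 * ofP e2 * ρ + 3 * ρ ^ 2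
    | .a6 => 0)

lemma fP_a1 : fP a1 = 0 := MvPolynomial.eval₂Hom_X' _ _ _
lemma fP_a2 : fP a2 = ofP e2 - 3 * ρ := MvPolynomial.eval₂Hom_X' _ _ _
lemma fP_a3 : fP a3 = 0 := MvPolynomial.eval₂Hom_X' _ _ _
lemma fP_a4 : fP a4 = ofP e4 - 2 * ofP e2 * ρ + 3 * ρ ^ 2 := MvPolynomial.eval₂Hom_X' _ _ _
lemma fP_a6 : fP a6 = 0 := MvPolynomial.eval₂Hom_X' _ _ _

/-- The map `Γ → P` classifying the change of coordinates that moves the chosen point of order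
two to the origin. -/
def πP : WΓ →+* P := ΓLift fP ρ (ofP (half * a1)) (ofP (half * a3))

lemma πP_ηL (a : WA) : πP (ηL a) = fP a := ΓLift_ηL' _ _ _ _ a
lemma πP_r : πP r = ρ := ΓLift_r _ _ _ _
lemma πP_s : πP s = ofP (half * a1) := ΓLift_s _ _ _ _
lemma πP_t : πP t = ofP (half * a3) := ΓLift_t _ _ _ _

lemma two_ofP_half : 2 * ofP half = 1 := by
  have := congrArg ofP two_half
  rwa [map_mul, map_one, map_ofNat] at this

lemma πP_ηR (a : WA) : πP (ηR a) = ofP a := by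
  refine RingHom.congr_fun (A_ext (f := πP.comp ηR) (g := ofP) ?_ ?_ ?_ ?_ ?_) a <;>
    simp only [RingHom.comp_apply, ηR_a1, ηR_a2, ηR_a3, ηR_a4, ηR_a6, map_add, map_sub, map_mul,
      map_pow, map_ofNat, πP_ηL, πP_r, πP_s, πP_t, fP_a1, fP_a2, fP_a3, fP_a4, fP_a6]
  · linear_combination ofP a1 * two_ofP_half
  · simp only [e2, map_add, map_mul, map_pow]; ring
  · linear_combination ofP a3 * two_ofP_half
  · simp only [e4, e2, map_add, map_mul, map_pow]
    linear_combination (-ofP half * ofP a1 * ofP a3) * two_ofP_half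
  · have := ρ_rel
    simp only [e6, e4, e2, map_add, map_mul, map_pow] at this ⊢
    linear_combination this

/-- The coordinates of an element of `P` with respect to the basis `1, ρ, ρ²`. -/
def coordP : P →+ (Fin 3 → WA) := coordPB (RingHom.id WA)

lemma coordP_eq (x y z : WA) : coordP (ofP x + ofP y * ρ + ofP z * ρ ^ 2) = ![x, y, z] :=
  coordPB_eq (RingHom.id WA) x y z

lemma coordP_sum (p : P) :
    p = ofP (coordP p 0) + ofP (coordP p 1) * ρ + ofP (coordP p 2) * ρ ^ 2 :=
  coordPB_sum (RingHom.id WA) p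

lemma coordP_mul_ofP (p : P) (a : WA) (i : Fin 3) : coordP (p * ofP a) i = coordP p i * a :=
  coordPB_mul_ofPB (RingHom.id WA) p a i

/-- The matrices of the multiplication by `fP a`. -/
def matP : WA →+* Matrix (Fin 3) (Fin 3) WA := (matPB (RingHom.id WA)).comp fP

/-- The coordinates of the image in `P` of an element of `Γ`. -/
def eP : WΓ →+ (Fin 3 → WA) := coordP.comp πP.toAddMonoidHom

lemma eP_apply (γ : WΓ) : eP γ = coordP (πP γ) := rfl

lemma eP_mul_ηR (γ : WΓ) (a : WA) (i : Fin 3) : eP (γ * ηR a) i = eP γ i * a := by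
  rw [eP_apply, eP_apply, map_mul, πP_ηR, coordP_mul_ofP]

lemma eP_ηL_mul (a : WA) (γ : WΓ) : eP (ηL a * γ) = (matP a).mulVec (eP γ) := by
  rw [eP_apply, map_mul, πP_ηL]
  exact (matPB_mulVec (RingHom.id WA) (fP a) (πP γ)).symm

section
variable {G : Type} [CommRing G] (f g : WA →+* G) (x : G)

/-- The map `p ↦ p ⊗ 1` from `P` to its base change. -/
def inclPB : P →+* PB f := liftPB (RingHom.id WA) ((ofPB f).comp f) (rootPB f) (rootPB_rel f)

lemma inclPB_ofP (a : WA) : inclPB f (ofP a) = ofPB f (f a) :=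
  liftPB_ofPB (RingHom.id WA) _ _ _ a

lemma inclPB_ρ : inclPB f ρ = rootPB f := liftPB_rootPB (RingHom.id WA) _ _ _

variable (h2 : g e2 = f e2 + 3 * x) (h4 : g e4 = f e4 + 2 * f e2 * x + 3 * x ^ 2)
  (h6 : g e6 = f e6 + f e4 * x + f e2 * x ^ 2 + x ^ 3)

/-- The map `ρ ↦ ρ + x` along a second map `g : A → G` for which `e₂, e₄, e₆` are translated
by `x`. -/
def coactPB : P →+* PB f :=
  liftPB (RingHom.id WA) ((ofPB f).comp g) (rootPB f + ofPB f x) (by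
    simp only [RingHom.comp_apply, RingHom.id_apply, h2, h4, h6, map_add, map_mul, map_pow,
      map_ofNat]
    linear_combination rootPB_rel f)

lemma coactPB_ofP (a : WA) : coactPB f g x h2 h4 h6 (ofP a) = ofPB f (g a) :=
  liftPB_ofPB (RingHom.id WA) _ _ _ a

lemma coactPB_ρ : coactPB f g x h2 h4 h6 ρ = rootPB f + ofPB f x :=
  liftPB_rootPB (RingHom.id WA) _ _ _

variable [Nontrivial G]

lemma coordPB_inclPB (p : P) (y : G) (i : Fin 3) :
    coordPB f (inclPB f p * ofPB f y) i = f (coordP p i) * y := by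
  have h : inclPB f p * ofPB f y = ofPB f (f (coordP p 0) * y) +
      ofPB f (f (coordP p 1) * y) * rootPB f + ofPB f (f (coordP p 2) * y) * rootPB f ^ 2 := by
    conv_lhs => rw [coordP_sum p]
    simp only [map_add, map_mul, map_pow, inclPB_ofP, inclPB_ρ]
    ring
  rw [h, coordPB_eq]
  fin_cases i <;> rfl

lemma coordPB_coactPB (p : P) : coordPB f (coactPB f g x h2 h4 h6 p) =
    ![g (coordP p 0) + x * g (coordP p 1) + x ^ 2 * g (coordP p 2),
      g (coordP p 1) + 2 * (x * g (coordP p 2)), g (coordP p 2)] := by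
  rw [← coordPB_eq]
  congr 1
  conv_lhs => rw [coordP_sum p]
  simp only [map_add, map_mul, map_pow, map_ofNat, coactPB_ofP, coactPB_ρ]
  ring

end

/-- The map `Γ → P` is a map of comodules. -/
lemma coact_comp_πP {R : Type} [CommRing R] (i k : P →+* R) (q : WΓ →+* R)
    (hi : ∀ a, i (ofP a) = q (ηL a)) (hk : ∀ a, k (ofP a) = q (ηR a)) (hρ : k ρ = i ρ + q r)
    (h : (i.comp πP).comp ηR = q.comp ηL) : k.comp πP = comp (i.comp πP) q h := by
  have h1 : 2 * q (ηL half) = 1 := by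
    have := congrArg q two_ηL_half
    rwa [map_mul, map_one, map_ofNat] at this
  apply Γ_ext
  · rw [comp_ηL]
    refine A_ext ?_ ?_ ?_ ?_ ?_ <;>
      simp only [RingHom.comp_apply, πP_ηL, fP_a1, fP_a2, fP_a3, fP_a4, fP_a6, map_zero, map_add,
        map_sub, map_mul, map_pow, map_ofNat, hi, hk, hρ, ηR_e2, ηR_e4] <;> ring
  · rw [comp_r]
    simp only [RingHom.comp_apply, πP_r, hρ]
  · rw [comp_s]
    simp only [RingHom.comp_apply, πP_s, hi, hk, map_mul, ηR_half, ηR_a1, map_add, map_ofNat]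
    linear_combination q s * h1
  · rw [comp_t]
    simp only [RingHom.comp_apply, πP_t, πP_s, hi, hk, map_mul, ηR_half, ηR_a3, map_add,
      map_ofNat]
    linear_combination q t * h1

instance : Nontrivial units.Γ := inferInstanceAs (Nontrivial WΓ)

/-- The ring `P ⊗_A Γ`. -/
def PΓ : Type := PB (B := units.Γ) units.ηL

instance : CommRing PΓ := PB.commRing (B := units.Γ) units.ηL

/-- The coordinates of an element of `P ⊗_A Γ`. -/
def coordPΓ : PΓ →+ (Fin 3 → units.Γ) := coordPB (B := units.Γ) units.ηL

/-- The map `γ ↦ 1 ⊗ γ`. -/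
def ofPΓ : WΓ →+* PΓ := ofPB (B := units.Γ) units.ηL

/-- The map `p ↦ p ⊗ 1`. -/
def inclP : P →+* PΓ := inclPB (G := units.Γ) units.ηL

/-- The coaction of `Γ` on `P`. -/
def coactP : P →+* PΓ := coactPB (G := units.Γ) units.ηL units.ηR r ηR_e2 ηR_e4 ηR_e6

lemma inclP_ofP (a : WA) : inclP (ofP a) = ofPΓ (ηL a) := inclPB_ofP (G := units.Γ) _ a

lemma pair_compat : (inclP.comp πP).comp ηR = ofPΓ.comp ηL := by
  refine RingHom.ext fun a => ?_
  simp only [RingHom.comp_apply, πP_ηR, inclP_ofP]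

lemma coactP_πP : coactP.comp πP = comp (inclP.comp πP) ofPΓ pair_compat :=
  coact_comp_πP inclP coactP ofPΓ inclP_ofP
    (coactPB_ofP (G := units.Γ) units.ηL units.ηR r ηR_e2 ηR_e4 ηR_e6)
    ((coactPB_ρ (G := units.Γ) units.ηL units.ηR r ηR_e2 ηR_e4 ηR_e6).trans
      (congrArg (fun z : PΓ => z + ofPΓ r) (inclPB_ρ (G := units.Γ) units.ηL).symm)) pair_compat

/-- The coordinates of the pairing `γ ⊗ γ' ↦ πP γ ⊗ γ'`. -/
def pairΓ (i : Fin 3) : units.ΓΓ →+ units.Γ :=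
  ((Pi.evalAddMonoidHom (fun _ => units.Γ) i).comp coordPΓ).comp
    (pr (inclP.comp πP) ofPΓ pair_compat).toAddMonoidHom

lemma pairΓ_tmul (i : Fin 3) (x y : WΓ) : pairΓ i (units.tmul x y) = ηL (eP x i) * y :=
  coordPB_inclPB (G := units.Γ) units.ηL (πP x) y i

lemma pairΓ_ψ (γ : WΓ) (i : Fin 3) : pairΓ i (ψ γ) =
    (![ηR (eP γ 0) + r * ηR (eP γ 1) + r ^ 2 * ηR (eP γ 2),
      ηR (eP γ 1) + 2 * (r * ηR (eP γ 2)), ηR (eP γ 2)] : Fin 3 → WΓ) i :=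
  (congrArg (fun p => coordPΓ p i)
    (RingHom.congr_fun coactP_πP γ).symm).trans
  (congrFun (coordPB_coactPB (G := units.Γ) units.ηL units.ηR r ηR_e2 ηR_e4 ηR_e6 (πP γ)) i)

lemma eP_one : eP 1 = ![1, 0, 0] := by
  have h := coordP_eq 1 0 0
  rwa [map_one, map_zero, zero_mul, zero_mul, add_zero, add_zero, ← map_one πP] at h

lemma eP_r : eP r = ![0, 1, 0] := by
  have h := coordP_eq 0 1 0
  rwa [map_one, map_zero, zero_mul, one_mul, zero_add, add_zero, ← πP_r] at h

lemma eP_r2 : eP (r ^ 2) = ![0, 0, 1] := by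
  have h := coordP_eq 0 0 1
  rwa [map_one, map_zero, zero_mul, one_mul, zero_add, zero_add, ← πP_r, ← map_pow] at h

/-- The cubic resolution of the elliptic curve Hopf algebroid, given by the ring over which the
curve acquires a chosen point of order two. -/
def resolution : CubicResolution weierstrass :=
  CubicResolution.ofPairing (H := weierstrass) eP matP r half two_half eP_mul_ηR eP_ηL_mul
    eP_one eP_r eP_r2 ψ_r pairΓ pairΓ_tmul fun γ =>
      ⟨pairΓ_ψ γ 0, pairΓ_ψ γ 1, pairΓ_ψ γ 2⟩

end W

end EllCoh

namespace EllCoh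

/-! ### Invariants and products in cohomology -/

namespace Cobar

variable {H : HopfAlgebroid}

/-- The component of degree `1` of a cochain, in the ring of upper triangular matrices over `Γ`. -/
def deg1Mat : Cobar H →+* Matrix (Fin 2) (Fin 2) H.Γ :=
  lift
    { toFun := fun a => !![H.ηL a, 0; 0, H.ηR a]
      map_one' := by simp [Matrix.one_fin_two]
      map_mul' := fun a b => by simp
      map_zero' := by ext i j; fin_cases i <;> fin_cases j <;> simp
      map_add' := fun a b => by ext i j; fin_cases i <;> fin_cases j <;> simp }
    (AddMonoidHom.mk' (fun γ => !![0, γ; 0, 0]) fun x y => by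
      ext i j; fin_cases i <;> fin_cases j <;> simp)
    (fun a x => by
      change !![H.ηL a, 0; 0, H.ηR a] * !![0, x; 0, 0] = !![0, H.ηL a * x; 0, 0]
      simp)
    (fun x a => by
      change !![0, x; 0, 0] * !![H.ηL a, 0; 0, H.ηR a] = !![0, x * H.ηR a; 0, 0]
      ext i j; fin_cases i <;> fin_cases j <;> simp [Matrix.mul_apply])

lemma bar_injective : Function.Injective (bar (H := H)) := by
  intro x y h
  have h1 : ∀ z : H.Γ, deg1Mat (bar z) = !![0, z; 0, 0] := fun z => lift_bar _ _ _ _ z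
  have := congrArg (fun t => deg1Mat t 0 1) h
  simpa [h1] using this

end Cobar

lemma mem_cocycles0_iff {H : HopfAlgebroid} {a : H.A} : a ∈ cocycles0 H ↔ H.ηR a = H.ηL a := by
  rw [mem_cocycles0]
  refine ⟨fun h => ?_, Cobar.d_coeff_eq_zero⟩
  rw [Cobar.d_coeff, sub_eq_zero] at h
  exact Cobar.bar_injective h

lemma Coh.commute_ofA {H : HopfAlgebroid} (a : cocycles0 H) (h : Coh H) :
    Commute (Coh.ofA H a) h := by
  obtain ⟨x, hx, rfl⟩ := Coh.exists_rep h
  change Coh.ofA H a * _ = _ * Coh.ofA H a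
  rw [Coh.ofA_eq, Coh.clsOf_mul, Coh.clsOf_mul]
  exact Coh.clsOf_congr (Cobar.coeff_commute (mem_cocycles0_iff.1 a.2) x) _

namespace CubicResolution

open Cobar Coh

variable {H : HopfAlgebroid} (R : CubicResolution H)

lemma F_cocycle (a : cocycles0 H) : R.F a.1 = ![a.1, 0, 0] :=
  R.F_of_d_eq_zero (mem_cocycles0.1 a.2)

lemma F_mul (a : H.A) (x : cocycles0 H) (i : Fin 3) : R.F (a * x) i = R.F a i * x := by
  rw [F_apply, F_apply, map_mul, ← mem_cocycles0_iff.1 x.2, R.e_ηR]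

lemma mem_cocycles0_of_F {a : H.A} (h0 : R.F a 0 = a) (h1 : R.F a 1 = 0) (h2 : R.F a 2 = 0) :
    a ∈ cocycles0 H := by
  have := (R.d_F a).1
  rw [h0, h1, h2, map_zero, mul_zero, mul_zero, add_zero, add_zero] at this
  exact mem_cocycles0.2 this

lemma IsOdd.mul {b : H.A} (hb : R.IsOdd b) (x : cocycles0 H) : R.IsOdd (b * x) := by
  constructor
  · rw [F_mul, hb.1]
  · rw [F_mul, hb.2, zero_mul]

lemma s_mul (b : H.A) (x : cocycles0 H) : R.s (b * x) = R.s b * coeff x.1 := by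
  rw [s, s, F_mul, map_mul, map_mul]
  noncomm_ring

lemma sCls_mul {b : H.A} (hb : R.IsOdd b) (x : cocycles0 H) :
    R.sCls (b * x) (hb.mul R x) = R.sCls b hb * ofA H x := by
  rw [sCls, sCls, ofA_eq, clsOf_mul]
  exact clsOf_congr (R.s_mul b x) _

lemma sCls_congr {b c : H.A} (h : b = c) (hb : R.IsOdd b) :
    R.sCls b hb = R.sCls c (h ▸ hb) := by
  subst h
  rfl

lemma IsOdd.neg {b : H.A} (hb : R.IsOdd b) : R.IsOdd (-b) := by
  constructor
  · rw [map_neg, Pi.neg_apply, hb.1]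
  · rw [map_neg, Pi.neg_apply, hb.2, neg_zero]

lemma IsOdd.sub {b b' : H.A} (hb : R.IsOdd b) (hb' : R.IsOdd b') : R.IsOdd (b - b') := by
  rw [sub_eq_add_neg]
  exact hb.add R (hb'.neg R)

lemma sCls_sub {b b' : H.A} (hb : R.IsOdd b) (hb' : R.IsOdd b') :
    R.sCls (b - b') (hb.sub R hb') = R.sCls b hb - R.sCls b' hb' := by
  rw [eq_sub_iff_add_eq, ← R.sCls_add (hb.sub R hb') hb']
  exact R.sCls_congr (sub_add_cancel _ _) _

lemma isOdd_cocycle (x : cocycles0 H) : R.IsOdd x.1 := by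
  unfold IsOdd
  rw [F_cocycle]
  exact ⟨rfl, rfl⟩

/-- The class `α` of `[r]`. -/
def α : Coh H := clsOf (bar R.r) R.d_r

lemma sCls_cocycle (x : cocycles0 H) : R.sCls x.1 (R.isOdd_cocycle x) = R.α * ofA H x := by
  rw [α, sCls, ofA_eq, clsOf_mul]
  refine clsOf_congr ?_ _
  rw [s, F_cocycle]
  simp

lemma α_mul_α : R.α * R.α = 0 := by
  rw [α, clsOf_mul, clsOf_eq_zero]
  refine ⟨-(R.h * bar (R.r ^ 2)), ?_⟩
  rw [map_neg, d_h_mul, d_r2, mul_neg, neg_neg, h_two_mul]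

lemma d_r4 : d (bar (R.r ^ 4)) = -(4 * (bar (R.r ^ 3) * bar R.r) +
    6 * (bar (R.r ^ 2) * bar (R.r ^ 2)) + 4 * (bar R.r * bar (R.r ^ 3))) := by
  have h1 : H.ψ (R.r ^ 4) = H.tmul (R.r ^ 4) 1 + 4 • H.tmul (R.r ^ 3) R.r +
      6 • H.tmul (R.r ^ 2) (R.r ^ 2) + 4 • H.tmul R.r (R.r ^ 3) + H.tmul 1 (R.r ^ 4) := by
    simp only [map_pow, R.ψ_r, ← Units2.inl_mul_inr, map_one, nsmul_eq_mul]
    push_cast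
    ring
  rw [d_bar, h1, map_add, map_add, map_add, map_add, map_nsmul, map_nsmul, map_nsmul, bar2_tmul,
    bar2_tmul, bar2_tmul, bar2_tmul, bar2_tmul, nsmul_eq_mul, nsmul_eq_mul, nsmul_eq_mul]
  push_cast
  abel

lemma eq_of_two_mul_eq (R : CubicResolution H) {x y : Cobar H} (h : 2 * x = 2 * y) : x = y :=
  (R.h_two_mul x).symm.trans ((congrArg (R.h * ·) h).trans (R.h_two_mul y))

/-- The class `β` commutes with classes of degree `1`: for `ηL b = ηR b + r ηR δ` the commutator
of `s b` with the cocycle of `β` is the coboundary of `-[r² | r²] b / 2 + [r | r⁴] δ / 4`. -/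
lemma commute_β_sCls {b : H.A} (hb : R.IsOdd b) {δ : cocycles0 H}
    (h : H.ηL b = H.ηR b + R.r * H.ηR δ) : Commute R.β (R.sCls b hb) := by
  have h0 : ∀ i, bar (R.r ^ i) * coeff b = coeff b * bar (R.r ^ i) -
      bar (R.r ^ (i + 1)) * coeff δ.1 := by
    intro i
    rw [coeff_mul_bar, bar_mul_coeff, bar_mul_coeff, ← map_sub, h]
    congr 1
    ring
  have h1 : bar R.r * coeff b = coeff b * bar R.r - bar (R.r ^ 2) * coeff δ.1 := by
    have := h0 1
    rwa [pow_one] at this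
  have hF : R.F b 1 = δ.1 := by
    have h2 : R.F b = ![b, δ.1, 0] := by
      rw [F_apply, h, map_add]
      funext i
      rw [Pi.add_apply, R.e_ηR, R.e_r, ← one_mul (H.ηR b), R.e_ηR, R.e_one]
      fin_cases i <;> simp
    rw [h2]
    rfl
  have hd : d (coeff b) = -(bar R.r * coeff δ.1) := by
    rw [d_coeff, h, map_add, bar_mul_coeff]
    abel
  have hδ : ∀ x, x * coeff δ.1 = coeff δ.1 * x := fun x =>
    (coeff_commute (mem_cocycles0_iff.1 δ.2) x).symm
  rw [commute_iff_eq, β, sCls, clsOf_mul, clsOf_mul, eq_comm, clsOf_eq_clsOf]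
  refine ⟨-(R.h * (bar (R.r ^ 2) * bar (R.r ^ 2) * coeff b)) +
    R.h * (R.h * (bar R.r * bar (R.r ^ 4) * coeff δ.1)), ?_⟩
  have h2 : coeff b * bar R.r = bar R.r * coeff b + bar (R.r ^ 2) * coeff δ.1 := by
    rw [h1, sub_add_cancel]
  have h3 : coeff b * bar (R.r ^ 2) = bar (R.r ^ 2) * coeff b + bar (R.r ^ 3) * coeff δ.1 := by
    rw [h0 2, sub_add_cancel]
  have hb' : coeff b * R.βc = R.βc * coeff b + (bar (R.r ^ 3) * bar R.r +
      2 * (bar (R.r ^ 2) * bar (R.r ^ 2)) + bar R.r * bar (R.r ^ 3)) * coeff δ.1 := by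
    rw [βc, mul_add, ← mul_assoc, ← mul_assoc, h3, h2, add_mul, add_mul, mul_assoc _ (coeff b),
      mul_assoc _ (coeff b), h2, h3, mul_assoc _ (coeff δ.1), mul_assoc _ (coeff δ.1), ← hδ, ← hδ]
    noncomm_ring
  have e2 : 2 * R.s b = 2 * (bar R.r * coeff b) + bar (R.r ^ 2) * coeff δ.1 := by
    rw [s, hF, mul_add, two_h_mul]
  apply R.eq_of_two_mul_eq
  apply R.eq_of_two_mul_eq
  have e3 : 2 * (2 * (R.s b * R.βc - R.βc * R.s b)) =
      2 * ((2 * R.s b) * R.βc - R.βc * (2 * R.s b)) := by noncomm_ring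
  have e4 : 2 * (bar R.r * coeff b) * R.βc = 2 * (bar R.r * (R.βc * coeff b +
      (bar (R.r ^ 3) * bar R.r + 2 * (bar (R.r ^ 2) * bar (R.r ^ 2)) +
        bar R.r * bar (R.r ^ 3)) * coeff δ.1)) := by
    rw [← hb']
    noncomm_ring
  have e5 : bar (R.r ^ 2) * coeff δ.1 * R.βc = bar (R.r ^ 2) * R.βc * coeff δ.1 := by
    rw [mul_assoc, ← hδ, mul_assoc]
  have e6 : d (bar (R.r ^ 2) * bar (R.r ^ 2) * coeff b) =
      -(2 * (bar R.r * bar R.r * (bar (R.r ^ 2) * coeff b))) + bar (R.r ^ 2) *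
        (2 * (bar R.r * bar R.r * coeff b) - bar (R.r ^ 2) * (bar R.r * coeff δ.1)) := by
    rw [mul_assoc, d_r2_mul, d_r2_mul, hd]
    noncomm_ring
  have e7 : d (bar R.r * bar (R.r ^ 4) * coeff δ.1) =
      bar R.r * (4 * (bar (R.r ^ 3) * bar R.r) + 6 * (bar (R.r ^ 2) * bar (R.r ^ 2)) +
        4 * (bar R.r * bar (R.r ^ 3))) * coeff δ.1 := by
    rw [mul_assoc, d_r_mul, d_bar_mul, mem_cocycles0.1 δ.2, R.d_r4]
    noncomm_ring
  rw [e3, e2, add_mul, e4, e5, map_add, map_neg, d_h_mul, d_h_mul, d_h_mul, e6, e7, mul_add 2 (-_),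
    mul_add 2 (2 * -_), mul_neg, mul_neg, two_h_mul, two_h_mul, two_h_mul, βc]
  noncomm_ring

end CubicResolution

end EllCoh

namespace EllCoh

/-! ### The bigrading of the cobar complex -/

/-- The group of homogeneous cochains of bidegree `p`. -/
def homogSub {H : HopfAlgebroid} (g : Grading H) (p : ℕ × ℤ) : AddSubgroup (Cobar H) where
  carrier := {x | IsHomog g p.1 p.2 x}
  zero_mem' := .zero _ _
  add_mem' := .add _ _ _ _
  neg_mem' := .neg _ _ _

/-- The internal grading of a Hopf algebroid, encoded by coactions `gA`, `gΓ` of the Laurent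
polynomial Hopf algebra: an element of degree `m` is sent to the monomial of exponent `m` with this
coefficient. -/
structure RingGrading {H : HopfAlgebroid} (g : Grading H) where
  /-- The coaction on `A`. -/
  gA : H.A →+* AddMonoidAlgebra H.A ℤ
  /-- The coaction on `Γ`. -/
  gΓ : H.Γ →+* AddMonoidAlgebra H.Γ ℤ
  gΓ_ηL : ∀ a, gΓ (H.ηL a) = AddMonoidAlgebra.mapRingHom ℤ H.ηL (gA a)
  gΓ_ηR : ∀ a, gΓ (H.ηR a) = AddMonoidAlgebra.mapRingHom ℤ H.ηR (gA a)
  gA_eq : ∀ m, ∀ a ∈ g.degA m, gA a = AddMonoidAlgebra.single m a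
  gΓ_eq : ∀ m, ∀ x ∈ g.degΓ m, gΓ x = AddMonoidAlgebra.single m x
  A_span : ∀ a, a ∈ AddSubgroup.closure {a | ∃ m, a ∈ g.degA m}
  Γ_span : ∀ x, x ∈ AddSubgroup.closure {x | ∃ m, x ∈ g.degΓ m}
  ψ_homog : ∀ m, ∀ x ∈ g.degΓ m, IsHomog g 2 m (Cobar.bar2 (H.ψ x))

namespace RingGrading

open Cobar AddMonoidAlgebra

variable {H : HopfAlgebroid} {g : Grading H}

lemma gA_mem (G : RingGrading g) (a : H.A) (m : ℤ) : (G.gA a).coeff m ∈ g.degA m := by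
  induction G.A_span a using AddSubgroup.closure_induction with
  | mem a ha =>
    obtain ⟨k, hk⟩ := ha
    rw [G.gA_eq k a hk, coeff_single, Finsupp.single_apply]
    split_ifs with h
    · rwa [← h]
    · exact zero_mem _
  | zero => rw [map_zero]; exact zero_mem _
  | add a b _ _ ha hb => rw [map_add, coeff_add]; exact add_mem ha hb
  | neg a _ ha => rw [map_neg, coeff_neg]; exact neg_mem ha

lemma gΓ_mem (G : RingGrading g) (a : H.Γ) (m : ℤ) : (G.gΓ a).coeff m ∈ g.degΓ m := by
  induction G.Γ_span a using AddSubgroup.closure_induction with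
  | mem a ha =>
    obtain ⟨k, hk⟩ := ha
    rw [G.gΓ_eq k a hk, coeff_single, Finsupp.single_apply]
    split_ifs with h
    · rwa [← h]
    · exact zero_mem _
  | zero => rw [map_zero]; exact zero_mem _
  | add a b _ _ ha hb => rw [map_add, coeff_add]; exact add_mem ha hb
  | neg a _ ha => rw [map_neg, coeff_neg]; exact neg_mem ha

lemma ηL_mem (G : RingGrading g) {m : ℤ} {a : H.A} (ha : a ∈ g.degA m) : H.ηL a ∈ g.degΓ m := by
  have h := G.gΓ_mem (H.ηL a) m
  rw [gΓ_ηL, G.gA_eq m a ha, mapRingHom_single, coeff_single, Finsupp.single_eq_same] at h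
  exact h

lemma ηR_mem (G : RingGrading g) {m : ℤ} {a : H.A} (ha : a ∈ g.degA m) : H.ηR a ∈ g.degΓ m := by
  have h := G.gΓ_mem (H.ηR a) m
  rw [gΓ_ηR, G.gA_eq m a ha, mapRingHom_single, coeff_single, Finsupp.single_eq_same] at h
  exact h

/-- The inclusion of the coaction on `A` in the coaction on the cobar complex. -/
def jA : AddMonoidAlgebra H.A ℤ →+* AddMonoidAlgebra (Cobar H) (ℕ × ℤ) :=
  (mapDomainRingHom (Cobar H) (AddMonoidHom.inr ℕ ℤ)).comp (mapRingHom ℤ coeff)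

lemma jA_single (m : ℤ) (a : H.A) : jA (single m a) = single (0, m) (coeff (H := H) a) := by
  rw [jA, RingHom.comp_apply, mapRingHom_single]
  exact mapDomain_single

/-- The inclusion of the coaction on `Γ` in the coaction on the cobar complex. -/
def jΓ : AddMonoidAlgebra H.Γ ℤ →+ AddMonoidAlgebra (Cobar H) (ℕ × ℤ) :=
  (Finsupp.liftAddHom fun m : ℤ => (singleAddHom ((1, m) : ℕ × ℤ)).comp (bar (H := H))).comp
    coeffAddEquiv.toAddMonoidHom

lemma jΓ_single (m : ℤ) (a : H.Γ) : jΓ (single m a) = single (1, m) (bar (H := H) a) :=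
  Finsupp.liftAddHom_apply_single _ _ _

lemma jA_mul_jΓ (u : AddMonoidAlgebra H.A ℤ) (v : AddMonoidAlgebra H.Γ ℤ) :
    jA u * jΓ v = jΓ (mapRingHom ℤ H.ηL u * v) := by
  induction u using induction_linear with
  | zero => simp
  | add x y hx hy => rw [map_add, map_add, add_mul, add_mul, map_add, hx, hy]
  | single m a =>
    induction v using induction_linear with
    | zero => simp
    | add x y hx hy => rw [map_add, mul_add, mul_add, map_add, hx, hy]
    | single k b =>
      rw [jA_single, jΓ_single, mapRingHom_single, single_mul_single, single_mul_single, jΓ_single,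
        coeff_mul_bar]
      simp

lemma jΓ_mul_jA (v : AddMonoidAlgebra H.Γ ℤ) (u : AddMonoidAlgebra H.A ℤ) :
    jΓ v * jA u = jΓ (v * mapRingHom ℤ H.ηR u) := by
  induction u using induction_linear with
  | zero => simp
  | add x y hx hy => rw [map_add, map_add, mul_add, mul_add, map_add, hx, hy]
  | single m a =>
    induction v using induction_linear with
    | zero => simp
    | add x y hx hy => rw [map_add, add_mul, add_mul, map_add, hx, hy]
    | single k b =>
      rw [jA_single, jΓ_single, mapRingHom_single, single_mul_single, single_mul_single, jΓ_single,
        bar_mul_coeff]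
      simp

/-- The coaction on the cobar complex. -/
def gT (G : RingGrading g) : Cobar H →+* AddMonoidAlgebra (Cobar H) (ℕ × ℤ) :=
  lift (jA.comp G.gA) (jΓ.comp G.gΓ.toAddMonoidHom)
    (fun a x => by
      change jA (G.gA a) * jΓ (G.gΓ x) = jΓ (G.gΓ (H.ηL a * x))
      rw [jA_mul_jΓ, map_mul G.gΓ, gΓ_ηL])
    (fun x a => by
      change jΓ (G.gΓ x) * jA (G.gA a) = jΓ (G.gΓ (x * H.ηR a))
      rw [jΓ_mul_jA, map_mul G.gΓ, gΓ_ηR])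

lemma gT_coeff (G : RingGrading g) (a : H.A) : G.gT (coeff a) = jA (G.gA a) := lift_coeff _ _ _ _ a

lemma gT_bar (G : RingGrading g) (x : H.Γ) : G.gT (bar x) = jΓ (G.gΓ x) := lift_bar _ _ _ _ x

lemma gT_homog (G : RingGrading g) {n : ℕ} {m : ℤ} {x : Cobar H} (hx : IsHomog g n m x) :
    G.gT x = single (n, m) x := by
  induction hx with
  | coeff m a ha => rw [gT_coeff, G.gA_eq m a ha, jA_single]
  | bar m a ha => rw [gT_bar, G.gΓ_eq m a ha, jΓ_single]
  | zero n m => rw [map_zero, single_zero]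
  | add n m x y _ _ hx hy => rw [map_add, hx, hy, single_add]
  | neg n m x _ hx => rw [map_neg, hx, ← single_neg]
  | mul n n' m m' x y _ _ hx hy => rw [map_mul, hx, hy, single_mul_single]; rfl

/-- The component of bidegree `p`. -/
def pr (G : RingGrading g) (p : ℕ × ℤ) : Cobar H →+ Cobar H :=
  AddMonoidHom.mk' (fun x => (G.gT x).coeff p) fun x y => by rw [map_add]; rfl

lemma pr_self (G : RingGrading g) {p : ℕ × ℤ} {x : Cobar H} (hx : IsHomog g p.1 p.2 x) :
    G.pr p x = x := by
  change (G.gT x).coeff p = x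
  rw [G.gT_homog hx, coeff_single, Finsupp.single_eq_same]

lemma pr_ne (G : RingGrading g) {p q : ℕ × ℤ} {x : Cobar H} (hx : IsHomog g p.1 p.2 x) (h : p ≠ q) :
    G.pr q x = 0 := by
  change (G.gT x).coeff q = 0
  rw [G.gT_homog hx, coeff_single, Finsupp.single_apply, if_neg h]

lemma span (G : RingGrading g) (x : Cobar H) :
    x ∈ AddSubgroup.closure {y | ∃ p : ℕ × ℤ, IsHomog g p.1 p.2 y} := by
  induction x using Cobar.induction with
  | hc a =>
    induction G.A_span a using AddSubgroup.closure_induction with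
    | mem a ha =>
      obtain ⟨m, hm⟩ := ha
      exact AddSubgroup.subset_closure ⟨(0, m), .coeff m a hm⟩
    | zero => rw [map_zero]; exact zero_mem _
    | add a b _ _ ha hb => rw [map_add]; exact add_mem ha hb
    | neg a _ ha => rw [map_neg]; exact neg_mem ha
  | hb a =>
    induction G.Γ_span a using AddSubgroup.closure_induction with
    | mem a ha =>
      obtain ⟨m, hm⟩ := ha
      exact AddSubgroup.subset_closure ⟨(1, m), .bar m a hm⟩
    | zero => rw [map_zero]; exact zero_mem _
    | add a b _ _ ha hb => rw [map_add]; exact add_mem ha hb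
    | neg a _ ha => rw [map_neg]; exact neg_mem ha
  | hm x y hx hy =>
    induction hx using AddSubgroup.closure_induction with
    | mem x hx =>
      induction hy using AddSubgroup.closure_induction with
      | mem y hy =>
        obtain ⟨p, hp⟩ := hx
        obtain ⟨q, hq⟩ := hy
        exact AddSubgroup.subset_closure ⟨(p.1 + q.1, p.2 + q.2), .mul _ _ _ _ _ _ hp hq⟩
      | zero => rw [mul_zero]; exact zero_mem _
      | add a b _ _ ha hb => rw [mul_add]; exact add_mem ha hb
      | neg a _ ha => rw [mul_neg]; exact neg_mem ha
    | zero => rw [zero_mul]; exact zero_mem _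
    | add a b _ _ ha hb => rw [add_mul]; exact add_mem ha hb
    | neg a _ ha => rw [neg_mul]; exact neg_mem ha
  | ha x y hx hy => exact add_mem hx hy

lemma pr_homog (G : RingGrading g) (p : ℕ × ℤ) (x : Cobar H) : IsHomog g p.1 p.2 (G.pr p x) := by
  induction G.span x using AddSubgroup.closure_induction with
  | mem x hx =>
    obtain ⟨q, hq⟩ := hx
    by_cases h : q = p
    · subst h
      rwa [G.pr_self hq]
    · rw [G.pr_ne hq h]
      exact .zero _ _
  | zero => rw [map_zero]; exact .zero _ _
  | add a b _ _ ha hb => rw [map_add]; exact .add _ _ _ _ ha hb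
  | neg a _ ha => rw [map_neg]; exact .neg _ _ _ ha

end RingGrading

lemma IsHomog.sgn {H : HopfAlgebroid} {g : Grading H} {n : ℕ} {m : ℤ} {x : Cobar H}
    (hx : IsHomog g n m x) : Cobar.sgn x = (-1) ^ n * x := by
  induction hx with
  | coeff m a ha => rw [Cobar.sgn_coeff, pow_zero, one_mul]
  | bar m a ha => rw [Cobar.sgn_bar, pow_one, neg_one_mul]
  | zero n m => rw [map_zero, mul_zero]
  | add n m x y _ _ hx hy => rw [map_add, hx, hy, mul_add]
  | neg n m x _ hx => rw [map_neg, hx, mul_neg]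
  | mul n n' m m' x y _ _ hx hy =>
    rw [map_mul, hx, hy, pow_add]
    rcases neg_one_pow_eq_or (Cobar H) n' with h | h <;> rw [h] <;> noncomm_ring

lemma IsHomog.sgn_homog {H : HopfAlgebroid} {g : Grading H} {n : ℕ} {m : ℤ} {x : Cobar H}
    (hx : IsHomog g n m x) : IsHomog g n m (Cobar.sgn x) := by
  rw [hx.sgn]
  rcases neg_one_pow_eq_or (Cobar H) n with h | h <;> rw [h]
  · rwa [one_mul]
  · rw [neg_one_mul]
    exact .neg _ _ _ hx

lemma IsHomog.cast {H : HopfAlgebroid} {g : Grading H} {n n' : ℕ} {m m' : ℤ} {x : Cobar H}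
    (hx : IsHomog g n m x) (hn : n = n') (hm : m = m') : IsHomog g n' m' x := by
  subst hn hm
  exact hx

lemma IsHomog.sub {H : HopfAlgebroid} {g : Grading H} {n : ℕ} {m : ℤ} {x y : Cobar H}
    (hx : IsHomog g n m x) (hy : IsHomog g n m y) : IsHomog g n m (x - y) := by
  rw [sub_eq_add_neg]
  exact hx.add _ _ _ _ (hy.neg _ _ _)

namespace RingGrading

open Cobar

variable {H : HopfAlgebroid} {g : Grading H}

lemma one_mem_degA (G : RingGrading g) : (1 : H.A) ∈ g.degA 0 := by
  have h := G.gA_mem 1 0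
  rwa [map_one, AddMonoidAlgebra.one_def, AddMonoidAlgebra.coeff_single,
    Finsupp.single_eq_same] at h

lemma homog_one (G : RingGrading g) : IsHomog g 0 0 (1 : Cobar H) := by
  rw [← map_one coeff]
  exact .coeff _ _ G.one_mem_degA

lemma d_homog (G : RingGrading g) {n : ℕ} {m : ℤ} {x : Cobar H} (hx : IsHomog g n m x) :
    IsHomog g (n + 1) m (d x) := by
  induction hx with
  | coeff m a ha =>
    rw [d_coeff]
    exact (IsHomog.bar _ _ (G.ηR_mem ha)).sub (.bar _ _ (G.ηL_mem ha))
  | bar m a ha =>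
    have h1 : IsHomog g 1 0 (bar (H := H) 1) := by
      rw [← map_one H.ηL]
      exact .bar _ _ (G.ηL_mem G.one_mem_degA)
    rw [d_bar]
    exact .add _ _ _ _ (((h1.mul _ _ _ _ _ _ (.bar _ _ ha)).cast rfl (zero_add m)).sub
      (G.ψ_homog m a ha)) (((IsHomog.bar _ _ ha).mul _ _ _ _ _ _ h1).cast rfl (add_zero m))
  | zero n m => rw [map_zero]; exact .zero _ _
  | add n m x y _ _ hx hy => rw [map_add]; exact .add _ _ _ _ hx hy
  | neg n m x _ hx => rw [map_neg]; exact .neg _ _ _ hx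
  | mul n n' m m' x y hx hy hx' hy' =>
    rw [d_mul]
    exact .add _ _ _ _ ((hx'.mul _ _ _ _ _ _ hy).cast (by omega) rfl)
      ((hx.sgn_homog.mul _ _ _ _ _ _ hy').cast (by omega) rfl)

lemma pr_d (G : RingGrading g) (n : ℕ) (m : ℤ) (x : Cobar H) :
    G.pr (n + 1, m) (d x) = d (G.pr (n, m) x) := by
  induction G.span x using AddSubgroup.closure_induction with
  | mem x hx =>
    obtain ⟨q, hq⟩ := hx
    have hd : IsHomog g (q.1 + 1, q.2).1 (q.1 + 1, q.2).2 (d x) := G.d_homog hq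
    by_cases h : q = (n, m)
    · subst h
      rw [G.pr_self hq, G.pr_self hd]
    · rw [G.pr_ne hq h, map_zero, G.pr_ne hd]
      intro h'
      apply h
      rw [Prod.ext_iff] at h' ⊢
      exact ⟨Nat.succ_injective h'.1, h'.2⟩
  | zero => rw [map_zero, map_zero, map_zero, map_zero]
  | add a b _ _ ha hb => rw [map_add, map_add, map_add, map_add, ha, hb]
  | neg a _ ha => rw [map_neg, map_neg, map_neg, map_neg, ha]

lemma pr_zero_d (G : RingGrading g) (m : ℤ) (x : Cobar H) : G.pr (0, m) (d x) = 0 := by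
  induction G.span x using AddSubgroup.closure_induction with
  | mem x hx =>
    obtain ⟨q, hq⟩ := hx
    have hd : IsHomog g (q.1 + 1, q.2).1 (q.1 + 1, q.2).2 (d x) := G.d_homog hq
    rw [G.pr_ne hd]
    intro h'
    exact Nat.succ_ne_zero _ (Prod.ext_iff.1 h').1
  | zero => rw [map_zero, map_zero]
  | add a b _ _ ha hb => rw [map_add, map_add, ha, hb, add_zero]
  | neg a _ ha => rw [map_neg, map_neg, ha, neg_zero]

/-- A homogeneous coboundary is the coboundary of a homogeneous cochain. -/
lemma exists_homog_of_eq_d (G : RingGrading g) {n : ℕ} {m : ℤ} {x w : Cobar H}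
    (hx : IsHomog g (n + 1) m x)
    (h : d w = x) : ∃ w', IsHomog g n m w' ∧ d w' = x :=
  ⟨G.pr (n, m) w, G.pr_homog (n, m) w, by
    rw [← G.pr_d, h]
    exact G.pr_self (p := (n + 1, m)) hx⟩

lemma eq_zero_of_eq_d (G : RingGrading g) {m : ℤ} {x w : Cobar H} (hx : IsHomog g 0 m x)
    (h : d w = x) : x = 0 := by
  rw [← G.pr_self (p := (0, m)) hx, ← h, pr_zero_d]

lemma d_pr (G : RingGrading g) {x : Cobar H} (hx : d x = 0) (p : ℕ × ℤ) : d (G.pr p x) = 0 := by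
  obtain ⟨n, m⟩ := p
  rw [← G.pr_d, hx, map_zero]

/-- The projection of the cohomology to the part of bidegree `p`. -/
def prCoh (G : RingGrading g) (p : ℕ × ℤ) : Coh H →+ Coh H :=
  AddMonoidHom.mk' (Quotient.lift (fun x : Cocycles H => Coh.clsOf (G.pr p x.1) (G.d_pr x.2 p))
    (by
      rintro x y ⟨w, hw⟩
      refine Coh.clsOf_eq_clsOf.2 ?_
      obtain ⟨n, m⟩ := p
      rcases n with _ | n
      · refine ⟨0, ?_⟩
        rw [map_zero, ← map_sub, ← hw, pr_zero_d]
      · refine ⟨G.pr (n, m) w, ?_⟩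
        rw [← pr_d, hw, map_sub])) (by
    intro h k
    obtain ⟨x, hx, rfl⟩ := Coh.exists_rep h
    obtain ⟨y, hy, rfl⟩ := Coh.exists_rep k
    refine (Coh.clsOf_congr (map_add (G.pr p) x y) _).trans ?_
    exact (Coh.clsOf_add (G.d_pr hx p) (G.d_pr hy p)).symm)

lemma prCoh_self (G : RingGrading g) {p : ℕ × ℤ} {h : Coh H} (hh : h ∈ bigr g p.1 p.2) :
    G.prCoh p h = h := by
  obtain ⟨x, hx, hx', rfl⟩ := hh
  exact Coh.clsOf_congr (G.pr_self hx) _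

lemma prCoh_ne (G : RingGrading g) {p q : ℕ × ℤ} {h : Coh H}
    (hh : h ∈ bigr g p.1 p.2) (hpq : p ≠ q) :
    G.prCoh q h = 0 := by
  obtain ⟨x, hx, hx', rfl⟩ := hh
  exact (Coh.clsOf_congr (G.pr_ne hx hpq) _).trans (map_zero Coh.cls)

/-- If homogeneous classes span the cohomology, then those of bidegree `p` span the part of
bidegree `p`. -/
lemma bigr_eq_closure (G : RingGrading g) (S : ℕ × ℤ → Set (Coh H))
    (hS : ∀ p, ∀ h ∈ S p, h ∈ bigr g p.1 p.2)
    (hs : ∀ h, h ∈ AddSubgroup.closure (⋃ p, S p)) (p : ℕ × ℤ) :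
    bigr g p.1 p.2 = AddSubgroup.closure (S p) := by
  refine le_antisymm (fun h hh => ?_) ((AddSubgroup.closure_le _).2 (hS p))
  rw [← G.prCoh_self hh]
  clear hh
  induction hs h using AddSubgroup.closure_induction with
  | mem x hx =>
    obtain ⟨q, hq⟩ := Set.mem_iUnion.1 hx
    by_cases h : q = p
    · subst h
      rw [G.prCoh_self (hS q x hq)]
      exact AddSubgroup.subset_closure hq
    · rw [G.prCoh_ne (hS q x hq) h]
      exact zero_mem _
  | zero => rw [map_zero]; exact zero_mem _
  | add a b _ _ ha hb => rw [map_add]; exact add_mem ha hb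
  | neg a _ ha => rw [map_neg]; exact neg_mem ha

/-- If the additive span of homogeneous sets `S p` is everything, then the cohomology is the direct
sum of its bigraded pieces; the projections `prCoh` give independence. -/
lemma isInternal (G : RingGrading g) (S : ℕ × ℤ → Set (Coh H))
    (hS : ∀ p, ∀ h ∈ S p, h ∈ bigr g p.1 p.2)
    (hs : ∀ h, h ∈ AddSubgroup.closure (⋃ p, S p)) :
    DirectSum.IsInternal (fun p : ℕ × ℤ => bigr g p.1 p.2) := by
  classical
  constructor
  · have key : ∀ p, ∀ v : DirectSum (ℕ × ℤ) fun p => bigr g p.1 p.2,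
        G.prCoh p (DirectSum.coeAddMonoidHom (fun p : ℕ × ℤ => bigr g p.1 p.2) v) = v p := by
      intro p v
      induction v using DirectSum.induction_on with
      | zero => simp
      | of q x =>
        rw [DirectSum.coeAddMonoidHom_of]
        by_cases h : q = p
        · subst h
          rw [G.prCoh_self x.2, DirectSum.of_eq_same]
        · rw [G.prCoh_ne x.2 h, DirectSum.of_eq_of_ne _ _ _ (Ne.symm h)]
          rfl
      | add x y hx hy =>
        rw [map_add, map_add, hx, hy]
        rfl
    intro x y h
    refine DFinsupp.ext fun p => Subtype.ext ?_
    rw [← key, ← key, h]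
  · intro h
    induction hs h using AddSubgroup.closure_induction with
    | mem x hx =>
      obtain ⟨q, hq⟩ := Set.mem_iUnion.1 hx
      exact ⟨DirectSum.of (fun p : ℕ × ℤ => bigr g p.1 p.2) q ⟨x, hS q x hq⟩,
        DirectSum.coeAddMonoidHom_of _ _ _⟩
    | zero => exact ⟨0, map_zero _⟩
    | add a b _ _ ha hb =>
      obtain ⟨x, rfl⟩ := ha
      obtain ⟨y, rfl⟩ := hb
      exact ⟨x + y, map_add _ _ _⟩
    | neg a _ ha =>
      obtain ⟨x, rfl⟩ := ha
      exact ⟨-x, map_neg _ _⟩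

end RingGrading

end EllCoh

namespace EllCoh

/-! ### Massey products -/

lemma Coh.Represents.neg {H : HopfAlgebroid} {x : Cobar H} {h : Coh H} (hx : Coh.Represents x h) :
    Coh.Represents (-x) (-h) := by
  obtain ⟨h1, rfl⟩ := hx
  exact ⟨by rw [map_neg, h1, neg_zero], Coh.clsOf_neg h1⟩

lemma Coh.Represents.neg_neg_one_pow_mul {H : HopfAlgebroid} {x : Cobar H} {h : Coh H}
    (hx : Coh.Represents x h) (n : ℕ) :
    Coh.Represents (-((-1) ^ n * x)) (-((-1) ^ n * h)) := by
  rcases Nat.even_or_odd n with hn | hn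
  · rw [hn.neg_one_pow, hn.neg_one_pow, one_mul, one_mul]
    exact hx.neg
  · rw [hn.neg_one_pow, hn.neg_one_pow, neg_one_mul, neg_one_mul, neg_neg, neg_neg]
    exact hx

namespace RingGrading

open Cobar Coh

variable {H : HopfAlgebroid} {g : Grading H}

/-- A Massey product with last two entries of degree `1` is contained in the coset of one of its
elements modulo the usual indeterminacy. -/
lemma massey_indeterminacy (G : RingGrading g) {p : ℕ} {k l m : ℤ} {a b c : Coh H}
    {x₀ y₀ z₀ u₀ v₀ : Cobar H} (hx₀ : IsHomog g p k x₀) (hxa : Represents x₀ a)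
    (hy₀ : IsHomog g 1 l y₀) (hyb : Represents y₀ b)
    (hz₀ : IsHomog g 1 m z₀) (hzc : Represents z₀ c) (hu₀ : IsHomog g p (k + l) u₀)
    (hdu₀ : d u₀ = x₀ * y₀) (hv₀ : IsHomog g 1 (l + m) v₀) (hdv₀ : d v₀ = y₀ * z₀)
    {h₀ : Coh H} (hh₀ : Represents (x₀ * v₀ - (-1) ^ p * (u₀ * z₀)) h₀) {h : Coh H}
    (hh : h ∈ massey g p k 1 l 1 m a b c) :
    ∃ c₁ ∈ bigr g p (k + l), ∃ c₂ ∈ bigr g 1 (l + m), h = h₀ + a * c₂ - (-1) ^ p * (c₁ * c) := by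
  obtain ⟨x, y, z, u, v, n, n', hx, ⟨hx', hxa'⟩, hy, ⟨hy', hyb'⟩, hz, ⟨hz', hzc'⟩, hn, hu, hdu,
    hn', hv, hdv, ⟨hh', hhh⟩⟩ := hh
  obtain rfl : n = p := by omega
  obtain rfl : n' = 1 := by omega
  obtain ⟨hx₀', hxa⟩ := hxa
  obtain ⟨hy₀', hyb⟩ := hyb
  obtain ⟨hz₀', hzc⟩ := hzc
  obtain ⟨hh₀', hh₀⟩ := hh₀
  have e1 : ∃ w₁, d w₁ = x - x₀ ∧ sgn w₁ = -((-1) ^ n * w₁) ∧ IsHomog g n (k + l) (w₁ * y) := by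
    obtain ⟨w, hw⟩ := (clsOf_eq_clsOf (hx := hx') (hy := hx₀')).1 (hxa'.trans hxa.symm)
    rcases n with _ | n
    · refine ⟨0, ?_, ?_, ?_⟩
      · rw [map_zero, G.eq_zero_of_eq_d (hx.sub hx₀) hw]
      · simp
      · rw [zero_mul]
        exact .zero _ _
    · obtain ⟨w', hw', h'⟩ := G.exists_homog_of_eq_d (hx.sub hx₀) hw
      refine ⟨w', h', ?_, hw'.mul _ _ _ _ _ _ hy⟩
      rw [hw'.sgn, pow_succ, mul_neg_one, neg_mul, neg_neg]
  obtain ⟨w₁, hw₁, hs₁, hwy⟩ := e1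
  obtain ⟨w₂', hw₂'⟩ := (clsOf_eq_clsOf (hx := hy') (hy := hy₀')).1 (hyb'.trans hyb.symm)
  obtain ⟨w₂, hw₂, hdw₂⟩ := G.exists_homog_of_eq_d (n := 0) (hy.sub hy₀) hw₂'
  obtain ⟨w₃', hw₃'⟩ := (clsOf_eq_clsOf (hx := hz') (hy := hz₀')).1 (hzc'.trans hzc.symm)
  obtain ⟨w₃, hw₃, hdw₃⟩ := G.exists_homog_of_eq_d (n := 0) (hz.sub hz₀) hw₃'
  have hs₂ : sgn w₂ = w₂ := by rw [hw₂.sgn, pow_zero, one_mul]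
  have hsx : sgn x₀ = (-1) ^ n * x₀ := hx₀.sgn
  have hsu : sgn u₀ = (-1) ^ n * u₀ := hu₀.sgn
  have hsy : sgn y₀ = -y₀ := by rw [hy₀.sgn, pow_one, neg_one_mul]
  set ε : Cobar H := (-1) ^ n with hε
  have hε' : ε = 1 ∨ ε = -1 := neg_one_pow_eq_or _ _
  have hdε : ∀ t, d (ε * t) = ε * d t := by
    intro t
    rcases hε' with h | h <;> rw [h]
    · rw [one_mul, one_mul]
    · rw [neg_one_mul, neg_one_mul, map_neg]
  have hdc₁ : d (u - u₀ - w₁ * y - ε * (x₀ * w₂)) = 0 := by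
    rw [map_sub, map_sub, map_sub, hdε, hdu, hdu₀, d_mul, d_mul, hw₁, hdw₂, hx₀', hy', hsx]
    rcases hε' with h | h <;> rw [h] <;> noncomm_ring
  have hdc₂ : d (v - v₀ - w₂ * z + y₀ * w₃) = 0 := by
    rw [map_add, map_sub, map_sub, hdv, hdv₀, d_mul, d_mul, hdw₂, hdw₃, hy₀', hz', hsy]
    noncomm_ring
  refine ⟨clsOf _ hdc₁, ⟨_, ?_, represents_clsOf _ hdc₁⟩, clsOf _ hdc₂,
    ⟨_, ?_, represents_clsOf _ hdc₂⟩, ?_⟩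
  · refine ((hu.sub hu₀).sub hwy).sub ?_
    have : IsHomog g n (k + l) (x₀ * w₂) := (hx₀.mul _ _ _ _ _ _ hw₂).cast (by omega) rfl
    rcases hε' with h | h <;> rw [h]
    · rwa [one_mul]
    · rw [neg_one_mul]
      exact this.neg _ _ _
  · exact .add _ _ _ _ ((hv.sub hv₀).sub ((hw₂.mul _ _ _ _ _ _ hz).cast (by omega) rfl))
      ((hy₀.mul _ _ _ _ _ _ hw₃).cast (by omega) rfl)
  · have hεC : Represents (-(ε * ((u - u₀ - w₁ * y - ε * (x₀ * w₂)) * z)))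
        (-((-1) ^ n * (clsOf _ hdc₁ * c))) := by
      have h1 : Represents ((u - u₀ - w₁ * y - ε * (x₀ * w₂)) * z) (clsOf _ hdc₁ * c) :=
        (represents_clsOf _ hdc₁).mul ⟨hz', hzc'⟩
      exact h1.neg_neg_one_pow_mul n
    obtain ⟨h1, h2⟩ := hεC
    obtain ⟨h3, h4⟩ := (show Represents x a from ⟨hx', hxa'⟩).mul (represents_clsOf _ hdc₂)
    rw [sub_eq_add_neg, ← h2, ← h4, ← hh₀, ← hhh]
    change clsOf _ hh' = clsOf _ hh₀' + clsOf _ h3 + clsOf _ h1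
    rw [clsOf_add, clsOf_add, clsOf_eq_clsOf]
    refine ⟨w₁ * v₀ + w₁ * w₂ * z - w₁ * y₀ * w₃ - u₀ * w₃, ?_⟩
    rw [map_sub, map_sub, map_add, mul_assoc, mul_assoc, d_mul, d_mul, d_mul w₂, d_mul w₁ (y₀ * w₃),
      d_mul, d_mul, hw₁, hdw₂, hdw₃, hz', hy₀', hdv₀, hdu₀, hs₁, hs₂, hsy, hsu]
    rcases hε' with h | h <;> rw [h] <;> noncomm_ring

/-- A Massey product without indeterminacy. -/
lemma massey_eq_singleton (G : RingGrading g) {p : ℕ} {k l m : ℤ} {a b c : Coh H}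
    {x₀ y₀ z₀ u₀ v₀ : Cobar H} (hx₀ : IsHomog g p k x₀) (hxa : Represents x₀ a)
    (hy₀ : IsHomog g 1 l y₀) (hyb : Represents y₀ b)
    (hz₀ : IsHomog g 1 m z₀) (hzc : Represents z₀ c) (hu₀ : IsHomog g p (k + l) u₀)
    (hdu₀ : d u₀ = x₀ * y₀) (hv₀ : IsHomog g 1 (l + m) v₀) (hdv₀ : d v₀ = y₀ * z₀)
    {h₀ : Coh H} (hh₀ : Represents (x₀ * v₀ - (-1) ^ p * (u₀ * z₀)) h₀)
    (h1 : ∀ c₁ ∈ bigr g p (k + l), c₁ * c = 0) (h2 : ∀ c₂ ∈ bigr g 1 (l + m), a * c₂ = 0) :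
    massey g p k 1 l 1 m a b c = {h₀} := by
  refine Set.eq_singleton_iff_unique_mem.2 ⟨?_, fun h hh => ?_⟩
  · exact ⟨x₀, y₀, z₀, u₀, v₀, p, 1, hx₀, hxa, hy₀, hyb, hz₀, hzc, rfl, hu₀, hdu₀, rfl, hv₀, hdv₀,
      hh₀⟩
  · obtain ⟨c₁, hc₁, c₂, hc₂, rfl⟩ := G.massey_indeterminacy hx₀ hxa hy₀ hyb hz₀ hzc hu₀ hdu₀ hv₀
      hdv₀ hh₀ hh
    rw [h1 c₁ hc₁, h2 c₂ hc₂, mul_zero, add_zero, sub_zero]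

end RingGrading

/-! ### The bigrading of the quotients of `(A', Γ')` -/

namespace CubicBase

open AddMonoidAlgebra

variable {A : Type} [CommRing A] (B : CubicBase A)

lemma Γ_induction {P : B.Γ → Prop} (ha : ∀ x y, P x → P y → P (x + y))
    (hm : ∀ a i, P (B.ηL a * B.r ^ i)) (x : B.Γ) : P x := by
  induction x using AdjoinRoot.induction_on with
  | ih p =>
    induction p using Polynomial.induction_on' with
    | add p q hp hq => rw [map_add]; exact ha _ _ hp hq
    | monomial n a =>
      have h : AdjoinRoot.mk (cubicPoly B.a2 B.a4) (Polynomial.monomial n a) =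
          B.ηL a * B.r ^ n := by
        rw [← Polynomial.C_mul_X_pow_eq_monomial, map_mul, map_pow]
        rfl
      rw [h]
      exact hm a n

variable (degA : ℤ → AddSubgroup A)

/-- The elements of `Γ` of degree `m`. -/
def degr (m : ℤ) : AddSubgroup B.Γ := AddSubgroup.closure {z : B.Γ | ∃ (a : A) (k : ℤ) (i : ℕ),
    a ∈ degA k ∧ k + 4 * i = m ∧ z = B.ηL a * B.r ^ i}

variable {degA}

lemma isHomog_cf {m : ℤ} {a : A} (ha : a ∈ degA m) : IsHomog (B.grading degA) 0 m (B.cf a) :=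
  IsHomog.coeff (g := B.grading degA) _ _ ha

lemma isHomog_br {m : ℤ} {a : A} (i : ℕ) (ha : a ∈ degA m) {k : ℤ} (h : m + 4 * i = k) :
    IsHomog (B.grading degA) 1 k (B.br (B.ηL a * B.r ^ i)) :=
  IsHomog.bar (g := B.grading degA) _ _ (AddSubgroup.subset_closure ⟨a, m, i, ha, h, rfl⟩)

lemma isHomog_br_r_pow (h1 : (1 : A) ∈ degA 0) (i : ℕ) :
    IsHomog (B.grading degA) 1 (4 * i) (B.br (B.r ^ i)) := by
  have := B.isHomog_br i h1 (zero_add _)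
  rwa [map_one, one_mul] at this

lemma isHomog_br_r (h1 : (1 : A) ∈ degA 0) : IsHomog (B.grading degA) 1 4 (B.br B.r) := by
  have := B.isHomog_br_r_pow h1 1
  rwa [pow_one] at this

lemma isHomog_βc (h1 : (1 : A) ∈ degA 0) : IsHomog (B.grading degA) 2 12 B.βc :=
  .add _ _ _ _ ((B.isHomog_br_r_pow h1 2).mul 1 1 8 4 _ _ (B.isHomog_br_r h1))
    ((B.isHomog_br_r h1).mul 1 1 4 8 _ _ (B.isHomog_br_r_pow h1 2))

lemma inl_pow_mul_inr_pow (m n : ℕ) :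
    B.inl B.r ^ m * B.inr B.r ^ n = B.units.tmul (B.r ^ m) (B.r ^ n) := by
  rw [← map_pow, ← map_pow]
  exact B.units.inl_mul_inr _ _

/-- The additive map `γ ↦ [ψ γ]`. -/
def brψ : B.Γ →+ Cobar B.hopf := (Cobar.bar2 (H := B.hopf)).comp B.ψ.toAddMonoidHom

lemma brψ_eq (a : A) (i : ℕ) : B.brψ (B.ηL a * B.r ^ i) = B.cf a *
    ∑ j ∈ Finset.range (i + 1), i.choose j • (B.br (B.r ^ j) * B.br (B.r ^ (i - j))) := by
  have h : B.ψ (B.ηL a * B.r ^ i) = B.inl (B.ηL a) * ∑ j ∈ Finset.range (i + 1),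
      i.choose j • B.units.tmul (B.r ^ j) (B.r ^ (i - j)) := by
    rw [map_mul, map_pow, B.ψ_ηL, B.ψ_r, add_pow]
    congr 1
    refine Finset.sum_congr rfl fun j _ => ?_
    rw [inl_pow_mul_inr_pow, nsmul_eq_mul, mul_comm]
  change Cobar.bar2 (H := B.hopf) (B.ψ (B.ηL a * B.r ^ i)) = _
  rw [h]
  refine (Cobar.bar2_inl_mul (H := B.hopf) a _).trans ?_
  refine congrArg (fun t => B.cf a * t) ((map_sum (Cobar.bar2 (H := B.hopf)) _ _).trans ?_)
  exact Finset.sum_congr rfl fun j _ => map_nsmul (Cobar.bar2 (H := B.hopf)) _ _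

lemma brψ_homog (h1 : (1 : A) ∈ degA 0) (m : ℤ) {x : B.Γ} (hx : x ∈ B.degr degA m) :
    IsHomog (B.grading degA) 2 m (B.brψ x) := by
  induction hx using AddSubgroup.closure_induction with
  | mem x hx =>
    obtain ⟨a, k, i, ha, rfl, rfl⟩ := hx
    rw [brψ_eq]
    refine ((B.isHomog_cf ha).mul 0 2 k (4 * i) _ _ ?_)
    refine AddSubgroup.sum_mem (homogSub (B.grading degA) (2, 4 * i))
      fun j hj => AddSubgroup.nsmul_mem _ ?_ _
    have hj' : j ≤ i := by
      have := Finset.mem_range.1 hj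
      omega
    exact ((B.isHomog_br_r_pow h1 j).mul 1 1 _ _ _ _ (B.isHomog_br_r_pow h1 (i - j))).cast rfl
      (by push_cast [hj']; ring)
  | zero => rw [map_zero]; exact .zero _ _
  | add a b _ _ ha hb => rw [map_add]; exact .add _ _ _ _ ha hb
  | neg a _ ha => rw [map_neg]; exact .neg _ _ _ ha

lemma two_mul_single {R : Type} [CommRing R] (m : ℤ) (x : R) :
    (2 : AddMonoidAlgebra R ℤ) * single m x = single m (2 * x) := by
  rw [two_mul, two_mul, single_add]

lemma three_mul_single {R : Type} [CommRing R] (m : ℤ) (x : R) :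
    (3 : AddMonoidAlgebra R ℤ) * single m x = single m (3 * x) := by
  rw [show (3 : AddMonoidAlgebra R ℤ) = 2 + 1 by norm_num, add_mul, two_mul_single, one_mul,
    ← single_add]
  congr 1
  ring

section
variable (gA : A →+* AddMonoidAlgebra A ℤ) (h2 : gA B.a2 = single 4 B.a2)
  (h4 : gA B.a4 = single 8 B.a4)

/-- The coaction of the Laurent polynomials on `Γ`, for a given one on `A`. -/
def gr : B.Γ →+* AddMonoidAlgebra B.Γ ℤ :=
  B.ΓLift ((mapRingHom ℤ B.ηL).comp gA) (single 4 B.r) (by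
    rw [RingHom.comp_apply, RingHom.comp_apply, h2, h4, mapRingHom_single, mapRingHom_single,
      single_pow, single_pow, single_mul_single, single_mul_single,
      show (3 • 4 : ℤ) = 12 by norm_num, show (4 + 2 • 4 : ℤ) = 12 by norm_num,
      show (8 + 4 : ℤ) = 12 by norm_num, ← single_add, ← single_add, B.rel, single_zero])

lemma gr_ηL (a : A) : B.gr gA h2 h4 (B.ηL a) = mapRingHom ℤ B.ηL (gA a) := B.ΓLift_ηL _ _ _ a

lemma gr_r : B.gr gA h2 h4 B.r = single 4 B.r := B.ΓLift_r _ _ _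

lemma gr_ηR (a : A) : B.gr gA h2 h4 (B.ηR a) = mapRingHom ℤ B.ηR (gA a) := by
  have h : (B.gr gA h2 h4).comp B.ηR = (mapRingHom ℤ B.ηR).comp gA := by
    apply B.hom_ext
    · rw [RingHom.comp_apply, RingHom.comp_apply, B.ηR_a2', h2, map_add, map_mul, gr_ηL, gr_r, h2,
        mapRingHom_single, mapRingHom_single, map_ofNat, B.ηR_a2', single_add, three_mul_single]
    · rw [RingHom.comp_apply, RingHom.comp_apply, B.ηR_a4', h4, map_add, map_add, map_mul, map_mul,
        map_mul, map_pow, gr_ηL, gr_ηL, gr_r, h4, h2, mapRingHom_single, mapRingHom_single,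
        mapRingHom_single, map_ofNat, map_ofNat, B.ηR_a4', single_add, single_add, single_pow,
        three_mul_single, two_mul_single, single_mul_single, show (4 + 4 : ℤ) = 8 by norm_num,
        show (2 • 4 : ℤ) = 8 by norm_num]
  exact RingHom.congr_fun h a

lemma gr_eq (gA_eq : ∀ m, ∀ a ∈ degA m, gA a = single m a) (m : ℤ) {x : B.Γ}
    (hx : x ∈ B.degr degA m) : B.gr gA h2 h4 x = single m x := by
  induction hx using AddSubgroup.closure_induction with
  | mem x hx =>
    obtain ⟨a, k, i, ha, rfl, rfl⟩ := hx
    rw [map_mul, map_pow, gr_ηL, gr_r, gA_eq k a ha, mapRingHom_single, single_pow,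
      single_mul_single, nsmul_eq_mul, mul_comm (4 : ℤ)]
  | zero => rw [map_zero, single_zero]
  | add a b _ _ ha hb => rw [map_add, ha, hb, single_add]
  | neg a _ ha => rw [map_neg, ha, ← single_neg]

end

lemma degr_span (A_span : ∀ a, a ∈ AddSubgroup.closure {a | ∃ m, a ∈ degA m}) (x : B.Γ) :
    x ∈ AddSubgroup.closure {x | ∃ m, x ∈ B.degr degA m} := by
  refine B.Γ_induction (P := fun x => x ∈ AddSubgroup.closure {x | ∃ m, x ∈ B.degr degA m})
    (fun _ _ => add_mem) ?_ x
  intro a i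
  induction A_span a using AddSubgroup.closure_induction with
  | mem a ha =>
    obtain ⟨m, hm⟩ := ha
    exact AddSubgroup.subset_closure ⟨m + 4 * i, AddSubgroup.subset_closure
      ⟨a, m, i, hm, rfl, rfl⟩⟩
  | zero => rw [map_zero, zero_mul]; exact zero_mem _
  | add a b _ _ ha hb => rw [map_add, add_mul]; exact add_mem ha hb
  | neg a _ ha => rw [map_neg, neg_mul]; exact neg_mem ha

/-- The bigrading of the cobar complex, for a grading of `A` given by a coaction of the Laurent
polynomials. -/
def ringGrading (gA : A →+* AddMonoidAlgebra A ℤ) (h2 : gA B.a2 = single 4 B.a2)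
    (h4 : gA B.a4 = single 8 B.a4) (gA_eq : ∀ m, ∀ a ∈ degA m, gA a = single m a)
    (h1 : (1 : A) ∈ degA 0)
    (A_span : ∀ a, a ∈ AddSubgroup.closure {a | ∃ m, a ∈ degA m}) :
    RingGrading (B.grading degA) where
  gA := gA
  gΓ := B.gr gA h2 h4
  gΓ_ηL := B.gr_ηL gA h2 h4
  gΓ_ηR := B.gr_ηR gA h2 h4
  gA_eq := gA_eq
  gΓ_eq m _ hx := B.gr_eq gA h2 h4 gA_eq m hx
  A_span := A_span
  Γ_span := B.degr_span A_span
  ψ_homog m _ hx := B.brψ_homog h1 m hx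

end CubicBase

end EllCoh

namespace EllCoh

/-! ### Polynomial gradings -/

section
open AddMonoidAlgebra

variable (k : Type) [CommRing k]

/-- The coaction on `k[a₂, a₄]` that encodes its grading. -/
def coact : MvPolynomial CVar k →+* AddMonoidAlgebra (MvPolynomial CVar k) ℤ :=
  MvPolynomial.eval₂Hom (singleZeroRingHom.comp MvPolynomial.C)
    fun v => single v.deg (MvPolynomial.X v)

lemma coact_X (v : CVar) : coact k (MvPolynomial.X v) = single v.deg (MvPolynomial.X v) :=
  MvPolynomial.eval₂Hom_X' _ _ _

lemma coact_monomial (d : CVar →₀ ℕ) (c : k) : coact k (MvPolynomial.monomial d c) =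
    single (Finsupp.weight CVar.deg d) (MvPolynomial.monomial d c) := by
  induction d using Finsupp.induction_linear generalizing c with
  | zero =>
    rw [map_zero]
    exact MvPolynomial.eval₂Hom_C _ _ _
  | add d e hd he =>
    rw [← mul_one c, ← MvPolynomial.monomial_mul, map_mul, hd, he, single_mul_single, map_add]
  | single v n =>
    rw [← MvPolynomial.C_mul_X_pow_eq_monomial, map_mul, map_pow, coact_X, single_pow,
      show coact k (MvPolynomial.C c) = single 0 (MvPolynomial.C c) from
        MvPolynomial.eval₂Hom_C _ _ _, single_mul_single, zero_add, Finsupp.weight_single]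

lemma coact_eq (m : ℤ) (a : MvPolynomial CVar k)
    (ha : a ∈ (MvPolynomial.weightedHomogeneousSubmodule k CVar.deg m).toAddSubgroup) :
    coact k a = single m a := by
  have ha' : MvPolynomial.IsWeightedHomogeneous CVar.deg a m := ha
  have : single m a = singleAddHom m (∑ d ∈ a.support, MvPolynomial.monomial d (a.coeff d)) := by
    rw [MvPolynomial.support_sum_monomial_coeff]
    rfl
  rw [this, map_sum]
  conv_lhs => rw [← MvPolynomial.support_sum_monomial_coeff a]
  rw [map_sum]
  refine Finset.sum_congr rfl fun d hd => ?_
  rw [coact_monomial, ha' (MvPolynomial.mem_support_iff.1 hd)]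
  rfl

lemma mem_closure_homogeneous (a : MvPolynomial CVar k) : a ∈ AddSubgroup.closure {a | ∃ m : ℤ, a ∈
    (MvPolynomial.weightedHomogeneousSubmodule k CVar.deg m).toAddSubgroup} := by
  rw [← MvPolynomial.support_sum_monomial_coeff a]
  exact sum_mem fun d _ => AddSubgroup.subset_closure
    ⟨_, MvPolynomial.isWeightedHomogeneous_monomial _ _ _ rfl⟩

/-- The bigrading of the cobar complex of `(A', Γ')`. -/
def grad' : RingGrading deg' :=
  base'.ringGrading (coact Z3) (coact_X _ _) (coact_X _ _) (coact_eq Z3)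
    (MvPolynomial.isWeightedHomogeneous_one _ _) (mem_closure_homogeneous Z3)

/-- The bigrading of the cobar complex of `(A₀, Γ₀)`. -/
def grad0 : RingGrading deg0 :=
  base0.ringGrading (coact (ZMod 3)) (coact_X _ _) (coact_X _ _) (coact_eq (ZMod 3))
    (MvPolynomial.isWeightedHomogeneous_one _ _) (mem_closure_homogeneous (ZMod 3))

/-- The coaction on `𝔽₃[a₄]` that encodes its grading. -/
def coact1 : Polynomial (ZMod 3) →+* AddMonoidAlgebra (Polynomial (ZMod 3)) ℤ :=
  Polynomial.eval₂RingHom (singleZeroRingHom.comp Polynomial.C) (single 8 Polynomial.X)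

/-- The bigrading of the cobar complex of `(A₁, Γ₁)`. -/
def grad1 : RingGrading deg1 :=
  base1.ringGrading coact1
    (by rw [show base1.a2 = 0 from rfl, map_zero, single_zero])
    (Polynomial.eval₂_X _ _)
    (fun m a ha => by
      induction ha using AddSubgroup.closure_induction with
      | mem a ha =>
        obtain ⟨x, i, rfl, rfl⟩ := ha
        have hX : coact1 Polynomial.X = single 8 Polynomial.X := Polynomial.eval₂_X _ _
        have hC : coact1 (Polynomial.C x) = single 0 (Polynomial.C x) := Polynomial.eval₂_C _ _
        rw [map_mul, map_pow, hX, hC, single_pow, single_mul_single, zero_add, nsmul_eq_mul,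
          mul_comm (8 : ℤ)]
      | zero => rw [map_zero, single_zero]
      | add a b _ _ ha hb => rw [map_add, ha, hb, single_add]
      | neg a _ ha => rw [map_neg, ha, ← single_neg])
    (AddSubgroup.subset_closure ⟨1, 0, by simp, by simp⟩)
    (fun a => by
      induction a using Polynomial.induction_on' with
      | add p q hp hq => exact add_mem hp hq
      | monomial n c =>
        rw [← Polynomial.C_mul_X_pow_eq_monomial]
        exact AddSubgroup.subset_closure ⟨_, AddSubgroup.subset_closure ⟨c, n, rfl, rfl⟩⟩)

/-- The bigrading of the cobar complex of `(A₂, Γ₂)`. -/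
def grad2 : RingGrading deg2 :=
  base2.ringGrading singleZeroRingHom
    (by rw [show base2.a2 = 0 from rfl, map_zero, single_zero])
    (by rw [show base2.a4 = 0 from rfl, map_zero, single_zero])
    (fun m a ha => by
      by_cases h : m = 0
      · subst h
        rfl
      · rw [if_neg h, AddSubgroup.mem_bot] at ha
        rw [ha, map_zero, single_zero])
    (by simp)
    (fun a => AddSubgroup.subset_closure ⟨0, by simp⟩)

end

/-! ### Rings that are generated by few elements over a central element -/

/-- If `M` contains `1` and `g M ⊆ M + β M` for all `g` in a set of ring generators, then
every element of the ring is obtained from `0` by finitely many steps `y ↦ m + β y`. -/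
lemma ring_induction {Q : Type} [Ring Q] {β : Q} {M : AddSubgroup Q} {S : Set Q}
    (hS : Subring.closure S = ⊤) (h1 : 1 ∈ M) (hβ : ∀ g ∈ S, g * β = β * g)
    (hM : ∀ g ∈ S, ∀ m ∈ M, ∃ m₁ ∈ M, ∃ m₂ ∈ M, g * m = m₁ + β * m₂)
    {P : Q → Prop} (h0 : P 0) (hs : ∀ m ∈ M, ∀ y, P y → P (m + β * y)) (q : Q) : P q := by
  let I : Q → Prop := fun q => ∀ P : Q → Prop, P 0 → (∀ m ∈ M, ∀ y, P y → P (m + β * y)) → P q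
  have I0 : I 0 := fun P h0 _ => h0
  have Is : ∀ m ∈ M, ∀ y, I y → I (m + β * y) := fun m hm y hy P h0 hs => hs m hm y (hy P h0 hs)
  have Iind : ∀ {q} (P : Q → Prop), I q → P 0 →
      (∀ m ∈ M, ∀ y, I y → P y → P (m + β * y)) → P q := by
    intro q P hq h0 hs
    exact (hq (fun q => I q ∧ P q) ⟨I0, h0⟩
      fun m hm y hy => ⟨Is m hm y hy.1, hs m hm y hy.1 hy.2⟩).2
  have IM : ∀ m ∈ M, I m := fun m hm => by
    have := Is m hm 0 I0
    rwa [mul_zero, add_zero] at this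
  have Iadd : ∀ x, I x → ∀ y, I y → I (x + y) := by
    intro x hx
    refine Iind (fun x => ∀ y, I y → I (x + y)) hx (fun y hy => by rwa [zero_add]) ?_
    intro m hm x hx ih y hy
    refine Iind (fun y => I (m + β * x + y)) hy ?_ ?_
    · rw [add_zero]
      exact Is m hm x hx
    · intro m' hm' y hy _
      have := Is _ (add_mem hm hm') _ (ih y hy)
      rwa [mul_add, add_add_add_comm] at this
  have Ineg : ∀ x, I x → I (-x) := by
    intro x hx
    refine Iind (fun x => I (-x)) hx (by rwa [neg_zero]) ?_
    intro m hm x _ ih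
    have := Is _ (neg_mem hm) _ ih
    rwa [mul_neg, ← neg_add] at this
  have Igen : ∀ g ∈ S, ∀ x, I x → I (g * x) := by
    intro g hg x hx
    refine Iind (fun x => I (g * x)) hx (by rwa [mul_zero]) ?_
    intro m hm x _ ih
    obtain ⟨m₁, hm₁, m₂, hm₂, h⟩ := hM g hg m hm
    have := Is _ hm₁ _ (Iadd _ (IM _ hm₂) _ ih)
    rwa [mul_add, ← add_assoc, ← h, ← mul_assoc, ← hβ g hg, mul_assoc, ← mul_add] at this
  have Imul : ∀ q, ∀ x, I x → I (q * x) := by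
    intro q
    have hq : q ∈ Subring.closure S := hS ▸ Subring.mem_top q
    induction hq using Subring.closure_induction with
    | mem g hg => exact Igen g hg
    | zero => intro x _; rwa [zero_mul]
    | one => intro x hx; rwa [one_mul]
    | add p q _ _ hp hq => intro x hx; rw [add_mul]; exact Iadd _ (hp x hx) _ (hq x hx)
    | neg p _ hp => intro x hx; rw [neg_mul]; exact Ineg _ (hp x hx)
    | mul p q _ _ hp hq => intro x hx; rw [mul_assoc]; exact hp _ (hq x hx)
  have := Imul q 1 (IM 1 h1)
  rw [mul_one] at this
  exact this P h0 hs

/-- The induction principle of `ring_induction`. -/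
def Exhausts {Q : Type} [Ring Q] (β : Q) (M : AddSubgroup Q) : Prop :=
  ∀ P : Q → Prop, P 0 → (∀ m ∈ M, ∀ y, P y → P (m + β * y)) → ∀ q, P q

lemma Exhausts.closure {Q : Type} [Ring Q] {β : Q} {M : AddSubgroup Q} (h : Exhausts β M)
    {T : Set Q} (hT : M ≤ AddSubgroup.closure T) (q : Q) :
    q ∈ AddSubgroup.closure {q | ∃ (i : ℕ), ∃ t ∈ T, q = β ^ i * t} := by
  refine h _ (zero_mem _) (fun m hm y hy => add_mem ?_ ?_) q
  · have hm' := hT hm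
    clear hm
    induction hm' using AddSubgroup.closure_induction with
    | mem x hx => exact AddSubgroup.subset_closure ⟨0, x, hx, by rw [pow_zero, one_mul]⟩
    | zero => exact zero_mem _
    | add a b _ _ ha hb => exact add_mem ha hb
    | neg a _ ha => exact neg_mem ha
  · induction hy using AddSubgroup.closure_induction with
    | mem x hx =>
      obtain ⟨i, t, ht, rfl⟩ := hx
      exact AddSubgroup.subset_closure ⟨i + 1, t, ht, by rw [pow_succ', mul_assoc]⟩
    | zero => rw [mul_zero]; exact zero_mem _
    | add a b _ _ ha hb => rw [mul_add]; exact add_mem ha hb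
    | neg a _ ha => rw [mul_neg]; exact neg_mem ha

namespace CubicResolution

open Coh

variable {H : HopfAlgebroid} (R : CubicResolution H) {Q : Type} [Ring Q] (φ : Q →+* Coh H) {β : Q}
  {M : AddSubgroup Q}

/-- A criterion for the injectivity of a ring map into the cohomology. -/
lemma injective_of_exhausts (hβ : φ β = R.β) (hQ : Exhausts β M)
    (hM : ∀ m ∈ M, ∃ a b, ∃ hb : R.IsOdd b, φ m = ofA H a + R.sCls b hb ∧
      (a = 0 → (∃ c, b = R.F c 1) → m = 0))
    (hF : ∀ c, ∃ k ∈ M, φ k = ofA H ⟨R.F c 2, R.F2_mem c⟩ ∧ β * k = 0) :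
    Function.Injective φ := by
  have key : ∀ y, ∀ k ∈ M, φ y = φ k → y = k := by
    refine hQ _ ?_ ?_
    · intro k hk h
      obtain ⟨a, b, hb, h1, h2⟩ := hM k hk
      rw [map_zero, h1] at h
      obtain ⟨ha, hb', -⟩ := R.eq_zero_of_coh
        (show ofA H a + R.sCls b hb + R.β * 0 = 0 by rw [mul_zero, add_zero, h])
      exact (h2 ha hb').symm
    · intro m hm y ih k hk h
      obtain ⟨a, b, hb, h1, h2⟩ := hM (m - k) (sub_mem hm hk)
      have h3 : ofA H a + R.sCls b hb + R.β * φ y = 0 := by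
        rw [← h1, ← hβ, ← map_mul, map_sub, sub_add_eq_add_sub, ← map_add, h, sub_self]
      obtain ⟨ha, hb', c, hc⟩ := R.eq_zero_of_coh h3
      obtain ⟨l, hl, hl', hl0⟩ := hF c
      rw [ih l hl (hc.trans hl'.symm), hl0, add_zero, ← sub_eq_zero]
      exact h2 ha hb'
  refine (injective_iff_map_eq_zero φ).2 fun y hy => key y 0 (zero_mem _) ?_
  rw [hy, map_zero]

/-- By `coh_induction` it suffices to reach `H⁰`, the classes `sCls` and `β`. -/
lemma surjective_of (hβ : φ β = R.β) (h0 : ∀ a, ∃ q, φ q = ofA H a)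
    (h1 : ∀ b (hb : R.IsOdd b), ∃ q, φ q = R.sCls b hb) : Function.Surjective φ := by
  intro h
  induction h using R.coh_induction with
  | h0 => exact ⟨0, map_zero _⟩
  | hs a b hb h ih =>
    obtain ⟨q, rfl⟩ := ih
    obtain ⟨p, hp⟩ := h0 a
    obtain ⟨o, ho⟩ := h1 b hb
    exact ⟨p + o + β * q, by rw [map_add, map_add, map_mul, hp, ho, hβ]⟩

end CubicResolution

section
variable {k σ T : Type} [CommRing k] [Ring T]

/-- The subring generated by pairwise commuting elements is commutative. -/
abbrev commRingClosure {s : Set T} (hc : ∀ x ∈ s, ∀ y ∈ s, x * y = y * x) :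
    CommRing (Subring.closure s) :=
  { (Subring.closure s).toRing with
    mul_comm := (Subring.isMulCommutative_closure hc).is_comm.comm }

/-- The map out of a polynomial ring given by commuting elements of a ring. -/
def mvLift (f : k →+* T) (t : σ → T)
    (hc : ∀ x ∈ Set.range f ∪ Set.range t, ∀ y ∈ Set.range f ∪ Set.range t, x * y = y * x) :
    MvPolynomial σ k →+* T :=
  letI := commRingClosure hc
  (Subring.closure (Set.range f ∪ Set.range t)).subtype.comp
    (MvPolynomial.eval₂Hom
      (f.codRestrict _ fun x => Subring.subset_closure (Or.inl (Set.mem_range_self x)))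
      (fun i => ⟨t i, Subring.subset_closure (Or.inr (Set.mem_range_self i))⟩))

variable (f : k →+* T) (t : σ → T)
    (hc : ∀ x ∈ Set.range f ∪ Set.range t, ∀ y ∈ Set.range f ∪ Set.range t, x * y = y * x)

lemma mvLift_C (x : k) : mvLift f t hc (MvPolynomial.C x) = f x := by
  let := commRingClosure hc
  exact congrArg Subtype.val (MvPolynomial.eval₂Hom_C
    (f.codRestrict _ fun x => Subring.subset_closure (Or.inl (Set.mem_range_self x)))
      (fun i => (⟨t i, Subring.subset_closure (Or.inr (Set.mem_range_self i))⟩ :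
        Subring.closure (Set.range f ∪ Set.range t))) x)

lemma mvLift_X (i : σ) : mvLift f t hc (MvPolynomial.X i) = t i := by
  let := commRingClosure hc
  exact congrArg Subtype.val (MvPolynomial.eval₂Hom_X'
    (f.codRestrict _ fun x => Subring.subset_closure (Or.inl (Set.mem_range_self x)))
      (fun i => (⟨t i, Subring.subset_closure (Or.inr (Set.mem_range_self i))⟩ :
        Subring.closure (Set.range f ∪ Set.range t))) i)

end

lemma MvPolynomial_closure (k σ : Type) [CommRing k] :
    Subring.closure (Set.range (MvPolynomial.C : k → MvPolynomial σ k) ∪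
      Set.range MvPolynomial.X) = ⊤ := by
  rw [eq_top_iff]
  intro p _
  induction p using MvPolynomial.induction_on with
  | C a => exact Subring.subset_closure (Or.inl ⟨a, rfl⟩)
  | add p q hp hq => exact add_mem (hp trivial) (hq trivial)
  | mul_X p i hp => exact mul_mem (hp trivial) (Subring.subset_closure (Or.inr ⟨i, rfl⟩))

lemma closure_image_eq_top {Q Q' : Type} [Ring Q] [Ring Q'] {f : Q →+* Q'}
    (hf : Function.Surjective f) {S : Set Q} (hS : Subring.closure S = ⊤) :
    Subring.closure (f '' S) = ⊤ := by
  rw [← RingHom.map_closure, hS, ← RingHom.range_eq_map, RingHom.range_eq_top.2 hf]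

end EllCoh

namespace EllCoh

/-! ### Bidegrees of cohomology classes -/

lemma bigr_mul {H : HopfAlgebroid} {g : Grading H} {n n' : ℕ} {m m' : ℤ} {h k : Coh H}
    (hh : h ∈ bigr g n m) (hk : k ∈ bigr g n' m') : h * k ∈ bigr g (n + n') (m + m') := by
  obtain ⟨x, hx, hx'⟩ := hh
  obtain ⟨y, hy, hy'⟩ := hk
  exact ⟨x * y, .mul _ _ _ _ _ _ hx hy, hx'.mul hy'⟩

lemma bigr_cast {H : HopfAlgebroid} {g : Grading H} {n n' : ℕ} {m m' : ℤ} {h : Coh H}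
    (hh : h ∈ bigr g n m) (hn : n = n') (hm : m = m') : h ∈ bigr g n' m' := by
  subst hn hm
  exact hh

lemma RingGrading.one_mem_bigr {H : HopfAlgebroid} {g : Grading H} (G : RingGrading g) :
    (1 : Coh H) ∈ bigr g 0 0 := ⟨1, G.homog_one, Cobar.d_one, map_one Coh.cls⟩

lemma bigr_pow {H : HopfAlgebroid} {g : Grading H} (h1 : (1 : Coh H) ∈ bigr g 0 0) {n : ℕ} {m : ℤ}
    {h : Coh H} (hh : h ∈ bigr g n m) (i : ℕ) : h ^ i ∈ bigr g (n * i) (m * i) := by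
  induction i with
  | zero =>
    rw [pow_zero]
    exact bigr_cast h1 rfl (by simp)
  | succ i ih =>
    rw [pow_succ]
    exact bigr_cast (bigr_mul ih hh) rfl (by push_cast; ring)

namespace Exhausts

variable {H : HopfAlgebroid} {g : Grading H} {Q : Type} [Ring Q] {φ : Q →+* Coh H} {β : Q}
  {M : AddSubgroup Q} {T : ℕ × ℤ → Set Q}

/-- The homogeneous classes `β ^ i * t` of bidegree `p`. -/
def powers (φ : Q →+* Coh H) (β : Q) (T : ℕ × ℤ → Set Q) (p : ℕ × ℤ) : Set (Coh H) :=
  {h | ∃ (i : ℕ) (q : ℕ × ℤ), ∃ t ∈ T q, 2 * i + q.1 = p.1 ∧ 12 * i + q.2 = p.2 ∧ h = φ (β ^ i * t)}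

lemma powers_homog (h1 : (1 : Coh H) ∈ bigr g 0 0) (hβ : φ β ∈ bigr g 2 12)
    (hT : ∀ p, ∀ t ∈ T p, φ t ∈ bigr g p.1 p.2) (p : ℕ × ℤ) :
    ∀ h ∈ powers φ β T p, h ∈ bigr g p.1 p.2 := by
  rintro _ ⟨i, q, t, ht, h2, h3, rfl⟩
  rw [map_mul, map_pow]
  exact bigr_cast (bigr_mul (bigr_pow h1 hβ i) (hT q t ht)) h2 h3

lemma powers_span (hQ : Exhausts β M) (hφ : Function.Surjective φ)
    (hM : M ≤ AddSubgroup.closure (⋃ p, T p)) (h : Coh H) :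
    h ∈ AddSubgroup.closure (⋃ p, powers φ β T p) := by
  obtain ⟨q, rfl⟩ := hφ h
  induction hQ.closure hM q using AddSubgroup.closure_induction with
  | mem x hx =>
    obtain ⟨i, t, ht, rfl⟩ := hx
    obtain ⟨p, hp⟩ := Set.mem_iUnion.1 ht
    exact AddSubgroup.subset_closure (Set.mem_iUnion.2
      ⟨(2 * i + p.1, 12 * i + p.2), i, p, t, hp, rfl, rfl, rfl⟩)
  | zero => rw [map_zero]; exact zero_mem _
  | add a b _ _ ha hb => rw [map_add]; exact add_mem ha hb
  | neg a _ ha => rw [map_neg]; exact neg_mem ha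

lemma isInternal (hQ : Exhausts β M) (G : RingGrading g) (hφ : Function.Surjective φ)
    (hβ : φ β ∈ bigr g 2 12) (hT : ∀ p, ∀ t ∈ T p, φ t ∈ bigr g p.1 p.2)
    (hM : M ≤ AddSubgroup.closure (⋃ p, T p)) :
    DirectSum.IsInternal (fun p : ℕ × ℤ => bigr g p.1 p.2) :=
  G.isInternal _ (powers_homog G.one_mem_bigr hβ hT) (hQ.powers_span hφ hM)

lemma bigr_eq (hQ : Exhausts β M) (G : RingGrading g) (hφ : Function.Surjective φ)
    (hβ : φ β ∈ bigr g 2 12) (hT : ∀ p, ∀ t ∈ T p, φ t ∈ bigr g p.1 p.2)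
    (hM : M ≤ AddSubgroup.closure (⋃ p, T p)) (n : ℕ) (m : ℤ) :
    bigr g n m = AddSubgroup.closure (powers φ β T (n, m)) :=
  G.bigr_eq_closure _ (powers_homog G.one_mem_bigr hβ hT) (hQ.powers_span hφ hM) (n, m)

end Exhausts

/-! ### The Massey product of `α` with itself -/

namespace CubicResolution

open Cobar Coh

variable {H : HopfAlgebroid} (R : CubicResolution H)

lemma α_eq_sCls : R.α = R.sCls 1 (R.isOdd_cocycle 1) := by
  have := R.sCls_cocycle 1
  rw [map_one, mul_one] at this
  exact this.symm

lemma commute_β_α : Commute R.β R.α := by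
  rw [α_eq_sCls]
  refine R.commute_β_sCls _ (δ := 0) ?_
  rw [map_one, map_one, ZeroMemClass.coe_zero, map_zero, mul_zero, add_zero]

lemma map_α {K : HopfAlgebroid} (f : HopfHom H K) (R' : CubicResolution K)
    (h : f.f₁ R.r = R'.r) : map f R.α = R'.α := by
  rw [α, map_clsOf]
  exact clsOf_congr (by rw [Cobar.map_bar, h]) _

lemma map_β {K : HopfAlgebroid} (f : HopfHom H K) (R' : CubicResolution K)
    (h : f.f₁ R.r = R'.r) : map f R.β = R'.β := by
  rw [β, map_clsOf]
  exact clsOf_congr (by rw [βc, βc, map_add, map_mul, map_mul, Cobar.map_bar, Cobar.map_bar,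
    map_pow, h]) _

lemma d_neg_h_r2 : d (-(R.h * bar (R.r ^ 2))) = bar R.r * bar R.r := by
  rw [map_neg, d_h_mul, d_r2, mul_neg, neg_neg, h_two_mul]

/-- The defining system of `⟨α, α, α⟩` with `u = v = - [r²] / 2` gives `- β / 2`, which is `β`
because `3 β = 0`. -/
lemma represents_β (h3 : (3 : Coh H) * R.β = 0) : Represents
    (bar R.r * -(R.h * bar (R.r ^ 2)) - (-1) ^ 1 * (-(R.h * bar (R.r ^ 2)) * bar R.r)) R.β := by
  have e : bar R.r * -(R.h * bar (R.r ^ 2)) - (-1) ^ 1 * (-(R.h * bar (R.r ^ 2)) * bar R.r) =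
      -(R.h * R.βc) := by
    rw [mul_neg, ← mul_assoc, R.h_comm, βc, pow_one]
    simp only [mul_add, mul_assoc, neg_mul, one_mul, mul_neg, neg_neg, neg_add,
      sub_eq_add_neg, add_comm]
  have hd : d (-(R.h * R.βc)) = 0 := by rw [map_neg, d_h_mul, d_βc, mul_zero, neg_zero]
  rw [e]
  refine ⟨hd, ?_⟩
  have hh : d R.h = 0 := by
    have := R.d_h_mul 1
    rwa [mul_one, d_one, mul_zero] at this
  have h1 : clsOf (-(R.h * R.βc)) hd + clsOf (-(R.h * R.βc)) hd = -R.β := by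
    rw [clsOf_add, β, clsOf_neg]
    refine clsOf_congr ?_ _
    rw [← neg_add, ← two_mul, two_h_mul]
  have h2 : clsOf (-(R.h * R.βc)) hd = -(clsOf R.h hh * R.β) := by
    rw [β, clsOf_mul, clsOf_neg]
  have h4 : (3 : Coh H) * clsOf (-(R.h * R.βc)) hd = 0 := by
    rw [h2, mul_neg, ← mul_assoc, show (3 : Coh H) * clsOf R.h hh = clsOf R.h hh * 3 from
      (Nat.cast_commute 3 _).eq, mul_assoc, h3, mul_zero, neg_zero]
  change clsOf _ hd = R.β
  have h5 : (3 : Coh H) * clsOf (-(R.h * R.βc)) hd =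
      clsOf (-(R.h * R.βc)) hd + (clsOf (-(R.h * R.βc)) hd + clsOf (-(R.h * R.βc)) hd) := by
    noncomm_ring
  rw [h1, h4] at h5
  rw [← sub_eq_zero, sub_eq_add_neg, ← h5]

lemma β_mem_massey {g : Grading H} (hr : IsHomog g 1 4 (bar R.r))
    (hr2 : IsHomog g 1 8 (R.h * bar (R.r ^ 2))) (h3 : (3 : Coh H) * R.β = 0) :
    R.β ∈ massey g 1 4 1 4 1 4 R.α R.α R.α :=
  ⟨_, _, _, _, _, 1, 1, hr, ⟨R.d_r, rfl⟩, hr, ⟨R.d_r, rfl⟩, hr, ⟨R.d_r, rfl⟩, rfl, .neg _ _ _ hr2,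
    R.d_neg_h_r2, rfl, .neg _ _ _ hr2, R.d_neg_h_r2, R.represents_β h3⟩

lemma massey_α {g : Grading H} (G : RingGrading g) (hr : IsHomog g 1 4 (bar R.r))
    (hr2 : IsHomog g 1 8 (R.h * bar (R.r ^ 2))) (h3 : (3 : Coh H) * R.β = 0)
    (h : bigr g 1 8 = ⊥) : massey g 1 4 1 4 1 4 R.α R.α R.α = {R.β} := by
  have h' : ∀ c ∈ bigr g 1 (4 + 4), c = 0 := fun c hc => by
    rw [show (4 + 4 : ℤ) = 8 by norm_num, h] at hc
    exact hc
  exact G.massey_eq_singleton hr ⟨R.d_r, rfl⟩ hr ⟨R.d_r, rfl⟩ hr ⟨R.d_r, rfl⟩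
    (.neg _ _ _ hr2) R.d_neg_h_r2 (.neg _ _ _ hr2) R.d_neg_h_r2 (R.represents_β h3)
    (fun c hc => by rw [h' c hc, zero_mul]) (fun c hc => by rw [h' c hc, mul_zero])

/-! ### Trivial right units -/

section
variable {Q : Type} [Ring Q]

/-- The elements `ι a + α * ι b`. -/
def evenOdd {A : Type} [CommRing A] (ι : A →+* Q) (α : Q) : AddSubgroup Q where
  carrier := {q | ∃ a b, q = ι a + α * ι b}
  zero_mem' := ⟨0, 0, by simp⟩
  add_mem' := by
    rintro _ _ ⟨a, b, rfl⟩ ⟨a', b', rfl⟩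
    exact ⟨a + a', b + b', by rw [map_add, map_add]; noncomm_ring⟩
  neg_mem' := by
    rintro _ ⟨a, b, rfl⟩
    exact ⟨-a, -b, by rw [map_neg, map_neg]; noncomm_ring⟩

lemma mem_cocycles0_of_trivial (hF : ∀ a, R.F a = ![a, 0, 0]) (a : H.A) : a ∈ cocycles0 H :=
  R.mem_cocycles0_of_F (by rw [hF]; rfl) (by rw [hF]; rfl) (by rw [hF]; rfl)

/-- The inclusion of `A` in the cohomology in case that the units agree. -/
def ofAll (hF : ∀ a, R.F a = ![a, 0, 0]) : H.A →+* Coh H :=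
  (ofA H).comp ((RingHom.id H.A).codRestrict (cocycles0 H) (R.mem_cocycles0_of_trivial hF))

lemma represents_ofAll (hF : ∀ a, R.F a = ![a, 0, 0]) (a : H.A) :
    Represents (coeff a) (R.ofAll hF a) :=
  ⟨mem_cocycles0.1 (R.mem_cocycles0_of_trivial hF a), rfl⟩

variable {φ : Q →+* Coh H} {ι : H.A →+* Q} {α' β' : Q}

lemma exhausts_of_trivial (hα2 : α' * α' = 0) (hα : ∀ a, ι a * α' = α' * ι a)
    (hβι : ∀ a, ι a * β' = β' * ι a) (hβα : α' * β' = β' * α')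
    (hS : Subring.closure (Set.range ι ∪ {α', β'}) = ⊤) : Exhausts β' (evenOdd ι α') := by
  intro P
  refine ring_induction hS (show ∃ a b, 1 = ι a + α' * ι b from ⟨1, 0, by simp⟩) ?_ ?_
  · rintro g (⟨a, rfl⟩ | rfl | rfl)
    · exact hβι a
    · exact hβα
    · rfl
  · rintro g (⟨c, rfl⟩ | rfl | rfl) m hm
    · obtain ⟨a, b, rfl⟩ := hm
      refine ⟨_, ⟨c * a, c * b, rfl⟩, 0, zero_mem _, ?_⟩
      rw [mul_zero, add_zero, map_mul, map_mul, mul_add, ← mul_assoc, hα, mul_assoc]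
    · obtain ⟨a, b, rfl⟩ := hm
      refine ⟨_, ⟨0, a, rfl⟩, 0, zero_mem _, ?_⟩
      rw [mul_zero, add_zero, map_zero, zero_add, mul_add, ← mul_assoc, hα2, zero_mul, add_zero]
    · exact ⟨0, zero_mem _, m, hm, by rw [zero_add]⟩

/-- If `ηL = ηR`, so that `F₁ = F₂ = 0`, the cohomology is `A ⊗ E(α) ⊗ P(β)`. -/
lemma bijective_of_trivial (hF : ∀ a, R.F a = ![a, 0, 0]) (hQ : Exhausts β' (evenOdd ι α'))
    (hφι : ∀ a, φ (ι a) = R.ofAll hF a) (hφα : φ α' = R.α) (hφβ : φ β' = R.β) :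
    Function.Bijective φ := by
  have hs : ∀ b, φ (α' * ι b) =
      R.sCls b (R.isOdd_cocycle ⟨b, R.mem_cocycles0_of_trivial hF b⟩) := by
    intro b
    rw [map_mul, hφι, hφα]
    exact (R.sCls_cocycle ⟨b, R.mem_cocycles0_of_trivial hF b⟩).symm
  constructor
  · refine R.injective_of_exhausts φ hφβ hQ ?_ ?_
    · rintro _ ⟨a, b, rfl⟩
      refine ⟨⟨a, R.mem_cocycles0_of_trivial hF a⟩, b,
        R.isOdd_cocycle ⟨b, R.mem_cocycles0_of_trivial hF b⟩, ?_, ?_⟩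
      · rw [map_add, hs, hφι]
        rfl
      · rintro ha ⟨c, hc⟩
        rw [hF] at hc
        rw [show a = 0 from congrArg Subtype.val ha, show b = 0 from hc, map_zero,
          mul_zero, add_zero]
    · intro c
      refine ⟨0, zero_mem _, ?_, mul_zero _⟩
      rw [map_zero, eq_comm]
      refine (congrArg (ofA H) (Subtype.ext ?_)).trans (map_zero _)
      exact congrFun (hF c) 2
  · refine R.surjective_of φ hφβ (fun a => ⟨ι a.1, hφι a.1⟩) fun b hb => ⟨α' * ι b, hs b⟩

/-- The homogeneous elements among the `ι a + α * ι b`. -/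
def evenOddT {A : Type} [CommRing A] (degA : ℤ → AddSubgroup A) (ι : A →+* Q) (α : Q)
    (p : ℕ × ℤ) : Set Q :=
  {q | ∃ m, ∃ a ∈ degA m, (p = (0, m) ∧ q = ι a) ∨ (p = (1, 4 + m) ∧ q = α * ι a)}

lemma evenOdd_le {A : Type} [CommRing A] {degA : ℤ → AddSubgroup A} (ι : A →+* Q) (α : Q)
    (hA : ∀ a, a ∈ AddSubgroup.closure {a | ∃ m, a ∈ degA m}) :
    evenOdd ι α ≤ AddSubgroup.closure (⋃ p, evenOddT degA ι α p) := by
  have h1 : ∀ a, ι a ∈ AddSubgroup.closure (⋃ p, evenOddT degA ι α p) := by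
    intro a
    induction hA a using AddSubgroup.closure_induction with
    | mem a ha =>
      obtain ⟨m, hm⟩ := ha
      exact AddSubgroup.subset_closure (Set.mem_iUnion.2 ⟨(0, m), m, a, hm, Or.inl ⟨rfl, rfl⟩⟩)
    | zero => rw [map_zero]; exact zero_mem _
    | add a b _ _ ha hb => rw [map_add]; exact add_mem ha hb
    | neg a _ ha => rw [map_neg]; exact neg_mem ha
  have h2 : ∀ a, α * ι a ∈ AddSubgroup.closure (⋃ p, evenOddT degA ι α p) := by
    intro a
    induction hA a using AddSubgroup.closure_induction with
    | mem a ha =>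
      obtain ⟨m, hm⟩ := ha
      exact AddSubgroup.subset_closure
        (Set.mem_iUnion.2 ⟨(1, 4 + m), m, a, hm, Or.inr ⟨rfl, rfl⟩⟩)
    | zero => rw [map_zero, mul_zero]; exact zero_mem _
    | add a b _ _ ha hb => rw [map_add, mul_add]; exact add_mem ha hb
    | neg a _ ha => rw [map_neg, mul_neg]; exact neg_mem ha
  rintro _ ⟨a, b, rfl⟩
  exact add_mem (h1 a) (h2 b)

lemma evenOddT_homog {g : Grading H} (hF : ∀ a, R.F a = ![a, 0, 0]) {φ : Q →+* Coh H}
    {ι : H.A →+* Q} {α' : Q} (hr : R.α ∈ bigr g 1 4)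
    (hφι : ∀ a, φ (ι a) = R.ofAll hF a) (hφα : φ α' = R.α) (p : ℕ × ℤ) :
    ∀ t ∈ evenOddT g.degA ι α' p, φ t ∈ bigr g p.1 p.2 := by
  have h1 : ∀ m, ∀ a ∈ g.degA m, φ (ι a) ∈ bigr g 0 m := fun m a ha => by
    rw [hφι]
    exact ⟨_, .coeff m a ha, R.represents_ofAll hF a⟩
  rintro t ⟨m, a, ha, ⟨rfl, rfl⟩ | ⟨rfl, rfl⟩⟩
  · exact h1 m a ha
  · rw [map_mul, hφα]
    exact bigr_mul hr (h1 m a ha)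

end

end CubicResolution

end EllCoh

namespace EllCoh

open Coh

lemma Coh.three_eq_zero {H : HopfAlgebroid} (h : (3 : H.A) = 0) : (3 : Coh H) = 0 := by
  have h1 : (3 : cocycles0 H) = 0 := Subtype.ext h
  rw [← map_ofNat (ofA H) 3, h1, map_zero]

namespace CubicBase

variable {A : Type} [CommRing A] (B : CubicBase A)

lemma homOf_r {A' : Type} [CommRing A'] (B' : CubicBase A') (f : A →+* A') (h2 : f B.a2 = B'.a2)
    (h4 : f B.a4 = B'.a4) : (B.homOf B' f h2 h4).f₁ B.r = B'.r :=
  B.ΓLift_r (B'.ηL.comp f) B'.r (by rw [RingHom.comp_apply, RingHom.comp_apply, h2, h4, B'.rel])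

variable [Nontrivial A]

lemma F_eq (half : A) (hh : 2 * half = 1) {a x y z : A}
    (h : B.ηL a = B.ηR x + B.r * B.ηR y + B.r ^ 2 * B.ηR z) :
    (B.resolution half hh).F a = ![x, y, z] :=
  (congrArg B.rcoord h).trans (B.rcoord_eq x y z)

lemma F_trivial (half : A) (hh : 2 * half = 1) (h : B.ηL = B.ηR) (a : A) :
    (B.resolution half hh).F a = ![a, 0, 0] :=
  B.F_eq half hh (by rw [h, map_zero, mul_zero, mul_zero, add_zero, add_zero])

variable {degA : ℤ → AddSubgroup A}

lemma α_mem_bigr (half : A) (hh : 2 * half = 1) (h1 : (1 : A) ∈ degA 0) :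
    (B.resolution half hh).α ∈ bigr (B.grading degA) 1 4 :=
  ⟨_, B.isHomog_br_r h1, represents_clsOf _ _⟩

lemma β_mem_bigr (half : A) (hh : 2 * half = 1) (h1 : (1 : A) ∈ degA 0) :
    (B.resolution half hh).β ∈ bigr (B.grading degA) 2 12 :=
  ⟨_, B.isHomog_βc h1, represents_clsOf _ _⟩

lemma massey_α (half : A) (hh : 2 * half = 1) (h1 : (1 : A) ∈ degA 0) (hhalf : half ∈ degA 0)
    (G : RingGrading (B.grading degA)) (h3 : (3 : Coh B.hopf) * (B.resolution half hh).β = 0)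
    (h : bigr (B.grading degA) 1 8 = ⊥) :
    massey (B.grading degA) 1 4 1 4 1 4 (B.resolution half hh).α (B.resolution half hh).α
      (B.resolution half hh).α = {(B.resolution half hh).β} :=
  (B.resolution half hh).massey_α G (B.isHomog_br_r h1)
    (.mul 0 1 0 8 _ _ (B.isHomog_cf hhalf) (B.isHomog_br_r_pow h1 2)) h3 h

end CubicBase

/-! ### The cohomology of `(A₂, Γ₂)` and `(A₁, Γ₁)` -/

/-- The values of a ring map on the generators `α, β`. -/
def gen2 {T : Type} (α β : T) : Gen2 → T
  | .α => α
  | .β => β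

lemma gen2_commute {T : Type} [Ring T] (f : ZMod 3 →+* T) {α β : T} (h : α * β = β * α) :
    ∀ x ∈ Set.range f ∪ Set.range (gen2 α β), ∀ y ∈ Set.range f ∪ Set.range (gen2 α β),
      x * y = y * x := by
  have hf : ∀ x y, f x * y = y * f x := fun x y => by
    rw [← ZMod.natCast_zmod_val x, map_natCast]
    exact Nat.cast_commute _ _
  rintro _ (⟨x, rfl⟩ | ⟨_ | _, rfl⟩) _ (⟨y, rfl⟩ | ⟨_ | _, rfl⟩)
  · exact hf _ _
  · exact hf _ _
  · exact hf _ _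
  · exact (hf _ _).symm
  · rfl
  · exact h
  · exact (hf _ _).symm
  · exact h.symm
  · rfl

/-- The map out of `𝔽₃[α, β]/(α²)` given by commuting elements. -/
def pres2Lift {T : Type} [Ring T] (f : ZMod 3 →+* T) (α β : T) (h : α * β = β * α)
    (h2 : α * α = 0) : Pres2 →+* T :=
  Ideal.Quotient.lift _ (mvLift f (gen2 α β) (gen2_commute f h)) (by
    intro p hp
    have hk : Ideal.span {(MvPolynomial.X Gen2.α : MvPolynomial Gen2 (ZMod 3)) ^ 2} ≤
        RingHom.ker (mvLift f (gen2 α β) (gen2_commute f h)) := by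
      rw [Ideal.span_singleton_le_iff_mem, RingHom.mem_ker, map_pow, mvLift_X, sq]
      exact h2
    exact hk hp)

section
variable {T : Type} [Ring T] (f : ZMod 3 →+* T) (α β : T) (h : α * β = β * α) (h2 : α * α = 0)

lemma pres2Lift_C (x : ZMod 3) :
    pres2Lift f α β h h2 (Ideal.Quotient.mk _ (MvPolynomial.C x)) = f x := mvLift_C _ _ _ _

lemma pres2Lift_α : pres2Lift f α β h h2 (Pres2.gen .α) = α := mvLift_X _ _ _ _

lemma pres2Lift_β : pres2Lift f α β h h2 (Pres2.gen .β) = β := mvLift_X _ _ _ _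

end

/-- The inclusion of `𝔽₃` in `𝔽₃[α, β]/(α²)`. -/
def ι2 : ZMod 3 →+* Pres2 := (Ideal.Quotient.mk _).comp MvPolynomial.C

lemma Pres2.closure : Subring.closure (Set.range ι2 ∪ {Pres2.gen .α, Pres2.gen .β}) = ⊤ := by
  have h := closure_image_eq_top (f := (Ideal.Quotient.mk _ : MvPolynomial Gen2 (ZMod 3) →+* Pres2))
    Ideal.Quotient.mk_surjective (MvPolynomial_closure (ZMod 3) Gen2)
  rw [eq_top_iff, ← h]
  refine Subring.closure_mono ?_
  rintro _ ⟨_, ⟨x, rfl⟩ | ⟨_ | _, rfl⟩, rfl⟩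
  · exact Or.inl ⟨x, rfl⟩
  · exact Or.inr (Or.inl rfl)
  · exact Or.inr (Or.inr rfl)

lemma Pres2.α_sq : Pres2.gen .α * Pres2.gen .α = 0 := by
  rw [← sq]
  exact Ideal.Quotient.eq_zero_iff_mem.2 (Ideal.subset_span rfl)

lemma Pres2.hom_ext {T : Type} [Ring T] {f g : Pres2 →+* T}
    (hα : f (Pres2.gen .α) = g (Pres2.gen .α)) (hβ : f (Pres2.gen .β) = g (Pres2.gen .β)) :
    f = g := by
  have h : ∀ x, f x = g x := by
    intro x
    have hx : x ∈ Subring.closure _ := Pres2.closure ▸ Subring.mem_top x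
    induction hx using Subring.closure_induction with
    | mem x hx =>
      obtain ⟨c, rfl⟩ | rfl | rfl := hx
      · exact RingHom.congr_fun (Subsingleton.elim (f.comp ι2) (g.comp ι2)) c
      · exact hα
      · exact hβ
    | zero => rw [map_zero, map_zero]
    | one => rw [map_one, map_one]
    | add a b _ _ ha hb => rw [map_add, map_add, ha, hb]
    | neg a _ ha => rw [map_neg, map_neg, ha]
    | mul a b _ _ ha hb => rw [map_mul, map_mul, ha, hb]
  exact RingHom.ext h

/-- The cubic resolution of `(A₂, Γ₂)`. -/
def R2 : CubicResolution base2.hopf := base2.resolution 2 rfl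

lemma R2_F (a : ZMod 3) : R2.F a = ![a, 0, 0] := base2.F_trivial 2 rfl rfl a

/-- The inclusion of `A₂` in the cohomology of `(A₂, Γ₂)`. -/
def o2 : ZMod 3 →+* Coh base2.hopf := R2.ofAll R2_F

/-- The isomorphism of `E(α) ⊗ P(β)` with the cohomology of `(A₂, Γ₂)`, as a ring map. -/
def φ2 : Pres2 →+* Coh base2.hopf :=
  pres2Lift (o2) R2.α R2.β R2.commute_β_α.symm R2.α_mul_α

lemma exhausts2 : Exhausts (Pres2.gen .β)
    (CubicResolution.evenOdd ι2 (Pres2.gen .α)) :=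
  CubicResolution.exhausts_of_trivial (H := base2.hopf) Pres2.α_sq (fun _ => mul_comm _ _)
    (fun _ => mul_comm _ _) (mul_comm _ _) Pres2.closure

lemma φ2_bijective : Function.Bijective φ2 :=
  R2.bijective_of_trivial R2_F exhausts2 (fun _ => pres2Lift_C _ _ _ _ _ _)
    (pres2Lift_α _ _ _ _ _) (pres2Lift_β _ _ _ _ _)

lemma one_mem_deg2 : (1 : ZMod 3) ∈ (if (0 : ℤ) = 0 then ⊤ else ⊥ : AddSubgroup (ZMod 3)) := by
  simp

lemma φ2_α : φ2 (Pres2.gen .α) = R2.α := pres2Lift_α _ _ _ _ _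

lemma φ2_β : φ2 (Pres2.gen .β) = R2.β := pres2Lift_β _ _ _ _ _

lemma R2_α_mem : R2.α ∈ bigr deg2 1 4 := base2.α_mem_bigr _ _ one_mem_deg2

lemma φ2_β_mem : φ2 (Pres2.gen .β) ∈ bigr deg2 2 12 := by
  rw [φ2_β]
  exact base2.β_mem_bigr _ _ one_mem_deg2

lemma isInternal2 : DirectSum.IsInternal (fun p : ℕ × ℤ => bigr deg2 p.1 p.2) :=
  exhausts2.isInternal grad2 φ2_bijective.2 φ2_β_mem
    (R2.evenOddT_homog R2_F R2_α_mem (fun _ => pres2Lift_C _ _ _ _ _ _) φ2_α)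
    (CubicResolution.evenOdd_le _ _ grad2.A_span)

lemma bigr2_1_8 : bigr deg2 1 8 = ⊥ := by
  rw [exhausts2.bigr_eq grad2 φ2_bijective.2 φ2_β_mem
    (R2.evenOddT_homog R2_F R2_α_mem (fun _ => pres2Lift_C _ _ _ _ _ _) φ2_α)
    (CubicResolution.evenOdd_le _ _ grad2.A_span), AddSubgroup.closure_eq_bot_iff]
  rintro _ ⟨i, q, t, ⟨m, a, ha, ⟨rfl, rfl⟩ | ⟨rfl, rfl⟩⟩, h1, h2, rfl⟩
  · dsimp only at h1
    omega
  · dsimp only at h1 h2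
    have ha' : a ∈ (if m = 0 then ⊤ else ⊥ : AddSubgroup (ZMod 3)) := ha
    rw [if_neg (by omega)] at ha'
    have e : (Pres2.gen .α : Pres2) * ι2 a = 0 := by
      rw [show ι2 a = 0 from (congrArg ι2 ha').trans (map_zero ι2), mul_zero]
    rw [Set.mem_singleton_iff]
    refine (congrArg (fun t => φ2 (Pres2.gen .β ^ i * t)) e).trans ?_
    rw [mul_zero, map_zero]

lemma massey2 : massey deg2 1 4 1 4 1 4 R2.α R2.α R2.α = {R2.β} :=
  base2.massey_α 2 rfl one_mem_deg2 (AddSubgroup.mem_top _) grad2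
    (by rw [Coh.three_eq_zero (H := base2.hopf) (rfl : (3 : ZMod 3) = 0), zero_mul]) bigr2_1_8

lemma two_mul_two {A : Type} [CommRing A] [CharP A 3] : (2 : A) * 2 = 1 := by
  have h : ((3 : ℕ) : A) = 0 := CharP.cast_eq_zero A 3
  push_cast at h
  linear_combination h

/-- The cubic resolution of `(A₁, Γ₁)`. -/
def R1 : CubicResolution base1.hopf := base1.resolution 2 two_mul_two

lemma R1_F (a : Polynomial (ZMod 3)) : R1.F a = ![a, 0, 0] := base1.F_trivial 2 _ rfl a

/-- The inclusion of `A₁` in the cohomology of `(A₁, Γ₁)`. -/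
def o1 : Polynomial (ZMod 3) →+* Coh base1.hopf := R1.ofAll R1_F

lemma map_red2_α : Coh.map red2 R1.α = R2.α :=
  R1.map_α red2 R2 (CubicBase.homOf_r _ _ _ _ _)

lemma map_red2_β : Coh.map red2 R1.β = R2.β :=
  R1.map_β red2 R2 (CubicBase.homOf_r _ _ _ _ _)

/-- The map of `E(α) ⊗ P(β)` to the cohomology of `(A₁, Γ₁)`. -/
def ψ1 : Pres2 →+* Coh base1.hopf :=
  pres2Lift ((o1).comp Polynomial.C) R1.α R1.β R1.commute_β_α.symm R1.α_mul_α

/-- The inverse of `φ2`. -/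
def e2 : Pres2 ≃+* Coh base2.hopf := RingEquiv.ofBijective φ2 φ2_bijective

lemma e2_α : e2 (Pres2.gen .α) = R2.α := φ2_α

lemma e2_β : e2 (Pres2.gen .β) = R2.β := φ2_β

/-- The isomorphism of `H^{**}(A₂, Γ₂) ⊗ P(a₄)` with the cohomology of `(A₁, Γ₁)`, as a ring
map. -/
def φ1 : Polynomial (Coh base2.hopf) →+* Coh base1.hopf :=
  Polynomial.eval₂RingHom' (ψ1.comp e2.symm.toRingHom) (o1 Polynomial.X)
    fun _ => (Coh.commute_ofA _ _).symm

lemma φ1_C (h : Coh base2.hopf) : φ1 (Polynomial.C h) = ψ1 (e2.symm h) :=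
  Polynomial.eval₂_C _ _

lemma φ1_X : φ1 Polynomial.X = o1 Polynomial.X := Polynomial.eval₂_X _ _

lemma φ1_α : φ1 (Polynomial.C R2.α) = R1.α := by
  rw [φ1_C, ← e2_α, RingEquiv.symm_apply_apply]
  exact pres2Lift_α _ _ _ _ _

lemma φ1_β : φ1 (Polynomial.C R2.β) = R1.β := by
  rw [φ1_C, ← e2_β, RingEquiv.symm_apply_apply]
  exact pres2Lift_β _ _ _ _ _

lemma map_red2_φ1 (h : Coh base2.hopf) : Coh.map red2 (φ1 (Polynomial.C h)) = h := by
  have key : (Coh.map red2).comp ψ1 = φ2 := by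
    apply Pres2.hom_ext
    · refine (congrArg (Coh.map red2) (pres2Lift_α _ _ _ _ _)).trans ?_
      rw [map_red2_α, φ2_α]
    · refine (congrArg (Coh.map red2) (pres2Lift_β _ _ _ _ _)).trans ?_
      rw [map_red2_β, φ2_β]
  rw [φ1_C]
  refine (RingHom.congr_fun key (e2.symm h)).trans ?_
  exact e2.apply_symm_apply h

/-- The inclusion of `𝔽₃[a₄]` in `H^{**}(A₂, Γ₂) ⊗ P(a₄)`. -/
def ι1 : Polynomial (ZMod 3) →+* Polynomial (Coh base2.hopf) :=
  Polynomial.mapRingHom (o2)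

lemma φ1_ι (a : Polynomial (ZMod 3)) : φ1 (ι1 a) = o1 a := by
  have h : φ1.comp ι1 = o1 := by
    apply Polynomial.ringHom_ext'
    · exact Subsingleton.elim _ _
    · rw [RingHom.comp_apply, ι1, Polynomial.coe_mapRingHom, Polynomial.map_X, φ1_X]
  exact RingHom.congr_fun h a

lemma commute_coh2 (x y : Coh base2.hopf) : x * y = y * x := by
  obtain ⟨x, rfl⟩ := φ2_bijective.2 x
  obtain ⟨y, rfl⟩ := φ2_bijective.2 y
  rw [← map_mul, mul_comm, map_mul]

lemma closure1 : Subring.closure (Set.range ι1 ∪ {Polynomial.C R2.α, Polynomial.C R2.β}) = ⊤ := by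
  have hC : ∀ h : Coh base2.hopf, Polynomial.C h ∈
      Subring.closure (Set.range ι1 ∪ {Polynomial.C R2.α, Polynomial.C R2.β}) := by
    have h : Subring.closure (φ2 '' (Set.range ι2 ∪ {Pres2.gen .α, Pres2.gen .β})) = ⊤ :=
      closure_image_eq_top φ2_bijective.2 Pres2.closure
    intro x
    have h2 : Polynomial.C x ∈ Subring.map (Polynomial.C : Coh base2.hopf →+* _)
        (Subring.closure (φ2 '' (Set.range ι2 ∪ {Pres2.gen .α, Pres2.gen .β}))) :=
      Subring.mem_map.2 ⟨x, h ▸ Subring.mem_top x, rfl⟩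
    rw [RingHom.map_closure] at h2
    refine Subring.closure_mono ?_ h2
    rintro _ ⟨_, ⟨_, ⟨c, rfl⟩ | rfl | rfl, rfl⟩, rfl⟩
    · refine Or.inl ⟨Polynomial.C c, ?_⟩
      rw [ι1, Polynomial.coe_mapRingHom, Polynomial.map_C]
      exact congrArg Polynomial.C (pres2Lift_C _ _ _ _ _ c).symm
    · rw [φ2_α]
      exact Or.inr (Or.inl rfl)
    · rw [φ2_β]
      exact Or.inr (Or.inr rfl)
  rw [eq_top_iff]
  intro p _
  induction p using Polynomial.induction_on' with
  | add p q hp hq => exact add_mem (hp trivial) (hq trivial)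
  | monomial n a =>
    rw [← Polynomial.C_mul_X_pow_eq_monomial]
    have hX : ι1 Polynomial.X = Polynomial.X := by
      rw [ι1, Polynomial.coe_mapRingHom, Polynomial.map_X]
    have hX' : Polynomial.X ∈
        Subring.closure (Set.range ι1 ∪ {Polynomial.C R2.α, Polynomial.C R2.β}) :=
      Subring.subset_closure (Or.inl ⟨Polynomial.X, hX⟩)
    exact mul_mem (hC a) (pow_mem hX' n)

lemma exhausts1 : Exhausts (Polynomial.C R2.β)
    (CubicResolution.evenOdd ι1 (Polynomial.C R2.α)) := by
  have hc : ∀ p q : Polynomial (Coh base2.hopf), p * q = q * p := by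
    let : CommRing (Coh base2.hopf) := { (inferInstance : Ring (Coh base2.hopf)) with
      mul_comm := commute_coh2 }
    exact fun p q => mul_comm (G := Polynomial (Coh base2.hopf)) p q
  have h0 : (Polynomial.C R2.α : Polynomial (Coh base2.hopf)) * Polynomial.C R2.α = 0 :=
    (map_mul (Polynomial.C : Coh base2.hopf →+* _) _ _).symm.trans
    ((congrArg (Polynomial.C : Coh base2.hopf →+* _) R2.α_mul_α).trans (map_zero _))
  exact CubicResolution.exhausts_of_trivial (H := base1.hopf) h0 (fun _ => hc _ _)
    (fun _ => hc _ _) (hc _ _) closure1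

lemma φ1_bijective : Function.Bijective φ1 :=
  R1.bijective_of_trivial R1_F exhausts1 φ1_ι φ1_α φ1_β

lemma one_mem_deg1 : (1 : Polynomial (ZMod 3)) ∈ deg1.degA 0 :=
  AddSubgroup.subset_closure ⟨1, 0, by simp, by simp⟩

lemma R1_α_mem : R1.α ∈ bigr deg1 1 4 := base1.α_mem_bigr _ _ one_mem_deg1

lemma R1_β_mem : R1.β ∈ bigr deg1 2 12 := base1.β_mem_bigr _ _ one_mem_deg1

lemma isInternal1 : DirectSum.IsInternal (fun p : ℕ × ℤ => bigr deg1 p.1 p.2) :=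
  exhausts1.isInternal grad1 φ1_bijective.2 (φ1_β ▸ R1_β_mem)
    (R1.evenOddT_homog R1_F R1_α_mem φ1_ι φ1_α)
    (CubicResolution.evenOdd_le _ _ grad1.A_span)

/-- The isomorphism of `H^{**}(A₂, Γ₂) ⊗ P(a₄)` with the cohomology of `(A₁, Γ₁)`. -/
def e1 : Polynomial (Coh base2.hopf) ≃+* Coh base1.hopf := RingEquiv.ofBijective φ1 φ1_bijective

lemma φ1_X_mem : φ1 Polynomial.X ∈ bigr deg1 0 8 := by
  rw [φ1_X]
  exact ⟨_, .coeff _ _ (AddSubgroup.subset_closure ⟨1, 1, by simp, by simp⟩),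
    R1.represents_ofAll R1_F _⟩

end EllCoh

namespace EllCoh

open Coh

/-! ### The cobar complex of a cubic Hopf algebroid in low degrees -/

namespace CubicBase

variable {A : Type} [CommRing A] (B : CubicBase A)

lemma cf_mul_br (a : A) (γ : B.Γ) : B.cf a * B.br γ = B.br (B.ηL a * γ) :=
  Cobar.coeff_mul_bar (H := B.hopf) a γ

lemma br_mul_cf (γ : B.Γ) (a : A) : B.br γ * B.cf a = B.br (γ * B.ηR a) :=
  Cobar.bar_mul_coeff (H := B.hopf) γ a

lemma d_cf (a : A) : Cobar.d (B.cf a) = B.br (B.ηR a) - B.br (B.ηL a) :=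
  Cobar.d_coeff (H := B.hopf) a

lemma d_cf_mul (a : A) (t : Cobar B.hopf) :
    Cobar.d (B.cf a * t) = Cobar.d (B.cf a) * t + B.cf a * Cobar.d t :=
  Cobar.d_coeff_mul (H := B.hopf) a t

lemma d_cf_a2 : Cobar.d (B.cf B.a2) = 3 * B.br B.r := by
  rw [d_cf, ηR_a2', ← map_sub, add_sub_cancel_left, ← map_ofNat B.cf 3, cf_mul_br, map_ofNat]

lemma d_cf_a4 : Cobar.d (B.cf B.a4) =
    2 * B.cf B.a2 * B.br B.r + 3 * B.br (B.r ^ 2) := by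
  rw [d_cf, ηR_a4', ← map_sub, ← map_ofNat B.cf 3, ← map_ofNat B.cf 2, ← map_mul, cf_mul_br,
    cf_mul_br, ← map_add, map_mul, map_ofNat, map_ofNat]
  congr 1
  ring

lemma d_br_r : Cobar.d (B.br B.r) = 0 := by
  have h : B.ψ B.r = B.units.tmul B.r 1 + B.units.tmul 1 B.r := by
    rw [ψ_r]
    have h1 := B.units.inl_mul_inr B.r 1
    have h2 := B.units.inl_mul_inr 1 B.r
    rw [map_one, mul_one] at h1
    rw [map_one, one_mul] at h2
    rw [← h1, ← h2]
    rfl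
  refine (Cobar.d_bar (H := B.hopf) B.r).trans ?_
  refine (congrArg (fun t => Cobar.bar (H := B.hopf) 1 * Cobar.bar (H := B.hopf) B.r -
    Cobar.bar2 (H := B.hopf) t +
      Cobar.bar (H := B.hopf) B.r * Cobar.bar (H := B.hopf) 1) h).trans ?_
  refine (congrArg (fun t => Cobar.bar (H := B.hopf) 1 * Cobar.bar (H := B.hopf) B.r - t +
    Cobar.bar (H := B.hopf) B.r * Cobar.bar (H := B.hopf) 1)
    (map_add (Cobar.bar2 (H := B.hopf)) (B.units.tmul B.r 1) (B.units.tmul 1 B.r))).trans ?_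
  change Cobar.bar (H := B.hopf) 1 * Cobar.bar (H := B.hopf) B.r -
    (Cobar.bar (H := B.hopf) B.r * Cobar.bar (H := B.hopf) 1 +
      Cobar.bar (H := B.hopf) 1 * Cobar.bar (H := B.hopf) B.r) +
    Cobar.bar (H := B.hopf) B.r * Cobar.bar (H := B.hopf) 1 = 0
  abel

lemma br_r3 : B.br (B.r ^ 3) = -(B.cf B.a2 * B.br (B.r ^ 2)) - B.cf B.a4 * B.br B.r := by
  rw [cf_mul_br, cf_mul_br, ← map_neg, ← map_sub]
  congr 1
  linear_combination B.rel

lemma ηL_a2' : B.ηL B.a2 = B.ηR B.a2 - 3 * B.r := by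
  rw [ηR_a2']
  ring

lemma ηL_a4' : B.ηL B.a4 = B.ηR B.a4 - 2 * B.ηR B.a2 * B.r + 3 * B.r ^ 2 := by
  rw [ηR_a4', ηR_a2']
  ring

lemma relR : B.r ^ 3 = B.ηR B.a2 * B.r ^ 2 - B.ηR B.a4 * B.r := by
  rw [ηR_a4', ηR_a2']
  linear_combination B.rel

lemma d_br_r2 [Nontrivial A] (half : A) (hh : 2 * half = 1) :
    Cobar.d (B.br (B.r ^ 2)) = -(2 * (B.br B.r * B.br B.r)) := (B.resolution half hh).d_r2

lemma br_r_mul_cf_a4 : B.br B.r * B.cf B.a4 = B.cf B.a4 * B.br B.r +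
    2 * B.cf B.a2 * B.br (B.r ^ 2) + 3 * B.br (B.r ^ 3) := by
  rw [br_mul_cf, ηR_a4', ← map_ofNat B.cf 3, ← map_ofNat B.cf 2, ← map_mul B.cf, cf_mul_br,
    cf_mul_br,
    cf_mul_br, ← map_add, ← map_add, map_mul B.ηL, map_ofNat, map_ofNat]
  congr 1
  ring

lemma br_r2_mul_cf_a4 : B.br (B.r ^ 2) * B.cf B.a4 = B.cf B.a4 * B.br (B.r ^ 2) +
    2 * B.cf B.a2 * B.br (B.r ^ 3) + 3 * B.br (B.r ^ 4) := by
  rw [br_mul_cf, ηR_a4', ← map_ofNat B.cf 3, ← map_ofNat B.cf 2, ← map_mul B.cf, cf_mul_br,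
    cf_mul_br,
    cf_mul_br, ← map_add, ← map_add, map_mul B.ηL, map_ofNat, map_ofNat]
  congr 1
  ring

end CubicBase

/-! ### The Bockstein differentials modulo `3` -/

instance : CharP base0.hopf.A 3 := inferInstanceAs (CharP (MvPolynomial CVar (ZMod 3)) 3)

lemma three0 : (3 : Cobar base0.hopf) = 0 := by
  have h : ((3 : ℕ) : base0.hopf.A) = 0 := CharP.cast_eq_zero _ 3
  have h2 := congrArg (Cobar.coeff (H := base0.hopf)) h
  rw [map_natCast, map_zero] at h2
  exact_mod_cast h2

/-- The cubic resolution of `(A₀, Γ₀)`. -/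
def R0 : CubicResolution base0.hopf := base0.resolution 2 two_mul_two

namespace Base0

/-- The cochain `a₂`. -/
def b : Cobar base0.hopf := base0.cf base0.a2
/-- The cochain `a₄`. -/
def a : Cobar base0.hopf := base0.cf base0.a4
/-- The cochain `[r]`. -/
def x : Cobar base0.hopf := base0.br base0.r
/-- The cochain `[r²]`. -/
def y : Cobar base0.hopf := base0.br (base0.r ^ 2)

lemma three_Γ : (3 : base0.Γ) = 0 :=
  EllCoh.three_eq_zero _ _ (CharP.cast_eq_zero (MvPolynomial CVar (ZMod 3)) 3)

lemma db : Cobar.d b = 0 := by rw [b, base0.d_cf_a2, three0, zero_mul]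

lemma ηR_a2 : base0.ηR base0.a2 = base0.ηL base0.a2 := by
  rw [base0.ηR_a2', three_Γ, zero_mul, add_zero]

lemma ηR_a4 : base0.ηR base0.a4 = base0.ηL base0.a4 + 2 * base0.ηL base0.a2 * base0.r := by
  rw [base0.ηR_a4', three_Γ, zero_mul, add_zero]

lemma b_comm (t : Cobar base0.hopf) : t * b = b * t :=
  (Cobar.coeff_commute (H := base0.hopf) (a := base0.a2) ηR_a2 t).symm

lemma da : Cobar.d a = 2 * (b * x) := by
  rw [a, base0.d_cf_a4, three0, zero_mul, add_zero, mul_assoc]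
  rfl

lemma xa : x * a = a * x + 2 * (b * y) := by
  rw [x, a, base0.br_r_mul_cf_a4, three0, zero_mul, add_zero, mul_assoc 2]
  rfl

lemma br_r3 : base0.br (base0.r ^ 3) = -(b * y) - a * x := base0.br_r3

lemma ya : y * a = a * y - 2 * (b * (b * y + a * x)) := by
  rw [y, a, base0.br_r2_mul_cf_a4, three0, zero_mul, add_zero, br_r3, mul_assoc 2,
    show base0.cf base0.a4 * base0.br (base0.r ^ 2) = a * y from rfl,
    show base0.cf base0.a4 = a from rfl, show base0.cf base0.a2 = b from rfl,
    show base0.br (base0.r ^ 2) = y from rfl]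
  noncomm_ring

lemma d_b_mul (t : Cobar base0.hopf) : Cobar.d (b * t) = b * Cobar.d t := by
  have := base0.d_cf_mul base0.a2 t
  rw [show base0.cf base0.a2 = b from rfl, db, zero_mul, zero_add] at this
  exact this

lemma d_a_mul (t : Cobar base0.hopf) : Cobar.d (a * t) = 2 * (b * x) * t + a * Cobar.d t := by
  rw [← da]
  exact base0.d_cf_mul base0.a4 t

lemma dx : Cobar.d x = 0 := base0.d_br_r

lemma dy : Cobar.d y = -(2 * (x * x)) := base0.d_br_r2 2 two_mul_two

/-- Two cochains that differ by a multiple of `3` agree. -/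
lemma eq_of_sub_eq_three_mul {s t u : Cobar base0.hopf} (h : s - t = 3 * u) : s = t := by
  rw [← sub_eq_zero, h, three0, zero_mul]

lemma ξc_eq : base0.ξc = a * x + b * y := rfl

lemma βc_eq : base0.βc = y * x + x * y := rfl

lemma da2 : Cobar.d (a * a) = b * base0.ξc := by
  refine eq_of_sub_eq_three_mul (u := b * (a * x) + b * (b * y)) ?_
  have h1 : a * (2 * (b * x)) = 2 * (b * (a * x)) := by
    rw [← mul_assoc b, ← b_comm a]
    noncomm_ring
  rw [d_a_mul, da, ξc_eq, mul_assoc 2, mul_assoc b, xa, h1]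
  noncomm_ring

lemma d_mul_b_pow (t : Cobar base0.hopf) (n : ℕ) : Cobar.d (t * b ^ n) = b ^ n * Cobar.d t := by
  induction n with
  | zero => rw [pow_zero, one_mul, mul_one]
  | succ n ih => rw [pow_succ, ← mul_assoc, b_comm, d_b_mul, ih, ← mul_assoc, ← pow_succ', pow_succ]

lemma cf_sq_mul_pow (n : ℕ) : base0.cf (base0.a4 ^ 2 * base0.a2 ^ n) = a * a * b ^ n := by
  rw [map_mul, map_pow, map_pow, sq]
  rfl

lemma cf_mul_pow (n : ℕ) : base0.cf (base0.a4 * base0.a2 ^ n) = a * b ^ n := by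
  rw [map_mul, map_pow]
  rfl

lemma cf_pow (n : ℕ) : base0.cf (base0.a2 ^ n) = b ^ n := map_pow _ _ _

lemma d_a4_mul_a2_pow (n : ℕ) : Cobar.d (base0.cf (base0.a4 * base0.a2 ^ n)) =
    2 * base0.cf (base0.a2 ^ (n + 1)) * base0.br base0.r := by
  rw [cf_mul_pow, cf_pow, d_mul_b_pow, da, pow_succ, show base0.br base0.r = x from rfl]
  noncomm_ring

lemma d_a4_sq_mul_a2_pow (n : ℕ) : Cobar.d (base0.cf (base0.a4 ^ 2 * base0.a2 ^ n)) =
    base0.cf (base0.a2 ^ (n + 1)) * base0.ξc := by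
  rw [cf_sq_mul_pow, cf_pow, d_mul_b_pow, da2, pow_succ, mul_assoc]

lemma d_ξc : Cobar.d base0.ξc = 0 := by
  rw [ξc_eq, map_add, d_a_mul, d_b_mul, dx, dy]
  noncomm_ring

lemma d_a4_sq_r_sub : Cobar.d (base0.cf (base0.a4 ^ 2) * base0.br base0.r -
    base0.cf (base0.a4 * base0.a2) * base0.br (base0.r ^ 2)) =
      base0.cf (base0.a2 ^ 2) * base0.βc := by
  have e1 : base0.cf (base0.a4 ^ 2) = a * a := by
    rw [map_pow, sq]
    rfl
  have e2 : base0.cf (base0.a4 * base0.a2) = b * a := by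
    rw [map_mul]
    exact b_comm a
  refine eq_of_sub_eq_three_mul (u := b * (a * (x * x)) - b * (b * (x * y))) ?_
  rw [e1, e2, cf_pow, show base0.br base0.r = x from rfl, show base0.br (base0.r ^ 2) = y from rfl,
    map_sub, Cobar.d_mul, da2, dx, mul_zero, add_zero, mul_assoc,
    mul_assoc b a, d_b_mul, d_a_mul, dy, ξc_eq, βc_eq]
  noncomm_ring

/-- The invariant `Δ` modulo `3`. -/
def Δ : MvPolynomial CVar (ZMod 3) := base0.a2 ^ 2 * base0.a4 ^ 2 - base0.a4 ^ 3

lemma ηR_Δ : base0.ηR Δ = base0.ηL Δ := by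
  rw [Δ]
  simp only [map_sub, map_mul, map_pow, ηR_a2, ηR_a4]
  have h := base0.rel
  have h3 := three_Γ
  generalize base0.ηL base0.a2 = p, base0.ηL base0.a4 = q at h ⊢
  linear_combination -8 * p ^ 3 * h + (-2 * p * q ^ 2 * base0.r - 4 * p ^ 2 * q * base0.r ^ 2 +
    4 * p ^ 3 * q * base0.r + 4 * p ^ 4 * base0.r ^ 2) * h3

lemma d_Δ : Cobar.d (base0.cf (base0.a4 ^ 3 - base0.a2 ^ 2 * base0.a4 ^ 2)) = 0 := by
  have h : base0.a4 ^ 3 - base0.a2 ^ 2 * base0.a4 ^ 2 = -Δ := by rw [Δ, neg_sub]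
  rw [h, map_neg, map_neg, base0.d_cf, ηR_Δ, sub_self, neg_zero]

lemma d_a_mul_y : Cobar.d (a * y) = base0.ξc * x - b * base0.βc := by
  refine eq_of_sub_eq_three_mul (u := b * (x * y) - a * (x * x)) ?_
  rw [d_a_mul, dy, ξc_eq, βc_eq]
  noncomm_ring

lemma x_mul_ξc : x * base0.ξc = -(base0.ξc * x) - Cobar.d (a * y) := by
  refine eq_of_sub_eq_three_mul (u := a * (x * x) + b * (y * x)) ?_
  have h : x * (b * y) = b * (x * y) := by rw [← mul_assoc, b_comm, mul_assoc]
  rw [d_a_mul_y, ξc_eq, βc_eq, mul_add, ← mul_assoc, xa, h]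
  noncomm_ring

/-- The relation `ξ² = 0` holds because the square of the cocycle is an explicit coboundary. -/
lemma ξc_mul_ξc : base0.ξc * base0.ξc = Cobar.d (a * a * y + b * (a * a) * x) := by
  have e1 : ∀ t, x * (a * t) = a * (x * t) + 2 * (b * (y * t)) := fun t => by
    rw [← mul_assoc, xa]
    noncomm_ring
  have e2 : ∀ t, y * (a * t) = a * (y * t) - 2 * (b * (b * (y * t) + a * (x * t))) := fun t => by
    rw [← mul_assoc, ya]
    noncomm_ring
  have e3 : ∀ s t, s * (b * t) = b * (s * t) := fun s t => by rw [← mul_assoc, b_comm, mul_assoc]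
  refine eq_of_sub_eq_three_mul (u := a * (a * (x * x)) + b * (a * (y * x)) - b * (a * (x * y)) -
    b * (b * (b * (y * x))) - b * (b * (a * (x * x))) - b * (b * (y * y))) ?_
  have h1 : Cobar.d (b * (a * a) * x) = b * (b * (a * (x * x))) + b * (b * (b * (y * x))) := by
    rw [Cobar.d_mul, d_b_mul, da2, dx, mul_zero, add_zero, ξc_eq]
    noncomm_ring
  have h2 : Cobar.d (a * a * y) = 4 * (b * (a * (x * y))) + 4 * (b * (b * (y * y))) -
      2 * (a * (a * (x * x))) := by
    rw [mul_assoc, d_a_mul, d_a_mul, dy, mul_assoc 2, mul_assoc b, e1, mul_assoc 2 (b * x),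
      mul_assoc b x y]
    have : a * (2 * (b * (x * y))) = 2 * (b * (a * (x * y))) := by
      rw [← e3 a]
      noncomm_ring
    rw [mul_add a, this]
    noncomm_ring
  have h3 : base0.ξc * base0.ξc = a * (a * (x * x)) + 2 * (b * (a * (y * x))) + b * (a * (x * y)) +
      b * (a * (y * x)) - 2 * (b * (b * (b * (y * x)))) - 2 * (b * (b * (a * (x * x)))) +
      b * (b * (y * y)) := by
    have : a * (2 * (b * (y * x))) = 2 * (b * (a * (y * x))) := by
      rw [← e3 a]
      noncomm_ring
    rw [ξc_eq, add_mul, mul_add, mul_add, mul_assoc a x, e1, mul_assoc a x, e3 x, mul_assoc b y,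
      e2, mul_assoc b y, e3 y, e3 a, mul_add a, this]
    noncomm_ring
  rw [map_add, h1, h2, h3]
  noncomm_ring

end Base0

end EllCoh

namespace EllCoh

open Coh

/-! ### The ring `𝔽₃[a₂, a₄]` over `𝔽₃[a₂, Δ]` -/

lemma CubicResolution.sCls_eq_add {H : HopfAlgebroid} (R : CubicResolution H) {c e : H.A}
    (hc : R.IsOdd c) (he : R.IsOdd e) {p q : cocycles0 H} (h : c = p.1 + e * q.1) :
    R.sCls c hc = R.α * ofA H p + R.sCls e he * ofA H q := by
  rw [← R.sCls_cocycle, ← R.sCls_mul, ← R.sCls_add]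
  exact R.sCls_congr h _

namespace Base0

/-- The ring `𝔽₃[Δ][a₂]`. -/
abbrev Inv : Type := Polynomial (Polynomial (ZMod 3))

/-- The inclusion of `𝔽₃[Δ]` in `𝔽₃[a₂, a₄]`. -/
def χΔ : Polynomial (ZMod 3) →+* MvPolynomial CVar (ZMod 3) :=
  Polynomial.eval₂RingHom MvPolynomial.C Δ

/-- The inclusion of `𝔽₃[Δ][a₂]` in `𝔽₃[a₂, a₄]`. -/
def χ : Inv →+* MvPolynomial CVar (ZMod 3) := Polynomial.eval₂RingHom χΔ base0.a2

lemma χ_X : χ Polynomial.X = base0.a2 := Polynomial.eval₂_X _ _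

lemma χ_C (p : Polynomial (ZMod 3)) : χ (Polynomial.C p) = χΔ p := Polynomial.eval₂_C _ _

lemma χΔ_X : χΔ Polynomial.X = Δ := Polynomial.eval₂_X _ _

lemma χΔ_C (c : ZMod 3) : χΔ (Polynomial.C c) = MvPolynomial.C c := Polynomial.eval₂_C _ _

/-- The monic polynomial `T³ - a₂² T² + Δ` with root `a₄`. -/
def cub : Polynomial Inv :=
  Polynomial.X ^ 3 - Polynomial.C (Polynomial.X ^ 2) * Polynomial.X ^ 2 +
    Polynomial.C (Polynomial.C Polynomial.X)

lemma cub_monic : cub.Monic := by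
  unfold cub
  monicity!

lemma cub_natDegree : cub.natDegree = 3 := by
  unfold cub
  compute_degree!

/-- The isomorphism of `𝔽₃[a₂, a₄]` with the extension of `𝔽₃[Δ][a₂]` by a root of `cub`. -/
def toRoot : MvPolynomial CVar (ZMod 3) →+* AdjoinRoot cub :=
  MvPolynomial.eval₂Hom ((AdjoinRoot.of cub).comp (Polynomial.C.comp Polynomial.C))
    fun v => match v with
      | .a2 => AdjoinRoot.of cub Polynomial.X
      | .a4 => AdjoinRoot.root cub

lemma toRoot_a2 : toRoot base0.a2 = AdjoinRoot.of cub Polynomial.X := MvPolynomial.eval₂Hom_X' _ _ _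

lemma toRoot_a4 : toRoot base0.a4 = AdjoinRoot.root cub := MvPolynomial.eval₂Hom_X' _ _ _

lemma cub_root : AdjoinRoot.root cub ^ 3 - AdjoinRoot.of cub Polynomial.X ^ 2 *
    AdjoinRoot.root cub ^ 2 + AdjoinRoot.of cub (Polynomial.C Polynomial.X) = 0 := by
  have h := AdjoinRoot.eval₂_root cub
  rw [cub] at h
  simp only [Polynomial.eval₂_add, Polynomial.eval₂_mul, Polynomial.eval₂_pow, Polynomial.eval₂_X,
    Polynomial.eval₂_C, Polynomial.eval₂_sub, map_pow] at h
  rw [← cub] at h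
  linear_combination h

lemma toRoot_χ (p : Inv) : toRoot (χ p) = AdjoinRoot.of cub p := by
  have h : toRoot.comp χ = AdjoinRoot.of cub := by
    apply Polynomial.ringHom_ext'
    · apply Polynomial.ringHom_ext'
      · exact Subsingleton.elim _ _
      · rw [RingHom.comp_apply, RingHom.comp_apply, RingHom.comp_apply, χ_C, χΔ_X, Δ, map_sub,
          map_mul, map_pow, map_pow, map_pow, toRoot_a2, toRoot_a4]
        linear_combination -cub_root
    · rw [RingHom.comp_apply, χ_X, toRoot_a2]
  exact RingHom.congr_fun h p

/-- The inverse of `toRoot`. -/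
def ofRoot : AdjoinRoot cub →+* MvPolynomial CVar (ZMod 3) :=
  AdjoinRoot.lift χ base0.a4 (by
    rw [cub]
    simp only [Polynomial.eval₂_add, Polynomial.eval₂_mul, Polynomial.eval₂_pow, Polynomial.eval₂_X,
      Polynomial.eval₂_C, Polynomial.eval₂_sub, map_pow, χ_X, χ_C, χΔ_X, Δ]
    ring)

lemma ofRoot_toRoot (x : MvPolynomial CVar (ZMod 3)) : ofRoot (toRoot x) = x := by
  have h : ofRoot.comp toRoot = RingHom.id _ := by
    apply base0.hom_ext
    · rw [RingHom.comp_apply, toRoot_a2, ofRoot, AdjoinRoot.lift_of, χ_X]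
      rfl
    · rw [RingHom.comp_apply, toRoot_a4, ofRoot, AdjoinRoot.lift_root]
      rfl
  exact RingHom.congr_fun h x

lemma exists_coords (x : MvPolynomial CVar (ZMod 3)) :
    ∃ p q s, x = χ p + χ q * base0.a4 + χ s * base0.a4 ^ 2 := by
  have h := congrArg ofRoot (cubicBasis_sum cub_monic cub_natDegree (toRoot x))
  rw [ofRoot_toRoot] at h
  refine ⟨(cubicBasis cub_monic cub_natDegree).repr (toRoot x) 0,
    (cubicBasis cub_monic cub_natDegree).repr (toRoot x) 1,
    (cubicBasis cub_monic cub_natDegree).repr (toRoot x) 2, h.trans ?_⟩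
  rw [map_add, map_add, map_mul, map_mul, map_pow]
  simp only [ofRoot, AdjoinRoot.lift_of, AdjoinRoot.lift_root]

lemma coords_unique {p q s p' q' s' : Inv}
    (h : χ p + χ q * base0.a4 + χ s * base0.a4 ^ 2 =
      χ p' + χ q' * base0.a4 + χ s' * base0.a4 ^ 2) : p = p' ∧ q = q' ∧ s = s' := by
  have h' := congrArg (fun x => ⇑((cubicBasis cub_monic cub_natDegree).repr (toRoot x))) h
  simp only [map_add, map_mul, map_pow, toRoot_χ, toRoot_a4] at h'
  rw [← map_add, ← map_add, ← map_add, ← map_add, cubicBasis_repr, cubicBasis_repr] at h'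
  exact ⟨congrFun h' 0, congrFun h' 1, congrFun h' 2⟩

lemma χ_injective : Function.Injective χ := by
  intro p q h
  refine (coords_unique (q := 0) (s := 0) (q' := 0) (s' := 0) ?_).1
  rw [h]

/-! ### The cohomology of `(A₀, Γ₀)` -/

lemma a2_mem : base0.a2 ∈ cocycles0 base0.hopf := mem_cocycles0_iff.2 ηR_a2

lemma Δ_mem : Δ ∈ cocycles0 base0.hopf := mem_cocycles0_iff.2 ηR_Δ

lemma χ_mem (p : Inv) : χ p ∈ cocycles0 base0.hopf := by
  induction p using Polynomial.induction_on' with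
  | add p q hp hq => rw [map_add]; exact add_mem hp hq
  | monomial n p =>
    rw [← Polynomial.C_mul_X_pow_eq_monomial, map_mul, map_pow, χ_X, χ_C]
    refine mul_mem ?_ (pow_mem a2_mem n)
    induction p using Polynomial.induction_on' with
    | add p q hp hq => rw [map_add]; exact add_mem hp hq
    | monomial n c =>
      rw [← Polynomial.C_mul_X_pow_eq_monomial, map_mul, map_pow, χΔ_X, χΔ_C]
      refine mul_mem (mem_cocycles0_iff.2 ?_) (pow_mem Δ_mem n)
      exact MvPolynomial.eval₂Hom_C _ _ _

/-- The inclusion of `𝔽₃[Δ][a₂]` in the ring of cocycles. -/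
def χ' : Inv →+* cocycles0 base0.hopf := χ.codRestrict _ χ_mem

lemma ηL_a4 : base0.ηL base0.a4 = base0.ηR base0.a4 + base0.r * base0.ηR base0.a2 := by
  rw [base0.ηL_a4']
  linear_combination (-base0.ηR base0.a2 * base0.r + base0.r ^ 2) * three_Γ

lemma F_a4 : R0.F base0.a4 = ![base0.a4, base0.a2, 0] :=
  base0.F_eq 2 _ (by rw [ηL_a4, map_zero, mul_zero, add_zero])

lemma F_a4_sq : R0.F (base0.a4 ^ 2) =
    ![base0.a4 ^ 2, 2 * (base0.a2 * base0.a4), base0.a2 ^ 2] := by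
  have h : base0.ηL (base0.a4 ^ 2) = base0.ηR (base0.a4 ^ 2) +
      base0.r * base0.ηR (2 * (base0.a2 * base0.a4)) +
        base0.r ^ 2 * base0.ηR (base0.a2 ^ 2) := by
    rw [map_pow, ηL_a4]
    simp only [map_mul, map_pow, map_ofNat]
    ring
  exact base0.F_eq 2 two_mul_two h

/-- The map `F`, as a map of polynomial rings. -/
def F0 : MvPolynomial CVar (ZMod 3) →+ (Fin 3 → MvPolynomial CVar (ZMod 3)) := R0.F

/-- In the basis `1, a₄, a₄²` over the invariants, `F₁` lowers the `a₄`-degree with factors `a₂`,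
`2 a₂` and `F₂` picks out `a₂²` times the coefficient of `a₄²`.  This gives the relations
`a₂ α = 0`, `a₂ ξ = 0` and `a₂² β = 0`. -/
lemma F_coords (p q s : Inv) : F0 (χ p + χ q * base0.a4 + χ s * base0.a4 ^ 2) =
    ![χ p + χ q * base0.a4 + χ s * base0.a4 ^ 2,
      χ (Polynomial.X * q) + χ (2 * Polynomial.X * s) * base0.a4,
      χ (Polynomial.X ^ 2 * s)] := by
  have h1 : F0 (χ p) = ![χ p, 0, 0] := R0.F_cocycle ⟨χ p, χ_mem p⟩
  have h2 : ∀ i, F0 (base0.a4 * χ q) i = F0 base0.a4 i * χ q :=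
    R0.F_mul base0.a4 ⟨χ q, χ_mem q⟩
  have h3 : ∀ i, F0 (base0.a4 ^ 2 * χ s) i = F0 (base0.a4 ^ 2) i * χ s :=
    R0.F_mul (base0.a4 ^ 2) ⟨χ s, χ_mem s⟩
  have h4 : F0 base0.a4 = ![base0.a4, base0.a2, 0] := F_a4
  have h5 : F0 (base0.a4 ^ 2) = ![base0.a4 ^ 2, 2 * (base0.a2 * base0.a4), base0.a2 ^ 2] := F_a4_sq
  have e : χ 2 = 2 := map_ofNat _ _
  rw [mul_comm (χ q), mul_comm (χ s), map_add, map_add]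
  funext i
  rw [Pi.add_apply, Pi.add_apply, h2, h3, h1, h4, h5]
  fin_cases i
  · rfl
  · change 0 + base0.a2 * χ q + 2 * (base0.a2 * base0.a4) * χ s =
      χ (Polynomial.X * q) + χ (2 * Polynomial.X * s) * base0.a4
    rw [map_mul, map_mul, map_mul, χ_X, e]
    ring
  · change 0 + 0 * χ q + base0.a2 ^ 2 * χ s = χ (Polynomial.X ^ 2 * s)
    rw [map_mul, map_pow, χ_X]
    ring

lemma F1_coords (p q s : Inv) : R0.F (χ p + χ q * base0.a4 + χ s * base0.a4 ^ 2) 1 =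
    χ (Polynomial.X * q) + χ (2 * Polynomial.X * s) * base0.a4 := congrFun (F_coords p q s) 1

lemma F2_coords (p q s : Inv) : R0.F (χ p + χ q * base0.a4 + χ s * base0.a4 ^ 2) 2 =
    χ (Polynomial.X ^ 2 * s) := congrFun (F_coords p q s) 2

lemma eq_zero_of_F2 {p q s : Inv}
    (h : R0.F (χ p + χ q * base0.a4 + χ s * base0.a4 ^ 2) 2 = 0) : s = 0 := by
  rw [F2_coords] at h
  have h' : Polynomial.X ^ 2 * s = 0 := χ_injective (h.trans (map_zero χ).symm)
  exact (mul_eq_zero.1 h').resolve_left (pow_ne_zero 2 Polynomial.X_ne_zero)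

lemma exists_of_isOdd {c : MvPolynomial CVar (ZMod 3)} (hc : R0.IsOdd c) :
    ∃ p q, c = χ p + χ q * base0.a4 := by
  obtain ⟨p, q, s, rfl⟩ := exists_coords c
  obtain rfl := eq_zero_of_F2 hc.2
  exact ⟨p, q, by rw [map_zero, zero_mul, add_zero]⟩

lemma exists_of_cocycle {c : MvPolynomial CVar (ZMod 3)} (hc : c ∈ cocycles0 base0.hopf) :
    ∃ p, c = χ p := by
  have h1 := R0.F_cocycle ⟨c, hc⟩
  obtain ⟨p, q, s, rfl⟩ := exists_coords c
  obtain rfl := eq_zero_of_F2 (congrFun h1 2)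
  have h2 : χ (Polynomial.X * q) + χ (2 * Polynomial.X * 0) * base0.a4 = 0 :=
    (F1_coords p q 0).symm.trans (congrFun h1 1)
  rw [mul_zero, map_zero, zero_mul, add_zero] at h2
  have h' : Polynomial.X * q = 0 := χ_injective (h2.trans (map_zero χ).symm)
  obtain rfl := (mul_eq_zero.1 h').resolve_left Polynomial.X_ne_zero
  exact ⟨p, by simp⟩

lemma isOdd_a4 : R0.IsOdd base0.a4 := by
  unfold CubicResolution.IsOdd
  rw [F_a4]
  exact ⟨rfl, rfl⟩

/-- The class of `a₄ [r] + a₂ [r²]`. -/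
def ξ : Coh base0.hopf := R0.sCls base0.a4 isOdd_a4

lemma sCls_lin {c : MvPolynomial CVar (ZMod 3)} (hc : R0.IsOdd c) {p q : Inv}
    (h : c = χ p + χ q * base0.a4) : R0.sCls c hc = R0.α * ofA _ (χ' p) + ξ * ofA _ (χ' q) := by
  have h' : c = χ p + base0.a4 * χ q := h.trans (congrArg (χ p + ·) (mul_comm _ _))
  exact R0.sCls_eq_add hc isOdd_a4 (p := χ' p) (q := χ' q) h'

lemma represents_ξ : Represents base0.ξc ξ := by
  have h : R0.s base0.a4 = base0.ξc := by
    have e : R0.s base0.a4 = x * a + 2 * (y * b) :=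
      (congrArg (fun t => x * a + R0.h * (y * Cobar.coeff (H := base0.hopf) t))
        (congrFun F_a4 1)).trans
        (congrArg (fun t => x * a + t * (y * b)) (map_ofNat (Cobar.coeff (H := base0.hopf)) 2))
    refine e.trans (eq_of_sub_eq_three_mul (u := b * y) ?_)
    rw [xa, b_comm, ξc_eq]
    noncomm_ring
  exact ⟨d_ξc, clsOf_congr h.symm _⟩

/-- The class of `a₂`. -/
def a2C : Coh base0.hopf := ofA _ (χ' Polynomial.X)

/-- The class of `Δ`. -/
def ΔC : Coh base0.hopf := ofA _ (χ' (Polynomial.C Polynomial.X))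

lemma represents_a2C : Represents b a2C :=
  ⟨db, clsOf_congr (congrArg base0.cf χ_X.symm) _⟩

lemma represents_ΔC : Represents (base0.cf Δ) ΔC :=
  ⟨Δ_mem, clsOf_congr (congrArg base0.cf ((χ_C _).trans χΔ_X).symm) _⟩

lemma represents_α : Represents x R0.α := ⟨dx, rfl⟩

lemma represents_β : Represents base0.βc R0.β := ⟨R0.d_βc, rfl⟩

lemma eq_of_represents {s t w : Cobar base0.hopf} {h k : Coh base0.hopf} (hs : Represents s h)
    (ht : Represents t k) (hw : Cobar.d w = s - t) : h = k := by
  obtain ⟨hs, rfl⟩ := hs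
  obtain ⟨ht, rfl⟩ := ht
  exact clsOf_eq_clsOf.2 ⟨w, hw⟩

lemma eq_zero_of_represents {s w : Cobar base0.hopf} {h : Coh base0.hopf} (hs : Represents s h)
    (hw : Cobar.d w = s) : h = 0 := by
  obtain ⟨hs, rfl⟩ := hs
  exact clsOf_eq_zero.2 ⟨w, hw⟩

lemma a2_mul_α : a2C * R0.α = 0 :=
  eq_zero_of_represents (w := 2 * a) (represents_a2C.mul represents_α) (by
    refine eq_of_sub_eq_three_mul (u := b * x) ?_
    rw [two_mul, map_add, da]
    noncomm_ring)

lemma a2_mul_ξ : a2C * ξ = 0 :=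
  eq_zero_of_represents (represents_a2C.mul represents_ξ) da2

lemma a2_sq_mul_β : a2C ^ 2 * R0.β = 0 := by
  rw [sq, mul_assoc]
  refine eq_zero_of_represents (represents_a2C.mul (represents_a2C.mul represents_β))
    (d_a4_sq_r_sub.trans ?_)
  rw [cf_pow, sq, mul_assoc]

lemma ξ_mul_α : ξ * R0.α = a2C * R0.β :=
  eq_of_represents (represents_ξ.mul represents_α) (represents_a2C.mul represents_β) d_a_mul_y

lemma α_mul_ξ : R0.α * ξ = -(ξ * R0.α) := by
  refine eq_of_represents (w := -(a * y)) (represents_α.mul represents_ξ)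
    (represents_ξ.mul represents_α).neg ?_
  rw [x_mul_ξc, map_neg]
  abel

lemma ξ_mul_ξ : ξ * ξ = 0 :=
  eq_zero_of_represents (represents_ξ.mul represents_ξ) ξc_mul_ξc.symm

lemma β_comm_ξ : R0.β * ξ = ξ * R0.β :=
  R0.commute_β_sCls _ (δ := ⟨base0.a2, a2_mem⟩) ηL_a4

lemma a2_comm (h : Coh base0.hopf) : a2C * h = h * a2C := Coh.commute_ofA _ _

lemma Δ_comm (h : Coh base0.hopf) : ΔC * h = h * ΔC := Coh.commute_ofA _ _

lemma a2_mul_β_ne_zero : a2C * R0.β ≠ 0 := by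
  intro h
  rw [a2_comm] at h
  have h0 : ofA _ (0 : cocycles0 base0.hopf) + R0.sCls 0 (R0.isOdd_cocycle 0) + R0.β * a2C = 0 := by
    have : R0.sCls 0 (R0.isOdd_cocycle 0) = 0 := by
      have := R0.sCls_cocycle 0
      rw [map_zero, mul_zero] at this
      exact this
    rw [map_zero, this, h, add_zero, add_zero]
  obtain ⟨-, -, c, hc⟩ := R0.eq_zero_of_coh h0
  have hc' := congrArg Subtype.val (CubicResolution.ofA_injective hc)
  obtain ⟨p, q, s, rfl⟩ := exists_coords c
  have h1 : Polynomial.X = Polynomial.X ^ 2 * s := χ_injective (hc'.trans (F2_coords p q s))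
  have h2 : Polynomial.X * (1 - Polynomial.X * s) = 0 := by linear_combination h1
  have h3 := (mul_eq_zero.1 h2).resolve_left Polynomial.X_ne_zero
  have h4 := congrArg (Polynomial.eval 0) h3
  simp at h4

end Base0

end EllCoh

namespace EllCoh

open Coh

/-! ### The presentation of the cohomology of `(A₀, Γ₀)` -/

namespace Pres0

open FreeAlgebra in
lemma rel {u v : FreeAlgebra (ZMod 3) Gen0} (h : Rel0 u v) :
    (RingQuot.mkRingHom Rel0 u : Pres0) = RingQuot.mkRingHom Rel0 v :=
  RingQuot.mkRingHom_rel h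

lemma closure : Subring.closure (Set.range Pres0.gen) = ⊤ := by
  rw [eq_top_iff]
  intro q _
  obtain ⟨w, rfl⟩ := RingQuot.mkRingHom_surjective Rel0 q
  induction w using FreeAlgebra.induction with
  | grade0 n =>
    have h : RingQuot.mkRingHom Rel0 (algebraMap (ZMod 3) _ n) = ((n.val : ℕ) : Pres0) := by
      conv_lhs => rw [← ZMod.natCast_zmod_val n, map_natCast, map_natCast]
    rw [h]
    exact natCast_mem _ _
  | grade1 v => exact Subring.subset_closure ⟨v, rfl⟩
  | mul a b ha hb => rw [map_mul]; exact mul_mem (ha trivial) (hb trivial)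
  | add a b ha hb => rw [map_add]; exact add_mem (ha trivial) (hb trivial)

lemma mem_center_of_commute {z : Pres0} (h : ∀ v, z * gen v = gen v * z) :
    z ∈ Subring.center Pres0 := by
  rw [Subring.mem_center_iff]
  intro q
  have hq : q ∈ Subring.centralizer {z} := by
    have h1 : Subring.closure (Set.range gen) ≤ Subring.centralizer {z} := by
      rw [Subring.closure_le]
      rintro _ ⟨v, rfl⟩
      rw [SetLike.mem_coe, Subring.mem_centralizer_iff]
      rintro _ rfl
      exact h v
    exact h1 (closure ▸ Subring.mem_top q)
  exact (Subring.mem_centralizer_iff.1 hq z rfl).symm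

lemma a2_mem : gen .a2 ∈ Subring.center Pres0 := mem_center_of_commute fun v => by
  have := rel (.a2_central v)
  rwa [map_mul, map_mul] at this

lemma Δ_mem : gen .Δ ∈ Subring.center Pres0 := mem_center_of_commute fun v => by
  have := rel (.Δ_central v)
  rwa [map_mul, map_mul] at this

lemma β_mem : gen .β ∈ Subring.center Pres0 := mem_center_of_commute fun v => by
  have := rel (.β_central v)
  rwa [map_mul, map_mul] at this

lemma α_sq : gen .α * gen .α = 0 := by
  have := rel .α_sq
  rwa [map_pow, map_zero, sq] at this

lemma ξ_sq : gen .ξ * gen .ξ = 0 := by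
  have := rel .ξ_sq
  rwa [map_pow, map_zero, sq] at this

lemma a2_α : gen .a2 * gen .α = 0 := by
  have := rel .a2_α
  rwa [map_mul, map_zero] at this

lemma a2_ξ : gen .a2 * gen .ξ = 0 := by
  have := rel .a2_ξ
  rwa [map_mul, map_zero] at this

lemma a2_sq_β : gen .a2 ^ 2 * gen .β = 0 := by
  have := rel .a2_sq_β
  rwa [map_mul, map_pow, map_zero] at this

lemma ξ_α : gen .ξ * gen .α = gen .a2 * gen .β := by
  have := rel .ξ_α
  rwa [map_mul, map_mul] at this

lemma α_ξ : gen .α * gen .ξ = -(gen .a2 * gen .β) := by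
  have := rel .anticomm
  rw [map_neg, map_mul, map_mul] at this
  rw [← ξ_α]
  exact this

/-- The inclusion of `𝔽₃[Δ][a₂]`, as a map to the center. -/
def ιc : Base0.Inv →+* Subring.center Pres0 :=
  Polynomial.eval₂RingHom
    (Polynomial.eval₂RingHom ((algebraMap (ZMod 3) Pres0).codRestrict _ fun x =>
      Subring.mem_center_iff.2 fun q => (Algebra.commutes x q).symm) ⟨gen .Δ, Δ_mem⟩)
    ⟨gen .a2, a2_mem⟩

/-- The inclusion of `𝔽₃[Δ][a₂]`. -/
def ι : Base0.Inv →+* Pres0 := (Subring.center Pres0).subtype.comp ιc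

lemma ι_comm (p : Base0.Inv) (q : Pres0) : ι p * q = q * ι p :=
  (Subring.mem_center_iff.1 (ιc p).2 q).symm

lemma ι_X : ι Polynomial.X = gen .a2 := congrArg Subtype.val (Polynomial.eval₂_X _ _)

lemma ι_C_X : ι (Polynomial.C Polynomial.X) = gen .Δ := by
  have h : ιc (Polynomial.C Polynomial.X) = ⟨gen .Δ, Δ_mem⟩ := by
    unfold ιc
    rw [Polynomial.coe_eval₂RingHom, Polynomial.eval₂_C, Polynomial.coe_eval₂RingHom,
      Polynomial.eval₂_X]
  exact congrArg Subtype.val h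

lemma exists_divX (p : Base0.Inv) : ∃ p₀ p₁, p = Polynomial.C p₀ + Polynomial.X * p₁ :=
  ⟨p.coeff 0, p.divX, by
    conv_lhs => rw [← Polynomial.divX_mul_X_add p]
    rw [add_comm, mul_comm]⟩

lemma neg_comb {T : Type} [Ring T] (p a p' b q' : T) :
    -(p + a * p' + b * q') = -p + a * -p' + b * -q' := by
  rw [mul_neg, mul_neg]
  abel

lemma neg_mul_assoc {T : Type} [Ring T] (s b a q : T) : s + -(b * a) * q = s + b * -(a * q) := by
  rw [neg_mul, mul_neg, mul_assoc]

/-- The elements `ι p + α * ι p' + ξ * ι q'` with `p', q'` in `𝔽₃[Δ]`. -/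
def low : AddSubgroup Pres0 where
  carrier := {t | ∃ (p : Base0.Inv) (p' q' : Polynomial (ZMod 3)),
    t = ι p + gen .α * ι (Polynomial.C p') + gen .ξ * ι (Polynomial.C q')}
  zero_mem' := ⟨0, 0, 0, by simp⟩
  add_mem' := by
    rintro _ _ ⟨p, p', q', rfl⟩ ⟨u, u', v', rfl⟩
    exact ⟨p + u, p' + u', q' + v', by simp only [map_add]; noncomm_ring⟩
  neg_mem' := by
    rintro _ ⟨p, p', q', rfl⟩
    exact ⟨-p, -p', -q', by
      rw [map_neg, map_neg, map_neg, map_neg, map_neg]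
      exact neg_comb _ _ _ _ _⟩

lemma α_ι (p₀ : Polynomial (ZMod 3)) (p₁ : Base0.Inv) :
    gen .α * ι (Polynomial.C p₀ + Polynomial.X * p₁) = gen .α * ι (Polynomial.C p₀) := by
  rw [map_add, map_mul, mul_add, ← mul_assoc, ← ι_comm Polynomial.X, ι_X, a2_α, zero_mul,
    add_zero]

lemma ξ_ι (p₀ : Polynomial (ZMod 3)) (p₁ : Base0.Inv) :
    gen .ξ * ι (Polynomial.C p₀ + Polynomial.X * p₁) = gen .ξ * ι (Polynomial.C p₀) := by
  rw [map_add, map_mul, mul_add, ← mul_assoc, ← ι_comm Polynomial.X, ι_X, a2_ξ, zero_mul,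
    add_zero]

lemma ι_mem (p : Base0.Inv) : ι p ∈ low := ⟨p, 0, 0, by simp⟩

/-- Modulo `β`, the presented ring is spanned over the invariants by `1`, `α` and `ξ`. -/
lemma exhausts : Exhausts (gen .β) low := by
  intro P
  refine ring_induction closure (show _ ∈ low from map_one ι ▸ ι_mem 1) ?_ ?_
  · rintro _ ⟨v, rfl⟩
    exact Subring.mem_center_iff.1 β_mem _
  · rintro _ ⟨v, rfl⟩ _ ⟨p, p', q', rfl⟩
    cases v with
    | a2 =>
      refine ⟨_, ι_mem (Polynomial.X * p), 0, zero_mem _, ?_⟩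
      rw [mul_add, mul_add, ← mul_assoc, ← mul_assoc, a2_α, a2_ξ, map_mul, ι_X]
      noncomm_ring
    | Δ =>
      refine ⟨_, ⟨Polynomial.C Polynomial.X * p, Polynomial.X * p', Polynomial.X * q', rfl⟩, 0,
        zero_mem _, ?_⟩
      have hΔ : ∀ q, gen .Δ * q = q * gen .Δ := fun q => (Subring.mem_center_iff.1 Δ_mem q).symm
      rw [map_mul, map_mul, map_mul, map_mul, map_mul, ι_C_X, mul_add, mul_add, ← mul_assoc,
        ← mul_assoc, ← mul_assoc, ← mul_assoc, hΔ (gen .α), hΔ (gen .ξ), mul_zero, add_zero]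
    | α =>
      obtain ⟨p₀, p₁, rfl⟩ := exists_divX p
      refine ⟨_, ⟨0, p₀, 0, rfl⟩, _, ι_mem (-(Polynomial.X * Polynomial.C q')), ?_⟩
      rw [mul_add, mul_add, α_ι, ← mul_assoc, ← mul_assoc, α_sq, α_ξ, map_neg, map_mul, ι_X,
        map_zero, map_zero, map_zero, Subring.mem_center_iff.1 β_mem]
      rw [zero_mul, mul_zero, zero_add, add_zero]
      exact neg_mul_assoc (T := Pres0) _ _ _ _
    | ξ =>
      obtain ⟨p₀, p₁, rfl⟩ := exists_divX p
      refine ⟨_, ⟨0, 0, p₀, rfl⟩, _, ι_mem (Polynomial.X * Polynomial.C p'), ?_⟩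
      rw [mul_add, mul_add, ξ_ι, ← mul_assoc, ← mul_assoc, ξ_sq, ξ_α, map_mul, ι_X,
        map_zero, map_zero, map_zero, Subring.mem_center_iff.1 β_mem]
      noncomm_ring
    | β => exact ⟨0, zero_mem _, _, ⟨p, p', q', rfl⟩, by rw [zero_add]⟩

end Pres0

namespace Base0

/-- The inclusion of `𝔽₃` in the cohomology of `(A₀, Γ₀)`. -/
def o0 : ZMod 3 →+* Coh base0.hopf := (ofA _).comp (χ'.comp (Polynomial.C.comp Polynomial.C))

/-- The classes of the generators. -/
def genC : Gen0 → Coh base0.hopf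
  | .a2 => a2C
  | .Δ => ΔC
  | .α => R0.α
  | .ξ => ξ
  | .β => R0.β

lemma o0_comm (c : ZMod 3) (h : Coh base0.hopf) : o0 c * h = h * o0 c := Coh.commute_ofA _ _

/-- The ring map from the free algebra to the cohomology. -/
def freeMap : FreeAlgebra (ZMod 3) Gen0 →+* Coh base0.hopf :=
  letI := o0.toAlgebra' o0_comm
  ((FreeAlgebra.lift (ZMod 3) genC : FreeAlgebra (ZMod 3) Gen0 →ₐ[ZMod 3] Coh base0.hopf) :
    FreeAlgebra (ZMod 3) Gen0 →+* Coh base0.hopf)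

lemma freeMap_ι (v : Gen0) : freeMap (FreeAlgebra.ι (ZMod 3) v) = genC v := by
  let := o0.toAlgebra' o0_comm
  exact FreeAlgebra.lift_ι_apply _ _

lemma freeMap_rel {u v : FreeAlgebra (ZMod 3) Gen0} (h : Rel0 u v) : freeMap u = freeMap v := by
  cases h with
  | a2_central v => simp only [map_mul, freeMap_ι]; exact a2_comm _
  | Δ_central v => simp only [map_mul, freeMap_ι]; exact Δ_comm _
  | β_central v =>
    simp only [map_mul, freeMap_ι]
    cases v with
    | a2 => exact (a2_comm _).symm
    | Δ => exact (Δ_comm _).symm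
    | α => exact R0.commute_β_α
    | ξ => exact β_comm_ξ
    | β => rfl
  | anticomm => simp only [map_mul, map_neg, freeMap_ι]; exact α_mul_ξ
  | α_sq => rw [sq, map_mul, freeMap_ι, map_zero]; exact R0.α_mul_α
  | ξ_sq => rw [sq, map_mul, freeMap_ι, map_zero]; exact ξ_mul_ξ
  | a2_α => simp only [map_mul, map_zero, freeMap_ι]; exact a2_mul_α
  | a2_ξ => simp only [map_mul, map_zero, freeMap_ι]; exact a2_mul_ξ
  | a2_sq_β => simp only [map_mul, map_pow, map_zero, freeMap_ι]; exact a2_sq_mul_β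
  | ξ_α => simp only [map_mul, freeMap_ι]; exact ξ_mul_α

/-- The map of the presented algebra to the cohomology of `(A₀, Γ₀)`. -/
def φ0 : Pres0 →+* Coh base0.hopf := RingQuot.lift ⟨freeMap, fun _ _ => freeMap_rel⟩

lemma φ0_gen (v : Gen0) : φ0 (Pres0.gen v) = genC v :=
  (RingQuot.lift_mkRingHom_apply _ _ _).trans (freeMap_ι v)

lemma φ0_ι (p : Inv) : φ0 (Pres0.ι p) = ofA _ (χ' p) := by
  have h : φ0.comp Pres0.ι = (ofA _).comp χ' := by
    apply Polynomial.ringHom_ext'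
    · apply Polynomial.ringHom_ext'
      · exact Subsingleton.elim _ _
      · exact (congrArg φ0 Pres0.ι_C_X).trans (φ0_gen .Δ)
    · exact (congrArg φ0 Pres0.ι_X).trans (φ0_gen .a2)
  exact RingHom.congr_fun h p

lemma φ0_low (p : Inv) (p' q' : Polynomial (ZMod 3)) :
    φ0 (Pres0.ι p + Pres0.gen .α * Pres0.ι (Polynomial.C p') +
      Pres0.gen .ξ * Pres0.ι (Polynomial.C q')) =
    ofA _ (χ' p) + (R0.α * ofA _ (χ' (Polynomial.C p')) + ξ * ofA _ (χ' (Polynomial.C q'))) := by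
  rw [map_add, map_add, map_mul, map_mul, φ0_ι, φ0_ι, φ0_ι, φ0_gen, φ0_gen, add_assoc]
  rfl

lemma isOdd_lin (p q : Inv) : R0.IsOdd (χ p + base0.a4 * χ q) :=
  (R0.isOdd_cocycle (χ' p)).add R0 (isOdd_a4.mul R0 (χ' q))

/-- By `F_coords` the odd part modulo values of `F₁` is `α 𝔽₃[Δ] + ξ 𝔽₃[Δ]`, and `β` kills only the
multiples of `a₂²` among the invariants; the presented ring satisfies the same relations. -/
lemma φ0_bijective : Function.Bijective φ0 := by
  constructor
  · refine R0.injective_of_exhausts φ0 (φ0_gen .β) Pres0.exhausts ?_ ?_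
    · rintro _ ⟨p, p', q', rfl⟩
      refine ⟨χ' p, _, isOdd_lin (Polynomial.C p') (Polynomial.C q'), ?_, ?_⟩
      · rw [φ0_low]
        exact congrArg (ofA _ (χ' p) + ·)
          (sCls_lin (isOdd_lin _ _) (congrArg (χ _ + ·) (mul_comm _ _))).symm
      · rintro hp ⟨c, hc⟩
        obtain rfl : p = 0 := χ_injective ((congrArg Subtype.val hp).trans (map_zero χ).symm)
        obtain ⟨u, v, w, rfl⟩ := exists_coords c
        have h1 : χ (Polynomial.C p') + χ (Polynomial.C q') * base0.a4 + χ 0 * base0.a4 ^ 2 =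
            χ (Polynomial.X * v) + χ (2 * Polynomial.X * w) * base0.a4 + χ 0 * base0.a4 ^ 2 := by
          rw [map_zero, zero_mul, add_zero, add_zero, mul_comm]
          exact hc.trans (F1_coords u v w)
        obtain ⟨h2, h3, -⟩ := coords_unique h1
        have h4 := congrArg (fun t => Polynomial.coeff t 0) h2
        have h5 := congrArg (fun t => Polynomial.coeff t 0) h3
        simp only [Polynomial.coeff_C_zero, Polynomial.mul_coeff_zero, Polynomial.coeff_X_zero,
          zero_mul, mul_zero] at h4 h5
        rw [h4, h5]
        simp
    · intro c
      obtain ⟨u, v, w, rfl⟩ := exists_coords c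
      refine ⟨_, Pres0.ι_mem (Polynomial.X ^ 2 * w), ?_, ?_⟩
      · rw [φ0_ι]
        exact congrArg (ofA _) (Subtype.ext (F2_coords u v w).symm)
      · rw [← Pres0.ι_comm, map_mul, map_pow, Pres0.ι_X, mul_assoc, Pres0.ι_comm, ← mul_assoc,
          Pres0.a2_sq_β, zero_mul]
  · refine R0.surjective_of φ0 (φ0_gen .β) ?_ ?_
    · intro c
      obtain ⟨p, hp⟩ := exists_of_cocycle c.2
      exact ⟨Pres0.ι p, (φ0_ι p).trans (congrArg (ofA _) (Subtype.ext hp.symm))⟩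
    · intro c hc
      obtain ⟨p, q, h⟩ := exists_of_isOdd hc
      refine ⟨Pres0.gen .α * Pres0.ι p + Pres0.gen .ξ * Pres0.ι q, ?_⟩
      rw [map_add, map_mul, map_mul, φ0_ι, φ0_ι, φ0_gen, φ0_gen]
      exact (sCls_lin hc h).symm

/-- The isomorphism of the presented algebra with the cohomology of `(A₀, Γ₀)`. -/
def e0 : Pres0 ≃+* Coh base0.hopf := RingEquiv.ofBijective φ0 φ0_bijective

/-! ### Degrees and Massey products in the cohomology of `(A₀, Γ₀)` -/

lemma one_mem : (1 : MvPolynomial CVar (ZMod 3)) ∈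
    (MvPolynomial.weightedHomogeneousSubmodule (ZMod 3) CVar.deg 0).toAddSubgroup :=
  MvPolynomial.isWeightedHomogeneous_one _ _

lemma weight_a2_pow (n : ℕ) : MvPolynomial.IsWeightedHomogeneous CVar.deg
    (base0.a2 ^ n : MvPolynomial CVar (ZMod 3)) (4 * n) := by
  have := (MvPolynomial.isWeightedHomogeneous_X (ZMod 3) CVar.deg CVar.a2).pow n
  rwa [nsmul_eq_mul, mul_comm] at this

lemma weight_a4_pow (n : ℕ) : MvPolynomial.IsWeightedHomogeneous CVar.deg
    (base0.a4 ^ n : MvPolynomial CVar (ZMod 3)) (8 * n) := by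
  have := (MvPolynomial.isWeightedHomogeneous_X (ZMod 3) CVar.deg CVar.a4).pow n
  rwa [nsmul_eq_mul, mul_comm] at this

lemma α_mem : R0.α ∈ bigr deg0 1 4 := base0.α_mem_bigr _ _ one_mem

lemma β_mem : R0.β ∈ bigr deg0 2 12 := base0.β_mem_bigr _ _ one_mem

lemma a2C_mem : a2C ∈ bigr deg0 0 4 :=
  ⟨b, .coeff _ _ (MvPolynomial.isWeightedHomogeneous_X (ZMod 3) CVar.deg CVar.a2), represents_a2C⟩

lemma ΔC_mem : ΔC ∈ bigr deg0 0 24 :=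
  ⟨base0.cf Δ, .coeff _ _ (sub_mem ((weight_a2_pow 2).mul (weight_a4_pow 2)) (weight_a4_pow 3)),
    represents_ΔC⟩

lemma homog_a : IsHomog deg0 0 8 a :=
  .coeff _ _ (MvPolynomial.isWeightedHomogeneous_X (ZMod 3) CVar.deg CVar.a4)

lemma homog_b : IsHomog deg0 0 4 b :=
  .coeff _ _ (MvPolynomial.isWeightedHomogeneous_X (ZMod 3) CVar.deg CVar.a2)

lemma homog_x : IsHomog deg0 1 4 x := base0.isHomog_br_r one_mem

lemma homog_y : IsHomog deg0 1 8 y := base0.isHomog_br_r_pow one_mem 2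

lemma ξ_mem : ξ ∈ bigr deg0 1 12 :=
  ⟨base0.ξc, .add _ _ _ _ (.mul 0 1 8 4 _ _ homog_a homog_x) (.mul 0 1 4 8 _ _ homog_b homog_y),
    represents_ξ⟩

/-- The monomials in `low`. -/
def mons (p : ℕ × ℤ) : Set Pres0 :=
  {t | ∃ (c : ZMod 3) (i j : ℕ), (p = (0, 4 * (j : ℤ) + 24 * (i : ℤ)) ∧
      t = Pres0.ι (Polynomial.C (Polynomial.C c * Polynomial.X ^ i) * Polynomial.X ^ j)) ∨
    (p = (1, 4 + 24 * (i : ℤ)) ∧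
      t = Pres0.gen .α * Pres0.ι (Polynomial.C (Polynomial.C c * Polynomial.X ^ i))) ∨
    (p = (1, 12 + 24 * (i : ℤ)) ∧
      t = Pres0.gen .ξ * Pres0.ι (Polynomial.C (Polynomial.C c * Polynomial.X ^ i)))}

/-- The homogeneous monomials span the part of the presented ring without `β`. -/
lemma low_le : Pres0.low ≤ AddSubgroup.closure (⋃ p, mons p) := by
  have h1 : ∀ p, Pres0.ι p ∈ AddSubgroup.closure (⋃ p, mons p) := by
    intro p
    induction p using Polynomial.induction_on' with
    | add p q hp hq => rw [map_add]; exact add_mem hp hq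
    | monomial j p =>
      rw [← Polynomial.C_mul_X_pow_eq_monomial]
      induction p using Polynomial.induction_on' with
      | add p q hp hq => rw [map_add, add_mul, map_add]; exact add_mem hp hq
      | monomial i c =>
        rw [← Polynomial.C_mul_X_pow_eq_monomial]
        exact AddSubgroup.subset_closure (Set.mem_iUnion.2 ⟨_, c, i, j, Or.inl ⟨rfl, rfl⟩⟩)
  have h2 : ∀ p, Pres0.gen .α * Pres0.ι (Polynomial.C p) ∈
      AddSubgroup.closure (⋃ p, mons p) := by
    intro p
    induction p using Polynomial.induction_on' with
    | add p q hp hq => rw [map_add, map_add, mul_add]; exact add_mem hp hq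
    | monomial i c =>
      rw [← Polynomial.C_mul_X_pow_eq_monomial]
      exact AddSubgroup.subset_closure
        (Set.mem_iUnion.2 ⟨_, c, i, 0, Or.inr (Or.inl ⟨rfl, rfl⟩)⟩)
  have h3 : ∀ p, Pres0.gen .ξ * Pres0.ι (Polynomial.C p) ∈
      AddSubgroup.closure (⋃ p, mons p) := by
    intro p
    induction p using Polynomial.induction_on' with
    | add p q hp hq => rw [map_add, map_add, mul_add]; exact add_mem hp hq
    | monomial i c =>
      rw [← Polynomial.C_mul_X_pow_eq_monomial]
      exact AddSubgroup.subset_closure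
        (Set.mem_iUnion.2 ⟨_, c, i, 0, Or.inr (Or.inr ⟨rfl, rfl⟩)⟩)
  rintro _ ⟨p, p', q', rfl⟩
  exact add_mem (add_mem (h1 p) (h2 p')) (h3 q')

lemma o0_mem (c : ZMod 3) : o0 c ∈ bigr deg0 0 0 := by
  have h1 : (1 : Coh base0.hopf) ∈ bigr deg0 0 0 :=
    ⟨1, grad0.homog_one, ⟨Cobar.d_one, map_one Coh.cls⟩⟩
  have h : o0 c = c.val • (1 : Coh base0.hopf) := by
    conv_lhs => rw [← ZMod.natCast_zmod_val c, map_natCast]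
    rw [nsmul_eq_mul, mul_one]
  rw [h]
  exact AddSubgroup.nsmul_mem _ h1 _

lemma mon_mem (c : ZMod 3) (i j : ℕ) : φ0 (Pres0.ι
    (Polynomial.C (Polynomial.C c * Polynomial.X ^ i) * Polynomial.X ^ j)) ∈
      bigr deg0 0 (4 * j + 24 * i) := by
  simp only [φ0_ι, map_mul, map_pow]
  exact bigr_cast (bigr_mul (bigr_mul (o0_mem c) (bigr_pow grad0.one_mem_bigr ΔC_mem i))
    (bigr_pow grad0.one_mem_bigr a2C_mem j)) (by simp) (by ring)

lemma mons_homog (p : ℕ × ℤ) : ∀ t ∈ mons p, φ0 t ∈ bigr deg0 p.1 p.2 := by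
  have h : ∀ (c : ZMod 3) (i : ℕ), φ0 (Pres0.ι (Polynomial.C (Polynomial.C c * Polynomial.X ^ i))) ∈
      bigr deg0 0 (24 * i) := fun c i => by
    have := mon_mem c i 0
    rw [pow_zero, mul_one] at this
    exact bigr_cast this rfl (by simp)
  rintro t ⟨c, i, j, ⟨rfl, rfl⟩ | ⟨rfl, rfl⟩ | ⟨rfl, rfl⟩⟩
  · exact mon_mem c i j
  · rw [map_mul, φ0_gen]
    exact bigr_mul α_mem (h c i)
  · rw [map_mul, φ0_gen]
    exact bigr_mul ξ_mem (h c i)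

lemma φ0_β_mem : φ0 (Pres0.gen .β) ∈ bigr deg0 2 12 := by
  rw [φ0_gen]
  exact β_mem

lemma isInternal : DirectSum.IsInternal (fun p : ℕ × ℤ => bigr deg0 p.1 p.2) :=
  Pres0.exhausts.isInternal grad0 φ0_bijective.2 φ0_β_mem mons_homog low_le

lemma bigr_eq (n : ℕ) (m : ℤ) :
    bigr deg0 n m = AddSubgroup.closure (Exhausts.powers φ0 (Pres0.gen .β) mons (n, m)) :=
  Pres0.exhausts.bigr_eq grad0 φ0_bijective.2 φ0_β_mem mons_homog low_le n m

lemma bigr_1_8 : bigr deg0 1 8 = ⊥ := by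
  rw [bigr_eq, AddSubgroup.closure_eq_bot_iff]
  rintro _ ⟨i, q, t, ⟨c, k, j, ⟨rfl, rfl⟩ | ⟨rfl, rfl⟩ | ⟨rfl, rfl⟩⟩, h1, h2, rfl⟩ <;>
    dsimp only at h1 h2 <;> omega

lemma mul_α_of_mem {h : Coh base0.hopf} (hh : h ∈ bigr deg0 0 8) : h * R0.α = 0 := by
  rw [bigr_eq] at hh
  induction hh using AddSubgroup.closure_induction with
  | mem h hh =>
    obtain ⟨i, q, t, ⟨c, k, j, ⟨rfl, rfl⟩ | ⟨rfl, rfl⟩ | ⟨rfl, rfl⟩⟩, h1, h2, rfl⟩ := hh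
    · dsimp only at h1 h2
      obtain ⟨j, rfl⟩ : ∃ j', j = j' + 1 := ⟨j - 1, by omega⟩
      rw [pow_succ Polynomial.X j, ← mul_assoc, map_mul, map_mul Pres0.ι, map_mul φ0, Pres0.ι_X,
        φ0_gen, mul_assoc, mul_assoc]
      exact (congrArg (_ * ·) ((congrArg (_ * ·) a2_mul_α).trans (mul_zero _))).trans
        (mul_zero _)
    · dsimp only at h1
      omega
    · dsimp only at h1
      omega
  | zero => rw [zero_mul]
  | add a b _ _ ha hb => rw [add_mul, ha, hb, add_zero]
  | neg a _ ha => rw [neg_mul, ha, neg_zero]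

lemma two_mem : (2 : MvPolynomial CVar (ZMod 3)) ∈
    (MvPolynomial.weightedHomogeneousSubmodule (ZMod 3) CVar.deg 0).toAddSubgroup :=
  one_add_one_eq_two (R := MvPolynomial CVar (ZMod 3)) ▸ add_mem one_mem one_mem

lemma massey_α_α_α : massey deg0 1 4 1 4 1 4 R0.α R0.α R0.α = {R0.β} :=
  base0.massey_α 2 two_mul_two one_mem two_mem grad0
    (by rw [Coh.three_eq_zero (H := base0.hopf) (CharP.ofNat_eq_zero base0.hopf.A 3), zero_mul])
    bigr_1_8

lemma dy' : Cobar.d y = x * x :=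
  eq_of_sub_eq_three_mul (u := -(x * x)) (by rw [dy]; noncomm_ring)

/-- The defining system `u = 2 a₄ a₂ ^ n`, `v = [r²]` of `⟨a₂ ^ (n + 1), α, α⟩`. -/
lemma massey_system (n : ℕ) : Cobar.d (2 * (a * b ^ n)) = b ^ (n + 1) * x ∧
    b ^ (n + 1) * y - (-1) ^ 0 * (2 * (a * b ^ n) * x) = b ^ n * base0.ξc := by
  have hc : ∀ t, t * b ^ n = b ^ n * t := fun t => Commute.pow_right (b_comm t) n
  constructor
  · refine eq_of_sub_eq_three_mul (u := b ^ n * (b * x)) ?_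
    rw [two_mul, map_add, d_mul_b_pow, da, pow_succ]
    noncomm_ring
  · refine eq_of_sub_eq_three_mul (u := -(b ^ n * (a * x))) ?_
    rw [hc a, pow_succ, ξc_eq, pow_zero, one_mul]
    noncomm_ring

lemma homog_pow (n : ℕ) : IsHomog deg0 0 (4 * n) (b ^ n) := by
  have := IsHomog.coeff (g := deg0) _ _ (weight_a2_pow n)
  exact cf_pow n ▸ this

lemma homog_u (n : ℕ) : IsHomog deg0 0 (4 * (n + 1) + 4) (2 * (a * b ^ n)) := by
  have h := IsHomog.mul _ _ _ _ _ _ homog_a (homog_pow n)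
  rw [two_mul]
  exact (IsHomog.add _ _ _ _ h h).cast rfl (by ring)

lemma represents_a2_pow (n : ℕ) : Represents (b ^ n) (a2C ^ n) := by
  induction n with
  | zero =>
    rw [pow_zero, pow_zero]
    exact ⟨Cobar.d_one, map_one Coh.cls⟩
  | succ n ih =>
    rw [pow_succ, pow_succ]
    exact ih.mul represents_a2C

lemma mem_massey (n : ℕ) : a2C ^ n * ξ ∈
    massey deg0 0 (4 * (n + 1)) 1 4 1 4 (a2C ^ (n + 1)) R0.α R0.α := by
  refine ⟨b ^ (n + 1), x, x, 2 * (a * b ^ n), y, 0, 1, ?_, represents_a2_pow _, homog_x,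
    represents_α,
    homog_x, represents_α, rfl, homog_u n, (massey_system n).1, rfl, homog_y, dy', ?_⟩
  · exact (homog_pow (n + 1)).cast rfl (by push_cast; ring)
  · rw [(massey_system n).2]
    exact (represents_a2_pow n).mul represents_ξ

lemma massey_a2_α_α : massey deg0 0 4 1 4 1 4 a2C R0.α R0.α = {ξ} := by
  obtain ⟨h1, h2⟩ := massey_system 0
  rw [zero_add, pow_one] at h1 h2
  refine grad0.massey_eq_singleton homog_b represents_a2C homog_x represents_α homog_x represents_α
    ((homog_u 0).cast rfl (by norm_num)) h1 homog_y dy'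
    (by rw [h2, pow_zero, one_mul]; exact represents_ξ) ?_ ?_
  · intro c hc
    exact mul_α_of_mem hc
  · intro c hc
    have hc' : c ∈ bigr deg0 1 8 := hc
    rw [bigr_1_8] at hc'
    rw [show c = 0 from hc', mul_zero]

end Base0

end EllCoh

namespace EllCoh

open Coh

/-! ### Reduction modulo `3` -/

lemma three_ne_zero_Z3 : (3 : Z3) ≠ 0 := by
  have h := (FaithfulSMul.algebraMap_injective ℤ Z3).ne (show (3 : ℤ) ≠ 0 by norm_num)
  rwa [map_ofNat, map_zero] at h

lemma CubicBase.homOf_a2 {A A' : Type} [CommRing A] [CommRing A'] (B : CubicBase A)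
    (B' : CubicBase A') (f : A →+* A') (h2 : f B.a2 = B'.a2) (h4 : f B.a4 = B'.a4) :
    (B.homOf B' f h2 h4).f₀ B.a2 = B'.a2 := h2

lemma CubicBase.homOf_a4 {A A' : Type} [CommRing A] [CommRing A'] (B : CubicBase A)
    (B' : CubicBase A') (f : A →+* A') (h2 : f B.a2 = B'.a2) (h4 : f B.a4 = B'.a4) :
    (B.homOf B' f h2 h4).f₀ B.a4 = B'.a4 := h4

/-- The reduction `ℤ_(3) → 𝔽₃`. -/
def redZ : Z3 →+* ZMod 3 := ((MvPolynomial.constantCoeff (σ := CVar)).comp red0.f₀).comp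
  MvPolynomial.C

lemma redZ_eq_zero {k : Z3} (h : redZ k = 0) : (3 : Z3) ∣ k := by
  obtain ⟨m, s, rfl⟩ := IsLocalization.exists_mk'_eq (Ideal.span {(3 : ℤ)}).primeCompl k
  have h1 : redZ (algebraMap ℤ Z3 m) = 0 := by
    rw [← IsLocalization.mk'_spec Z3 m s, map_mul, h, zero_mul]
  rw [eq_intCast, map_intCast] at h1
  obtain ⟨n, rfl⟩ := (ZMod.intCast_zmod_eq_zero_iff_dvd _ 3).1 h1
  refine ⟨IsLocalization.mk' Z3 n s, ?_⟩
  have h3 : (3 : Z3) = algebraMap ℤ Z3 3 := (map_ofNat _ _).symm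
  rw [h3, IsLocalization.mul_mk'_eq_mk'_of_mul]
  rfl

lemma redZ_surjective : Function.Surjective redZ := fun k =>
  ⟨(k.val : Z3), by rw [map_natCast, ZMod.natCast_zmod_val]⟩

/-- The reduction `ℤ_(3)[a₂, a₄] → 𝔽₃[a₂, a₄]`. -/
def redA : MvPolynomial CVar Z3 →+* MvPolynomial CVar (ZMod 3) := MvPolynomial.map redZ

lemma redA_a2 : redA base'.a2 = base0.a2 := MvPolynomial.map_X _ _

lemma redA_a4 : redA base'.a4 = base0.a4 := MvPolynomial.map_X _ _

lemma redA_unique {f : MvPolynomial CVar Z3 →+* MvPolynomial CVar (ZMod 3)}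
    (h2 : f base'.a2 = base0.a2) (h4 : f base'.a4 = base0.a4) : redA = f :=
  base'.hom_ext _ _ _ (redA_a2.trans h2.symm) (redA_a4.trans h4.symm)

lemma redA_eq : redA = red0.f₀ :=
  redA_unique (CubicBase.homOf_a2 _ _ _ _ _) (CubicBase.homOf_a4 _ _ _ _ _)

lemma redA_surjective : Function.Surjective redA := MvPolynomial.map_surjective _ redZ_surjective

lemma three_eq_C {σ : Type} : (3 : MvPolynomial σ Z3) = MvPolynomial.C 3 := (map_ofNat _ _).symm

lemma redA_eq_zero {x : MvPolynomial CVar Z3} (h : redA x = 0) : ∃ y, x = 3 * y := by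
  have : MvPolynomial.C (3 : Z3) ∣ x := by
    rw [MvPolynomial.C_dvd_iff_dvd_coeff]
    intro d
    apply redZ_eq_zero
    have := congrArg (MvPolynomial.coeff d) h
    rwa [redA, MvPolynomial.coeff_map, MvPolynomial.coeff_zero] at this
  rwa [← three_eq_C] at this

lemma polyRed_eq_zero {x : Polynomial Z3} (h : Polynomial.mapRingHom redZ x = 0) :
    (3 : Polynomial Z3) ∣ x := by
  have : Polynomial.C (3 : Z3) ∣ x := by
    rw [Polynomial.C_dvd_iff_dvd_coeff]
    intro d
    apply redZ_eq_zero
    have := congrArg (fun p => Polynomial.coeff p d) h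
    simpa using this
  rwa [map_ofNat] at this

namespace BaseZ

/-- The element `1/2`. -/
def half : MvPolynomial CVar Z3 := MvPolynomial.C halfZ3

lemma two_half : 2 * half = 1 := by
  have := congrArg (MvPolynomial.C (σ := CVar)) two_mul_halfZ3
  rwa [map_mul, map_one, map_ofNat] at this

end BaseZ

/-- The cubic resolution of `(A', Γ')`. -/
def R' : CubicResolution base'.hopf := base'.resolution BaseZ.half BaseZ.two_half

namespace BaseZ

/-- The generator `a₂`. -/
def a : MvPolynomial CVar Z3 := base'.a2
/-- The generator `a₄`. -/
def c : MvPolynomial CVar Z3 := base'.a4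

/-- The coefficient of `r` in `ηL x`. -/
def F1 : MvPolynomial CVar Z3 →+ MvPolynomial CVar Z3 :=
  (Pi.evalAddMonoidHom (fun _ => MvPolynomial CVar Z3) 1).comp R'.F
/-- The coefficient of `r²` in `ηL x`. -/
def F2 : MvPolynomial CVar Z3 →+ MvPolynomial CVar Z3 :=
  (Pi.evalAddMonoidHom (fun _ => MvPolynomial CVar Z3) 2).comp R'.F

lemma F_eq {x y z w : MvPolynomial CVar Z3}
    (h : base'.ηL x = base'.ηR y + base'.r * base'.ηR z + base'.r ^ 2 * base'.ηR w) :
    F1 x = z ∧ F2 x = w := by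
  have h' := base'.F_eq half two_half h
  exact ⟨congrFun h' 1, congrFun h' 2⟩

lemma F_0 (x : MvPolynomial CVar Z3) : R'.F x 0 = x := by
  have h := congrArg base'.ε (base'.rcoord_sum (base'.ηL x))
  simp only [map_add, map_mul, base'.ε_r, base'.ε_ηL, zero_mul, add_zero, map_pow,
    ne_eq, OfNat.ofNat_ne_zero, not_false_eq_true, zero_pow] at h
  exact (h.trans (RingHom.congr_fun base'.ε_ηR _)).symm

lemma ηL_eq (x : MvPolynomial CVar Z3) : base'.ηL x =
    base'.ηR x + base'.r * base'.ηR (F1 x) + base'.r ^ 2 * base'.ηR (F2 x) := by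
  have h : base'.ηR (R'.F x 0) = base'.ηR x := congrArg base'.ηR (F_0 x)
  rw [← h]
  exact base'.rcoord_sum (base'.ηL x)

lemma isOdd_iff {x : MvPolynomial CVar Z3} : R'.IsOdd x ↔ F2 x = 0 :=
  ⟨fun h => h.2, fun h => ⟨F_0 x, h⟩⟩

lemma F1_F1 (x : MvPolynomial CVar Z3) : F1 (F1 x) = 2 * F2 x := congrFun (R'.F_F x) 1

lemma F2_F1 (x : MvPolynomial CVar Z3) : F2 (F1 x) = 0 := congrFun (R'.F_F x) 2

/-- The ring of invariants. -/
def inv : Subring (MvPolynomial CVar Z3) := cocycles0 base'.hopf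

lemma mem_inv {x : MvPolynomial CVar Z3} : x ∈ inv ↔ F1 x = 0 ∧ F2 x = 0 := by
  constructor
  · intro h
    have h' := R'.F_cocycle ⟨x, h⟩
    exact ⟨congrFun h' 1, congrFun h' 2⟩
  · rintro ⟨h1, h2⟩
    exact R'.mem_cocycles0_of_F (F_0 x) h1 h2

lemma F1_mul (x : MvPolynomial CVar Z3) {y : MvPolynomial CVar Z3} (hy : y ∈ inv) :
    F1 (x * y) = F1 x * y := R'.F_mul x ⟨y, hy⟩ 1

lemma F2_mul (x : MvPolynomial CVar Z3) {y : MvPolynomial CVar Z3} (hy : y ∈ inv) :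
    F2 (x * y) = F2 x * y := R'.F_mul x ⟨y, hy⟩ 2

lemma ηL_a : base'.ηL a = base'.ηR a - 3 * base'.r := base'.ηL_a2'

lemma ηL_c : base'.ηL c = base'.ηR c - 2 * base'.ηR a * base'.r + 3 * base'.r ^ 2 := base'.ηL_a4'

lemma relR : base'.r ^ 3 = base'.ηR a * base'.r ^ 2 - base'.ηR c * base'.r := base'.relR

lemma F_a : F1 a = -3 ∧ F2 a = 0 := F_eq (y := a) (by
  rw [ηL_a, map_neg, map_ofNat, map_zero]
  ring)

lemma F_c : F1 c = -(2 * a) ∧ F2 c = 3 := F_eq (y := c) (by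
  rw [ηL_c, map_neg, map_mul, map_ofNat, map_ofNat]
  ring)

lemma F_a_sq : F1 (a ^ 2) = -(6 * a) ∧ F2 (a ^ 2) = 9 := F_eq (y := a ^ 2) (by
  rw [map_pow, ηL_a, map_neg, map_mul, map_pow, map_ofNat, map_ofNat]
  ring)

lemma F2_c_sq : F2 (c ^ 2) = a ^ 2 - 3 * c := (F_eq (y := c ^ 2) (z := -(a * c)) (by
  simp only [map_pow, ηL_c, map_neg, map_mul, map_sub, map_ofNat]
  linear_combination (9 * base'.r - 3 * base'.ηR a) * relR)).2

lemma F2_a_mul_c_sq : F2 (a * c ^ 2) = -(2 * a ^ 3 - 9 * a * c) :=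
  (F_eq (y := a * c ^ 2) (z := -(a ^ 2 * c) + 3 * (a ^ 2 - 3 * c) * c - 3 * c ^ 2) (by
  simp only [map_pow, ηL_c, ηL_a, map_neg, map_mul, map_sub, map_add, map_ofNat]
  linear_combination (-27 * base'.r ^ 2 + 18 * base'.ηR a * base'.r - 6 * base'.ηR a ^ 2 + 
    9 * base'.ηR c) * relR)).2

lemma three_cancel {x y : MvPolynomial CVar Z3} (h : 3 * x = 3 * y) : x = y :=
  mul_left_cancel₀ (by
    rw [three_eq_C, Ne, MvPolynomial.C_eq_zero]
    exact three_ne_zero_Z3) h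

/-- Three times an odd element is a value of `F1`. -/
lemma three_mul_eq_F1 {x : MvPolynomial CVar Z3} (hx : F2 x = 0) :
    3 * x = F1 (-(a * x + half * (c * F1 x))) := by
  have hy : F1 x ∈ inv := mem_inv.2 ⟨by rw [F1_F1, hx, mul_zero], F2_F1 x⟩
  have hh : half ∈ inv := (mem_cocycles0_iff (H := base'.hopf)).2 (MvPolynomial.eval₂Hom_C _ _ _)
  have h1 : F1 (a * x) = a * F1 x - 3 * x := (F_eq (y := a * x) (w := -(3 * F1 x)) (by
    have h := ηL_eq x
    rw [hx, map_zero, mul_zero, add_zero] at h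
    rw [map_mul, h, ηL_a]
    simp only [map_mul, map_sub, map_neg, map_ofNat]
    ring)).1
  have h2 : F1 (half * (c * F1 x)) = -(a * F1 x) := by
    rw [mul_comm, F1_mul _ hh, F1_mul _ hy, F_c.1]
    linear_combination (-a * F1 x) * two_half
  rw [map_neg, map_add, h1, h2]
  ring

/-! ### The classical invariants -/

/-- The invariant `c₄`. -/
def c4 : MvPolynomial CVar Z3 := 16 * (a ^ 2 - 3 * c)
/-- The invariant `c₆`. -/
def c6 : MvPolynomial CVar Z3 := -(32 * (2 * a ^ 3 - 9 * a * c))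
/-- The discriminant. -/
def Δ : MvPolynomial CVar Z3 := 16 * c ^ 2 * (a ^ 2 - 4 * c)

lemma c6_sq : c6 * c6 = c4 ^ 3 - 1728 * Δ := by
  rw [c6, c4, Δ]
  ring

lemma c4_eq : c4 = F2 (16 * c ^ 2) := by
  have : (16 : MvPolynomial CVar Z3) ∈ inv := natCast_mem inv 16
  rw [mul_comm, F2_mul _ this, F2_c_sq, c4]
  ring

lemma c6_eq : c6 = F2 (32 * (a * c ^ 2)) := by
  have : (32 : MvPolynomial CVar Z3) ∈ inv := natCast_mem inv 32
  rw [mul_comm, F2_mul _ this, F2_a_mul_c_sq, c6]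
  ring

lemma F2_mem_inv (x : MvPolynomial CVar Z3) : F2 x ∈ inv := R'.F2_mem x

lemma Δ_mem : Δ ∈ inv := (mem_cocycles0_iff (H := base'.hopf)).2 (by
  have h : base'.ηR Δ = base'.ηL Δ := by
    have h1 := base'.ηR_a2'
    have h2 := base'.ηR_a4'
    have h3 := base'.rel
    rw [Δ, show a = base'.a2 from rfl, show c = base'.a4 from rfl]
    simp only [map_mul, map_sub, map_pow, map_ofNat, h1, h2]
    generalize base'.ηL base'.a2 = p, base'.ηL base'.a4 = q, base'.r = r at h3 ⊢
    linear_combination (-432 * r ^ 3 - 432 * q * r - 432 * p * r ^ 2 - 288 * p * q +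
      64 * p ^ 3) * h3
  exact h)

/-- The ring `ℤ_(3)[Δ][c₄]`. -/
abbrev Inv : Type := Polynomial (Polynomial Z3)

/-- The map `ℤ_(3)[Δ] → ℤ_(3)[a₂, a₄]`. -/
def χΔ : Polynomial Z3 →+* MvPolynomial CVar Z3 := Polynomial.eval₂RingHom MvPolynomial.C Δ

/-- The map `ℤ_(3)[Δ][c₄] → ℤ_(3)[a₂, a₄]`. -/
def χ : Inv →+* MvPolynomial CVar Z3 := Polynomial.eval₂RingHom χΔ c4

lemma χ_X : χ Polynomial.X = c4 := Polynomial.eval₂_X _ _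

lemma χ_C (p : Polynomial Z3) : χ (Polynomial.C p) = χΔ p := Polynomial.eval₂_C _ _

lemma χΔ_X : χΔ Polynomial.X = Δ := Polynomial.eval₂_X _ _

lemma χΔ_C (k : Z3) : χΔ (Polynomial.C k) = MvPolynomial.C k := Polynomial.eval₂_C _ _

lemma C_mem (k : Z3) : MvPolynomial.C k ∈ inv :=
  (mem_cocycles0_iff (H := base'.hopf)).2 (MvPolynomial.eval₂Hom_C _ _ _)

lemma χΔ_mem (p : Polynomial Z3) : χΔ p ∈ inv := by
  induction p using Polynomial.induction_on' with
  | add p q hp hq => rw [map_add]; exact add_mem hp hq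
  | monomial n k =>
    rw [← Polynomial.C_mul_X_pow_eq_monomial, map_mul, map_pow, χΔ_X, χΔ_C]
    exact mul_mem (C_mem k) (pow_mem Δ_mem n)

lemma c4_mem : c4 ∈ inv := c4_eq ▸ F2_mem_inv _

lemma c6_mem : c6 ∈ inv := c6_eq ▸ F2_mem_inv _

lemma χ_mem (p : Inv) : χ p ∈ inv := by
  induction p using Polynomial.induction_on' with
  | add p q hp hq => rw [map_add]; exact add_mem hp hq
  | monomial n p =>
    rw [← Polynomial.C_mul_X_pow_eq_monomial, map_mul, map_pow, χ_X, χ_C]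
    exact mul_mem (χΔ_mem p) (pow_mem c4_mem n)

lemma χ_neg (p : Inv) : χ (-p) = -χ p := map_neg χ p

/-- The subring generated by the invariants `c₄, c₆, Δ`. -/
def S : Subring (MvPolynomial CVar Z3) where
  carrier := {x | ∃ p q, x = χ p + χ q * c6}
  zero_mem' := ⟨0, 0, by simp⟩
  one_mem' := ⟨1, 0, by simp⟩
  add_mem' := by
    rintro _ _ ⟨p, q, rfl⟩ ⟨p', q', rfl⟩
    exact ⟨p + p', q + q', by rw [map_add, map_add]; ring⟩
  neg_mem' := by
    rintro _ ⟨p, q, rfl⟩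
    exact ⟨-p, -q, by rw [χ_neg, χ_neg]; ring⟩
  mul_mem' := by
    rintro _ _ ⟨p, q, rfl⟩ ⟨p', q', rfl⟩
    refine ⟨p * p' + q * q' * (Polynomial.X ^ 3 - 1728 * Polynomial.C Polynomial.X),
      p * q' + q * p', ?_⟩
    have h : χ (Polynomial.X ^ 3 - 1728 * Polynomial.C Polynomial.X) = c6 * c6 := by
      refine (map_sub χ _ _).trans ?_
      rw [map_pow, map_mul, χ_X, χ_C, χΔ_X, map_ofNat, c6_sq]
    simp only [map_add, map_mul, h]
    ring

lemma χ_mem_S (p : Inv) : χ p ∈ S := ⟨p, 0, by simp⟩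

lemma c4_mem_S : c4 ∈ S := χ_X ▸ χ_mem_S _

lemma c6_mem_S : c6 ∈ S := ⟨0, 1, by simp⟩

lemma C_mem_S (k : Z3) : MvPolynomial.C k ∈ S := by
  rw [← χΔ_C, ← χ_C]
  exact χ_mem_S _

lemma half_mem_S : half ∈ S := C_mem_S _

/-- The span of `1, a₂, a₂²` over the subring generated by `c₄, c₆, Δ`. -/
def N : AddSubgroup (MvPolynomial CVar Z3) where
  carrier := {x | ∃ u ∈ S, ∃ v ∈ S, ∃ w ∈ S, x = u + v * a + w * a ^ 2}
  zero_mem' := ⟨0, zero_mem _, 0, zero_mem _, 0, zero_mem _, by ring⟩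
  add_mem' := by
    rintro _ _ ⟨u, hu, v, hv, w, hw, rfl⟩ ⟨u', hu', v', hv', w', hw', rfl⟩
    exact ⟨_, add_mem hu hu', _, add_mem hv hv', _, add_mem hw hw', by ring⟩
  neg_mem' := by
    rintro _ ⟨u, hu, v, hv, w, hw, rfl⟩
    exact ⟨_, neg_mem hu, _, neg_mem hv, _, neg_mem hw, by ring⟩

lemma mul_mem_N {s x : MvPolynomial CVar Z3} (hs : s ∈ S) (hx : x ∈ N) : s * x ∈ N := by
  obtain ⟨u, hu, v, hv, w, hw, rfl⟩ := hx
  exact ⟨_, mul_mem hs hu, _, mul_mem hs hv, _, mul_mem hs hw, by ring⟩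

/-- The element `a₂` is a root of a cubic polynomial with coefficients in `ℤ_(3)[c₄, c₆]`. -/
lemma a_cubed : a ^ 3 = half ^ 5 * c6 + half ^ 5 * (6 * c4) * a := by
  have h : (32 : MvPolynomial CVar Z3) * half ^ 5 = 1 := by
    have := congrArg (· ^ 5) two_half
    simp only [mul_pow, one_pow] at this
    linear_combination this
  rw [c6, c4]
  linear_combination (-a ^ 3) * h

lemma a_mul_mem_N {x : MvPolynomial CVar Z3} (hx : x ∈ N) : a * x ∈ N := by
  obtain ⟨u, hu, v, hv, w, hw, rfl⟩ := hx
  have h6 : (6 : MvPolynomial CVar Z3) ∈ S := natCast_mem S 6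
  refine ⟨_, mul_mem hw (mul_mem (pow_mem half_mem_S 5) c6_mem_S), _,
    add_mem hu (mul_mem hw (mul_mem (pow_mem half_mem_S 5) (mul_mem h6 c4_mem_S))), _, hv, ?_⟩
  linear_combination w * a_cubed

lemma three_c_mul_mem_N {x : MvPolynomial CVar Z3} (hx : x ∈ N) : 3 * c * x ∈ N := by
  have h : (16 : MvPolynomial CVar Z3) * half ^ 4 = 1 := by
    have := congrArg (· ^ 4) two_half
    simp only [mul_pow, one_pow] at this
    linear_combination this
  have e : 3 * c * x = a * (a * x) - half ^ 4 * c4 * x := by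
    rw [c4]
    linear_combination (a ^ 2 * x - 3 * c * x) * h
  rw [e]
  exact sub_mem (a_mul_mem_N (a_mul_mem_N hx))
    (mul_mem_N (mul_mem (pow_mem half_mem_S 4) c4_mem_S) hx)

lemma three_pow_mem_S (k : ℕ) : (3 : MvPolynomial CVar Z3) ^ k ∈ S :=
  pow_mem (natCast_mem S 3) k

/-- Every polynomial in `a₂, a₄` lies in the span `N` of `1, a₂, a₂²` over `S` after multiplication
by a power of `3`, because `c₄ = 16 (a₂² - 3 a₄)` expresses `3 a₄` in `N`. -/
lemma exists_three_pow_mul_mem_N (x : MvPolynomial CVar Z3) : ∃ k : ℕ, 3 ^ k * x ∈ N := by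
  induction x using MvPolynomial.induction_on with
  | C k =>
    refine ⟨0, ?_⟩
    rw [pow_zero, one_mul]
    exact ⟨_, C_mem_S k, 0, zero_mem _, 0, zero_mem _, by ring⟩
  | add p q hp hq =>
    obtain ⟨i, hi⟩ := hp
    obtain ⟨j, hj⟩ := hq
    refine ⟨i + j, ?_⟩
    have e : 3 ^ (i + j) * (p + q) = 3 ^ j * (3 ^ i * p) + 3 ^ i * (3 ^ j * q) := by ring
    rw [e]
    exact add_mem (mul_mem_N (three_pow_mem_S j) hi) (mul_mem_N (three_pow_mem_S i) hj)
  | mul_X p v hp =>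
    obtain ⟨i, hi⟩ := hp
    cases v with
    | a2 =>
      refine ⟨i, ?_⟩
      have e : 3 ^ i * (p * MvPolynomial.X CVar.a2) = a * (3 ^ i * p) := by
        rw [show MvPolynomial.X CVar.a2 = a from rfl]
        ring
      rw [e]
      exact a_mul_mem_N hi
    | a4 =>
      refine ⟨i + 1, ?_⟩
      have e : 3 ^ (i + 1) * (p * MvPolynomial.X CVar.a4) = 3 * c * (3 ^ i * p) := by
        rw [show MvPolynomial.X CVar.a4 = c from rfl]
        ring
      rw [e]
      exact three_c_mul_mem_N hi

/-! ### The reduction of the invariants modulo `3` -/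

/-- The reduction of `ℤ_(3)[Δ][c₄]` modulo `3`. -/
def redInv : Inv →+* Base0.Inv := Polynomial.mapRingHom (Polynomial.mapRingHom redZ)

lemma redInv_eq_zero {p : Inv} (h : redInv p = 0) : (3 : Inv) ∣ p := by
  have : Polynomial.C (3 : Polynomial Z3) ∣ p := by
    rw [Polynomial.C_dvd_iff_dvd_coeff]
    intro d
    apply polyRed_eq_zero
    have := congrArg (fun p => Polynomial.coeff p d) h
    simpa [redInv] using this
  rwa [map_ofNat] at this

lemma three0 : (3 : MvPolynomial CVar (ZMod 3)) = 0 := CharP.ofNat_eq_zero _ 3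

lemma redA_c4 : redA c4 = base0.a2 ^ 2 := by
  rw [c4, a, c]
  simp only [map_mul, map_sub, map_pow, map_ofNat, redA_a2, redA_a4]
  linear_combination (5 * base0.a2 ^ 2 - 16 * base0.a4) * three0

lemma redA_c6 : redA c6 = -base0.a2 ^ 3 := by
  rw [c6, a, c]
  simp only [map_mul, map_sub, map_pow, map_ofNat, map_neg, redA_a2, redA_a4]
  linear_combination (-21 * base0.a2 ^ 3 + 96 * base0.a2 * base0.a4) * three0

lemma redA_Δ : redA Δ = Base0.Δ := by
  rw [Δ, a, c, Base0.Δ]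
  simp only [map_mul, map_sub, map_pow, map_ofNat, redA_a2, redA_a4]
  linear_combination (5 * base0.a2 ^ 2 * base0.a4 ^ 2 - 21 * base0.a4 ^ 3) * three0

lemma redA_χΔ (p : Polynomial Z3) :
    redA (χΔ p) = Base0.χΔ (Polynomial.mapRingHom redZ p) := by
  have h : redA.comp χΔ = Base0.χΔ.comp (Polynomial.mapRingHom redZ) := by
    apply Polynomial.ringHom_ext'
    · exact Z3_hom_ext _ _
    · rw [RingHom.comp_apply, RingHom.comp_apply, χΔ_X, Polynomial.coe_mapRingHom,
        Polynomial.map_X, Base0.χΔ_X, redA_Δ]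
  exact RingHom.congr_fun h p

/-- Modulo `3`, the invariant `c₄` is the square of `a₂`. -/
lemma redA_χ (p : Inv) :
    redA (χ p) = Base0.χ (Polynomial.expand (Polynomial (ZMod 3)) 2 (redInv p)) := by
  have h : redA.comp χ = (Base0.χ.comp
      (Polynomial.expand (Polynomial (ZMod 3)) 2 : Base0.Inv →+* Base0.Inv)).comp redInv := by
    apply Polynomial.ringHom_ext'
    · refine RingHom.ext fun p => ?_
      simp only [RingHom.comp_apply, redInv, Polynomial.coe_mapRingHom, Polynomial.map_C,
        RingHom.coe_coe, Polynomial.expand_C, χ_C, Base0.χ_C, redA_χΔ]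
    · simp only [RingHom.comp_apply, redInv, Polynomial.coe_mapRingHom, Polynomial.map_X,
        RingHom.coe_coe, Polynomial.expand_X, χ_X, map_pow, Base0.χ_X, redA_c4]
  exact RingHom.congr_fun h p

/-- The invariants `χ p + χ q c₆` are not divisible by `3`: modulo `3` the two summands have even
and odd degree in `a₂`. -/
lemma three_dvd_of_redA {p q : Inv} (h : redA (χ p + χ q * c6) = 0) :
    (3 : Inv) ∣ p ∧ (3 : Inv) ∣ q := by
  have h1 : Polynomial.expand (Polynomial (ZMod 3)) 2 (redInv p) =
      Polynomial.expand (Polynomial (ZMod 3)) 2 (redInv q) * Polynomial.X ^ 3 := by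
    apply Base0.χ_injective
    rw [map_add, map_mul, redA_χ, redA_χ, redA_c6] at h
    rw [map_mul, map_pow, Base0.χ_X]
    linear_combination h
  have hp : redInv p = 0 := by
    ext1 n
    have h2 := congrArg (fun t => Polynomial.coeff t (n * 2)) h1
    simp only [Polynomial.coeff_expand_mul (Nat.zero_lt_two), Polynomial.coeff_mul_X_pow'] at h2
    rw [h2, Polynomial.coeff_zero]
    split_ifs with h3
    · rw [Polynomial.coeff_expand Nat.zero_lt_two, if_neg (by omega)]
    · rfl
  rw [hp, map_zero] at h1
  have hq := (mul_eq_zero.1 h1.symm).resolve_right (pow_ne_zero 3 Polynomial.X_ne_zero)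
  have hq' := Polynomial.expand_injective Nat.zero_lt_two (hq.trans (map_zero _).symm)
  exact ⟨redInv_eq_zero hp, redInv_eq_zero hq'⟩

lemma redA_three_mul (x : MvPolynomial CVar Z3) : redA (3 * x) = 0 := by
  rw [map_mul, map_ofNat, three0, zero_mul]

lemma mem_S_of_three_mul {x : MvPolynomial CVar Z3} (h : 3 * x ∈ S) : x ∈ S := by
  obtain ⟨p, q, h⟩ := h
  obtain ⟨⟨p, rfl⟩, ⟨q, rfl⟩⟩ := three_dvd_of_redA (h ▸ redA_three_mul x)
  refine ⟨p, q, three_cancel (h.trans ?_)⟩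
  rw [map_mul, map_mul, map_ofNat]
  ring

lemma mem_S_of_three_pow_mul {x : MvPolynomial CVar Z3} (k : ℕ) (h : 3 ^ k * x ∈ S) : x ∈ S := by
  induction k with
  | zero => rwa [pow_zero, one_mul] at h
  | succ k ih => exact ih (mem_S_of_three_mul (by rwa [pow_succ', mul_assoc] at h))

lemma S_le : S ≤ inv := by
  rintro _ ⟨p, q, rfl⟩
  exact add_mem (χ_mem p) (mul_mem (χ_mem q) c6_mem)

/-- The invariants are generated by `c₄, c₆, Δ`. -/
lemma inv_eq : inv = S := by
  refine le_antisymm (fun x hx => ?_) S_le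
  obtain ⟨k, u, hu, v, hv, w, hw, h⟩ := exists_three_pow_mul_mem_N x
  have hk : (3 : MvPolynomial CVar Z3) ^ k * x ∈ inv := mul_mem (S_le (three_pow_mem_S k)) hx
  obtain ⟨h1, h2⟩ := mem_inv.1 hk
  obtain ⟨u1, u2⟩ := mem_inv.1 (S_le hu)
  rw [h, map_add, map_add, mul_comm v, mul_comm w, F1_mul _ (S_le hv), F1_mul _ (S_le hw), u1,
    F_a.1, F_a_sq.1] at h1
  rw [h, map_add, map_add, mul_comm v, mul_comm w, F2_mul _ (S_le hv), F2_mul _ (S_le hw), u2,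
    F_a.2, F_a_sq.2] at h2
  have w0 : w = 0 := three_cancel (three_cancel (by linear_combination h2))
  subst w0
  have v0 : v = 0 := three_cancel (by linear_combination -h1)
  subst v0
  refine mem_S_of_three_pow_mul k ?_
  rw [h, zero_mul, zero_mul, add_zero, add_zero]
  exact hu

lemma three_pow_dvd {p q : Inv} (h : χ p + χ q * c6 = 0) (k : ℕ) :
    (3 : Inv) ^ k ∣ p ∧ (3 : Inv) ^ k ∣ q := by
  induction k generalizing p q with
  | zero => exact ⟨by simp, by simp⟩
  | succ k ih =>
    obtain ⟨⟨p, rfl⟩, ⟨q, rfl⟩⟩ := three_dvd_of_redA ((congrArg redA h).trans (map_zero _))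
    have h' : χ p + χ q * c6 = 0 := three_cancel (by
      rw [map_mul, map_mul, map_ofNat] at h
      linear_combination h)
    obtain ⟨h1, h2⟩ := ih h'
    rw [pow_succ']
    exact ⟨mul_dvd_mul_left 3 h1, mul_dvd_mul_left 3 h2⟩

lemma eq_zero_of_three_pow_dvd {p : Inv} (h : ∀ k : ℕ, (3 : Inv) ^ k ∣ p) : p = 0 := by
  by_contra! hp
  have h3 : ¬ IsUnit (3 : Inv) := by
    intro h
    have h' := h.map (redInv : Inv →+* Base0.Inv)
    rw [map_ofNat, show (3 : Base0.Inv) = 0 from CharP.ofNat_eq_zero _ 3] at h'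
    exact not_isUnit_zero h'
  obtain ⟨n, hn⟩ := FiniteMultiplicity.of_not_isUnit (α := Inv) h3 hp
  exact hn (h _)

lemma χ_unique {p q : Inv} (h : χ p + χ q * c6 = 0) : p = 0 ∧ q = 0 :=
  ⟨eq_zero_of_three_pow_dvd fun k => (three_pow_dvd h k).1,
    eq_zero_of_three_pow_dvd fun k => (three_pow_dvd h k).2⟩

/-! ### Odd elements and the image of `F` -/

lemma redA_F (x : MvPolynomial CVar Z3) :
    R0.F (redA x) = ![redA x, redA (F1 x), redA (F2 x)] := by
  refine base0.F_eq 2 two_mul_two ?_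
  have hL : ∀ y, red0.f₁ (base'.ηL y) = base0.ηL (redA y) := fun y =>
    (RingHom.congr_fun red0.map_ηL y).trans (congrArg base0.ηL (RingHom.congr_fun redA_eq y).symm)
  have hR : ∀ y, red0.f₁ (base'.ηR y) = base0.ηR (redA y) := fun y =>
    (RingHom.congr_fun red0.map_ηR y).trans (congrArg base0.ηR (RingHom.congr_fun redA_eq y).symm)
  have hr : red0.f₁ base'.r = base0.r := CubicBase.homOf_r _ _ _ _ _
  rw [← hL, ← hR, ← hR, ← hR, ← hr]
  refine (congrArg red0.f₁ (ηL_eq x)).trans ?_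
  refine (map_add red0.f₁ _ _).trans (congrArg₂ (· + ·) ((map_add red0.f₁ _ _).trans
    (congrArg₂ (· + ·) rfl (map_mul red0.f₁ _ _))) ((map_mul red0.f₁ _ _).trans
      (congrArg (· * _) (map_pow red0.f₁ _ _))))

lemma redA_F1 (x : MvPolynomial CVar Z3) : redA (F1 x) = R0.F (redA x) 1 :=
  (congrFun (redA_F x) 1).symm

lemma redA_F2 (x : MvPolynomial CVar Z3) : redA (F2 x) = R0.F (redA x) 2 :=
  (congrFun (redA_F x) 2).symm

/-- Modulo `3`, a polynomial in `Δ` is a value of `F1` only if it vanishes. -/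
lemma three_dvd_of_eq_F1 {p : Polynomial Z3} {x : MvPolynomial CVar Z3} (h : χΔ p = F1 x) :
    (3 : Polynomial Z3) ∣ p := by
  apply polyRed_eq_zero
  have h1 : Base0.χΔ (Polynomial.mapRingHom redZ p) = R0.F (redA x) 1 := by
    rw [← redA_χΔ, h, redA_F1]
  obtain ⟨u, v, w, hx⟩ := Base0.exists_coords (redA x)
  have h4 : R0.F (redA x) 1 = _ := (congrArg (fun x => R0.F x 1) hx).trans (Base0.F1_coords u v w)
  rw [h4, ← Base0.χ_C] at h1
  have h2 := (Base0.coords_unique (p := Polynomial.C (Polynomial.mapRingHom redZ p)) (q := 0)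
    (s := 0) (p' := Polynomial.X * v) (q' := 2 * Polynomial.X * w) (s' := 0)
    (by rw [map_zero, zero_mul, zero_mul, add_zero, add_zero, add_zero]; exact h1)).1
  have h3 := congrArg (fun t => Polynomial.coeff t 0) h2
  simpa using h3

lemma three_dvd_of_eq_F2 {p : Polynomial Z3} {x : MvPolynomial CVar Z3} (h : χΔ p = F2 x) :
    (3 : Polynomial Z3) ∣ p := by
  refine three_dvd_of_eq_F1 (x := half * F1 x) ?_
  have hh : half ∈ inv := C_mem _
  rw [mul_comm, F1_mul _ hh, F1_F1, h]
  linear_combination (-F2 x) * two_half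

/-- Modulo values of `F1`, every odd element is a polynomial in `Δ`. -/
lemma exists_of_isOdd {x : MvPolynomial CVar Z3} (hx : F2 x = 0) :
    ∃ p w, x = χΔ p + F1 w := by
  have h0 : R0.IsOdd (redA x) := by
    constructor
    · exact congrFun (redA_F x) 0
    · exact (redA_F2 x).symm.trans ((congrArg redA hx).trans (map_zero _))
  obtain ⟨u, v, huv⟩ := Base0.exists_of_isOdd h0
  obtain ⟨u₀, u₁, rfl⟩ := Pres0.exists_divX u
  obtain ⟨v₀, v₁, rfl⟩ := Pres0.exists_divX v
  obtain ⟨p, hp⟩ := Polynomial.map_surjective redZ redZ_surjective u₀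
  obtain ⟨q, hq⟩ := Polynomial.map_surjective redZ redZ_surjective v₀
  obtain ⟨w, hw⟩ := redA_surjective (Base0.χ 0 + Base0.χ u₁ * base0.a4 +
    Base0.χ (2 * v₁) * base0.a4 ^ 2)
  have hw' : redA (F1 w) = Base0.χ (Polynomial.X * u₁) +
      Base0.χ (2 * Polynomial.X * (2 * v₁)) * base0.a4 := by
    rw [redA_F1]
    exact (congrArg (fun x => R0.F x 1) hw).trans (Base0.F1_coords _ _ _)
  obtain ⟨y, hy⟩ : ∃ y, x - χΔ p - c * χΔ q - F1 w = 3 * y := by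
    apply redA_eq_zero
    rw [map_sub, map_sub, map_sub, map_mul, huv, redA_χΔ, redA_χΔ, hw',
      show redA c = base0.a4 from redA_a4, Polynomial.coe_mapRingHom, hp, hq, ← Base0.χ_C,
      ← Base0.χ_C]
    simp only [map_add, map_mul, map_ofNat]
    linear_combination (-Base0.χ Polynomial.X * Base0.χ v₁ * base0.a4) * three0
  have h1 : -χΔ q = F2 y := by
    have h2 := congrArg F2 hy
    have h3 : (3 : MvPolynomial CVar Z3) ∈ inv := natCast_mem inv 3
    rw [map_sub, map_sub, map_sub, hx, (mem_inv.1 (χΔ_mem p)).2, F2_mul _ (χΔ_mem q), F_c.2,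
      F2_F1, mul_comm _ y, F2_mul _ h3] at h2
    exact three_cancel (by linear_combination h2)
  have h3 : χΔ (-q) = F2 y := (map_neg χΔ q).trans h1
  obtain ⟨q, rfl⟩ : (3 : Polynomial Z3) ∣ q :=
    (dvd_neg (α := Polynomial Z3)).1 (three_dvd_of_eq_F2 h3)
  have h2 : F2 (y + c * χΔ q) = 0 := by
    rw [map_add, F2_mul _ (χΔ_mem q), F_c.2, ← h1, map_mul, map_ofNat]
    ring
  refine ⟨p, w - (a * (y + c * χΔ q) + half * (c * F1 (y + c * χΔ q))), ?_⟩
  rw [sub_eq_add_neg, map_add, ← three_mul_eq_F1 h2]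
  rw [map_mul, map_ofNat] at hy
  linear_combination hy

/-- The values of `F2` lie in the ideal `(3, c₄, c₆)` of the ring of invariants. -/
lemma exists_F2_eq (x : MvPolynomial CVar Z3) : ∃ (p₀ : Polynomial Z3) (p₁ q : Inv),
    F2 x = 3 * χΔ p₀ + c4 * χ p₁ + χ q * c6 := by
  obtain ⟨p, q, h⟩ : F2 x ∈ S := inv_eq ▸ F2_mem_inv x
  have hp : χ p = χΔ (p.coeff 0) + c4 * χ p.divX := by
    conv_lhs => rw [← Polynomial.divX_mul_X_add p, map_add, map_mul, χ_X, χ_C]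
    ring
  have h1 : χΔ (p.coeff 0) = F2 (x - 16 * c ^ 2 * χ p.divX - 32 * (a * c ^ 2) * χ q) := by
    rw [map_sub, map_sub, F2_mul _ (χ_mem _), F2_mul _ (χ_mem _), ← c4_eq, ← c6_eq, h, hp]
    ring
  obtain ⟨p₀, hp₀⟩ := three_dvd_of_eq_F2 h1
  refine ⟨p₀, p.divX, q, ?_⟩
  rw [h, hp, hp₀, map_mul, map_ofNat]

end BaseZ

end EllCoh

namespace EllCoh

open Coh

lemma CubicBase.d_ξc {A : Type} [CommRing A] [Nontrivial A] (B : CubicBase A) (half : A)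
    (hh : 2 * half = 1) : Cobar.d B.ξc = 3 * B.βc := by
  have h1 : Cobar.d (B.cf B.a4 * B.br B.r) =
      2 * (B.cf B.a2 * (B.br B.r * B.br B.r)) + 3 * (B.br (B.r ^ 2) * B.br B.r) := by
    rw [d_cf_mul, d_cf_a4, d_br_r, mul_zero, add_zero, add_mul]
    noncomm_ring
  have h2 : Cobar.d (B.cf B.a2 * B.br (B.r ^ 2)) =
      3 * (B.br B.r * B.br (B.r ^ 2)) - 2 * (B.cf B.a2 * (B.br B.r * B.br B.r)) := by
    rw [d_cf_mul, d_cf_a2, B.d_br_r2 half hh]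
    noncomm_ring
  have h3 : Cobar.d B.ξc = Cobar.d (B.cf B.a4 * B.br B.r) + Cobar.d (B.cf B.a2 * B.br (B.r ^ 2)) :=
    map_add _ _ _
  rw [h3, h1, h2, βc, mul_add 3]
  abel

/-! ### The presentation of the cohomology of `(A', Γ')` -/

namespace PresE

open BaseZ

/-- The inclusion of the scalars. -/
def scalar : Z3 →+* PresE := (Ideal.Quotient.mk _).comp MvPolynomial.C

lemma closure : Subring.closure (Set.range scalar ∪ Set.range PresE.gen) = ⊤ := by
  have h := closure_image_eq_top (f := (Ideal.Quotient.mk _ : MvPolynomial GenE Z3 →+* PresE))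
    Ideal.Quotient.mk_surjective (MvPolynomial_closure Z3 GenE)
  rw [eq_top_iff, ← h]
  refine Subring.closure_mono ?_
  rintro _ ⟨_, ⟨x, rfl⟩ | ⟨v, rfl⟩, rfl⟩
  · exact Or.inl ⟨x, rfl⟩
  · exact Or.inr ⟨v, rfl⟩

section
open MvPolynomial

lemma mk_eq_zero {x : MvPolynomial GenE Z3}
    (h : x ∈ ({X GenE.c4 ^ 3 - X GenE.c6 ^ 2 - 1728 * X GenE.Δ,
    3 * X GenE.α, 3 * X GenE.β, X GenE.α ^ 2, X GenE.c4 * X GenE.α, X GenE.c6 * X GenE.α,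
    X GenE.c4 * X GenE.β, X GenE.c6 * X GenE.β} : Set (MvPolynomial GenE Z3))) :
    (Ideal.Quotient.mk relE x : PresE) = 0 :=
  Ideal.Quotient.eq_zero_iff_mem.2 (Ideal.subset_span h)

lemma c6_sq : gen .c6 * gen .c6 = gen .c4 ^ 3 - 1728 * gen .Δ := by
  have h : gen .c4 ^ 3 - gen .c6 ^ 2 - 1728 * gen .Δ = 0 := mk_eq_zero (by simp)
  linear_combination -h

lemma three_α : 3 * gen .α = 0 := mk_eq_zero (x := 3 * X GenE.α) (by simp)

lemma three_β : 3 * gen .β = 0 := mk_eq_zero (x := 3 * X GenE.β) (by simp)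

lemma α_sq : gen .α ^ 2 = 0 := mk_eq_zero (x := X GenE.α ^ 2) (by simp)

lemma c4_α : gen .c4 * gen .α = 0 := mk_eq_zero (x := X GenE.c4 * X GenE.α) (by simp)

lemma c6_α : gen .c6 * gen .α = 0 := mk_eq_zero (x := X GenE.c6 * X GenE.α) (by simp)

lemma c4_β : gen .c4 * gen .β = 0 := mk_eq_zero (x := X GenE.c4 * X GenE.β) (by simp)

lemma c6_β : gen .c6 * gen .β = 0 := mk_eq_zero (x := X GenE.c6 * X GenE.β) (by simp)

end

/-- The map `ℤ_(3)[Δ][c₄] → PresE`. -/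
def ι : Inv →+* PresE :=
  Polynomial.eval₂RingHom (Polynomial.eval₂RingHom scalar (gen .Δ)) (gen .c4)

lemma ι_X : ι Polynomial.X = gen .c4 := Polynomial.eval₂_X _ _

lemma ι_C (p : Polynomial Z3) :
    ι (Polynomial.C p) = Polynomial.eval₂RingHom scalar (gen .Δ) p := Polynomial.eval₂_C _ _

lemma ι_C_X : ι (Polynomial.C Polynomial.X) = gen .Δ := (ι_C _).trans (Polynomial.eval₂_X _ _)

lemma ι_C_C (k : Z3) : ι (Polynomial.C (Polynomial.C k)) = scalar k :=
  (ι_C _).trans (Polynomial.eval₂_C _ _)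

/-- The elements `ι p + c₆ ι q + α ι s` with `s` a polynomial in `Δ`. -/
def low : AddSubgroup PresE where
  carrier := {t | ∃ (p q : Inv) (s : Polynomial Z3),
    t = ι p + gen .c6 * ι q + gen .α * ι (Polynomial.C s)}
  zero_mem' := ⟨0, 0, 0, by simp⟩
  add_mem' := by
    rintro _ _ ⟨p, q, s, rfl⟩ ⟨p', q', s', rfl⟩
    exact ⟨p + p', q + q', s + s', by simp only [map_add]; ring⟩
  neg_mem' := by
    rintro _ ⟨p, q, s, rfl⟩
    have h : ∀ p : Inv, ι (-p) = -ι p := map_neg ι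
    have h' : Polynomial.C (-s) = -Polynomial.C s := map_neg Polynomial.C s
    exact ⟨-p, -q, -s, by rw [h', h, h, h]; ring⟩

lemma exhausts : Exhausts (gen .β) low := by
  intro P
  have h1 : ∃ (p q : Inv) (s : Polynomial Z3),
      (1 : PresE) = ι p + gen .c6 * ι q + gen .α * ι (Polynomial.C s) := ⟨1, 0, 0, by simp⟩
  refine ring_induction closure h1 (fun g _ => mul_comm (G := PresE) g _) ?_
  have hmul : ∀ p : Polynomial Z3, ∀ m ∈ low, ∃ m₁ ∈ low, ∃ m₂ ∈ low,
      ι (Polynomial.C p) * m = m₁ + gen .β * m₂ := by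
    rintro x _ ⟨p, q, s, rfl⟩
    refine ⟨_, ⟨Polynomial.C x * p, Polynomial.C x * q, x * s, rfl⟩, 0, zero_mem _, ?_⟩
    simp only [map_mul]
    ring
  rintro _ (⟨k, rfl⟩ | ⟨v, rfl⟩) m hm
  · rw [← ι_C_C]
    exact hmul _ m hm
  · cases v with
    | c4 =>
      obtain ⟨p, q, s, rfl⟩ := hm
      refine ⟨_, ⟨Polynomial.X * p, Polynomial.X * q, 0, rfl⟩, 0, zero_mem _, ?_⟩
      simp only [map_mul, map_zero, ι_X]
      linear_combination ι (Polynomial.C s) * c4_α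
    | c6 =>
      obtain ⟨p, q, s, rfl⟩ := hm
      refine ⟨_, ⟨(Polynomial.X ^ 3 - 1728 * Polynomial.C Polynomial.X) * q, p, 0, rfl⟩, 0,
        zero_mem _, ?_⟩
      have h : ι (Polynomial.X ^ 3 - 1728 * Polynomial.C Polynomial.X) =
          gen .c4 ^ 3 - 1728 * gen .Δ := by
        refine (map_sub ι _ _).trans ?_
        rw [map_pow, map_mul, ι_X, ι_C_X, map_ofNat]
      rw [map_mul, h, map_zero, map_zero]
      linear_combination ι (Polynomial.C s) * c6_α + ι q * c6_sq
    | Δ =>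
      rw [← ι_C_X]
      exact hmul _ m hm
    | α =>
      obtain ⟨p, q, s, rfl⟩ := hm
      refine ⟨_, ⟨0, 0, p.coeff 0, rfl⟩, 0, zero_mem _, ?_⟩
      have h : ι p = ι p.divX * gen .c4 + ι (Polynomial.C (p.coeff 0)) := by
        rw [← ι_X, ← map_mul, ← map_add, Polynomial.divX_mul_X_add]
      rw [h, map_zero]
      linear_combination ι p.divX * c4_α + ι q * c6_α + ι (Polynomial.C s) * α_sq
    | β => exact ⟨0, zero_mem _, m, hm, by rw [zero_add]⟩

end PresE

namespace BaseZ

/-- The inclusion of `ℤ_(3)[Δ][c₄]` in the ring of cocycles. -/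
def χ' : Inv →+* cocycles0 base'.hopf := χ.codRestrict _ χ_mem

/-- The class of `c₆`. -/
def c6' : cocycles0 base'.hopf := ⟨c6, c6_mem⟩

/-- The classes of the generators. -/
def genC : GenE → Coh base'.hopf
  | .c4 => ofA _ (χ' Polynomial.X)
  | .c6 => ofA _ c6'
  | .Δ => ofA _ (χ' (Polynomial.C Polynomial.X))
  | .α => R'.α
  | .β => R'.β

/-- The inclusion of `ℤ_(3)` in the cohomology of `(A', Γ')`. -/
def o' : Z3 →+* Coh base'.hopf := (ofA _).comp (χ'.comp (Polynomial.C.comp Polynomial.C))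

lemma genC_commute : ∀ x ∈ Set.range o' ∪ Set.range genC, ∀ y ∈ Set.range o' ∪ Set.range genC,
    x * y = y * x := by
  have ho : ∀ z h, ofA _ z * h = h * ofA _ z := fun z h => Coh.commute_ofA (H := base'.hopf) z h
  have h : ∀ x ∈ Set.range o' ∪ Set.range genC, (∃ z, x = ofA _ z) ∨ x = R'.α ∨ x = R'.β := by
    rintro _ (⟨k, rfl⟩ | ⟨v, rfl⟩)
    · exact Or.inl ⟨_, rfl⟩
    · cases v with
      | c4 => exact Or.inl ⟨_, rfl⟩
      | c6 => exact Or.inl ⟨_, rfl⟩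
      | Δ => exact Or.inl ⟨_, rfl⟩
      | α => exact Or.inr (Or.inl rfl)
      | β => exact Or.inr (Or.inr rfl)
  intro x hx y hy
  obtain ⟨z, rfl⟩ | hx := h x hx
  · exact ho _ _
  obtain ⟨z, rfl⟩ | hy := h y hy
  · exact (ho _ _).symm
  obtain rfl | rfl := hx <;> obtain rfl | rfl := hy
  · rfl
  · exact R'.commute_β_α.symm
  · exact R'.commute_β_α
  · rfl

/-- The map of the polynomial ring to the cohomology of `(A', Γ')`. -/
def polyMap : MvPolynomial GenE Z3 →+* Coh base'.hopf := mvLift o' genC genC_commute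

lemma polyMap_X (v : GenE) : polyMap (MvPolynomial.X v) = genC v := mvLift_X _ _ _ _

lemma α_mul_eq_zero (x : cocycles0 base'.hopf) {w : MvPolynomial CVar Z3} (h : x.1 = F1 w) :
    R'.α * ofA _ x = 0 := by
  rw [← R'.sCls_cocycle]
  exact (R'.sCls_congr h _).trans (R'.sCls_F w)

lemma β_mul_eq_zero (x : cocycles0 base'.hopf) {w : MvPolynomial CVar Z3} (h : x.1 = F2 w) :
    R'.β * ofA _ x = 0 := by
  have h' : x = ⟨R'.F w 2, R'.F2_mem w⟩ := Subtype.ext h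
  rw [h']
  exact R'.β_mul_F w

lemma F2_eq_F1 (w : MvPolynomial CVar Z3) : F2 w = F1 (half * F1 w) := by
  have hh : half ∈ inv := C_mem _
  rw [mul_comm, F1_mul _ hh, F1_F1]
  linear_combination (-F2 w) * two_half

lemma α_mul_eq_zero_of_F2 (x : cocycles0 base'.hopf) {w : MvPolynomial CVar Z3} (h : x.1 = F2 w) :
    R'.α * ofA _ x = 0 := α_mul_eq_zero x (h.trans (F2_eq_F1 w))

lemma three_eq : (3 : Coh base'.hopf) = ofA _ 3 := (map_ofNat _ _).symm

lemma three_eq_F2 : (3 : cocycles0 base'.hopf).1 = F2 c := F_c.2.symm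

lemma c4_eq_F2 : ((χ' Polynomial.X).1 : MvPolynomial CVar Z3) = F2 (16 * c ^ 2) :=
  χ_X.trans c4_eq

lemma three_mul_β : (3 : Coh base'.hopf) * R'.β = 0 := by
  rw [three_eq]
  exact (Coh.commute_ofA (H := base'.hopf) _ _).eq.trans (β_mul_eq_zero _ three_eq_F2)

lemma relE_le : relE ≤ RingHom.ker polyMap := by
  have ho : ∀ z h, ofA _ z * h = h * ofA _ z := fun z h => Coh.commute_ofA (H := base'.hopf) z h
  refine Ideal.span_le.2 ?_
  rintro _ (rfl | rfl | rfl | rfl | rfl | rfl | rfl | rfl)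
  · have h : (χ' Polynomial.X) ^ 3 - c6' ^ 2 - 1728 * χ' (Polynomial.C Polynomial.X) = 0 := by
      apply Subtype.ext
      have h1 := c6_sq
      have h2 : (χ Polynomial.X) ^ 3 - c6 ^ 2 - 1728 * χ (Polynomial.C Polynomial.X) = 0 := by
        rw [χ_X, χ_C, χΔ_X]
        linear_combination -h1
      exact h2
    rw [SetLike.mem_coe, RingHom.mem_ker]
    have h' := congrArg (ofA base'.hopf) h
    rw [map_zero, map_sub, map_sub, map_pow, map_pow, map_mul, map_ofNat] at h'
    refine (map_sub polyMap _ _).trans ?_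
    rw [map_sub, map_mul, map_pow, map_pow, map_ofNat, polyMap_X, polyMap_X, polyMap_X]
    exact h'
  · rw [SetLike.mem_coe, RingHom.mem_ker, map_mul, map_ofNat, polyMap_X, three_eq]
    exact (ho _ _).trans (α_mul_eq_zero_of_F2 _ three_eq_F2)
  · rw [SetLike.mem_coe, RingHom.mem_ker, map_mul, map_ofNat, polyMap_X]
    exact three_mul_β
  · rw [SetLike.mem_coe, RingHom.mem_ker, map_pow, polyMap_X, sq]
    exact R'.α_mul_α
  · rw [SetLike.mem_coe, RingHom.mem_ker, map_mul, polyMap_X, polyMap_X]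
    exact (ho _ _).trans (α_mul_eq_zero_of_F2 _ c4_eq_F2)
  · rw [SetLike.mem_coe, RingHom.mem_ker, map_mul, polyMap_X, polyMap_X]
    exact (ho _ _).trans (α_mul_eq_zero_of_F2 c6' c6_eq)
  · rw [SetLike.mem_coe, RingHom.mem_ker, map_mul, polyMap_X, polyMap_X]
    exact (ho _ _).trans (β_mul_eq_zero _ c4_eq_F2)
  · rw [SetLike.mem_coe, RingHom.mem_ker, map_mul, polyMap_X, polyMap_X]
    exact (ho _ _).trans (β_mul_eq_zero c6' c6_eq)

/-- The map of the presented algebra to the cohomology of `(A', Γ')`. -/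
def φ' : PresE →+* Coh base'.hopf := Ideal.Quotient.lift relE polyMap fun _ h => relE_le h

lemma φ'_gen (v : GenE) : φ' (PresE.gen v) = genC v := polyMap_X v

lemma φ'_ι (p : Inv) : φ' (PresE.ι p) = ofA _ (χ' p) := by
  have h : φ'.comp PresE.ι = (ofA _).comp χ' := by
    apply Polynomial.ringHom_ext'
    · apply Polynomial.ringHom_ext'
      · refine RingHom.ext fun k => ?_
        exact (congrArg φ' (PresE.ι_C_C k)).trans (mvLift_C _ _ _ _)
      · exact (congrArg φ' PresE.ι_C_X).trans (φ'_gen .Δ)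
    · exact (congrArg φ' PresE.ι_X).trans (φ'_gen .c4)
  exact RingHom.congr_fun h p

/-- The invariants, in terms of `c₄, c₆, Δ`. -/
def evenC (p q : Inv) : cocycles0 base'.hopf := χ' p + χ' q * c6'

lemma φ'_even (p q : Inv) : φ' (PresE.ι p + PresE.gen .c6 * PresE.ι q) = ofA _ (evenC p q) := by
  rw [map_add, map_mul, φ'_ι, φ'_ι, φ'_gen, evenC, map_add, map_mul]
  exact congrArg (_ + ·) (Coh.commute_ofA (H := base'.hopf) _ _)

lemma φ'_odd (s : Polynomial Z3) : φ' (PresE.gen .α * PresE.ι (Polynomial.C s)) =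
    R'.sCls _ (R'.isOdd_cocycle (χ' (Polynomial.C s))) := by
  rw [map_mul, φ'_ι, φ'_gen]
  exact (R'.sCls_cocycle _).symm

lemma α_mul_three (s : Polynomial Z3) :
    PresE.gen .α * PresE.ι (Polynomial.C (3 * s)) = 0 := by
  rw [map_mul, map_mul, map_ofNat, map_ofNat]
  linear_combination PresE.ι (Polynomial.C s) * PresE.three_α

/-- By `exists_of_isOdd` the odd elements modulo values of `F₁` are the polynomials in `Δ` modulo
`3`, and by `exists_F2_eq` the element `β` kills exactly the ideal `(3, c₄, c₆)` of the
invariants. -/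
lemma φ'_bijective : Function.Bijective φ' := by
  constructor
  · refine R'.injective_of_exhausts φ' (φ'_gen .β) PresE.exhausts ?_ ?_
    · rintro _ ⟨p, q, s, rfl⟩
      refine ⟨evenC p q, _, R'.isOdd_cocycle (χ' (Polynomial.C s)), ?_, ?_⟩
      · rw [map_add, φ'_even, φ'_odd]
      · rintro h0 ⟨w, hw⟩
        obtain ⟨rfl, rfl⟩ := χ_unique (congrArg Subtype.val h0)
        obtain ⟨s, rfl⟩ := three_dvd_of_eq_F1 (p := s) (x := w) ((χ_C s).symm.trans hw)
        rw [α_mul_three, map_zero, mul_zero, zero_add, zero_add]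
    · intro w
      obtain ⟨p₀, p₁, q, h⟩ := exists_F2_eq w
      refine ⟨PresE.ι (3 * Polynomial.C p₀ + Polynomial.X * p₁) + PresE.gen .c6 * PresE.ι q,
        ⟨3 * Polynomial.C p₀ + Polynomial.X * p₁, q, 0, by
          rw [map_zero, map_zero, mul_zero, add_zero]⟩, ?_, ?_⟩
      · rw [φ'_even]
        have h' : χ (3 * Polynomial.C p₀ + Polynomial.X * p₁) + χ q * c6 = F2 w := by
          rw [h, map_add, map_mul, map_mul, χ_X, χ_C, map_ofNat]
        exact congrArg (ofA _) (Subtype.ext h')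
      · rw [map_add, map_mul, map_mul, PresE.ι_X, map_ofNat]
        linear_combination PresE.ι (Polynomial.C p₀) * PresE.three_β +
          PresE.ι p₁ * PresE.c4_β + PresE.ι q * PresE.c6_β
  · refine R'.surjective_of φ' (φ'_gen .β) ?_ ?_
    · intro x
      obtain ⟨p, q, h⟩ : x.1 ∈ S := inv_eq ▸ x.2
      exact ⟨_, (φ'_even p q).trans (congrArg (ofA _) (Subtype.ext h.symm))⟩
    · intro b hb
      obtain ⟨p, w, h⟩ := exists_of_isOdd (isOdd_iff.1 hb)
      refine ⟨_, (φ'_odd p).trans ?_⟩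
      have h1 := R'.sCls_add (R'.isOdd_cocycle (χ' (Polynomial.C p))) (R'.isOdd_F w)
      rw [R'.sCls_F w, add_zero] at h1
      rw [← h1]
      exact R'.sCls_congr ((congrArg (· + F1 w) (χ_C p)).trans h.symm) _

/-- The isomorphism of the presented algebra with the cohomology of `(A', Γ')`. -/
def e' : PresE ≃+* Coh base'.hopf := RingEquiv.ofBijective φ' φ'_bijective

/-! ### Degrees and Massey products in the cohomology of `(A', Γ')` -/

lemma weight_C (k : Z3) : MvPolynomial.IsWeightedHomogeneous CVar.deg
    (MvPolynomial.C k : MvPolynomial CVar Z3) 0 := MvPolynomial.isWeightedHomogeneous_C _ _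

lemma weight_a : MvPolynomial.IsWeightedHomogeneous CVar.deg a 4 :=
  MvPolynomial.isWeightedHomogeneous_X Z3 CVar.deg CVar.a2

lemma weight_c : MvPolynomial.IsWeightedHomogeneous CVar.deg c 8 :=
  MvPolynomial.isWeightedHomogeneous_X Z3 CVar.deg CVar.a4

lemma weight_ofNat (n : ℕ) [n.AtLeastTwo] : MvPolynomial.IsWeightedHomogeneous CVar.deg
    (ofNat(n) : MvPolynomial CVar Z3) 0 := by
  have h := weight_C (ofNat(n) : Z3)
  rwa [map_ofNat] at h

lemma weight_sub {x y : MvPolynomial CVar Z3} {m : ℤ}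
    (hx : MvPolynomial.IsWeightedHomogeneous CVar.deg x m)
    (hy : MvPolynomial.IsWeightedHomogeneous CVar.deg y m) :
    MvPolynomial.IsWeightedHomogeneous CVar.deg (x - y) m :=
  (MvPolynomial.weightedHomogeneousSubmodule Z3 CVar.deg m).sub_mem hx hy

lemma weight_c4 : MvPolynomial.IsWeightedHomogeneous CVar.deg c4 8 :=
  (weight_ofNat 16).mul (weight_sub (weight_a.pow 2) ((weight_ofNat 3).mul weight_c))

lemma weight_c6 : MvPolynomial.IsWeightedHomogeneous CVar.deg c6 12 :=
  (MvPolynomial.weightedHomogeneousSubmodule Z3 CVar.deg 12).neg_mem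
    ((weight_ofNat 32).mul (weight_sub ((weight_ofNat 2).mul (weight_a.pow 3))
      (((weight_ofNat 9).mul weight_a).mul weight_c)))

lemma weight_Δ : MvPolynomial.IsWeightedHomogeneous CVar.deg Δ 24 :=
  ((weight_ofNat 16).mul (weight_c.pow 2)).mul
    (weight_sub (weight_a.pow 2) ((weight_ofNat 4).mul weight_c))

lemma represents_c4 : Represents (base'.cf c4) (genC .c4) :=
  ⟨c4_mem, clsOf_congr (congrArg base'.cf χ_X.symm) _⟩

lemma represents_c6 : Represents (base'.cf c6) (genC .c6) := ⟨c6_mem, rfl⟩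

lemma represents_Δ : Represents (base'.cf Δ) (genC .Δ) :=
  ⟨Δ_mem, clsOf_congr (congrArg base'.cf ((χ_C _).trans χΔ_X).symm) _⟩

lemma c4_mem_bigr : genC .c4 ∈ bigr deg' 0 8 := ⟨_, .coeff _ _ weight_c4, represents_c4⟩

lemma c6_mem_bigr : genC .c6 ∈ bigr deg' 0 12 := ⟨_, .coeff _ _ weight_c6, represents_c6⟩

lemma Δ_mem_bigr : genC .Δ ∈ bigr deg' 0 24 := ⟨_, .coeff _ _ weight_Δ, represents_Δ⟩

lemma one_mem : (1 : MvPolynomial CVar Z3) ∈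
    (MvPolynomial.weightedHomogeneousSubmodule Z3 CVar.deg 0).toAddSubgroup :=
  MvPolynomial.isWeightedHomogeneous_one _ _

lemma α_mem_bigr : genC .α ∈ bigr deg' 1 4 := base'.α_mem_bigr _ _ one_mem

lemma β_mem_bigr : genC .β ∈ bigr deg' 2 12 := base'.β_mem_bigr _ _ one_mem

lemma o'_mem (k : Z3) : o' k ∈ bigr deg' 0 0 :=
  ⟨base'.cf (MvPolynomial.C k), .coeff _ _ (weight_C k), C_mem k,
    clsOf_congr (congrArg base'.cf ((χ_C _).trans (χΔ_C k)).symm) _⟩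

/-- The monomials in `PresE.low`. -/
def mons (p : ℕ × ℤ) : Set PresE :=
  {t | ∃ (k : Z3) (i j : ℕ), (p = (0, 8 * (j : ℤ) + 24 * (i : ℤ)) ∧
      t = PresE.ι (Polynomial.C (Polynomial.C k * Polynomial.X ^ i) * Polynomial.X ^ j)) ∨
    (p = (0, 12 + (8 * (j : ℤ) + 24 * (i : ℤ))) ∧ t = PresE.gen .c6 *
      PresE.ι (Polynomial.C (Polynomial.C k * Polynomial.X ^ i) * Polynomial.X ^ j)) ∨
    (p = (1, 4 + 24 * (i : ℤ)) ∧
      t = PresE.gen .α * PresE.ι (Polynomial.C (Polynomial.C k * Polynomial.X ^ i)))}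

/-- The homogeneous monomials span the part of the presented ring without `β`. -/
lemma low_le : PresE.low ≤ AddSubgroup.closure (⋃ p, mons p) := by
  have h1 : ∀ p, PresE.ι p ∈ AddSubgroup.closure (⋃ p, mons p) := by
    intro p
    induction p using Polynomial.induction_on' with
    | add p q hp hq => rw [map_add]; exact add_mem hp hq
    | monomial j p =>
      rw [← Polynomial.C_mul_X_pow_eq_monomial]
      induction p using Polynomial.induction_on' with
      | add p q hp hq => rw [map_add, add_mul, map_add]; exact add_mem hp hq
      | monomial i k =>
        rw [← Polynomial.C_mul_X_pow_eq_monomial]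
        exact AddSubgroup.subset_closure (Set.mem_iUnion.2 ⟨_, k, i, j, Or.inl ⟨rfl, rfl⟩⟩)
  have h2 : ∀ p, PresE.gen .c6 * PresE.ι p ∈ AddSubgroup.closure (⋃ p, mons p) := by
    intro p
    induction p using Polynomial.induction_on' with
    | add p q hp hq => rw [map_add, mul_add]; exact add_mem hp hq
    | monomial j p =>
      rw [← Polynomial.C_mul_X_pow_eq_monomial]
      induction p using Polynomial.induction_on' with
      | add p q hp hq => rw [map_add, add_mul, map_add, mul_add]; exact add_mem hp hq
      | monomial i k =>
        rw [← Polynomial.C_mul_X_pow_eq_monomial]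
        exact AddSubgroup.subset_closure
          (Set.mem_iUnion.2 ⟨_, k, i, j, Or.inr (Or.inl ⟨rfl, rfl⟩)⟩)
  have h3 : ∀ p, PresE.gen .α * PresE.ι (Polynomial.C p) ∈
      AddSubgroup.closure (⋃ p, mons p) := by
    intro p
    induction p using Polynomial.induction_on' with
    | add p q hp hq => rw [map_add, map_add, mul_add]; exact add_mem hp hq
    | monomial i k =>
      rw [← Polynomial.C_mul_X_pow_eq_monomial]
      exact AddSubgroup.subset_closure
        (Set.mem_iUnion.2 ⟨_, k, i, 0, Or.inr (Or.inr ⟨rfl, rfl⟩)⟩)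
  rintro _ ⟨p, q, s, rfl⟩
  exact add_mem (add_mem (h1 p) (h2 q)) (h3 s)

lemma φ'_monomial (k : Z3) (i j : ℕ) :
    φ' (PresE.ι (Polynomial.C (Polynomial.C k * Polynomial.X ^ i) * Polynomial.X ^ j)) =
      o' k * genC .Δ ^ i * genC .c4 ^ j := by
  simp only [φ'_ι, map_mul, map_pow]
  rfl

lemma mon_mem (k : Z3) (i j : ℕ) : φ' (PresE.ι
    (Polynomial.C (Polynomial.C k * Polynomial.X ^ i) * Polynomial.X ^ j)) ∈
      bigr deg' 0 (8 * j + 24 * i) := by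
  rw [φ'_monomial]
  exact bigr_cast (bigr_mul (bigr_mul (o'_mem k) (bigr_pow grad'.one_mem_bigr Δ_mem_bigr i))
    (bigr_pow grad'.one_mem_bigr c4_mem_bigr j)) (by simp) (by ring)

lemma mons_homog (p : ℕ × ℤ) : ∀ t ∈ mons p, φ' t ∈ bigr deg' p.1 p.2 := by
  have h : ∀ (k : Z3) (i : ℕ),
      φ' (PresE.ι (Polynomial.C (Polynomial.C k * Polynomial.X ^ i))) ∈
        bigr deg' 0 (24 * i) := fun k i => by
    have := mon_mem k i 0
    rw [pow_zero, mul_one] at this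
    exact bigr_cast this rfl (by simp)
  rintro t ⟨k, i, j, ⟨rfl, rfl⟩ | ⟨rfl, rfl⟩ | ⟨rfl, rfl⟩⟩
  · exact mon_mem k i j
  · rw [map_mul, φ'_gen]
    exact bigr_mul c6_mem_bigr (mon_mem k i j)
  · rw [map_mul, φ'_gen]
    exact bigr_mul α_mem_bigr (h k i)

lemma φ'_β_mem : φ' (PresE.gen .β) ∈ bigr deg' 2 12 := by
  rw [φ'_gen]
  exact β_mem_bigr

lemma isInternal : DirectSum.IsInternal (fun p : ℕ × ℤ => bigr deg' p.1 p.2) :=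
  PresE.exhausts.isInternal grad' φ'_bijective.2 φ'_β_mem mons_homog low_le

lemma bigr_eq (n : ℕ) (m : ℤ) :
    bigr deg' n m = AddSubgroup.closure (Exhausts.powers φ' (PresE.gen .β) mons (n, m)) :=
  PresE.exhausts.bigr_eq grad' φ'_bijective.2 φ'_β_mem mons_homog low_le n m

lemma bigr_1_8 : bigr deg' 1 8 = ⊥ := by
  rw [bigr_eq, AddSubgroup.closure_eq_bot_iff]
  rintro _ ⟨i, q, t, ⟨k, l, j, ⟨rfl, rfl⟩ | ⟨rfl, rfl⟩ | ⟨rfl, rfl⟩⟩, h1, h2, rfl⟩ <;>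
    dsimp only at h1 h2 <;> omega

lemma massey_α_α_α : massey deg' 1 4 1 4 1 4 R'.α R'.α R'.α = {R'.β} :=
  base'.massey_α half two_half one_mem (weight_C _) grad' three_mul_β bigr_1_8

end BaseZ

end EllCoh

namespace EllCoh
open Coh

/-! ### Maps of Hopf algebroids with compatible cubic resolutions -/

namespace CubicResolution

variable {H K : HopfAlgebroid} (R : CubicResolution H) (R' : CubicResolution K)
  (f : HopfHom H K)

/-- A map of Hopf algebroids is compatible with cubic resolutions if it preserves `r` and the
coordinates `F` of the left unit. -/
structure Compatible : Prop where
  r : f.f₁ R.r = R'.r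
  F : ∀ a i, f.f₀ (R.F a i) = R'.F (f.f₀ a) i

namespace Compatible

variable {R R' f}

lemma map_half : f.f₀ R.half = R'.half := by
  have h := congrArg f.f₀ R.two_half
  rw [map_mul, map_ofNat, map_one] at h
  linear_combination R'.half * h - f.f₀ R.half * R'.two_half

lemma isOdd (hf : R.Compatible R' f) {b : H.A} (hb : R.IsOdd b) : R'.IsOdd (f.f₀ b) :=
  ⟨by rw [← hf.F, hb.1], by rw [← hf.F, hb.2, map_zero]⟩

lemma mem_cocycles0 {a : H.A} (ha : a ∈ cocycles0 H) : f.f₀ a ∈ cocycles0 K := by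
  rw [EllCoh.mem_cocycles0, ← Cobar.map_coeff, ← Cobar.map_d, EllCoh.mem_cocycles0.1 ha, map_zero]

lemma map_ofA (a : cocycles0 H) : map f (ofA H a) = ofA K ⟨f.f₀ a.1, mem_cocycles0 a.2⟩ := by
  rw [ofA_eq, map_clsOf]
  exact clsOf_congr (Cobar.map_coeff _ _) _

lemma map_sCls (hf : R.Compatible R' f) {b : H.A} (hb : R.IsOdd b) :
    map f (R.sCls b hb) = R'.sCls (f.f₀ b) (hf.isOdd hb) := by
  rw [sCls, map_clsOf]
  refine clsOf_congr ?_ _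
  rw [s, s, h, h, map_add, map_mul, map_mul, map_mul, Cobar.map_bar, Cobar.map_bar,
    Cobar.map_coeff, Cobar.map_coeff, Cobar.map_coeff, map_pow, hf.r, hf.F,
    map_half (R := R) (R' := R')]

variable (R) in
/-- The sums of classes of degree `0` and `1`. -/
def low : AddSubgroup (Coh H) where
  carrier := {q | ∃ a b, ∃ hb : R.IsOdd b, q = ofA H a + R.sCls b hb}
  zero_mem' := ⟨0, R.F 0 1, R.isOdd_F 0, by rw [sCls_F, map_zero, add_zero]⟩
  add_mem' := by
    rintro _ _ ⟨a, b, hb, rfl⟩ ⟨a', b', hb', rfl⟩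
    refine ⟨a + a', b + b', hb.add R hb', ?_⟩
    rw [map_add, sCls_add R hb hb']
    abel
  neg_mem' := by
    rintro _ ⟨a, b, hb, rfl⟩
    refine ⟨-a, R.F 0 1 - b, (R.isOdd_F 0).sub R hb, ?_⟩
    rw [map_neg, sCls_sub R (R.isOdd_F 0) hb, sCls_F]
    abel

/-- A compatible map that is surjective on `A` and whose kernel is killed by `F` is an isomorphism
in cohomology. -/
lemma bijective (hf : R.Compatible R' f) (hs : Function.Surjective f.f₀)
    (h0 : ∀ a, f.f₀ a = 0 → R.F a = 0) : Function.Bijective (map f) := by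
  have hβ : map f R.β = R'.β := map_β R f R' hf.r
  have key : ∀ b, f.f₀ b = 0 → R.F b 0 = b → b = 0 := fun b hb hb' => by
    rw [← hb', h0 b hb, Pi.zero_apply]
  have hc : ∀ a, R.F a 2 ∈ cocycles0 H := R.F2_mem
  constructor
  · refine R'.injective_of_exhausts (map f) (M := low R) hβ ?_ ?_ ?_
    · intro P hP0 hP q
      refine R.coh_induction hP0 (fun a b hb h hh => hP _ ?_ _ hh) q
      exact ⟨a, b, hb, rfl⟩
    · rintro _ ⟨a, b, hb, rfl⟩
      refine ⟨_, _, hf.isOdd hb, by rw [map_add, map_ofA, hf.map_sCls], ?_⟩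
      rintro ha ⟨c', hc'⟩
      obtain ⟨c, rfl⟩ := hs c'
      have ha' : a = 0 := Subtype.ext (key _ (congrArg Subtype.val ha)
        (congrFun (R.F_cocycle a) 0))
      have hb' : b = R.F c 1 := sub_eq_zero.1 (key _ (by rw [map_sub, hc', hf.F, sub_self])
        (hb.sub R (R.isOdd_F c)).1)
      rw [ha', map_zero, zero_add, R.sCls_congr hb' hb, sCls_F]
    · intro c'
      obtain ⟨c, rfl⟩ := hs c'
      refine ⟨ofA H ⟨R.F c 2, hc c⟩, ?_, ?_, R.β_mul_F c⟩
      · have h : ∃ a b, ∃ hb : R.IsOdd b, ofA H ⟨R.F c 2, hc c⟩ = ofA H a + R.sCls b hb :=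
          ⟨_, R.F 0 1, R.isOdd_F 0, by rw [sCls_F, add_zero]⟩
        exact h
      · rw [map_ofA]
        exact congrArg (ofA K) (Subtype.ext (hf.F c 2))
  -- If `F' b 0 = b` and `x` lifts `b`, then `F x 0` is another lift, with `F (F x 0) = F x`.
  · have lift : ∀ b, R'.F b 0 = b → ∃ x, f.f₀ x = b ∧ R.F x 0 = x := by
      intro b hb
      obtain ⟨x, rfl⟩ := hs b
      have hx : f.f₀ (R.F x 0) = f.f₀ x := by rw [hf.F, hb]
      refine ⟨R.F x 0, hx, ?_⟩
      have := h0 (R.F x 0 - x) (by rw [map_sub, hx, sub_self])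
      rw [map_sub, sub_eq_zero] at this
      rw [this]
    have lift2 : ∀ x, R'.F (f.f₀ x) 2 = 0 → R.F x 2 = 0 := fun x hx =>
      key _ (by rw [hf.F, hx]) (congrFun (R.F_cocycle ⟨_, hc x⟩) 0)
    refine R'.surjective_of (map f) hβ ?_ ?_
    · intro a
      have ha := R'.F_cocycle a
      obtain ⟨x, hx, hx0⟩ := lift a.1 (congrFun ha 0)
      have hx1 : R.F x 1 = 0 := key _ (by rw [hf.F, hx, ha]; rfl) (R.isOdd_F x).1
      have hx2 : R.F x 2 = 0 := lift2 x (by rw [hx, ha]; rfl)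
      refine ⟨ofA H ⟨x, R.mem_cocycles0_of_F hx0 hx1 hx2⟩, ?_⟩
      rw [map_ofA]
      exact congrArg (ofA K) (Subtype.ext hx)
    · intro b hb
      obtain ⟨x, hx, hx0⟩ := lift b hb.1
      have hx' : R.IsOdd x := ⟨hx0, lift2 x (by rw [hx, hb.2])⟩
      exact ⟨R.sCls x hx', by rw [hf.map_sCls hx', R'.sCls_congr hx]⟩

end Compatible
end CubicResolution

end EllCoh

namespace EllCoh
open Coh

/-! ### The comparison of the elliptic curve Hopf algebroid with `(A', Γ')` -/

namespace W

lemma proj_a1 : proj₀ a1 = 0 := MvPolynomial.eval₂Hom_X' _ _ _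
lemma proj_a2 : proj₀ a2 = BaseZ.a := MvPolynomial.eval₂Hom_X' _ _ _
lemma proj_a3 : proj₀ a3 = 0 := MvPolynomial.eval₂Hom_X' _ _ _
lemma proj_a4 : proj₀ a4 = BaseZ.c := MvPolynomial.eval₂Hom_X' _ _ _
lemma proj_a6 : proj₀ a6 = 0 := MvPolynomial.eval₂Hom_X' _ _ _

lemma proj_e2 : proj₀ e2 = BaseZ.a := by
  rw [e2, map_add, map_mul, map_pow, map_pow, proj_a1, proj_a2]
  ring

lemma proj_e4 : proj₀ e4 = BaseZ.c := by
  rw [e4, map_add, map_mul, map_mul, proj_a1, proj_a4]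
  ring

lemma proj_e6 : proj₀ e6 = 0 := by
  rw [e6, map_add, map_mul, map_pow, map_pow, proj_a3, proj_a6]
  ring

/-- The base change of `P` along `A → A'` is `Γ'`, with `A'` acting through the right unit. -/
def projP : P →+* base'.Γ :=
  liftPB (RingHom.id WA) (base'.ηR.comp proj₀) base'.r (by
    rw [RingHom.comp_apply, RingHom.comp_apply, RingHom.comp_apply, RingHom.id_apply,
      RingHom.id_apply, RingHom.id_apply, proj_e2, proj_e4, proj_e6, map_zero, BaseZ.relR]
    ring)

lemma projP_ofP (a : WA) : projP (ofP a) = base'.ηR (proj₀ a) :=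
  liftPB_ofPB (RingHom.id WA) _ _ _ a

lemma projP_ρ : projP ρ = base'.r := liftPB_rootPB (RingHom.id WA) _ _ _

lemma projP_fP (a : WA) : projP (fP a) = base'.ηL (proj₀ a) := by
  refine RingHom.congr_fun (A_ext (f := projP.comp fP) (g := base'.ηL.comp proj₀) ?_ ?_ ?_ ?_ ?_) a
  all_goals rw [RingHom.comp_apply, RingHom.comp_apply]
  · rw [fP_a1, proj_a1, map_zero, map_zero]
  · rw [fP_a2, proj_a2, BaseZ.ηL_a]
    simp only [map_sub, map_mul, map_ofNat, projP_ofP, projP_ρ, proj_e2]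
  · rw [fP_a3, proj_a3, map_zero, map_zero]
  · rw [fP_a4, proj_a4, BaseZ.ηL_c]
    simp only [map_sub, map_add, map_mul, map_pow, map_ofNat, projP_ofP, projP_ρ, proj_e2, proj_e4]
  · rw [fP_a6, proj_a6, map_zero, map_zero]

lemma F_eq_coordP (a : WA) : resolution.F a = coordP (fP a) := congrArg coordP (πP_ηL a)

lemma proj_F (a : WA) (i : Fin 3) : proj₀ (resolution.F a i) = R'.F (proj₀ a) i := by
  have h := congrArg projP (coordP_sum (fP a))
  simp only [projP_fP, map_add, map_mul, map_pow, projP_ofP, projP_ρ] at h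
  have h' := base'.F_eq BaseZ.half BaseZ.two_half (h.trans (by ring) :
    base'.ηL (proj₀ a) = base'.ηR (proj₀ (coordP (fP a) 0)) +
      base'.r * base'.ηR (proj₀ (coordP (fP a) 1)) +
        base'.r ^ 2 * base'.ηR (proj₀ (coordP (fP a) 2)))
  refine Eq.trans ?_ (congrFun h' i).symm
  rw [F_eq_coordP]
  fin_cases i <;> rfl

/-- The map `fP` only depends on the curve with equation `y² = x³ + a₂ x² + a₄ x`. -/
lemma exists_fP_eq : ∃ g : MvPolynomial CVar Z3 →+* P, ∀ a, fP a = g (proj₀ a) := by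
  let g : MvPolynomial CVar Z3 →+* P := MvPolynomial.eval₂Hom (ofP.comp MvPolynomial.C)
    (fun v => match v with | .a2 => fP a2 | .a4 => fP a4)
  have h2 : g BaseZ.a = fP a2 := MvPolynomial.eval₂Hom_X' _ _ _
  have h4 : g BaseZ.c = fP a4 := MvPolynomial.eval₂Hom_X' _ _ _
  refine ⟨g, RingHom.congr_fun (A_ext (f := fP) (g := g.comp proj₀) ?_ ?_ ?_ ?_ ?_)⟩
  all_goals rw [RingHom.comp_apply]
  · rw [fP_a1, proj_a1, map_zero]
  · rw [proj_a2, h2]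
  · rw [fP_a3, proj_a3, map_zero]
  · rw [proj_a4, h4]
  · rw [fP_a6, proj_a6, map_zero]

lemma F_eq_zero {a : WA} (ha : proj₀ a = 0) : resolution.F a = 0 := by
  obtain ⟨g, hg⟩ := exists_fP_eq
  rw [F_eq_coordP, hg, ha, map_zero, map_zero]
  rfl

lemma proj₀_surjective : Function.Surjective proj₀ := by
  let j : MvPolynomial CVar Z3 →+* WA := MvPolynomial.eval₂Hom MvPolynomial.C
    (fun v => match v with | .a2 => a2 | .a4 => a4)
  have h2 : j BaseZ.a = a2 := MvPolynomial.eval₂Hom_X' _ _ _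
  have h4 : j BaseZ.c = a4 := MvPolynomial.eval₂Hom_X' _ _ _
  refine fun x => ⟨j x, RingHom.congr_fun (base'.hom_ext _ (proj₀.comp j) (RingHom.id _) ?_ ?_) x⟩
  · exact (congrArg proj₀ h2).trans proj_a2
  · exact (congrArg proj₀ h4).trans proj_a4

lemma proj_r : proj₁ r = base'.r := ΓLift_r _ _ _ _
lemma proj_s : proj₁ s = 0 := ΓLift_s _ _ _ _
lemma proj_t : proj₁ t = 0 := ΓLift_t _ _ _ _
lemma proj_ηL (a : WA) : proj₁ (ηL a) = base'.ηL (proj₀ a) := ΓLift_ηL' _ _ _ _ a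

lemma compatible : resolution.Compatible R' proj := ⟨proj_r, proj_F⟩

/-- The reduction to `(A', Γ')` is an isomorphism in cohomology. -/
theorem bijective_map_proj : Function.Bijective (Coh.map proj) :=
  compatible.bijective proj₀_surjective fun _ => F_eq_zero

end W

end EllCoh

namespace EllCoh
open Coh

/-! ### The classical invariants of the elliptic curve Hopf algebroid -/

namespace W

lemma ηR_b2 : ηR b2 = ηL b2 + 12 * r := by
  simp only [b2, map_add, map_mul, map_pow, map_ofNat, ηR_a1, ηR_a2]
  ring

lemma ηR_b4 : ηR b4 = ηL b4 + r * ηL b2 + 6 * r ^ 2 := by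
  simp only [b4, b2, map_add, map_mul, map_pow, map_ofNat, ηR_a1, ηR_a3, ηR_a4]
  ring

lemma ηR_b6 : ηR b6 = ηL b6 + 2 * r * ηL b4 + r ^ 2 * ηL b2 + 4 * r ^ 3 := by
  simp only [b6, b4, b2, map_add, map_mul, map_pow, map_ofNat, ηR_a3, ηR_a6]
  ring

lemma ηR_b8 : ηR b8 = ηL b8 + 3 * r * ηL b6 + 3 * r ^ 2 * ηL b4 + r ^ 3 * ηL b2 + 3 * r ^ 4 := by
  simp only [b8, b6, b4, b2, map_add, map_sub, map_mul, map_pow, map_ofNat, ηR_a1, ηR_a2, ηR_a3,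
    ηR_a4, ηR_a6]
  generalize ηL a1 = x1, ηL a2 = x2, ηL a3 = x3, ηL a4 = x4, ηL a6 = x6, r = r, s = s, t = t
  ring

lemma ηR_c4 : ηR c4 = ηL c4 := by
  simp only [c4, map_sub, map_mul, map_pow, map_ofNat, ηR_b2, ηR_b4]
  ring

lemma ηR_c6 : ηR c6 = ηL c6 := by
  simp only [c6, map_sub, map_add, map_neg, map_mul, map_pow, map_ofNat, ηR_b2, ηR_b4, ηR_b6]
  ring

lemma four_mul_b8 : 4 * b8 = b2 * b6 - b4 ^ 2 := by
  simp only [b8, b6, b4, b2]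
  ring

lemma ηR_Δ : ηR Δ = ηL Δ := by
  have h := congrArg ηL four_mul_b8
  simp only [Δ, map_sub, map_add, map_neg, map_mul, map_pow, map_ofNat, ηR_b2, ηR_b4, ηR_b6,
    ηR_b8] at h ⊢
  linear_combination (-6 * r * ηL b2 - 36 * r ^ 2) * h

lemma proj_c4 : proj₀ c4 = BaseZ.c4 := by
  simp only [c4, b2, b4, map_sub, map_add, map_mul, map_pow, map_ofNat, proj_a1, proj_a2, proj_a3,
    proj_a4, BaseZ.c4]
  ring

lemma proj_c6 : proj₀ c6 = BaseZ.c6 := by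
  simp only [c6, b2, b4, b6, map_sub, map_add, map_neg, map_mul, map_pow, map_ofNat, proj_a1,
    proj_a2, proj_a3, proj_a4, proj_a6, BaseZ.c6]
  ring

lemma proj_Δ : proj₀ Δ = BaseZ.Δ := by
  simp only [Δ, b2, b4, b6, b8, map_sub, map_add, map_neg, map_mul, map_pow, map_ofNat, proj_a1,
    proj_a2, proj_a3, proj_a4, proj_a6, BaseZ.Δ]
  ring

lemma d_cf {x : WA} (h : ηR x = ηL x) : Cobar.d (cf x) = 0 :=
  mem_cocycles0.1 ((mem_cocycles0_iff (H := weierstrass)).2 h)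

/-! ### Degrees -/

/-- The homogeneous elements of `A_(3)`. -/
abbrev Wt (x : WA) (m : ℤ) : Prop := MvPolynomial.IsWeightedHomogeneous WVar.deg x m

lemma wt_a1 : Wt a1 2 := MvPolynomial.isWeightedHomogeneous_X Z3 WVar.deg WVar.a1
lemma wt_a2 : Wt a2 4 := MvPolynomial.isWeightedHomogeneous_X Z3 WVar.deg WVar.a2
lemma wt_a3 : Wt a3 6 := MvPolynomial.isWeightedHomogeneous_X Z3 WVar.deg WVar.a3
lemma wt_a4 : Wt a4 8 := MvPolynomial.isWeightedHomogeneous_X Z3 WVar.deg WVar.a4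
lemma wt_a6 : Wt a6 12 := MvPolynomial.isWeightedHomogeneous_X Z3 WVar.deg WVar.a6

lemma wt_C (k : Z3) : Wt (MvPolynomial.C k) 0 := MvPolynomial.isWeightedHomogeneous_C _ _

lemma wt_ofNat (n : ℕ) [n.AtLeastTwo] : Wt (ofNat(n) : WA) 0 := by
  have h := wt_C (ofNat(n) : Z3)
  rwa [map_ofNat] at h

lemma Wt.sub {x y : WA} {m : ℤ} (hx : Wt x m) (hy : Wt y m) : Wt (x - y) m :=
  (MvPolynomial.weightedHomogeneousSubmodule Z3 WVar.deg m).sub_mem hx hy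

lemma Wt.neg {x : WA} {m : ℤ} (hx : Wt x m) : Wt (-x) m :=
  (MvPolynomial.weightedHomogeneousSubmodule Z3 WVar.deg m).neg_mem hx

lemma wt_b2 : Wt b2 4 := (wt_a1.pow 2).add ((wt_ofNat 4).mul wt_a2)
lemma wt_b4 : Wt b4 8 := ((wt_ofNat 2).mul wt_a4).add (wt_a1.mul wt_a3)
lemma wt_b6 : Wt b6 12 := (wt_a3.pow 2).add ((wt_ofNat 4).mul wt_a6)

lemma wt_b8 : Wt b8 16 :=
  (((((wt_a1.pow 2).mul wt_a6).add (((wt_ofNat 4).mul wt_a2).mul wt_a6)).sub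
    ((wt_a1.mul wt_a3).mul wt_a4)).add (wt_a2.mul (wt_a3.pow 2))).sub (wt_a4.pow 2)

lemma wt_c4 : Wt c4 8 := Wt.sub (wt_b2.pow 2) ((wt_ofNat 24).mul wt_b4)

lemma wt_c6 : Wt c6 12 :=
  Wt.sub ((Wt.neg (wt_b2.pow 3)).add (((wt_ofNat 36).mul wt_b2).mul wt_b4))
    ((wt_ofNat 216).mul wt_b6)

lemma wt_Δ : Wt Δ 24 :=
  (Wt.sub (Wt.sub ((Wt.neg (wt_b2.pow 2)).mul wt_b8) ((wt_ofNat 8).mul (wt_b4.pow 3)))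
    ((wt_ofNat 27).mul (wt_b6.pow 2))).add ((((wt_ofNat 9).mul wt_b2).mul wt_b4).mul wt_b6)

/-- The projection to `A'` preserves the weights. -/
lemma proj_wt {x : WA} {m : ℤ} (hx : Wt x m) :
    MvPolynomial.IsWeightedHomogeneous CVar.deg (proj₀ x) m := by
  have key : ∀ (d : WVar →₀ ℕ) (c : Z3), MvPolynomial.IsWeightedHomogeneous CVar.deg
      (proj₀ (MvPolynomial.monomial d c)) (Finsupp.weight WVar.deg d) := by
    intro d
    induction d using Finsupp.induction_linear with
    | zero =>
      intro c
      rw [map_zero]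
      have : proj₀ (MvPolynomial.monomial 0 c) = MvPolynomial.C c := MvPolynomial.eval₂Hom_C _ _ _
      rw [this]
      exact BaseZ.weight_C c
    | add d e hd he =>
      intro c
      rw [← mul_one c, ← MvPolynomial.monomial_mul, map_mul, map_add]
      exact (hd c).mul (he 1)
    | single v n =>
      intro c
      have hC : proj₀ (MvPolynomial.C c) = MvPolynomial.C c := MvPolynomial.eval₂Hom_C _ _ _
      rw [← MvPolynomial.C_mul_X_pow_eq_monomial, map_mul, map_pow, hC, Finsupp.weight_single,
        ← zero_add (n • _)]
      refine (BaseZ.weight_C c).mul (MvPolynomial.IsWeightedHomogeneous.pow ?_ n)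
      have h0 : ∀ k, MvPolynomial.IsWeightedHomogeneous CVar.deg
        (0 : MvPolynomial CVar Z3) k := fun k => MvPolynomial.isWeightedHomogeneous_zero _ _ k
      cases v with
      | a1 => exact proj_a1 ▸ h0 _
      | a2 => exact proj_a2 ▸ BaseZ.weight_a
      | a3 => exact proj_a3 ▸ h0 _
      | a4 => exact proj_a4 ▸ BaseZ.weight_c
      | a6 => exact proj_a6 ▸ h0 _
  rw [← MvPolynomial.support_sum_monomial_coeff x, map_sum]
  refine (MvPolynomial.weightedHomogeneousSubmodule Z3 CVar.deg m).sum_mem fun d hd => ?_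
  have h := key d (x.coeff d)
  rwa [hx (MvPolynomial.mem_support_iff.1 hd)] at h

end W

lemma IsHomog.map {H K : HopfAlgebroid} {g : Grading H} {g' : Grading K} (f : HopfHom H K)
    (hA : ∀ m, ∀ a ∈ g.degA m, f.f₀ a ∈ g'.degA m)
    (hΓ : ∀ m, ∀ x ∈ g.degΓ m, f.f₁ x ∈ g'.degΓ m) {n : ℕ} {m : ℤ} {x : Cobar H}
    (hx : IsHomog g n m x) : IsHomog g' n m (Cobar.map f x) := by
  induction hx with
  | coeff m a ha => rw [Cobar.map_coeff]; exact .coeff _ _ (hA m a ha)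
  | bar m x hx => rw [Cobar.map_bar]; exact .bar _ _ (hΓ m x hx)
  | zero n m => rw [map_zero]; exact .zero _ _
  | add n m x y _ _ hx hy => rw [map_add]; exact .add _ _ _ _ hx hy
  | neg n m x _ hx => rw [map_neg]; exact .neg _ _ _ hx
  | mul n n' m m' x y _ _ hx hy => rw [map_mul]; exact .mul _ _ _ _ _ _ hx hy

namespace W

lemma proj_monomial (a : WA) (i j l : ℕ) : proj₁ (ηL a * r ^ i * s ^ j * t ^ l) =
    base'.ηL (proj₀ a) * base'.r ^ i * 0 ^ j * 0 ^ l := by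
  rw [map_mul, map_mul, map_mul, map_pow, map_pow, map_pow, proj_ηL, proj_r, proj_s, proj_t]

/-- The elements of `Γ_(3)` of degree `m`. -/
def degr (m : ℤ) : AddSubgroup WΓ := AddSubgroup.closure {z : WΓ | ∃ (a : WA) (k : ℤ) (i j l : ℕ),
  a.IsWeightedHomogeneous WVar.deg k ∧ k + 4 * i + 2 * j + 6 * l = m ∧
  z = ηL a * r ^ i * s ^ j * t ^ l}

lemma proj_degr (m : ℤ) (x : WΓ) (hx : x ∈ degr m) : proj₁ x ∈ base'.degr (fun m =>
    (MvPolynomial.weightedHomogeneousSubmodule Z3 CVar.deg m).toAddSubgroup) m := by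
  induction hx using AddSubgroup.closure_induction with
  | mem x hx =>
    obtain ⟨a, k, i, j, l, ha, h, rfl⟩ := hx
    rw [proj_monomial]
    rcases eq_or_ne j 0 with rfl | hj
    · rcases eq_or_ne l 0 with rfl | hl
      · rw [pow_zero, mul_one, mul_one]
        exact AddSubgroup.subset_closure ⟨_, k, i, proj_wt ha, by simpa using h, rfl⟩
      · rw [zero_pow hl, mul_zero]
        exact zero_mem _
    · rw [zero_pow hj, mul_zero, zero_mul]
      exact zero_mem _
  | zero => rw [map_zero]; exact zero_mem _
  | add x y _ _ hx hy => rw [map_add]; exact add_mem hx hy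
  | neg x _ hx => rw [map_neg]; exact neg_mem hx

lemma isHomog_map_proj {n : ℕ} {m : ℤ} {x : Cobar weierstrass} (hx : IsHomog weierstrassDeg n m x) :
    IsHomog deg' n m (Cobar.map proj x) :=
  IsHomog.map (g := weierstrassDeg) (g' := deg') proj (fun _ _ => proj_wt) proj_degr hx

lemma isHomog_cf {x : WA} {m : ℤ} (hx : Wt x m) : IsHomog weierstrassDeg 0 m (cf x) :=
  .coeff _ _ hx

lemma isHomog_br_r_pow (i : ℕ) : IsHomog weierstrassDeg 1 (4 * i) (br (r ^ i)) :=
  .bar _ _ (AddSubgroup.subset_closure ⟨1, 0, i, 0, 0, MvPolynomial.isWeightedHomogeneous_one _ _,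
    by simp, by rw [pow_zero, pow_zero, map_one, one_mul, mul_one, mul_one]⟩)

lemma isHomog_br_r : IsHomog weierstrassDeg 1 4 (br r) := by
  have := isHomog_br_r_pow 1
  rwa [pow_one] at this

lemma isHomog_βc : IsHomog weierstrassDeg 2 12 βc :=
  .add _ _ _ _ ((isHomog_br_r_pow 2).mul 1 1 8 4 _ _ isHomog_br_r)
    (isHomog_br_r.mul 1 1 4 8 _ _ (isHomog_br_r_pow 2))

/-- The presentation of the cohomology of the elliptic curve Hopf algebroid. -/
def e : PresE ≃+* Coh weierstrass :=
  BaseZ.e'.trans (RingEquiv.ofBijective (Coh.map proj) bijective_map_proj).symm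

lemma map_e (x : PresE) : Coh.map proj (e x) = BaseZ.φ' x :=
  (RingEquiv.ofBijective (Coh.map proj) bijective_map_proj).apply_symm_apply (BaseZ.φ' x)

lemma represents_of_map {x : Cobar weierstrass} {y : PresE} {z : Cobar base'.hopf}
    (hx : Cobar.d x = 0) (hxz : Cobar.map proj x = z) (hz : Represents z (BaseZ.φ' y)) :
    Represents x (e y) := by
  have h : clsOf x hx = e y := bijective_map_proj.1 (((hxz ▸
    (represents_clsOf x hx).map proj : Represents z (Coh.map proj (clsOf x hx))).unique hz).trans
      (map_e y).symm)
  exact h ▸ represents_clsOf x hx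

lemma represents_c4 : Represents (cf c4) (e (PresE.gen .c4)) :=
  represents_of_map (d_cf ηR_c4) ((Cobar.map_coeff proj c4).trans (congrArg base'.cf proj_c4))
    (BaseZ.φ'_gen _ ▸ BaseZ.represents_c4)

lemma represents_c6 : Represents (cf c6) (e (PresE.gen .c6)) :=
  represents_of_map (d_cf ηR_c6) ((Cobar.map_coeff proj c6).trans (congrArg base'.cf proj_c6))
    (BaseZ.φ'_gen _ ▸ BaseZ.represents_c6)

lemma represents_Δ : Represents (cf Δ) (e (PresE.gen .Δ)) :=
  represents_of_map (d_cf ηR_Δ) ((Cobar.map_coeff proj Δ).trans (congrArg base'.cf proj_Δ))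
    (BaseZ.φ'_gen _ ▸ BaseZ.represents_Δ)

lemma e_α : e (PresE.gen .α) = resolution.α :=
  bijective_map_proj.1 ((map_e _).trans ((BaseZ.φ'_gen _).trans
    (resolution.map_α proj R' proj_r).symm))

lemma e_β : e (PresE.gen .β) = resolution.β :=
  bijective_map_proj.1 ((map_e _).trans ((BaseZ.φ'_gen _).trans
    (resolution.map_β proj R' proj_r).symm))

lemma represents_α : Represents (br r) (e (PresE.gen .α)) := e_α ▸ ⟨resolution.d_r, rfl⟩

lemma represents_β : Represents βc (e (PresE.gen .β)) := e_β ▸ ⟨resolution.d_βc, rfl⟩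

lemma c4_mem : e (PresE.gen .c4) ∈ bigr weierstrassDeg 0 8 := ⟨_, isHomog_cf wt_c4, represents_c4⟩

lemma c6_mem : e (PresE.gen .c6) ∈ bigr weierstrassDeg 0 12 :=
  ⟨_, isHomog_cf wt_c6, represents_c6⟩

lemma Δ_mem : e (PresE.gen .Δ) ∈ bigr weierstrassDeg 0 24 := ⟨_, isHomog_cf wt_Δ, represents_Δ⟩

lemma α_mem : e (PresE.gen .α) ∈ bigr weierstrassDeg 1 4 := ⟨_, isHomog_br_r, represents_α⟩

lemma β_mem : e (PresE.gen .β) ∈ bigr weierstrassDeg 2 12 := ⟨_, isHomog_βc, represents_β⟩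

end W

end EllCoh

namespace EllCoh
open Coh

/-! ### The bigrading of the cohomology of the elliptic curve Hopf algebroid -/

/-- Direct sum decompositions are carried back along isomorphisms. -/
lemma isInternal_of_map {ι A B : Type} [DecidableEq ι] [AddCommGroup A] [AddCommGroup B]
    (f : A →+ B) (hf : Function.Bijective f) (S : ι → AddSubgroup A)
    (h : DirectSum.IsInternal fun i => (S i).map f) : DirectSum.IsInternal S := by
  have hmap : Function.Bijective (DirectSum.map fun i => f.addSubgroupMap (S i)) :=
    ⟨(DirectSum.map_injective _).2 fun i x y hxy => Subtype.ext (hf.1 (congrArg Subtype.val hxy)),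
      (DirectSum.map_surjective _).2 fun i => f.addSubgroupMap_surjective (S i)⟩
  have key : (DirectSum.coeAddMonoidHom fun i => (S i).map f).comp
      (DirectSum.map fun i => f.addSubgroupMap (S i)) = f.comp (DirectSum.coeAddMonoidHom S) := by
    refine DirectSum.addHom_ext fun i x => ?_
    rw [AddMonoidHom.comp_apply, AddMonoidHom.comp_apply, DirectSum.map_of,
      DirectSum.coeAddMonoidHom_of, DirectSum.coeAddMonoidHom_of]
    rfl
  have hb := h.comp hmap
  rw [← AddMonoidHom.coe_comp, key, AddMonoidHom.coe_comp] at hb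
  exact (Function.Bijective.of_comp_iff' hf _).1 hb

namespace W

lemma map_bigr_le {n : ℕ} {m : ℤ} {h : Coh weierstrass} (hh : h ∈ bigr weierstrassDeg n m) :
    Coh.map proj h ∈ bigr deg' n m := by
  obtain ⟨x, hx, hx'⟩ := hh
  exact ⟨_, isHomog_map_proj hx, hx'.map proj⟩

lemma one_mem : (1 : Coh weierstrass) ∈ bigr weierstrassDeg 0 0 :=
  ⟨cf 1, isHomog_cf (MvPolynomial.isWeightedHomogeneous_one _ _), by
    rw [map_one]; exact ⟨Cobar.d_one, map_one Coh.cls⟩⟩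

lemma scalar_mem (k : Z3) : e (PresE.scalar k) ∈ bigr weierstrassDeg 0 0 := by
  have hk : ηR (MvPolynomial.C k) = ηL (MvPolynomial.C k) := MvPolynomial.eval₂Hom_C _ _ _
  have hp : proj₀ (MvPolynomial.C k) = MvPolynomial.C k := MvPolynomial.eval₂Hom_C _ _ _
  have h := BaseZ.φ'_monomial k 0 0
  simp only [pow_zero, mul_one] at h
  rw [PresE.ι_C_C] at h
  refine ⟨cf (MvPolynomial.C k), isHomog_cf (wt_C k), represents_of_map (d_cf hk)
    ((Cobar.map_coeff proj _).trans (congrArg base'.cf hp)) ?_⟩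
  rw [h]
  exact ⟨BaseZ.C_mem k, clsOf_congr (congrArg base'.cf
    ((BaseZ.χ_C _).trans (BaseZ.χΔ_C k)).symm) _⟩

lemma mon_mem (k : Z3) (i j : ℕ) : e (PresE.ι
    (Polynomial.C (Polynomial.C k * Polynomial.X ^ i) * Polynomial.X ^ j)) ∈
      bigr weierstrassDeg 0 (8 * j + 24 * i) := by
  simp only [map_mul, map_pow, PresE.ι_C_C, PresE.ι_C_X, PresE.ι_X]
  exact bigr_cast (bigr_mul (bigr_mul (scalar_mem k) (bigr_pow one_mem Δ_mem i))
    (bigr_pow one_mem c4_mem j)) (by simp) (by ring)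

lemma mons_homog (p : ℕ × ℤ) : ∀ t ∈ BaseZ.mons p, e t ∈ bigr weierstrassDeg p.1 p.2 := by
  have h : ∀ (k : Z3) (i : ℕ),
      e (PresE.ι (Polynomial.C (Polynomial.C k * Polynomial.X ^ i))) ∈
        bigr weierstrassDeg 0 (24 * i) := fun k i => by
    have := mon_mem k i 0
    rw [pow_zero, mul_one] at this
    exact bigr_cast this rfl (by simp)
  rintro t ⟨k, i, j, ⟨rfl, rfl⟩ | ⟨rfl, rfl⟩ | ⟨rfl, rfl⟩⟩
  · exact mon_mem k i j
  · rw [map_mul]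
    exact bigr_mul c6_mem (mon_mem k i j)
  · rw [map_mul]
    exact bigr_mul α_mem (h k i)

/-- The isomorphism with the cohomology of `(A', Γ')` preserves the bigrading. -/
theorem map_bigr (n : ℕ) (m : ℤ) :
    (bigr weierstrassDeg n m).map (Coh.map proj).toAddMonoidHom = bigr deg' n m := by
  refine le_antisymm ?_ ?_
  · rintro _ ⟨h, hh, rfl⟩
    exact map_bigr_le hh
  · rw [BaseZ.bigr_eq, AddSubgroup.closure_le]
    rintro _ ⟨i, q, t, ht, h1, h2, rfl⟩
    have h : ∃ h ∈ bigr weierstrassDeg n m, Coh.map proj h = BaseZ.φ' (PresE.gen .β ^ i * t) :=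
      ⟨e (PresE.gen .β ^ i * t), Exhausts.powers_homog (φ := e.toRingHom) one_mem β_mem mons_homog
        (n, m) _ ⟨i, q, t, ht, h1, h2, rfl⟩, map_e _⟩
    exact h

theorem isInternal : DirectSum.IsInternal (fun p : ℕ × ℤ => bigr weierstrassDeg p.1 p.2) := by
  refine isInternal_of_map (Coh.map proj).toAddMonoidHom bijective_map_proj _ ?_
  have h : (fun p : ℕ × ℤ => (bigr weierstrassDeg p.1 p.2).map (Coh.map proj).toAddMonoidHom) =
      fun p => bigr deg' p.1 p.2 := funext fun p => map_bigr p.1 p.2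
  rw [h]
  exact BaseZ.isInternal

lemma massey_map {p q s : ℕ} {k l m : ℤ} {a b c h : Coh weierstrass}
    (hh : h ∈ massey weierstrassDeg p k q l s m a b c) :
    Coh.map proj h ∈ massey deg' p k q l s m (Coh.map proj a) (Coh.map proj b)
      (Coh.map proj c) := by
  obtain ⟨x, y, z, u, v, n, n', hx, hxa, hy, hyb, hz, hzc, hn, hu, hdu, hn', hv, hdv, hr⟩ := hh
  have hr' := hr.map proj
  simp only [map_sub, map_mul, map_pow, map_neg, map_one] at hr'
  exact ⟨_, _, _, _, _, n, n', isHomog_map_proj hx, hxa.map proj, isHomog_map_proj hy,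
    hyb.map proj, isHomog_map_proj hz, hzc.map proj, hn, isHomog_map_proj hu,
    by rw [← Cobar.map_d, hdu, map_mul], hn', isHomog_map_proj hv,
    by rw [← Cobar.map_d, hdv, map_mul], hr'⟩

theorem massey_α_α_α : massey weierstrassDeg 1 4 1 4 1 4 (e (PresE.gen .α)) (e (PresE.gen .α))
    (e (PresE.gen .α)) = {e (PresE.gen .β)} := by
  have hα : Coh.map proj resolution.α = R'.α := resolution.map_α proj R' proj_r
  have hβ : Coh.map proj resolution.β = R'.β := resolution.map_β proj R' proj_r
  rw [e_α, e_β]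
  refine Set.eq_singleton_iff_unique_mem.2 ⟨?_, fun h hh => bijective_map_proj.1 ?_⟩
  · refine resolution.β_mem_massey isHomog_br_r ?_ ?_
    · have hh : Wt half 0 := wt_C halfZ3
      exact .mul 0 1 0 8 _ _ (isHomog_cf hh) (isHomog_br_r_pow 2)
    · refine bijective_map_proj.1 ?_
      rw [map_mul, hβ, map_zero, map_ofNat]
      exact BaseZ.three_mul_β
  · have h' := massey_map hh
    rw [hα, BaseZ.massey_α_α_α] at h'
    exact h'.trans hβ.symm

end W

end EllCoh

namespace EllCoh
open Coh

/-! ### The kernels of the reduction maps -/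

namespace CubicBase

variable {A A' : Type} [CommRing A] [CommRing A'] [Nontrivial A'] {B' : CubicBase A'}
  {f₀ : A →+* A'}

/-- A map `Γ → Γ'` that extends a surjection `A → A'` and preserves `r` is surjective. -/
lemma surjective_of_map_r {G : Type} [CommRing G] {ηL : A →+* G} {f₁ : G →+* B'.Γ} {r : G}
    (hL : ∀ a, f₁ (ηL a) = B'.ηL (f₀ a)) (hr : f₁ r = B'.r)
    (hs : Function.Surjective f₀) : Function.Surjective f₁ := by
  intro x
  obtain ⟨a, ha⟩ := hs (B'.coord x 0)
  obtain ⟨b, hb⟩ := hs (B'.coord x 1)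
  obtain ⟨c, hc⟩ := hs (B'.coord x 2)
  refine ⟨ηL a + ηL b * r + ηL c * r ^ 2, ?_⟩
  rw [map_add, map_add, map_mul, map_mul, map_pow, hL, hL, hL, hr, ha, hb, hc]
  exact (B'.coord_sum x).symm

lemma ker_eq_map [Nontrivial A] {B : CubicBase A} {f₁ : B.Γ →+* B'.Γ}
    (hL : ∀ a, f₁ (B.ηL a) = B'.ηL (f₀ a)) (hr : f₁ B.r = B'.r) :
    RingHom.ker f₁ = (RingHom.ker f₀).map B.ηL := by
  refine le_antisymm (fun x hx => ?_) (Ideal.map_le_iff_le_comap.2 fun a ha => ?_)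
  · have h : f₁ x = 0 := hx
    rw [B.coord_sum x, map_add, map_add, map_mul, map_mul, map_pow, hL, hL, hL, hr] at h
    have h' := B'.coord_eq (f₀ (B.coord x 0)) (f₀ (B.coord x 1)) (f₀ (B.coord x 2))
    rw [h, map_zero] at h'
    have hm : ∀ i, f₀ (B.coord x i) = 0 → B.ηL (B.coord x i) ∈ (RingHom.ker f₀).map B.ηL :=
      fun i hi => Ideal.mem_map_of_mem _ hi
    rw [B.coord_sum x]
    exact add_mem (add_mem (hm 0 (congrFun h' 0).symm)
      (Ideal.mul_mem_right _ _ (hm 1 (congrFun h' 1).symm)))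
      (Ideal.mul_mem_right _ _ (hm 2 (congrFun h' 2).symm))
  · rw [Ideal.mem_comap, RingHom.mem_ker, hL, show f₀ a = 0 from ha, map_zero]

end CubicBase

lemma red0_eq (x : MvPolynomial CVar Z3) : red0.f₀ x = redA x := RingHom.congr_fun redA_eq.symm x

/-- The composite reduction `ℤ_(3)[a₂, a₄] → 𝔽₃[a₄]`. -/
def redA1 : MvPolynomial CVar Z3 →+* Polynomial (ZMod 3) := red1.f₀.comp red0.f₀

/-- The composite reduction `ℤ_(3)[a₂, a₄] → 𝔽₃`. -/
def redA2 : MvPolynomial CVar Z3 →+* ZMod 3 := red2.f₀.comp redA1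

lemma red0_L (a : MvPolynomial CVar Z3) : red0.f₁ (base'.ηL a) = base0.ηL (redA a) :=
  (RingHom.congr_fun red0.map_ηL a).trans (congrArg base0.ηL (red0_eq a))

lemma red1_L (a : MvPolynomial CVar Z3) : (red1.f₁.comp red0.f₁) (base'.ηL a) =
    base1.ηL (redA1 a) :=
  (congrArg red1.f₁ (RingHom.congr_fun red0.map_ηL a)).trans
    (RingHom.congr_fun red1.map_ηL (red0.f₀ a))

lemma red2_L (a : MvPolynomial CVar Z3) : (red2.f₁.comp (red1.f₁.comp red0.f₁)) (base'.ηL a) =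
    base2.ηL (redA2 a) :=
  (congrArg red2.f₁ (red1_L a)).trans (RingHom.congr_fun red2.map_ηL (redA1 a))

lemma red0_r : red0.f₁ base'.r = base0.r := CubicBase.homOf_r _ _ _ _ _

lemma red1_r : (red1.f₁.comp red0.f₁) base'.r = base1.r :=
  (congrArg red1.f₁ red0_r).trans (CubicBase.homOf_r _ _ _ _ _)

lemma red2_r : (red2.f₁.comp (red1.f₁.comp red0.f₁)) base'.r = base2.r :=
  (congrArg red2.f₁ red1_r).trans (CubicBase.homOf_r _ _ _ _ _)

lemma redA1_a2 : redA1 base'.a2 = 0 :=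
  (congrArg red1.f₀ ((red0_eq _).trans redA_a2)).trans (CubicBase.homOf_a2 _ _ _ _ _)

lemma redA1_a4 : redA1 base'.a4 = Polynomial.X :=
  (congrArg red1.f₀ ((red0_eq _).trans redA_a4)).trans (CubicBase.homOf_a4 _ _ _ _ _)

lemma redA2_a4 : redA2 base'.a4 = 0 := (congrArg red2.f₀ redA1_a4).trans Polynomial.eval_X

lemma redA1_surjective : Function.Surjective redA1 := by
  intro p
  induction p using Polynomial.induction_on' with
  | add p q hp hq =>
    obtain ⟨x, rfl⟩ := hp
    obtain ⟨y, rfl⟩ := hq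
    exact ⟨x + y, map_add _ _ _⟩
  | monomial n k =>
    refine ⟨(k.val : MvPolynomial CVar Z3) * base'.a4 ^ n, ?_⟩
    rw [map_mul, map_pow, redA1_a4, map_natCast, ← Polynomial.C_mul_X_pow_eq_monomial,
      ← map_natCast Polynomial.C, ZMod.natCast_zmod_val]

lemma redA2_surjective : Function.Surjective redA2 := fun k =>
  ⟨(k.val : MvPolynomial CVar Z3), by rw [map_natCast, ZMod.natCast_zmod_val]⟩

/-- The kernel of `A' → A₁` is generated by `3` and `a₂`. -/
lemma redA1_eq_zero {x : MvPolynomial CVar Z3} (h : redA1 x = 0) :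
    ∃ y z, x = 3 * y + base'.a2 * z := by
  let j : Polynomial (ZMod 3) →+* MvPolynomial CVar (ZMod 3) :=
    Polynomial.eval₂RingHom MvPolynomial.C base0.a4
  have hj : j Polynomial.X = base0.a4 := Polynomial.eval₂_X _ _
  have key : ∀ x, ∃ z, redA x = j (redA1 x) + base0.a2 * z := by
    intro x
    induction x using MvPolynomial.induction_on with
    | C k =>
      have h : (redA.comp MvPolynomial.C) k = ((j.comp redA1).comp MvPolynomial.C) k :=
        RingHom.congr_fun (Z3_hom_ext _ _) k
      exact ⟨0, by rw [mul_zero, add_zero]; exact h⟩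
    | add x y hx hy =>
      obtain ⟨u, hu⟩ := hx
      obtain ⟨v, hv⟩ := hy
      exact ⟨u + v, by rw [map_add, map_add, map_add, hu, hv]; ring⟩
    | mul_X x v hx =>
      obtain ⟨u, hu⟩ := hx
      rw [map_mul, map_mul, map_mul, hu]
      cases v with
      | a2 =>
        have h1 : redA1 (MvPolynomial.X CVar.a2) = 0 := redA1_a2
        have h2 : redA (MvPolynomial.X CVar.a2) = base0.a2 := redA_a2
        exact ⟨j (redA1 x) + base0.a2 * u, by rw [h1, h2, map_zero]; ring⟩
      | a4 =>
        have h1 : redA1 (MvPolynomial.X CVar.a4) = Polynomial.X := redA1_a4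
        have h2 : redA (MvPolynomial.X CVar.a4) = base0.a4 := redA_a4
        exact ⟨u * base0.a4, by rw [h1, h2, hj]; ring⟩
  obtain ⟨z', hz⟩ := key x
  obtain ⟨z, rfl⟩ := redA_surjective z'
  obtain ⟨y, hy⟩ := redA_eq_zero (x := x - base'.a2 * z) (by
    rw [map_sub, map_mul, redA_a2, hz, h, map_zero, zero_add, sub_self])
  exact ⟨y, z, by rw [← hy]; ring⟩

lemma redA2_eq_zero {x : MvPolynomial CVar Z3} (h : redA2 x = 0) :
    ∃ y z w, x = 3 * y + base'.a2 * z + base'.a4 * w := by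
  have h0 : (redA1 x).coeff 0 = 0 := by
    rw [Polynomial.coeff_zero_eq_eval_zero]
    exact h
  obtain ⟨w', hw⟩ := Polynomial.X_dvd_iff.2 h0
  obtain ⟨w, rfl⟩ := redA1_surjective w'
  obtain ⟨y, z, hy⟩ := redA1_eq_zero (x := x - base'.a4 * w) (by
    rw [map_sub, map_mul, redA1_a4, hw, sub_self])
  exact ⟨y, z, w, by rw [← hy]; ring⟩

lemma ker_redA : RingHom.ker redA = Ideal.span {3} := by
  refine le_antisymm (fun x hx => ?_) ((Ideal.span_singleton_le_iff_mem _).2 ?_)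
  · obtain ⟨y, rfl⟩ := redA_eq_zero hx
    exact Ideal.mul_mem_right _ _ (Ideal.mem_span_singleton_self _)
  · rw [RingHom.mem_ker, map_ofNat]
    exact CharP.cast_eq_zero (MvPolynomial CVar (ZMod 3)) 3

lemma ker_redA1 : RingHom.ker redA1 = Ideal.span {3, base'.a2} := by
  refine le_antisymm (fun x hx => ?_) (Ideal.span_le.2 ?_)
  · obtain ⟨y, z, rfl⟩ := redA1_eq_zero hx
    exact add_mem (Ideal.mul_mem_right _ _ (Ideal.subset_span (by simp)))
      (Ideal.mul_mem_right _ _ (Ideal.subset_span (by simp)))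
  · rintro _ (rfl | rfl)
    · change redA1 3 = 0
      rw [map_ofNat]
      exact CharP.cast_eq_zero (Polynomial (ZMod 3)) 3
    · exact redA1_a2

lemma ker_redA2 : RingHom.ker redA2 = Ideal.span {3, base'.a2, base'.a4} := by
  refine le_antisymm (fun x hx => ?_) (Ideal.span_le.2 ?_)
  · obtain ⟨y, z, w, rfl⟩ := redA2_eq_zero hx
    exact add_mem (add_mem (Ideal.mul_mem_right _ _ (Ideal.subset_span (by simp)))
      (Ideal.mul_mem_right _ _ (Ideal.subset_span (by simp))))
      (Ideal.mul_mem_right _ _ (Ideal.subset_span (by simp)))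
  · rintro _ (rfl | rfl | rfl)
    · change redA2 3 = 0
      rw [map_ofNat]
      exact CharP.cast_eq_zero (ZMod 3) 3
    · exact (congrArg red2.f₀ redA1_a2).trans (map_zero _)
    · exact redA2_a4

lemma exists_ringHom_ker_eq {G : Type} [CommRing G] (J : Ideal G) :
    ∃ (Q : Type) (_ : CommRing Q) (q : G →+* Q), ∀ y, q y = 0 ↔ y ∈ J :=
  ⟨G ⧸ J, inferInstance, Ideal.Quotient.mk J, fun _ => Ideal.Quotient.eq_zero_iff_mem⟩

namespace W

/-- A ring map that identifies the two images of each element of the kernel of `A_(3) → A'` with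
zero kills `s` and `t`, because `2` is invertible and `2 s = ηR a₁ - a₁`,
`2 t = ηR a₃ - a₃ - a₁ r`; then the value at `ηR a₆` gives the relation of `Γ'`. -/
lemma exists_factor {Q : Type} [CommRing Q] (q : WΓ →+* Q) (hL : ∀ a, proj₀ a = 0 → q (ηL a) = 0)
    (hR : ∀ a, proj₀ a = 0 → q (ηR a) = 0) : ∃ σ : base'.Γ →+* Q, ∀ x, q x = σ (proj₁ x) := by
  have h2 := congrArg q two_ηL_half
  rw [map_mul, map_ofNat, map_one] at h2
  have l1 := hL a1 proj_a1
  have l3 := hL a3 proj_a3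
  have l6 := hL a6 proj_a6
  have hs : q s = 0 := by
    have h := hR a1 proj_a1
    rw [ηR_a1, map_add, map_mul, map_ofNat, l1] at h
    linear_combination q (ηL half) * h - q s * h2
  have ht : q t = 0 := by
    have h := hR a3 proj_a3
    rw [ηR_a3, map_add, map_add, map_mul, map_mul, map_ofNat, l1, l3] at h
    linear_combination q (ηL half) * h - q t * h2
  have hr : q r ^ 3 + q (ηL a2) * q r ^ 2 + q (ηL a4) * q r = 0 := by
    have h := hR a6 proj_a6
    simp only [ηR_a6, map_add, map_sub, map_mul, map_pow, l1, l3, l6, ht] at h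
    linear_combination h
  let j : MvPolynomial CVar Z3 →+* WA := MvPolynomial.eval₂Hom MvPolynomial.C
    (fun v => match v with | .a2 => a2 | .a4 => a4)
  have j2 : j base'.a2 = a2 := MvPolynomial.eval₂Hom_X' _ _ _
  have j4 : j base'.a4 = a4 := MvPolynomial.eval₂Hom_X' _ _ _
  let p : MvPolynomial CVar Z3 →+* Q := (q.comp ηL).comp j
  have p2 : p base'.a2 = q (ηL a2) := congrArg (fun x => q (ηL x)) j2
  have p4 : p base'.a4 = q (ηL a4) := congrArg (fun x => q (ηL x)) j4
  have hp : q.comp ηL = p.comp proj₀ := by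
    refine A_ext ?_ ?_ ?_ ?_ ?_
    all_goals rw [RingHom.comp_apply, RingHom.comp_apply]
    · rw [proj_a1, l1, map_zero]
    · rw [proj_a2]; exact p2.symm
    · rw [proj_a3, l3, map_zero]
    · rw [proj_a4]; exact p4.symm
    · rw [proj_a6, l6, map_zero]
  let σ : base'.Γ →+* Q := base'.ΓLift p (q r) (by rw [p2, p4, hr])
  refine ⟨σ, RingHom.congr_fun (Γ_ext (f := q) (g := σ.comp proj₁) ?_ ?_ ?_ ?_)⟩
  · refine hp.trans (RingHom.ext fun a => ?_)
    change p (proj₀ a) = σ (proj₁ (ηL a))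
    rw [proj_ηL]
    exact (base'.ΓLift_ηL _ _ _ _).symm
  · rw [RingHom.comp_apply, proj_r]
    exact (base'.ΓLift_r _ _ _).symm
  · rw [RingHom.comp_apply, proj_s, hs, map_zero]
  · rw [RingHom.comp_apply, proj_t, ht, map_zero]

lemma proj_ηR (a : WA) : proj₁ (ηR a) = base'.ηR (proj₀ a) := RingHom.congr_fun proj.map_ηR a

lemma mem_of_proj_eq_zero (J : Ideal WΓ) (hL : ∀ a, proj₀ a = 0 → ηL a ∈ J)
    (hR : ∀ a, proj₀ a = 0 → ηR a ∈ J) {x : WΓ} (hx : proj₁ x = 0) : x ∈ J := by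
  obtain ⟨Q, _, q, hq⟩ := exists_ringHom_ker_eq (G := WΓ) J
  obtain ⟨σ, hσ⟩ := exists_factor q (fun a ha => (hq _).2 (hL a ha)) fun a ha => (hq _).2 (hR a ha)
  rw [← hq, hσ, hx, map_zero]

lemma ker_proj : RingHom.ker proj₁ =
    (RingHom.ker proj₀).map ηL ⊔ (RingHom.ker proj₀).map ηR := by
  refine le_antisymm (fun x hx => ?_) (sup_le ?_ ?_)
  · exact mem_of_proj_eq_zero _ (fun a ha => Ideal.mem_sup_left (Ideal.mem_map_of_mem _ ha))
      (fun a ha => Ideal.mem_sup_right (Ideal.mem_map_of_mem _ ha)) hx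
  · refine Ideal.map_le_iff_le_comap.2 fun a ha => ?_
    rw [Ideal.mem_comap, RingHom.mem_ker, proj_ηL, show proj₀ a = 0 from ha, map_zero]
  · refine Ideal.map_le_iff_le_comap.2 fun a ha => ?_
    rw [Ideal.mem_comap, RingHom.mem_ker, proj_ηR, show proj₀ a = 0 from ha, map_zero]

lemma proj₁_surjective : Function.Surjective proj₁ :=
  CubicBase.surjective_of_map_r (G := WΓ) (f₀ := proj₀) (f₁ := proj₁) (ηL := ηL) proj_ηL proj_r
    proj₀_surjective

end W

end EllCoh

end

theorem mainTheorem4 :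
    -- The reduction of the Hopf algebroid: base change along `A_(3) → A'`
    (Function.Surjective proj.f₀ ∧ Function.Surjective proj.f₁ ∧
      RingHom.ker proj.f₁ = (RingHom.ker proj.f₀).map weierstrass.ηL ⊔
        (RingHom.ker proj.f₀).map weierstrass.ηR) ∧
    Function.Bijective (Coh.map proj) ∧
    (∀ (n : ℕ) (m : ℤ), (bigr weierstrassDeg n m).map (Coh.map proj).toAddMonoidHom =
      bigr deg' n m) ∧
    -- `(A₀, Γ₀)`, `(A₁, Γ₁)`, `(A₂, Γ₂)` are the quotients by `(3)`, `(3, a₂)`, `(3, a₂, a₄)`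
    (Function.Surjective red0.f₀ ∧ Function.Surjective red0.f₁ ∧
      RingHom.ker red0.f₀ = Ideal.span {3} ∧
      RingHom.ker red0.f₁ = (Ideal.span {3}).map base'.hopf.ηL) ∧
    (Function.Surjective (red1.f₀.comp red0.f₀) ∧ Function.Surjective (red1.f₁.comp red0.f₁) ∧
      RingHom.ker (red1.f₀.comp red0.f₀) = Ideal.span {3, base'.a2} ∧
      RingHom.ker (red1.f₁.comp red0.f₁) = (Ideal.span {3, base'.a2}).map base'.hopf.ηL) ∧
    (Function.Surjective (red2.f₀.comp (red1.f₀.comp red0.f₀)) ∧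
      Function.Surjective (red2.f₁.comp (red1.f₁.comp red0.f₁)) ∧
      RingHom.ker (red2.f₀.comp (red1.f₀.comp red0.f₀)) =
        Ideal.span {3, base'.a2, base'.a4} ∧
      RingHom.ker (red2.f₁.comp (red1.f₁.comp red0.f₁)) =
        (Ideal.span {3, base'.a2, base'.a4}).map base'.hopf.ηL) ∧
    -- `H^{**}(A₂, Γ₂) = E(α) ⊗ P(β)` with `β = ⟨α, α, α⟩`
    (∃ φ : Pres2 ≃+* Coh base2.hopf,
      Coh.Represents (base2.br base2.r) (φ (Pres2.gen .α)) ∧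
      Coh.Represents base2.βc (φ (Pres2.gen .β)) ∧
      φ (Pres2.gen .α) ∈ bigr deg2 1 4 ∧ φ (Pres2.gen .β) ∈ bigr deg2 2 12 ∧
      DirectSum.IsInternal (fun p : ℕ × ℤ => bigr deg2 p.1 p.2) ∧
      massey deg2 1 4 1 4 1 4 (φ (Pres2.gen .α)) (φ (Pres2.gen .α)) (φ (Pres2.gen .α)) =
        {φ (Pres2.gen .β)} ∧
      -- `H^{**}(A₁, Γ₁) = H^{**}(A₂, Γ₂) ⊗ P(a₄)`
      ∃ φ₁ : Polynomial (Coh base2.hopf) ≃+* Coh base1.hopf,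
        (∀ h, Coh.map red2 (φ₁ (Polynomial.C h)) = h) ∧
        Coh.Represents (base1.cf base1.a4) (φ₁ Polynomial.X) ∧
        Coh.Represents (base1.br base1.r) (φ₁ (Polynomial.C (φ (Pres2.gen .α)))) ∧
        Coh.Represents base1.βc (φ₁ (Polynomial.C (φ (Pres2.gen .β)))) ∧
        φ₁ Polynomial.X ∈ bigr deg1 0 8 ∧
        φ₁ (Polynomial.C (φ (Pres2.gen .α))) ∈ bigr deg1 1 4 ∧
        φ₁ (Polynomial.C (φ (Pres2.gen .β))) ∈ bigr deg1 2 12 ∧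
        DirectSum.IsInternal (fun p : ℕ × ℤ => bigr deg1 p.1 p.2)) ∧
    -- the differentials of the `a₂`-Bockstein spectral sequence, in the cobar complex
    (∀ n : ℕ,
      Cobar.d (base0.cf (base0.a4 * base0.a2 ^ n)) =
        2 * base0.cf (base0.a2 ^ (n + 1)) * base0.br base0.r ∧
      Cobar.d (base0.cf (base0.a4 ^ 2 * base0.a2 ^ n)) =
        base0.cf (base0.a2 ^ (n + 1)) * base0.ξc) ∧
    Cobar.d base0.ξc = 0 ∧
    Cobar.d (base0.cf (base0.a4 ^ 2) * base0.br base0.r -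
        base0.cf (base0.a4 * base0.a2) * base0.br (base0.r ^ 2)) =
      base0.cf (base0.a2 ^ 2) * base0.βc ∧
    Cobar.d (base0.cf (base0.a4 ^ 3 - base0.a2 ^ 2 * base0.a4 ^ 2)) = 0 ∧
    -- `H^{**}(A₀, Γ₀)`, with the Massey products and the exotic extension
    (∃ φ : Pres0 ≃+* Coh base0.hopf,
      Coh.Represents (base0.cf base0.a2) (φ (Pres0.gen .a2)) ∧
      Coh.Represents (base0.cf (base0.a2 ^ 2 * base0.a4 ^ 2 - base0.a4 ^ 3))
        (φ (Pres0.gen .Δ)) ∧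
      Coh.Represents (base0.br base0.r) (φ (Pres0.gen .α)) ∧
      Coh.Represents base0.ξc (φ (Pres0.gen .ξ)) ∧
      Coh.Represents base0.βc (φ (Pres0.gen .β)) ∧
      φ (Pres0.gen .a2) ∈ bigr deg0 0 4 ∧ φ (Pres0.gen .Δ) ∈ bigr deg0 0 24 ∧
      φ (Pres0.gen .α) ∈ bigr deg0 1 4 ∧ φ (Pres0.gen .ξ) ∈ bigr deg0 1 12 ∧
      φ (Pres0.gen .β) ∈ bigr deg0 2 12 ∧
      DirectSum.IsInternal (fun p : ℕ × ℤ => bigr deg0 p.1 p.2) ∧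
      massey deg0 1 4 1 4 1 4 (φ (Pres0.gen .α)) (φ (Pres0.gen .α)) (φ (Pres0.gen .α)) =
        {φ (Pres0.gen .β)} ∧
      massey deg0 0 4 1 4 1 4 (φ (Pres0.gen .a2)) (φ (Pres0.gen .α)) (φ (Pres0.gen .α)) =
        {φ (Pres0.gen .ξ)} ∧
      (∀ n : ℕ, φ (Pres0.gen .a2) ^ n * φ (Pres0.gen .ξ) ∈
        massey deg0 0 (4 * (n + 1)) 1 4 1 4 (φ (Pres0.gen .a2) ^ (n + 1))
          (φ (Pres0.gen .α)) (φ (Pres0.gen .α))) ∧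
      φ (Pres0.gen .ξ) * φ (Pres0.gen .α) = φ (Pres0.gen .a2) * φ (Pres0.gen .β) ∧
      φ (Pres0.gen .a2) * φ (Pres0.gen .β) ≠ 0) ∧
    -- the differentials of the `3`-Bockstein spectral sequence, in the cobar complex
    Cobar.d (base'.cf base'.a2) = 3 * base'.br base'.r ∧
    Cobar.d base'.ξc = 3 * base'.βc ∧
    -- `H^{**}(A_(3), Γ_(3))`, the `3`-local `E₂`-term
    (∃ φ : PresE ≃+* Coh weierstrass,
      Coh.Represents (W.cf W.c4) (φ (PresE.gen .c4)) ∧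
      Coh.Represents (W.cf W.c6) (φ (PresE.gen .c6)) ∧
      Coh.Represents (W.cf W.Δ) (φ (PresE.gen .Δ)) ∧
      Coh.Represents (W.br W.r) (φ (PresE.gen .α)) ∧
      Coh.Represents W.βc (φ (PresE.gen .β)) ∧
      φ (PresE.gen .c4) ∈ bigr weierstrassDeg 0 8 ∧
      φ (PresE.gen .c6) ∈ bigr weierstrassDeg 0 12 ∧
      φ (PresE.gen .Δ) ∈ bigr weierstrassDeg 0 24 ∧
      φ (PresE.gen .α) ∈ bigr weierstrassDeg 1 4 ∧
      φ (PresE.gen .β) ∈ bigr weierstrassDeg 2 12 ∧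
      DirectSum.IsInternal (fun p : ℕ × ℤ => bigr weierstrassDeg p.1 p.2) ∧
      massey weierstrassDeg 1 4 1 4 1 4 (φ (PresE.gen .α)) (φ (PresE.gen .α))
        (φ (PresE.gen .α)) = {φ (PresE.gen .β)}) := by
  refine ⟨⟨W.proj₀_surjective, W.proj₁_surjective, W.ker_proj⟩, W.bijective_map_proj, W.map_bigr,
    ?_, ?_, ?_, ?_, fun n => ⟨Base0.d_a4_mul_a2_pow n, Base0.d_a4_sq_mul_a2_pow n⟩, Base0.d_ξc,
    Base0.d_a4_sq_r_sub, Base0.d_Δ, ?_, base'.d_cf_a2, base'.d_ξc BaseZ.half BaseZ.two_half, ?_⟩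
  · have hs := redA_surjective
    have hk := CubicBase.ker_eq_map (f₀ := redA) red0_L red0_r
    have hs' := CubicBase.surjective_of_map_r (f₀ := redA) red0_L red0_r hs
    have hk₀ := ker_redA
    rw [hk₀] at hk
    rw [redA_eq] at hs hk₀
    exact ⟨hs, hs', hk₀, hk⟩
  · have hk := CubicBase.ker_eq_map (f₀ := redA1) red1_L red1_r
    rw [ker_redA1] at hk
    exact ⟨redA1_surjective, CubicBase.surjective_of_map_r (f₀ := redA1) red1_L red1_r
      redA1_surjective, ker_redA1, hk⟩
  · have hk := CubicBase.ker_eq_map (f₀ := redA2) red2_L red2_r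
    rw [ker_redA2] at hk
    exact ⟨redA2_surjective, CubicBase.surjective_of_map_r (f₀ := redA2) red2_L red2_r
      redA2_surjective, ker_redA2, hk⟩
  · refine ⟨e2, ?_⟩
    rw [e2_α, e2_β]
    refine ⟨⟨R2.d_r, rfl⟩, ⟨R2.d_βc, rfl⟩, R2_α_mem, φ2_β ▸ φ2_β_mem, isInternal2, massey2,
      e1, map_red2_φ1, ?_, ?_, ?_, φ1_X_mem, ?_, ?_, isInternal1⟩
    · exact φ1_X ▸ R1.represents_ofAll R1_F _
    · exact φ1_α ▸ ⟨R1.d_r, rfl⟩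
    · exact φ1_β ▸ ⟨R1.d_βc, rfl⟩
    · exact φ1_α ▸ R1_α_mem
    · exact φ1_β ▸ R1_β_mem
  · have h : ∀ v, Base0.e0 (Pres0.gen v) = Base0.genC v := Base0.φ0_gen
    refine ⟨Base0.e0, ?_⟩
    simp only [h]
    exact ⟨Base0.represents_a2C, Base0.represents_ΔC, Base0.represents_α, Base0.represents_ξ,
      Base0.represents_β, Base0.a2C_mem, Base0.ΔC_mem, Base0.α_mem, Base0.ξ_mem, Base0.β_mem,
      Base0.isInternal, Base0.massey_α_α_α, Base0.massey_a2_α_α, Base0.mem_massey,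
      Base0.ξ_mul_α, Base0.a2_mul_β_ne_zero⟩
  · exact ⟨W.e, W.represents_c4, W.represents_c6, W.represents_Δ, W.represents_α, W.represents_β,
      W.c4_mem, W.c6_mem, W.Δ_mem, W.α_mem, W.β_mem, W.isInternal, W.massey_α_α_α⟩
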